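/- \textbf{Setting.} Let $(a_\omega(n),V_\omega(n))_{n\in\mathbb Z}$ be real random variables, almost surely bounded by a common constant, whose joint law is invariant under translation by some period $q\ge 1$ ($q=1$: stationarity). Let $H_\omega$ be the random Jacobi operator on $\ell^2(\mathbb Z)$, $$(H_\omega u)(n)=a_\omega(n+1)u(n+1)+a_\omega(n)u(n-1)+V_\omega(n)u(n),$$ let $H_\omega(\Lambda)$ be its restriction to $\ell^2(\Lambda)$ with Dirichlet boundary conditions for a finite interval $\Lambda\subset\mathbb Z$, and let $\Lambda=\Lambda_L=[1,L]\cap\mathbb Z$, with eigenvalues $E_j(\omega,\Lambda)$, $1\le j\le L$, repeated according to multiplicity. The integrated density of states (IDS) is $N(E)=\kappa((-\infty,E])$, where $\kappa$ is the measure with $\int\psi\,d\kappa=\frac1q\sum_{x=0}^{q-1}\mathbb E\langle\delta_x,\psi(H_\omega)\delta_x\rangle$ for all continuous $\psi$; for an interval $J$ write $N(J)=\kappa(J)$. Let $I\subset\mathbb R$ be a bounded open set. Assume: (IAD) There is $S\in\mathbb N$ such that the operators $H_\omega(\Lambda_1),\dots,H_\omega(\Lambda_n)$ are independent whenever $\Lambda_1,\dots,\Lambda_n\subset\mathbb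 Z$ are finite intervals at pairwise distance at least $S$. (W) There are $C>0$, $m\ge1$ with $\mathbb P[\operatorname{tr}\mathbf 1_J(H_\omega(\Lambda))\ge1]\le C|J||\Lambda|^m$ for all compact intervals $J\subset I$ and finite intervals $\Lambda\subset\mathbb N$. (M) There are $C>0$, $\rho>0$ with $\mathbb P\big[\operatorname{tr}\mathbf 1_J(H_\omega(\Lambda))\,(\operatorname{tr}\mathbf 1_J(H_\omega(\Lambda))-1)\ge1\big]\le C(|J||\Lambda|)^{1+\rho}$ for all such $J,\Lambda$. (Loc) For every $\xi\in(0,1)$, $$\sup_{L}\ \sup_{x\in\Lambda_L}\ \sup_{f}\ \mathbb E\Big(\sum_{y\in\Lambda_L}e^{|x-y|^\xi}\,|\langle\delta_x,f(H_\omega(\Lambda_L))\delta_y\rangle|\Big)<\infty,$$ where $f$ runs over the Borel functions with $|f|\le1$ vanishing outside $I$. (R) For all $\beta,\eta\in(0,1)$, $\ \lim_{L\to\infty}L\cdot\sup\{N(J): J\subset I\text{ compact interval},\ |J|\le e^{-(L^\beta)^\eta}\}=0$. \textbf{Theorem.} Let $\overline\rho\in[0,\frac{\rho}{1+\rho})$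 with $\rho$ as in (M), and let $E_0\in I$ be such that for every $\delta\in(0,1)$ there are $C(\delta)>0$ and $\epsilon_0>0$ with $$|N(E_0+(t+\delta)\epsilon)-N(E_0+t\epsilon)|\ge C(\delta)\,\epsilon^{1+\overline\rho}\qquad\text{for all }\epsilon\in(0,\epsilon_0),\ t\in[-1,1].$$ Let $\xi_j(\omega,\Lambda)=|\Lambda|\,(N(E_j(\omega,\Lambda))-N(E_0))$ and $\alpha\in\big((1+\overline\rho)\frac{1+\rho}{1+2\rho},\,1\big)$. Then there is $\delta>0$ such that, for any finite families of intervals $I_1=I_1^\Lambda,\dots,I_p=I_p^\Lambda$ in $|\Lambda|^{1-\alpha}\cdot[-1,1]$, where $p$ may depend on $\Lambda$, satisfying $\inf_{j\ne k}\operatorname{dist}(I_j,I_k)\ge e^{-|\Lambda|^\delta}$, and for any integers $k_j=k_j^\Lambda\ge0$, $$\lim_{|\Lambda|\to\infty}\left|\mathbb P\big(\#\{i:\xi_i(\omega,\Lambda)\in I_j\}=k_j\text{ for }j=1,\dots,p\big)-\prod_{j=1}^{p}e^{-|I_j|}\frac{|I_j|^{k_j}}{k_j!}\right|=0.$$ In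 particular, the point process $\Xi=\sum_j\delta_{\xi_j(\omega,\Lambda)}$ converges weakly, as $|\Lambda|\to\infty$, to the Poisson process on $\mathbb R$ with Lebesgue intensity; and for fixed pairwise disjoint bounded intervals $I_1,\dots,I_p$ and fixed integers $k_j\ge0$, the above probability converges to $\prod_j e^{-|I_j|}|I_j|^{k_j}/k_j!$. -/

import Mathlib

open MeasureTheory ProbabilityTheory Filter Topology

noncomputable section

namespace RandomJacobi

/-! ### Jacobi operators on the whole lattice -/

/-- The Hilbert space `ℓ²(ℤ)`. -/
abbrev L2Z : Type := lp (fun _ : ℤ => ℂ) 2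

/-- The basis vector `δ_x` of `ℓ²(ℤ)`. -/
def delta (x : ℤ) : L2Z := lp.single 2 x 1

theorem memℓp_two_of_bound {f g : ℤ → ℂ} {K : ℝ} (hg : Memℓp g 2)
    (h : ∀ n, ‖f n‖ ≤ K * ‖g n‖) : Memℓp f 2 := by
  have hp : (0 : ℝ) < (2 : ENNReal).toReal := by norm_num
  rw [memℓp_gen_iff hp] at hg ⊢
  refine Summable.of_nonneg_of_le (fun n => by positivity) (fun n => ?_) (hg.mul_left (K ^ 2))
  have h2 : (2 : ENNReal).toReal = ((2 : ℕ) : ℝ) := by norm_num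
  rw [h2, Real.rpow_natCast, Real.rpow_natCast, ← mul_pow]
  exact pow_le_pow_left₀ (norm_nonneg _) (h n) 2

theorem memℓp_two_shift {f : ℤ → ℂ} (k : ℤ) (hf : Memℓp f 2) :
    Memℓp (fun n => f (n + k)) 2 := by
  have hp : (0 : ℝ) < (2 : ENNReal).toReal := by norm_num
  rw [memℓp_gen_iff hp] at hf ⊢
  exact (Equiv.addRight k).summable_iff.mpr hf

/-- The translation `(S_k u)(n) = u(n + k)` on `ℓ²(ℤ)`. -/
def shiftOp (k : ℤ) : L2Z →L[ℂ] L2Z :=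
  LinearMap.mkContinuous
    { toFun := fun u => ⟨fun n => u (n + k), memℓp_two_shift k (lp.memℓp u)⟩
      map_add' := fun _ _ => rfl
      map_smul' := fun _ _ => rfl } 1 (by
    intro u
    have hp : (0 : ℝ) < (2 : ENNReal).toReal := by norm_num
    rw [one_mul, lp.norm_eq_tsum_rpow hp, lp.norm_eq_tsum_rpow hp]
    exact le_of_eq (congrArg (· ^ (1 / (2 : ENNReal).toReal))
      ((Equiv.addRight k).tsum_eq fun n => ‖u n‖ ^ (2 : ENNReal).toReal)))

open Classical in
/-- Multiplication by a bounded real sequence (and `0` if the sequence is not bounded). -/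
def mulOp (c : ℤ → ℝ) : L2Z →L[ℂ] L2Z :=
  if h : ∃ K : ℝ, ∀ n, |c n| ≤ K then
    LinearMap.mkContinuous
      { toFun := fun u => ⟨fun n => (c n : ℂ) * u n,
          memℓp_two_of_bound (K := h.choose) (lp.memℓp u) fun n => by
            rw [norm_mul, Complex.norm_real]
            exact mul_le_mul_of_nonneg_right (h.choose_spec n) (norm_nonneg _)⟩
        map_add' := fun u v => by
          ext n
          exact mul_add _ _ _
        map_smul' := fun r u => by
          ext n
          exact mul_left_comm _ _ _ } h.choose (by
      intro u
      have hp : (0 : ℝ) < (2 : ENNReal).toReal := by norm_num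
      have hK : 0 ≤ h.choose := (abs_nonneg _).trans (h.choose_spec 0)
      refine lp.norm_le_of_forall_sum_le hp (by positivity) fun s => ?_
      calc _ ≤ ∑ n ∈ s, h.choose ^ (2 : ENNReal).toReal * ‖u n‖ ^ (2 : ENNReal).toReal := by
            refine Finset.sum_le_sum fun n _ => ?_
            rw [← Real.mul_rpow hK (norm_nonneg _)]
            refine Real.rpow_le_rpow (norm_nonneg _) ?_ hp.le
            change ‖(c n : ℂ) * u n‖ ≤ _
            rw [norm_mul, Complex.norm_real]
            exact mul_le_mul_of_nonneg_right (h.choose_spec n) (norm_nonneg _)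
        _ ≤ _ := by
            rw [← Finset.mul_sum, Real.mul_rpow hK (norm_nonneg _)]
            exact mul_le_mul_of_nonneg_left (lp.sum_rpow_le_norm_rpow hp u s) (by positivity))
  else 0

/-- The Jacobi operator
`(H u)(n) = a(n+1) u(n+1) + a(n) u(n-1) + V(n) u(n)` on `ℓ²(ℤ)`, for bounded `a` and `V`. -/
def jacobiOp (a V : ℤ → ℝ) : L2Z →L[ℂ] L2Z :=
  shiftOp 1 ∘L mulOp a + mulOp a ∘L shiftOp (-1) + mulOp V

theorem shiftOp_apply (k : ℤ) (u : L2Z) (n : ℤ) : shiftOp k u n = u (n + k) := rfl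

theorem mulOp_apply {c : ℤ → ℝ} {K : ℝ} (h : ∀ n, |c n| ≤ K) (u : L2Z) (n : ℤ) :
    mulOp c u n = c n * u n := by
  have h' : ∃ K : ℝ, ∀ n, |c n| ≤ K := ⟨K, h⟩
  rw [mulOp, dif_pos h']
  rfl

theorem jacobiOp_apply {a V : ℤ → ℝ} {K : ℝ} (ha : ∀ n, |a n| ≤ K) (hV : ∀ n, |V n| ≤ K)
    (u : L2Z) (n : ℤ) :
    jacobiOp a V u n = a (n + 1) * u (n + 1) + a n * u (n - 1) + V n * u n := by
  have h1 : jacobiOp a V u n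
      = mulOp a u (n + 1) + mulOp a (shiftOp (-1) u) n + mulOp V u n := rfl
  rw [h1, mulOp_apply ha, mulOp_apply ha, mulOp_apply hV, shiftOp_apply, ← sub_eq_add_neg]

theorem shiftOp_adjoint (k : ℤ) : shiftOp k = (shiftOp (-k)).adjoint := by
  rw [ContinuousLinearMap.eq_adjoint_iff]
  intro u v
  rw [lp.inner_eq_tsum, lp.inner_eq_tsum]
  rw [← (Equiv.addRight k).tsum_eq fun n => inner ℂ (u n) (shiftOp (-k) v n)]
  refine tsum_congr fun n => ?_
  simp [shiftOp_apply]

theorem mulOp_adjoint (c : ℤ → ℝ) : mulOp c = (mulOp c).adjoint := by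
  by_cases h : ∃ K : ℝ, ∀ n, |c n| ≤ K
  · obtain ⟨K, hK⟩ := h
    rw [ContinuousLinearMap.eq_adjoint_iff]
    intro u v
    rw [lp.inner_eq_tsum, lp.inner_eq_tsum]
    refine tsum_congr fun n => ?_
    rw [mulOp_apply hK, mulOp_apply hK]
    simp [mul_assoc, mul_left_comm]
  · rw [mulOp, dif_neg h, map_zero]

theorem jacobiOp_isSelfAdjoint (a V : ℤ → ℝ) : IsSelfAdjoint (jacobiOp a V) := by
  rw [ContinuousLinearMap.isSelfAdjoint_iff', jacobiOp, map_add, map_add,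
    ContinuousLinearMap.adjoint_comp, ContinuousLinearMap.adjoint_comp, ← mulOp_adjoint,
    ← mulOp_adjoint, ← shiftOp_adjoint]
  have h := shiftOp_adjoint (-1)
  rw [neg_neg] at h
  rw [← h, add_comm (mulOp a ∘L shiftOp (-1))]

/-- The continuous functional calculus `ψ(T)` of a bounded self-adjoint operator `T`. -/
def funcCalc {H : Type*} [NormedAddCommGroup H] [InnerProductSpace ℂ H] [CompleteSpace H]
    (ψ : ℝ → ℝ) (T : H →L[ℂ] H) : H →L[ℂ] H := cfc ψ T

/-! ### Restrictions to finite boxes -/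

/-- The restriction `H(Λ)` of the Jacobi operator to `ℓ²(Λ)` with Dirichlet boundary conditions:
the compression to `Λ` of the infinite matrix with entries `V(n)` on the diagonal and `a(n)` at the
positions `(n-1, n)` and `(n, n-1)`. -/
def boxMatrix (a V : ℤ → ℝ) (Λ : Finset ℤ) : Matrix Λ Λ ℝ :=
  Matrix.of fun x y =>
    if (y : ℤ) = x then V x
    else if (y : ℤ) = x + 1 then a y
    else if (x : ℤ) = y + 1 then a x
    else 0

theorem boxMatrix_isHermitian (a V : ℤ → ℝ) (Λ : Finset ℤ) : (boxMatrix a V Λ).IsHermitian := by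
  refine Matrix.IsHermitian.ext fun x y => ?_
  simp only [boxMatrix, Matrix.of_apply, star_trivial]
  by_cases h1 : (y : ℤ) = x
  · have : x = y := Subtype.ext h1.symm
    subst this; rfl
  · have h1' : ¬ (x : ℤ) = y := fun h => h1 h.symm
    rw [if_neg h1, if_neg h1']
    by_cases h2 : (y : ℤ) = x + 1
    · have h3 : ¬ (x : ℤ) = y + 1 := by omega
      rw [if_pos h2, if_neg h3, if_pos h2]
    · by_cases h3 : (x : ℤ) = y + 1
      · simp only [h2, if_pos h3, if_false]
      · simp [h2, h3]

/-- The eigenvalues of `H(Λ)`, listed with multiplicity. -/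
def levels (a V : ℤ → ℝ) (Λ : Finset ℤ) : Λ → ℝ := (boxMatrix_isHermitian a V Λ).eigenvalues

open Classical in
/-- `tr 1_J(H(Λ))`, the number of eigenvalues of `H(Λ)` in `J`, with multiplicity. -/
def levelCount (a V : ℤ → ℝ) (Λ : Finset ℤ) (J : Set ℝ) : ℕ :=
  (Finset.univ.filter fun j : Λ => levels a V Λ j ∈ J).card

/-- The box `Λ_L = [1, L] ∩ ℤ`. -/
def box (L : ℕ) : Finset ℤ := Finset.Icc 1 (L : ℤ)

/-! ### Assumptions on the random operator -/

section Random

variable {Ω : Type*} [MeasurableSpace Ω] (P : Measure Ω) (a V : ℤ → Ω → ℝ)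

/-- Stationarity up to a period `q`: the joint law of the coefficients is invariant under the
translation by `q`. -/
def PeriodicInLaw (q : ℕ) : Prop :=
  P.map (fun ω (n : ℤ) => (a (n + q) ω, V (n + q) ω)) = P.map (fun ω (n : ℤ) => (a n ω, V n ω))

/-- (IAD): there is `S` such that the operators restricted to finitely many intervals of `ℤ` at
pairwise distance at least `S` are independent. -/
def IndepAtDistance : Prop :=
  ∃ S : ℕ, ∀ (n : ℕ) (l r : Fin n → ℤ),
    (∀ k k', k ≠ k' → ∀ x ∈ Finset.Icc (l k) (r k), ∀ y ∈ Finset.Icc (l k') (r k'),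
      (S : ℤ) ≤ |x - y|) →
    iIndepFun (fun k ω (e : Finset.Icc (l k) (r k) × Finset.Icc (l k) (r k)) =>
      boxMatrix (a · ω) (V · ω) (Finset.Icc (l k) (r k)) e.1 e.2) P

/-- (W): `ℙ[tr 1_J(H(Λ)) ≥ 1] ≤ C |J| |Λ|^m` for intervals `J ⊆ I` and `Λ ⊆ ℕ`. -/
def Wegner (I : Set ℝ) : Prop :=
  ∃ C > (0 : ℝ), ∃ m ≥ (1 : ℝ), ∀ (l r : ℕ) (c d : ℝ), c ≤ d → Set.Icc c d ⊆ I →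
    P.real {ω | 1 ≤ levelCount (a · ω) (V · ω) (Finset.Icc (l : ℤ) r) (Set.Icc c d)}
      ≤ C * (d - c) * ((Finset.Icc (l : ℤ) r).card : ℝ) ^ m

/-- (M) with exponent `ρ`: `ℙ[tr 1_J(H(Λ)) (tr 1_J(H(Λ)) - 1) ≥ 1] ≤ C (|J| |Λ|)^(1+ρ)` for
intervals `J ⊆ I` and `Λ ⊆ ℕ`; the event says that `H(Λ)` has at least two eigenvalues in `J`. -/
def Minami (I : Set ℝ) (ρ : ℝ) : Prop :=
  ∃ C > (0 : ℝ), ∀ (l r : ℕ) (c d : ℝ), c ≤ d → Set.Icc c d ⊆ I →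
    P.real {ω | 2 ≤ levelCount (a · ω) (V · ω) (Finset.Icc (l : ℤ) r) (Set.Icc c d)}
      ≤ C * ((d - c) * ((Finset.Icc (l : ℤ) r).card : ℝ)) ^ (1 + ρ)

/-- (Loc): for every `ξ ∈ (0,1)`, the expectation of
`∑_y e^{|x-y|^ξ} |⟨δ_x, f(H(Λ_L)) δ_y⟩|` is bounded uniformly in the box `Λ_L`, the site
`x ∈ Λ_L`, and the Borel functions `f` with `|f| ≤ 1` that are supported in `I`. -/
def Localized (I : Set ℝ) : Prop :=
  ∀ ξ ∈ Set.Ioo (0 : ℝ) 1, ∃ B : NNReal, ∀ (L : ℕ) (x : box L) (f : ℝ → ℝ), Measurable f →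
    (∀ E, |f E| ≤ 1) → Function.support f ⊆ I →
    ∫⁻ ω, ∑ y : box L, ENNReal.ofReal
      (Real.exp (|((x : ℤ) : ℝ) - ((y : ℤ) : ℝ)| ^ ξ)
        * |cfc f (boxMatrix (a · ω) (V · ω) (box L)) x y|) ∂P ≤ B

/-- `κ` is the density of states measure of an operator with period `q` in law: for continuous `ψ`,
`∫ ψ dκ` is the mean of `𝔼⟨δ_x, ψ(H_ω) δ_x⟩` over one period of sites `x`. -/
def IsDensityOfStates (q : ℕ) (κ : Measure ℝ) : Prop :=
  ∀ ψ : ℝ → ℝ, Continuous ψ →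
    ∫ E, ψ E ∂κ = (1 / (q : ℝ)) * ∑ x ∈ Finset.range q,
      ∫ ω, (inner ℂ (delta x) (funcCalc ψ (jacobiOp (a · ω) (V · ω)) (delta x))).re ∂P

end Random

/-- The integrated density of states `N(E) = κ((-∞, E])`. -/
def ids (κ : Measure ℝ) (E : ℝ) : ℝ := κ.real (Set.Iic E)

/-- `R(t)`, the supremum of `N(J) = κ(J)` over the intervals `J ⊆ I` with `|J| ≤ t`. -/
def idsModulus (κ : Measure ℝ) (I : Set ℝ) (t : ℝ) : ENNReal :=
  ⨆ (c : ℝ) (d : ℝ) (_ : c ≤ d) (_ : Set.Icc c d ⊆ I) (_ : d - c ≤ t), κ (Set.Icc c d)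

/-- (R), at polynomial scales `l' = L^β`: for all `η ∈ (0,1)`,
`L * sup {N(J) : |J| ≤ e^{-(l')^η}} → 0`. -/
def RegularIDS (κ : Measure ℝ) (I : Set ℝ) : Prop :=
  ∀ β ∈ Set.Ioo (0 : ℝ) 1, ∀ η ∈ Set.Ioo (0 : ℝ) 1,
    Tendsto (fun L : ℕ => (L : ENNReal) * idsModulus κ I (Real.exp (-(((L : ℝ) ^ β) ^ η))))
      atTop (𝓝 0)

/-- The lower growth bound on the IDS near `E₀` with exponent `1 + ρ'`. -/
def LowerGrowth (κ : Measure ℝ) (E₀ ρ' : ℝ) : Prop :=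
  ∀ δ ∈ Set.Ioo (0 : ℝ) 1, ∃ C > (0 : ℝ), ∃ ε₀ > (0 : ℝ), ∀ ε ∈ Set.Ioo 0 ε₀,
    ∀ t ∈ Set.Icc (-1 : ℝ) 1,
      C * ε ^ (1 + ρ') ≤ |ids κ (E₀ + (t + δ) * ε) - ids κ (E₀ + t * ε)|

/-! ### Unfolded level statistics -/

/-- The unfolded levels `ξ_j = |Λ| (N(E_j) - N(E₀))` of `H(Λ_L)`. -/
def unfolded (κ : Measure ℝ) (E₀ : ℝ) (a V : ℤ → ℝ) (L : ℕ) (j : box L) : ℝ :=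
  (L : ℝ) * (ids κ (levels a V (box L) j) - ids κ E₀)

open Classical in
/-- `#{j : ξ_j ∈ I}`. -/
def unfoldedCount (κ : Measure ℝ) (E₀ : ℝ) (a V : ℤ → ℝ) (L : ℕ) (I : Set ℝ) : ℕ :=
  (Finset.univ.filter fun j : box L => unfolded κ E₀ a V L j ∈ I).card

/-- The point process `Ξ = ∑_j δ_{ξ_j}`. -/
def unfoldedProcess (κ : Measure ℝ) (E₀ : ℝ) (a V : ℤ → ℝ) (L : ℕ) : Measure ℝ :=
  ∑ j : box L, Measure.dirac (unfolded κ E₀ a V L j)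

/-- The probability that independent Poisson variables with means `|I_j|` take the values `k_j`. -/
def poissonProb {p : ℕ} (I : Fin p → Set ℝ) (k : Fin p → ℕ) : ℝ :=
  ∏ j, Real.exp (-volume.real (I j)) * volume.real (I j) ^ k j / (k j).factorial

/-- Weak convergence (for the vague topology on locally finite measures) of the point processes
`Ξ L` to the Poisson process on `ℝ` with Lebesgue intensity, expressed by the convergence of the
Laplace functionals at every continuous compactly supported `f ≥ 0`; the Laplace functional of this
Poisson process is `exp (-∫ (1 - e^{-f(x)}) dx)`. -/
def WeaklyConvergesToPoisson {Ω : Type*} [MeasurableSpace Ω] (P : Measure Ω)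
    (Ξ : ℕ → Ω → Measure ℝ) : Prop :=
  ∀ f : ℝ → ℝ, Continuous f → HasCompactSupport f → (∀ x, 0 ≤ f x) →
    Tendsto (fun L => ∫ ω, Real.exp (-∫ x, f x ∂(Ξ L ω)) ∂P) atTop
      (𝓝 (Real.exp (-∫ x, (1 - Real.exp (-f x)))))

end RandomJacobi

end

open RandomJacobi

/-! Counts of unfolded levels in disjoint intervals are compared in total variation (`CloseWithin`)
with independent Poisson variables, by cutting the box of length `L` into `n ≈ L^(1-β)` blocks of
length `m ≈ L^β`, separated by gaps that make them independent. Since the IDS is monotone, an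
interval `J` of unfolded values comes from an interval of energies, of `κ`-mass `|J|/L`;
`LowerGrowth` confines the energies with unfolded value at most `L^(1-α)` to a window around `E₀` of
width of order `w = L^(-a₀)`, `a₀ = α/(1+ρ')`.

Decoupling. With high probability every eigenfunction of the box and of the blocks has a centre, and
is negligible beyond distance `L^τ` from it. To see this, cut the energies into polynomially many
cells; by (M) each contains at most one level, so the spectral projection of a cell has rank at most
one and (Loc) bounds the eigenfunction itself. Restricting eigenfunctions to blocks, or extending
those of blocks by zero, gives almost orthonormal approximate eigenvectors, so
`card_le_card_eigenvalues_near` compares the counts of the box with the summed counts of the blocks.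
They differ only through levels exponentially close to the ends of an interval and levels centred in
gaps or near ends of blocks. The mean numbers of both are bounded by (W); for the second kind it is
applied only to boxes of size `L^τ`, so its power of the volume costs a factor `L^O(τ)`. This is
`LocalizedModel.decoupling`.

One block. A law on configurations is close to a Poisson law with means `l j` if the mean number of
points in multiple configurations, the total error of the means and `(∑ l j)^2` are small
(`closeWithin_poissonPi`). Errors add under convolution, so each of these must be `o(1/n)`. For
multiple points, (M) bounds the probability of two levels; a large number of levels would need many
separated centres, which is unlikely by (W) and independence (`exists_integral_multiple_le`). For
the means, decoupling a box into its halves shows that mean counts are almost additive; iterated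
doubling telescopes to the density of states, which is identified as a limit through moments
(`exists_meanCount_sub_le`). (R) enters only by excluding atoms of `κ` in `I`. For the square, `∑ l
j` is essentially the probability `p` that the block has a level in the window. Since (W) may carry
a high power of the volume, it is too weak here. Instead, two independent copies of the block fit
into a box about twice as long; if both are occupied, that box has two levels unless decoupling
fails, so (M) bounds `p^2` by about `(w m)^(1+ρ)` (`exists_occupied_sq_le`).

Exponents. The total error vanishes if `max β (1-β) < a₀` and `1 + ρβ < a₀(1+ρ)`. Such `β` exists
exactly because `a₀(1+2ρ) > 1+ρ`, which is the lower bound on `α`. The estimate is uniform over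
families of up to `exp(L^δ)` intervals: edge terms are exponentially small, and disjointness makes
the other terms insensitive to the number of intervals. Probabilities of prescribed counts and
Laplace functionals are then read off from total variation closeness. -/

namespace RandomJacobi

/-! ### Spectral decomposition and approximate eigenvectors of symmetric matrices. -/

section Spectral

variable {n : Type*} [Fintype n] [DecidableEq n] {A : Matrix n n ℝ}

/-- The entries of an orthonormal basis of eigenvectors. -/
noncomputable def eigvec (hA : A.IsHermitian) (i x : n) : ℝ := hA.eigenvectorBasis i x

theorem eigvec_orthonormal (hA : A.IsHermitian) (i j : n) :
    ∑ x, eigvec hA i x * eigvec hA j x = if i = j then 1 else 0 := by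
  have h := orthonormal_iff_ite.mp hA.eigenvectorBasis.orthonormal i j
  rw [← h, PiLp.inner_apply]
  simp [eigvec, mul_comm]

theorem eigvec_complete (hA : A.IsHermitian) (x y : n) :
    ∑ i, eigvec hA i x * eigvec hA i y = if x = y then 1 else 0 := by
  have h := congrFun₂ (Unitary.coe_mul_star_self hA.eigenvectorUnitary) x y
  rw [Matrix.mul_apply] at h
  simpa [Matrix.one_apply, eigvec, Matrix.star_apply, Matrix.IsHermitian.eigenvectorUnitary_apply] using h

theorem sum_mul_eigvec (hA : A.IsHermitian) (i x : n) :
    ∑ y, A x y * eigvec hA i y = hA.eigenvalues i * eigvec hA i x := by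
  have h := congrFun (hA.mulVec_eigenvectorBasis i) x
  simpa [Matrix.mulVec, dotProduct, eigvec] using h

theorem cfc_apply_eq_sum (hA : A.IsHermitian) (f : ℝ → ℝ) (x y : n) :
    cfc f A x y = ∑ i, f (hA.eigenvalues i) * (eigvec hA i x * eigvec hA i y) := by
  rw [hA.cfc_eq, Matrix.IsHermitian.cfc, Unitary.conjStarAlgAut_apply, Matrix.mul_apply]
  refine Finset.sum_congr rfl fun i _ => ?_
  simp [Matrix.mul_diagonal, eigvec, Matrix.star_apply, Matrix.IsHermitian.eigenvectorUnitary_apply]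
  ring

open Classical in
theorem trace_cfc_indicator (hA : A.IsHermitian) (J : Set ℝ) :
    ∑ x, cfc (J.indicator (fun _ => (1 : ℝ))) A x x
      = ((Finset.univ.filter fun i => hA.eigenvalues i ∈ J).card : ℝ) := by
  simp_rw [cfc_apply_eq_sum hA]
  rw [Finset.sum_comm]
  simp_rw [← Finset.mul_sum, eigvec_orthonormal]
  simp [Set.indicator_apply]

-- On the two finite spectra `f` agrees with one interpolating polynomial, and polynomials commute
-- with the algebra isomorphism given by reindexing.
open Polynomial in
theorem cfc_submatrix_equiv {m : Type*} [Fintype m] [DecidableEq m] (hA : A.IsHermitian)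
    (e : m ≃ n) (f : ℝ → ℝ) (x y : m) :
    cfc f (A.submatrix e e) x y = cfc f A (e x) (e y) := by
  have hB : (A.submatrix e e).IsHermitian := hA.submatrix e
  let S : Finset ℝ := Finset.univ.image hA.eigenvalues ∪ Finset.univ.image hB.eigenvalues
  let p : ℝ[X] := Lagrange.interpolate S id f
  have hp : ∀ E ∈ S, f E = p.eval E := fun E hE =>
    (Lagrange.eval_interpolate_at_node (v := id) f (Set.injOn_id _) hE).symm
  have h1 : cfc f A = aeval A p := by
    rw [← cfc_polynomial p A hA.isSelfAdjoint]
    refine cfc_congr fun E hE => hp E ?_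
    rw [hA.spectrum_real_eq_range_eigenvalues] at hE
    obtain ⟨i, rfl⟩ := hE
    simp [S]
  have h2 : cfc f (A.submatrix e e) = aeval (A.submatrix e e) p := by
    rw [← cfc_polynomial p _ hB.isSelfAdjoint]
    refine cfc_congr fun E hE => hp E ?_
    rw [hB.spectrum_real_eq_range_eigenvalues] at hE
    obtain ⟨i, rfl⟩ := hE
    simp [S]
  have h3 : A.submatrix e e = Matrix.reindexAlgEquiv ℝ ℝ e.symm A := by
    ext i j; simp
  rw [h1, h2, h3, aeval_algHom_apply]
  simp

theorem sum_sq_eigvec_coeff (hA : A.IsHermitian) (u : n → ℝ) :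
    ∑ i, (∑ x, eigvec hA i x * u x) ^ 2 = ∑ x, u x ^ 2 := by
  calc ∑ i, (∑ x, eigvec hA i x * u x) ^ 2
      = ∑ i, ∑ x, ∑ y, (eigvec hA i x * eigvec hA i y) * (u x * u y) := by
        refine Finset.sum_congr rfl fun i _ => ?_
        rw [sq, Finset.sum_mul_sum]
        exact Finset.sum_congr rfl fun x _ => Finset.sum_congr rfl fun y _ => by ring
    _ = ∑ x, ∑ y, (∑ i, eigvec hA i x * eigvec hA i y) * (u x * u y) := by
        rw [Finset.sum_comm]
        refine Finset.sum_congr rfl fun x _ => ?_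
        rw [Finset.sum_comm]
        exact Finset.sum_congr rfl fun y _ => (Finset.sum_mul _ _ _).symm
    _ = ∑ x, u x ^ 2 := by
        simp [eigvec_complete, sq]

theorem sum_eigvec_mul_mulVec (hA : A.IsHermitian) (i : n) (u : n → ℝ) :
    ∑ x, eigvec hA i x * ∑ y, A x y * u y = hA.eigenvalues i * ∑ x, eigvec hA i x * u x := by
  simp_rw [Finset.mul_sum]
  rw [Finset.sum_comm]
  refine Finset.sum_congr rfl fun y _ => ?_
  rw [← mul_assoc, ← sum_mul_eigvec, Finset.sum_mul]
  refine Finset.sum_congr rfl fun x _ => ?_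
  have : A x y = A y x := by simpa using hA.apply y x
  rw [this]; ring

open Classical in
/-- An almost orthonormal family of approximate eigenvectors forces at least as many eigenvalues
near the approximate ones. -/
theorem card_le_card_eigenvalues_near (hA : A.IsHermitian) {s : Type*} [Fintype s]
    [DecidableEq s] (v : s → n → ℝ) (E : s → ℝ) {η η' ε : ℝ} (hε : 0 < ε)
    (horth : ∀ i j, |∑ x, v i x * v j x - if i = j then 1 else 0| ≤ η)
    (happ : ∀ i, ∑ x, (∑ y, A x y * v i y - E i * v i x) ^ 2 ≤ η')
    (hsmall : Fintype.card s * (η + η' / ε ^ 2) < 1) :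
    Fintype.card s ≤ (Finset.univ.filter fun e => ∃ i, |hA.eigenvalues e - E i| ≤ ε).card := by
  by_contra! hlt
  set T := Finset.univ.filter fun e => ∃ i, |hA.eigenvalues e - E i| ≤ ε with hT
  let b : n → s → ℝ := fun e i => ∑ x, eigvec hA e x * v i x
  -- If `T` had fewer elements than `s`, some nonzero combination of the `v i` would be orthogonal
  -- to all eigenvectors indexed by `T`. Almost orthonormality makes its norm large, while `hres`
  -- makes the part outside `T` small.
  let F : (s → ℝ) →ₗ[ℝ] (T → ℝ) := Matrix.toLin' (Matrix.of fun (e : T) i => b e i)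
  have hker : LinearMap.ker F ≠ ⊥ := by
    apply LinearMap.ker_ne_bot_of_finrank_lt
    simpa using hlt
  obtain ⟨c, hc, hc0⟩ := (Submodule.ne_bot_iff _).1 hker
  have hbc : ∀ e ∈ T, ∑ i, b e i * c i = 0 := by
    intro e he
    have := congrFun (LinearMap.mem_ker.1 hc) ⟨e, he⟩
    simpa [F, Matrix.toLin'_apply, Matrix.mulVec, dotProduct] using this
  set N : ℝ := ∑ i, c i ^ 2 with hN
  have hNpos : 0 < N := by
    obtain ⟨i, hi⟩ := Function.ne_iff.1 hc0
    have hi' : c i ≠ 0 := by simpa using hi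
    exact Finset.sum_pos' (fun _ _ => sq_nonneg _) ⟨i, Finset.mem_univ _, by positivity⟩
  have hl1 : (∑ i, |c i|) ^ 2 ≤ Fintype.card s * N := by
    have := sq_sum_le_card_mul_sum_sq (s := (Finset.univ : Finset s)) (f := fun i => |c i|)
    simpa [sq_abs] using this
  have hη : 0 ≤ η := by
    obtain ⟨i, -⟩ := Function.ne_iff.1 hc0
    exact (abs_nonneg _).trans (horth i i)
  -- lower bound for the norm of the combination
  have hlow : N - η * (Fintype.card s * N) ≤ ∑ x, (∑ i, c i * v i x) ^ 2 := by
    have h1 : ∑ x, (∑ i, c i * v i x) ^ 2 = ∑ i, ∑ j, c i * c j * ∑ x, v i x * v j x := by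
      simp_rw [sq, Finset.sum_mul_sum, Finset.mul_sum]
      rw [Finset.sum_comm]
      refine Finset.sum_congr rfl fun i _ => ?_
      rw [Finset.sum_comm]
      exact Finset.sum_congr rfl fun j _ => Finset.sum_congr rfl fun x _ => by ring
    have h2 : N = ∑ i, ∑ j, c i * c j * (if i = j then 1 else 0) := by
      simp [hN, sq]
    have h3 : N - ∑ x, (∑ i, c i * v i x) ^ 2 ≤ η * (∑ i, |c i|) ^ 2 := by
      rw [h1, h2, ← Finset.sum_sub_distrib, sq, Finset.sum_mul_sum, Finset.mul_sum]
      refine Finset.sum_le_sum fun i _ => ?_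
      rw [← Finset.sum_sub_distrib, Finset.mul_sum]
      refine Finset.sum_le_sum fun j _ => ?_
      rw [← mul_sub]
      refine (le_abs_self _).trans ?_
      rw [abs_mul, abs_mul, abs_sub_comm, mul_comm]
      exact mul_le_mul_of_nonneg_right (horth i j) (by positivity)
    nlinarith
  -- upper bound
  have hcoef : ∀ e, ∑ x, eigvec hA e x * (∑ i, c i * v i x) = ∑ i, b e i * c i := by
    intro e
    simp_rw [b, Finset.mul_sum, Finset.sum_mul]
    rw [Finset.sum_comm]
    exact Finset.sum_congr rfl fun j _ => Finset.sum_congr rfl fun x _ => by ring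
  -- The residual of `v i` has coefficient `(λ_e - E i) * b e i` along the eigenvector `e`, and
  -- `|λ_e - E i| > ε` off `T`.
  have hres : ∀ i, ∑ e ∈ Finset.univ.filter (fun e => e ∉ T), b e i ^ 2 ≤ η' / ε ^ 2 := by
    intro i
    rw [le_div_iff₀ (by positivity), Finset.sum_mul]
    refine le_trans ?_ (happ i)
    rw [← sum_sq_eigvec_coeff hA]
    refine le_trans (Finset.sum_le_sum fun e he => ?_)
      (Finset.sum_le_sum_of_subset_of_nonneg (Finset.filter_subset (fun e => e ∉ T) _)
        fun _ _ _ => sq_nonneg _)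
    have h1 : ∑ x, eigvec hA e x * (∑ y, A x y * v i y - E i * v i x)
        = (hA.eigenvalues e - E i) * b e i := by
      simp_rw [mul_sub, Finset.sum_sub_distrib, sum_eigvec_mul_mulVec]
      rw [sub_mul, Finset.mul_sum (a := E i)]
      congr 1
      exact Finset.sum_congr rfl fun x _ => by ring
    rw [h1, mul_pow, mul_comm]
    refine mul_le_mul_of_nonneg_right ?_ (sq_nonneg _)
    have h2 : ε < |hA.eigenvalues e - E i| := by
      by_contra! hcon
      exact (Finset.mem_filter.1 he).2 (Finset.mem_filter.2 ⟨Finset.mem_univ _, i, hcon⟩)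
    rw [← sq_abs (hA.eigenvalues e - E i)]
    exact pow_le_pow_left₀ hε.le h2.le 2
  have hup : ∑ x, (∑ i, c i * v i x) ^ 2 ≤ N * (Fintype.card s * (η' / ε ^ 2)) := by
    rw [← sum_sq_eigvec_coeff hA]
    simp_rw [hcoef]
    rw [← Finset.sum_filter_add_sum_filter_not Finset.univ (fun e => e ∈ T),
      Finset.sum_eq_zero fun e he => by rw [hbc e (Finset.mem_filter.1 he).2, sq, mul_zero],
      zero_add]
    calc _ ≤ ∑ e ∈ Finset.univ.filter (fun e => e ∉ T), (∑ i, b e i ^ 2) * N :=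
          Finset.sum_le_sum fun e _ => Finset.sum_mul_sq_le_sq_mul_sq _ _ _
      _ = (∑ i, ∑ e ∈ Finset.univ.filter (fun e => e ∉ T), b e i ^ 2) * N := by
          rw [Finset.sum_comm, Finset.sum_mul]
      _ ≤ (∑ _i : s, η' / ε ^ 2) * N :=
          mul_le_mul_of_nonneg_right (Finset.sum_le_sum fun i _ => hres i) hNpos.le
      _ = _ := by simp; ring
  have : N * (Fintype.card s * (η + η' / ε ^ 2)) < N * 1 := mul_lt_mul_of_pos_left hsmall hNpos
  nlinarith

end Spectral

/-! ### Measurability of the functional calculus of a random matrix. -/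

section Measurability

variable {X n : Type*} [MeasurableSpace X] [Fintype n] [DecidableEq n]

theorem measurable_pow_apply {A : X → Matrix n n ℝ} (hA : ∀ i j, Measurable fun ω => A ω i j)
    (k : ℕ) (i j : n) : Measurable fun ω => (A ω ^ k) i j := by
  induction k generalizing i j with
  | zero => simp only [pow_zero]; exact measurable_const
  | succ k ih =>
    simp only [pow_succ, Matrix.mul_apply]
    exact Finset.measurable_sum _ fun l _ => (ih i l).mul (hA l j)

open Polynomial in
theorem measurable_aeval_apply {A : X → Matrix n n ℝ} (hA : ∀ i j, Measurable fun ω => A ω i j)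
    (p : ℝ[X]) (i j : n) : Measurable fun ω => (aeval (A ω) p) i j := by
  simp only [aeval_eq_sum_range, Matrix.sum_apply, Matrix.smul_apply, smul_eq_mul]
  exact Finset.measurable_sum _ fun k _ => (measurable_pow_apply hA k i j).const_mul _

/-- The chosen eigenbasis need not depend measurably on `ω`, so the entries are obtained as
pointwise limits of polynomials in the matrix: `p N` approximates `f` on `[-N, N]`, which eventually
contains each given spectrum. -/
theorem measurable_cfc_apply_of_continuous {A : X → Matrix n n ℝ}
    (hA : ∀ i j, Measurable fun ω => A ω i j) (hH : ∀ ω, (A ω).IsHermitian)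
    {f : ℝ → ℝ} (hf : Continuous f) (i j : n) : Measurable fun ω => cfc f (A ω) i j := by
  have h : ∀ N : ℕ, ∃ p : Polynomial ℝ, ∀ x ∈ Set.Icc (-(N : ℝ)) N,
      |p.eval x - f x| < 1 / ((N : ℝ) + 1) := fun N =>
    exists_polynomial_near_of_continuousOn _ _ f hf.continuousOn _ (by positivity)
  choose p hp using h
  refine measurable_of_tendsto_metrizable (f := fun N ω => (Polynomial.aeval (A ω) (p N)) i j)
    (fun N => measurable_aeval_apply hA _ i j) (tendsto_pi_nhds.2 fun ω => ?_)
  have : ∀ N, (Polynomial.aeval (A ω) (p N)) i j = cfc (p N).eval (A ω) i j := fun N => by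
    rw [← cfc_polynomial (p N) _ (hH ω).isSelfAdjoint]
  simp_rw [this, cfc_apply_eq_sum (hH ω)]
  refine tendsto_finsetSum _ fun e _ => Tendsto.mul_const _ ?_
  rw [tendsto_iff_norm_sub_tendsto_zero]
  refine squeeze_zero' (Eventually.of_forall fun _ => norm_nonneg _) ?_
    tendsto_one_div_add_atTop_nhds_zero_nat
  obtain ⟨N₀, hN₀⟩ := exists_nat_ge |(hH ω).eigenvalues e|
  filter_upwards [eventually_ge_atTop N₀] with N hN
  exact (hp N _ (abs_le.1 (hN₀.trans (by exact_mod_cast hN)))).le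

/-- A π-λ argument started from closed sets, whose indicators are pointwise limits of continuous
functions; on a finite spectrum, pointwise convergence of functions passes to the entries. -/
theorem measurable_cfc_indicator_apply {A : X → Matrix n n ℝ}
    (hA : ∀ i j, Measurable fun ω => A ω i j) (hH : ∀ ω, (A ω).IsHermitian)
    {J : Set ℝ} (hJ : MeasurableSet J) (i j : n) :
    Measurable fun ω => cfc (J.indicator fun _ => (1 : ℝ)) (A ω) i j := by
  have hlim : ∀ (g : ℕ → ℝ → ℝ) (f : ℝ → ℝ), Tendsto g atTop (𝓝 f) →
      (∀ N, Measurable fun ω => cfc (g N) (A ω) i j) → Measurable fun ω => cfc f (A ω) i j := by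
    intro g f hg hm
    refine measurable_of_tendsto_metrizable hm (tendsto_pi_nhds.2 fun ω => ?_)
    simp_rw [cfc_apply_eq_sum (hH ω)]
    exact tendsto_finsetSum _ fun e _ => (tendsto_pi_nhds.1 hg _).mul_const _
  have hgen : (inferInstance : MeasurableSpace ℝ)
      = MeasurableSpace.generateFrom {s : Set ℝ | IsClosed s} := by
    rw [← borel_eq_generateFrom_isClosed]
    exact BorelSpace.measurable_eq
  induction J, hJ using MeasurableSpace.induction_on_inter hgen isPiSystem_isClosed with
  | empty =>
    simp_rw [cfc_apply_eq_sum (hH _)]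
    simp
  | basic t ht =>
    replace ht : IsClosed t := ht
    have hk := HasOuterApproxClosed.tendsto_apprSeq (X := ℝ) (F := t) ht
    refine hlim (fun N x => ((IsClosed.apprSeq ht N x : NNReal) : ℝ)) _ ?_ fun N => ?_
    · rw [tendsto_pi_nhds] at hk ⊢
      intro x
      have e : t.indicator (fun _ => (1 : ℝ)) x
          = ((t.indicator (fun _ => (1 : NNReal)) x : NNReal) : ℝ) := by
        by_cases hx : x ∈ t <;> simp [hx]
      rw [e]
      exact (NNReal.continuous_coe.tendsto _).comp (hk x)
    · exact measurable_cfc_apply_of_continuous hA hH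
        (NNReal.continuous_coe.comp (IsClosed.apprSeq ht N).continuous) i j
  | compl t _ ih =>
    have : (fun ω => cfc (tᶜ.indicator fun _ => (1 : ℝ)) (A ω) i j)
        = fun ω => (if i = j then 1 else 0) - cfc (t.indicator fun _ => (1 : ℝ)) (A ω) i j := by
      funext ω
      rw [cfc_apply_eq_sum (hH ω), cfc_apply_eq_sum (hH ω), ← eigvec_complete (hH ω),
        ← Finset.sum_sub_distrib]
      refine Finset.sum_congr rfl fun e _ => ?_
      by_cases h : (hH ω).eigenvalues e ∈ t <;> simp [h]
    rw [this]
    exact measurable_const.sub ih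
  | iUnion f hd _ ih =>
    refine hlim (fun N x => ∑ k ∈ Finset.range N, (f k).indicator (fun _ => (1 : ℝ)) x) _ ?_
      fun N => ?_
    · rw [tendsto_pi_nhds]
      intro x
      by_cases hx : x ∈ ⋃ k, f k
      · obtain ⟨k, hk⟩ := Set.mem_iUnion.1 hx
        refine tendsto_const_nhds.congr' ?_
        filter_upwards [eventually_gt_atTop k] with N hN
        rw [Set.indicator_of_mem hx, Finset.sum_eq_single k]
        · rw [Set.indicator_of_mem hk]
        · intro l _ hl
          exact Set.indicator_of_notMem (fun h => Set.disjoint_left.1 (hd hl) h hk) _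
        · intro h; simp at h; omega
      · rw [Set.indicator_of_notMem hx]
        refine tendsto_const_nhds.congr fun N => (Finset.sum_eq_zero fun k _ => ?_).symm
        exact Set.indicator_of_notMem (fun h => hx (Set.mem_iUnion.2 ⟨k, h⟩)) _
    · have : (fun ω => cfc (fun x => ∑ k ∈ Finset.range N, (f k).indicator (fun _ => (1 : ℝ)) x)
          (A ω) i j) = fun ω => ∑ k ∈ Finset.range N,
            cfc ((f k).indicator fun _ => (1 : ℝ)) (A ω) i j := by
        funext ω
        simp_rw [cfc_apply_eq_sum (hH ω), Finset.sum_mul]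
        rw [Finset.sum_comm]
      rw [this]
      exact Finset.measurable_sum _ fun k _ => ih k

end Measurability

end RandomJacobi

namespace RandomJacobi

/-! ### Eigenfunctions of boxes as functions on the lattice -/

/-- The matrix entries of the Jacobi operator on `ℤ`. -/
noncomputable def jacobiKernel (a V : ℤ → ℝ) (x y : ℤ) : ℝ :=
  if y = x then V x else if y = x + 1 then a y else if x = y + 1 then a x else 0

theorem abs_jacobiKernel_le {a V : ℤ → ℝ} {K : ℝ} (hK : ∀ n, |a n| ≤ K ∧ |V n| ≤ K) (x y : ℤ) :
    |jacobiKernel a V x y| ≤ K := by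
  have h0 : 0 ≤ K := (abs_nonneg _).trans (hK 0).1
  unfold jacobiKernel
  split_ifs
  exacts [(hK _).2, (hK _).1, (hK _).1, by simpa using h0]

theorem jacobiKernel_eq_zero {a V : ℤ → ℝ} {x y : ℤ} (h : 1 < |x - y|) :
    jacobiKernel a V x y = 0 := by
  unfold jacobiKernel
  rw [if_neg, if_neg, if_neg]
  · rintro rfl; simp at h
  · rintro rfl; simp at h
  · rintro rfl; simp at h

/-- The eigenfunctions of `H(Λ)`, extended by zero to `ℤ`. -/
noncomputable def boxEig (a V : ℤ → ℝ) (Λ : Finset ℤ) (i : Λ) (n : ℤ) : ℝ :=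
  if h : n ∈ Λ then eigvec (boxMatrix_isHermitian a V Λ) i ⟨n, h⟩ else 0

theorem boxEig_coe (a V : ℤ → ℝ) (Λ : Finset ℤ) (i x : Λ) :
    boxEig a V Λ i x = eigvec (boxMatrix_isHermitian a V Λ) i x := by
  simp [boxEig]

theorem boxEig_of_notMem (a V : ℤ → ℝ) {Λ : Finset ℤ} (i : Λ) {n : ℤ} (h : n ∉ Λ) :
    boxEig a V Λ i n = 0 := by
  simp [boxEig, h]

theorem boxEig_orthonormal (a V : ℤ → ℝ) (Λ : Finset ℤ) (i j : Λ) :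
    ∑ n ∈ Λ, boxEig a V Λ i n * boxEig a V Λ j n = if i = j then 1 else 0 := by
  rw [← eigvec_orthonormal (boxMatrix_isHermitian a V Λ) i j, ← Finset.sum_coe_sort]
  simp_rw [boxEig_coe]

theorem sum_jacobiKernel_mul_boxEig (a V : ℤ → ℝ) (Λ : Finset ℤ) (i : Λ) {n : ℤ} (hn : n ∈ Λ) :
    ∑ y ∈ Λ, jacobiKernel a V n y * boxEig a V Λ i y = levels a V Λ i * boxEig a V Λ i n := by
  have h := sum_mul_eigvec (boxMatrix_isHermitian a V Λ) i ⟨n, hn⟩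
  rw [← Finset.sum_coe_sort]
  simp_rw [boxEig_coe]
  rw [show boxEig a V Λ i n = boxEig a V Λ i ((⟨n, hn⟩ : Λ) : ℤ) from rfl, boxEig_coe]
  exact h

/-! ### Level counts -/

theorem levelCount_mono (a V : ℤ → ℝ) (Λ : Finset ℤ) {J J' : Set ℝ} (h : J ⊆ J') :
    levelCount a V Λ J ≤ levelCount a V Λ J' := by
  classical
  exact Finset.card_le_card fun i hi => by simpa using h (by simpa using hi)

theorem levelCount_le_card (a V : ℤ → ℝ) (Λ : Finset ℤ) (J : Set ℝ) :
    levelCount a V Λ J ≤ Λ.card := by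
  classical
  exact (Finset.card_le_univ _).trans (by simp)

theorem levelCount_union_le (a V : ℤ → ℝ) (Λ : Finset ℤ) (J J' : Set ℝ) :
    levelCount a V Λ (J ∪ J') ≤ levelCount a V Λ J + levelCount a V Λ J' := by
  classical
  refine le_trans (Finset.card_le_card fun i hi => ?_) (Finset.card_union_le _ _)
  simpa using hi

theorem sum_levelCount_le {ι : Type*} [Fintype ι] (a V : ℤ → ℝ) (Λ : Finset ℤ) {J : ι → Set ℝ}
    {W : Set ℝ} (hJ : ∀ j, J j ⊆ W) (hd : ∀ i j, i ≠ j → Disjoint (J i) (J j)) :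
    ∑ j, levelCount a V Λ (J j) ≤ levelCount a V Λ W := by
  classical
  unfold levelCount
  rw [← Finset.card_biUnion]
  · exact Finset.card_le_card fun i hi => by
      obtain ⟨j, -, hj⟩ := Finset.mem_biUnion.1 hi
      exact Finset.mem_filter.2 ⟨Finset.mem_univ _, hJ j (Finset.mem_filter.1 hj).2⟩
  · intro i _ j _ hij
    refine Finset.disjoint_left.2 fun e he he' => ?_
    exact Set.disjoint_left.1 (hd i j hij) (Finset.mem_filter.1 he).2 (Finset.mem_filter.1 he').2

/-- Writing the count as a trace frees it from the choice of eigenbasis; measurability and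
translation covariance are deduced in this form. -/
theorem levelCount_eq_trace (a V : ℤ → ℝ) (Λ : Finset ℤ) (J : Set ℝ) :
    (levelCount a V Λ J : ℝ)
      = ∑ x, cfc (J.indicator fun _ => (1 : ℝ)) (boxMatrix a V Λ) x x :=
  (trace_cfc_indicator (boxMatrix_isHermitian a V Λ) J).symm

/-- The closed `ε`-neighbourhood of a set of energies. -/
def nearSet (ε : ℝ) (J : Set ℝ) : Set ℝ := {E | ∃ E' ∈ J, |E - E'| ≤ ε}

theorem levelCount_nearSet_le (a V : ℤ → ℝ) (Λ : Finset ℤ) (ε : ℝ) (J : Set ℝ) :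
    levelCount a V Λ (nearSet ε J)
      ≤ levelCount a V Λ J + levelCount a V Λ (nearSet ε J \ J) :=
  (levelCount_mono a V Λ (by rw [Set.union_sdiff_self]; exact Set.subset_union_right)).trans
    (levelCount_union_le a V Λ _ _)

/-! ### Localized eigenfunctions and decoupling -/

/-- Every eigenfunction of `H(Λ)` with energy in `W` is at most `δ` outside the ball of radius `t`
around some centre. -/
def HasCenters (a V : ℤ → ℝ) (Λ : Finset ℤ) (W : Set ℝ) (t : ℤ) (δ : ℝ) : Prop :=
  ∀ i : Λ, levels a V Λ i ∈ W →
    ∃ x ∈ Λ, ∀ y ∈ Λ, t ≤ |y - x| → |boxEig a V Λ i y| ≤ δ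

/-- The smallness of the errors for boxes of size at most `M`. -/
def SmallErr (K M δ ε : ℝ) : Prop := M * (M * δ ^ 2 + M * (M * K * δ) ^ 2 / ε ^ 2) < 1

/-- Restricted to `b`, these eigenfunctions lose only entries of size `δ`: inner products change by
at most `M δ²`, and the eigenvalue equation fails only by the hopping terms from `Λ \ b`, at most `M
K δ` per site. They are thus approximate eigenvectors of `H(b)`. -/
theorem card_le_levelCount_restrict {a V : ℤ → ℝ} {K : ℝ} (hK : ∀ n, |a n| ≤ K ∧ |V n| ≤ K)
    {Λ b : Finset ℤ} (hb : b ⊆ Λ) {δ ε M : ℝ} (hε : 0 < ε) (hM : (Λ.card : ℝ) ≤ M)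
    (hsmall : SmallErr K M δ ε) {J : Set ℝ} (s : Finset Λ) (hs : ∀ i ∈ s, levels a V Λ i ∈ J)
    (hδ : ∀ i ∈ s, ∀ y ∈ Λ, y ∉ b → |boxEig a V Λ i y| ≤ δ) :
    s.card ≤ levelCount a V b (nearSet ε J) := by
  classical
  have hK0 : 0 ≤ K := (abs_nonneg _).trans (hK 0).1
  rcases s.eq_empty_or_nonempty with rfl | ⟨i₀, hi₀⟩
  · simp
  have hM0 : 0 ≤ M := (Nat.cast_nonneg _).trans hM
  have hcard : ((Λ \ b).card : ℝ) ≤ M :=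
    le_trans (by exact_mod_cast Finset.card_le_card Finset.sdiff_subset) hM
  have hcardb : (b.card : ℝ) ≤ M := le_trans (by exact_mod_cast Finset.card_le_card hb) hM
  have key := card_le_card_eigenvalues_near (boxMatrix_isHermitian a V b)
    (s := s) (fun i x => boxEig a V Λ i x) (fun i => levels a V Λ i)
    (η := M * δ ^ 2) (η' := M * (M * K * δ) ^ 2) hε ?_ ?_ ?_
  · rw [Fintype.card_coe] at key
    refine key.trans (Finset.card_le_card fun e he => ?_)
    obtain ⟨i, hi⟩ := (Finset.mem_filter.1 he).2
    exact Finset.mem_filter.2 ⟨Finset.mem_univ _, _, hs i i.2, hi⟩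
  · intro i j
    have h1 := boxEig_orthonormal a V Λ i j
    rw [← Finset.sum_sdiff hb] at h1
    have h2 : ∑ x : b, boxEig a V Λ i x * boxEig a V Λ j x
        = ∑ x ∈ b, boxEig a V Λ i x * boxEig a V Λ j x :=
      Finset.sum_coe_sort b fun x => boxEig a V Λ i x * boxEig a V Λ j x
    have hij : (if (i : Λ) = j then (1 : ℝ) else 0) = if i = j then 1 else 0 := by
      by_cases h : i = j
      · rw [if_pos h, if_pos (congrArg _ h)]
      · rw [if_neg h, if_neg fun h' => h (Subtype.ext h')]
    have h3 : ∑ x : b, boxEig a V Λ i x * boxEig a V Λ j x - (if i = j then 1 else 0)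
        = -∑ x ∈ Λ \ b, boxEig a V Λ i x * boxEig a V Λ j x := by
      rw [h2, ← hij, ← h1]; ring
    rw [h3, abs_neg]
    refine (Finset.abs_sum_le_sum_abs _ _).trans ?_
    calc ∑ x ∈ Λ \ b, |boxEig a V Λ i x * boxEig a V Λ j x| ≤ ∑ _x ∈ Λ \ b, δ ^ 2 := by
          refine Finset.sum_le_sum fun x hx => ?_
          rw [Finset.mem_sdiff] at hx
          rw [abs_mul, sq]
          exact mul_le_mul (hδ i i.2 x hx.1 hx.2) (hδ j j.2 x hx.1 hx.2) (abs_nonneg _)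
            ((abs_nonneg _).trans (hδ i i.2 x hx.1 hx.2))
      _ ≤ _ := by
          rw [Finset.sum_const, nsmul_eq_mul]
          exact mul_le_mul_of_nonneg_right hcard (sq_nonneg _)
  · intro i
    have hpt : ∀ x : b, |∑ y : b, boxMatrix a V b x y * boxEig a V Λ i y
        - levels a V Λ i * boxEig a V Λ i x| ≤ M * K * |δ| := by
      intro x
      have h1 := sum_jacobiKernel_mul_boxEig a V Λ i (hb x.2)
      rw [← Finset.sum_sdiff hb] at h1
      have h2 : ∑ y : b, boxMatrix a V b x y * boxEig a V Λ i y
          = ∑ y ∈ b, jacobiKernel a V x y * boxEig a V Λ i y :=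
        Finset.sum_coe_sort b fun y => jacobiKernel a V x y * boxEig a V Λ i y
      rw [h2, ← h1, sub_add_cancel_right, abs_neg]
      refine (Finset.abs_sum_le_sum_abs _ _).trans ?_
      calc _ ≤ ∑ _y ∈ Λ \ b, K * |δ| := by
            refine Finset.sum_le_sum fun y hy => ?_
            rw [Finset.mem_sdiff] at hy
            rw [abs_mul]
            exact mul_le_mul (abs_jacobiKernel_le hK _ _)
              ((hδ i i.2 y hy.1 hy.2).trans (le_abs_self _)) (abs_nonneg _) hK0
        _ ≤ _ := by
            rw [Finset.sum_const, nsmul_eq_mul, mul_assoc]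
            exact mul_le_mul_of_nonneg_right hcard (by positivity)
    calc _ ≤ ∑ _x : b, (M * K * δ) ^ 2 := by
          refine Finset.sum_le_sum fun x _ => ?_
          have := pow_le_pow_left₀ (abs_nonneg _) (hpt x) 2
          rwa [sq_abs, mul_pow, sq_abs, ← mul_pow] at this
      _ ≤ _ := by
          rw [Finset.sum_const, nsmul_eq_mul, Finset.card_univ, Fintype.card_coe]
          exact mul_le_mul_of_nonneg_right hcardb (sq_nonneg _)
  · refine lt_of_le_of_lt ?_ hsmall
    refine mul_le_mul_of_nonneg_right (le_trans ?_ hM) (by positivity)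
    rw [Fintype.card_coe]
    exact_mod_cast (Finset.card_le_univ s).trans (by simp)

/-- Extended by zero, eigenfunctions of disjoint boxes are exactly orthonormal. They violate the
eigenvalue equation of `H(Λ)` only at sites outside their box adjacent to it, which is why smallness
is needed only at sites with a neighbour in `Λ` outside the box. -/
theorem card_le_levelCount_extend {a V : ℤ → ℝ} {K : ℝ} (hK : ∀ n, |a n| ≤ K ∧ |V n| ≤ K)
    {Λ : Finset ℤ} {κ : Type*} [Fintype κ] {B : κ → Finset ℤ} (hB : ∀ k, B k ⊆ Λ)
    (hBd : ∀ k k', k ≠ k' → Disjoint (B k) (B k'))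
    {δ ε M : ℝ} (hε : 0 < ε) (hM : (Λ.card : ℝ) ≤ M) (hsmall : SmallErr K M δ ε)
    {J : Set ℝ} (s : Finset (Σ k, B k)) (hs : ∀ p ∈ s, levels a V (B p.1) p.2 ∈ J)
    (hδ : ∀ p ∈ s, ∀ y ∈ B p.1, (∃ z ∈ Λ, z ∉ B p.1 ∧ |z - y| ≤ 1) →
      |boxEig a V (B p.1) p.2 y| ≤ δ) :
    s.card ≤ levelCount a V Λ (nearSet ε J) := by
  classical
  have hK0 : 0 ≤ K := (abs_nonneg _).trans (hK 0).1
  have hM0 : 0 ≤ M := (Nat.cast_nonneg _).trans hM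
  have key := card_le_card_eigenvalues_near (boxMatrix_isHermitian a V Λ)
    (s := s) (fun p x => boxEig a V (B p.1.1) p.1.2 x) (fun p => levels a V (B p.1.1) p.1.2)
    (η := M * δ ^ 2) (η' := M * (M * K * δ) ^ 2) hε ?_ ?_ ?_
  · rw [Fintype.card_coe] at key
    refine key.trans (Finset.card_le_card fun e he => ?_)
    obtain ⟨i, hi⟩ := (Finset.mem_filter.1 he).2
    exact Finset.mem_filter.2 ⟨Finset.mem_univ _, _, hs i i.2, hi⟩
  · rintro ⟨⟨k, i⟩, hp⟩ ⟨⟨k', j⟩, hp'⟩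
    have h2 : ∑ x : Λ, boxEig a V (B k) i x * boxEig a V (B k') j x
        = ∑ x ∈ Λ, boxEig a V (B k) i x * boxEig a V (B k') j x :=
      Finset.sum_coe_sort Λ fun x => boxEig a V (B k) i x * boxEig a V (B k') j x
    have h3 : ∑ x ∈ Λ, boxEig a V (B k) i x * boxEig a V (B k') j x
        = if (⟨⟨k, i⟩, hp⟩ : s) = ⟨⟨k', j⟩, hp'⟩ then 1 else 0 := by
      by_cases hk : k = k'
      · subst hk
        rw [← Finset.sum_subset (hB k) fun x _ hx => by rw [boxEig_of_notMem a V i hx, zero_mul],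
          boxEig_orthonormal]
        simp
      · rw [if_neg fun h => hk (by simpa using congrArg (fun p : s => p.1.1) h)]
        refine Finset.sum_eq_zero fun x _ => ?_
        by_cases hx : x ∈ B k
        · rw [boxEig_of_notMem a V j (Finset.disjoint_left.1 (hBd k k' hk) hx), mul_zero]
        · rw [boxEig_of_notMem a V i hx, zero_mul]
    rw [h2, h3, sub_self, abs_zero]
    positivity
  · rintro ⟨⟨k, i⟩, hp⟩
    have hpt : ∀ x : Λ, |∑ y : Λ, boxMatrix a V Λ x y * boxEig a V (B k) i y
        - levels a V (B k) i * boxEig a V (B k) i x| ≤ M * K * |δ| := by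
      intro x
      have h2 : ∑ y : Λ, boxMatrix a V Λ x y * boxEig a V (B k) i y
          = ∑ y ∈ B k, jacobiKernel a V x y * boxEig a V (B k) i y := by
        rw [Finset.sum_subset (hB k) fun y _ hy => by rw [boxEig_of_notMem a V i hy, mul_zero]]
        exact Finset.sum_coe_sort Λ fun y => jacobiKernel a V x y * boxEig a V (B k) i y
      by_cases hx : (x : ℤ) ∈ B k
      · rw [h2, sum_jacobiKernel_mul_boxEig a V (B k) i hx, sub_self, abs_zero]
        positivity
      · rw [h2, boxEig_of_notMem a V i hx, mul_zero, sub_zero]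
        refine (Finset.abs_sum_le_sum_abs _ _).trans ?_
        calc _ ≤ ∑ _y ∈ B k, K * |δ| := by
              refine Finset.sum_le_sum fun y hy => ?_
              rcases lt_or_ge 1 |(x : ℤ) - y| with hxy | hxy
              · rw [jacobiKernel_eq_zero hxy, zero_mul, abs_zero]
                positivity
              · rw [abs_mul]
                exact mul_le_mul (abs_jacobiKernel_le hK _ _)
                  ((hδ _ hp y hy ⟨x, x.2, hx, hxy⟩).trans (le_abs_self _)) (abs_nonneg _) hK0
          _ ≤ _ := by
              rw [Finset.sum_const, nsmul_eq_mul, mul_assoc]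
              refine mul_le_mul_of_nonneg_right (le_trans ?_ hM) (by positivity)
              exact_mod_cast Finset.card_le_card (hB k)
    calc _ ≤ ∑ _x : Λ, (M * K * δ) ^ 2 := by
          refine Finset.sum_le_sum fun x _ => ?_
          have := pow_le_pow_left₀ (abs_nonneg _) (hpt x) 2
          rwa [sq_abs, mul_pow, sq_abs, ← mul_pow] at this
      _ ≤ _ := by
          rw [Finset.sum_const, nsmul_eq_mul, Finset.card_univ, Fintype.card_coe]
          exact mul_le_mul_of_nonneg_right hM (sq_nonneg _)
  · refine lt_of_le_of_lt ?_ hsmall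
    refine mul_le_mul_of_nonneg_right (le_trans ?_ hM) (by positivity)
    rw [Fintype.card_coe]
    have h1 : s.card ≤ ∑ k, (B k).card := by
      refine (Finset.card_le_univ s).trans ?_
      simp
    have h2 : ∑ k, (B k).card ≤ Λ.card := by
      rw [← Finset.card_biUnion fun k _ k' _ h => hBd k k' h]
      exact Finset.card_le_card (Finset.biUnion_subset.2 fun k _ => hB k)
    exact_mod_cast h1.trans h2

open Classical in
/-- The sites of `Λ` whose `t`-neighbourhood in `Λ` is not contained in one of the boxes `B k`. -/
noncomputable def badSites {κ : Type*} (Λ : Finset ℤ) (B : κ → Finset ℤ) (t : ℤ) : Finset ℤ :=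
  Λ.filter fun x => ¬ ∃ k, Λ.filter (fun y => |y - x| ≤ t) ⊆ B k

theorem mem_badSites {κ : Type*} {Λ : Finset ℤ} {B : κ → Finset ℤ} {t x : ℤ} :
    x ∈ badSites Λ B t ↔ x ∈ Λ ∧ ¬ ∃ k, Λ.filter (fun y => |y - x| ≤ t) ⊆ B k := by
  classical
  simp [badSites]

/-- The number of levels in `W` with centre in a set `D` of sites is bounded by local level
counts. -/
theorem card_centers_le {a V : ℤ → ℝ} {K : ℝ} (hK : ∀ n, |a n| ≤ K ∧ |V n| ≤ K)
    {Λ : Finset ℤ} {t : ℤ} {δ ε M : ℝ} (hε : 0 < ε) (hM : (Λ.card : ℝ) ≤ M)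
    (hsmall : SmallErr K M δ ε) {W : Set ℝ} (c : Λ → ℤ)
    (hc : ∀ i, levels a V Λ i ∈ W → ∀ y ∈ Λ, t ≤ |y - c i| → |boxEig a V Λ i y| ≤ δ)
    (D : Finset ℤ) (s : Finset Λ) (hs : ∀ i ∈ s, levels a V Λ i ∈ W ∧ c i ∈ D) :
    s.card ≤ ∑ x ∈ D, levelCount a V (Λ.filter fun y => |y - x| ≤ t) (nearSet ε W) := by
  classical
  -- Levels are grouped by centre: those with a common centre `x` are all small outside one ball
  -- around `x`, and are counted there together.
  rw [Finset.card_eq_sum_card_fiberwise (f := c) (t := D) fun i hi => (hs i hi).2]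
  refine Finset.sum_le_sum fun x _ => ?_
  refine card_le_levelCount_restrict hK (Finset.filter_subset _ _) hε hM hsmall _
    (fun i hi => (hs i (Finset.mem_filter.1 hi).1).1) fun i hi y hy hyb => ?_
  obtain ⟨hi1, hi2⟩ := Finset.mem_filter.1 hi
  refine hc i (hs i hi1).1 y hy ?_
  rw [hi2]
  by_contra! h
  exact hyb (Finset.mem_filter.2 ⟨hy, h.le⟩)

theorem abs_sub_le_of_nat_le {κ : Type*} [Fintype κ] {x x' u : ℕ} {y y' v : κ → ℕ}
    (h : x ≤ ∑ k, y k + ∑ k, y' k + u) (h' : ∑ k, y k ≤ x + x' + ∑ k, v k) :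
    |(x : ℝ) - ∑ k, (y k : ℝ)| ≤ (x' + ∑ k, (y' k : ℝ)) + (u + ∑ k, (v k : ℝ)) := by
  have e1 : (x : ℝ) ≤ ∑ k, (y k : ℝ) + ∑ k, (y' k : ℝ) + u := by exact_mod_cast h
  have e2 : ∑ k, (y k : ℝ) ≤ (x : ℝ) + x' + ∑ k, (v k : ℝ) := by exact_mod_cast h'
  have p1 : (0 : ℝ) ≤ ∑ k, (y' k : ℝ) := by positivity
  have p2 : (0 : ℝ) ≤ ∑ k, (v k : ℝ) := by positivity
  have p3 : (0 : ℝ) ≤ u := by positivity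
  have p4 : (0 : ℝ) ≤ x' := by positivity
  rw [abs_le]
  constructor <;> linarith

/-- **Decoupling.** The level counts of `Λ` in disjoint sets `J j` of energies differ from the sums
of the level counts of the boxes `B k` at most by the numbers of levels near the edges of the `J j`
and of levels of small boxes around the bad sites. -/
theorem sum_abs_levelCount_sub_le {a V : ℤ → ℝ} {K : ℝ} (hK : ∀ n, |a n| ≤ K ∧ |V n| ≤ K)
    {Λ : Finset ℤ} {κ ι : Type*} [Fintype κ] [Fintype ι] {B : κ → Finset ℤ} (hB : ∀ k, B k ⊆ Λ)
    (hBd : ∀ k k', k ≠ k' → Disjoint (B k) (B k'))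
    {t : ℤ} (ht : 0 ≤ t) {δ ε M : ℝ} (hε : 0 < ε) (hM : (Λ.card : ℝ) ≤ M)
    (hsmall : SmallErr K M δ ε) {W W₀ : Set ℝ} (hW : W ⊆ W₀) {J : ι → Set ℝ} (hJ : ∀ j, J j ⊆ W)
    (hd : ∀ i j, i ≠ j → Disjoint (J i) (J j))
    (hΛ : HasCenters a V Λ W₀ t δ) (hBk : ∀ k, HasCenters a V (B k) W₀ t δ) :
    ∑ j, |(levelCount a V Λ (J j) : ℝ) - ∑ k, (levelCount a V (B k) (J j) : ℝ)|
      ≤ ∑ j, ((levelCount a V Λ (nearSet ε (J j) \ J j) : ℝ)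
          + ∑ k, (levelCount a V (B k) (nearSet ε (J j) \ J j) : ℝ))
        + (∑ x ∈ badSites Λ B t,
            (levelCount a V (Λ.filter fun y => |y - x| ≤ t) (nearSet ε W) : ℝ)
          + ∑ k, ∑ x ∈ badSites Λ B t ∩ B k,
            (levelCount a V ((B k).filter fun y => |y - x| ≤ t) (nearSet ε W) : ℝ)) := by
  classical
  choose! c hcΛ hc using hΛ
  choose! c' hcB' hc' using hBk
  set bad := badSites Λ B t with hbad
  -- levels of `Λ`, by centre
  let X : ι → Finset Λ := fun j => Finset.univ.filter fun i => levels a V Λ i ∈ J j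
  let Xb : ι → Finset Λ := fun j => (X j).filter fun i => c i ∈ bad
  -- A level whose centre is not bad is small outside the block containing the neighbourhood of that
  -- centre, and is transferred to this block.
  have hX : ∀ j, levelCount a V Λ (J j)
      ≤ ∑ k, levelCount a V (B k) (nearSet ε (J j)) + (Xb j).card := by
    intro j
    have h1 : X j ⊆ (Finset.univ.biUnion fun k =>
        (X j).filter fun i => Λ.filter (fun y => |y - c i| ≤ t) ⊆ B k) ∪ Xb j := by
      intro i hi
      by_cases hib : c i ∈ bad
      · exact Finset.mem_union_right _ (Finset.mem_filter.2 ⟨hi, hib⟩)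
      · refine Finset.mem_union_left _ ?_
        have hiW := hW (hJ j (Finset.mem_filter.1 hi).2)
        rw [hbad, mem_badSites, not_and, not_not] at hib
        obtain ⟨k, hk⟩ := hib (hcΛ i hiW)
        exact Finset.mem_biUnion.2 ⟨k, Finset.mem_univ _, Finset.mem_filter.2 ⟨hi, hk⟩⟩
    refine (Finset.card_le_card h1).trans ((Finset.card_union_le _ _).trans ?_)
    refine Nat.add_le_add_right (Finset.card_biUnion_le.trans (Finset.sum_le_sum fun k _ => ?_)) _
    refine card_le_levelCount_restrict hK (hB k) hε hM hsmall _
      (fun i hi => (Finset.mem_filter.1 (Finset.mem_filter.1 hi).1).2) fun i hi y hy hyb => ?_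
    obtain ⟨hi1, hi2⟩ := Finset.mem_filter.1 hi
    refine hc i (hW (hJ j (Finset.mem_filter.1 hi1).2)) y hy ?_
    by_contra! h
    exact hyb (hi2 (Finset.mem_filter.2 ⟨hy, h.le⟩))
  -- Disjointness of the `J j` means that each badly centred level is counted for one `j` only, so
  -- the bound carries no factor for the number of intervals.
  have hXb : ∑ j, (Xb j).card
      ≤ ∑ x ∈ bad, levelCount a V (Λ.filter fun y => |y - x| ≤ t) (nearSet ε W) := by
    rw [← Finset.card_biUnion]
    · refine card_centers_le hK hε hM hsmall c (fun i hi => hc i (hW hi)) bad _ fun i hi => ?_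
      obtain ⟨j, -, hj⟩ := Finset.mem_biUnion.1 hi
      obtain ⟨h1, h2⟩ := Finset.mem_filter.1 hj
      exact ⟨hJ j (Finset.mem_filter.1 h1).2, h2⟩
    · intro i _ j _ hij
      refine Finset.disjoint_left.2 fun e he he' => ?_
      exact Set.disjoint_left.1 (hd i j hij)
        (Finset.mem_filter.1 (Finset.mem_filter.1 he).1).2
        (Finset.mem_filter.1 (Finset.mem_filter.1 he').1).2
  -- levels of the boxes, by centre
  let Y : ι → ∀ k, Finset (B k) := fun j k => Finset.univ.filter fun i => levels a V (B k) i ∈ J j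
  let Yb : ι → ∀ k, Finset (B k) := fun j k => (Y j k).filter fun i => c' k i ∈ bad ∩ B k
  have hY : ∀ j, ∑ k, levelCount a V (B k) (J j)
      ≤ levelCount a V Λ (nearSet ε (J j)) + ∑ k, (Yb j k).card := by
    intro j
    let Yg : ∀ k, Finset (B k) := fun k => (Y j k).filter fun i => ¬ c' k i ∈ bad ∩ B k
    have h1 : ∀ k, levelCount a V (B k) (J j) = (Yb j k).card + (Yg k).card := fun k =>
      (Finset.card_filter_add_card_filter_not (s := Y j k) _).symm
    simp_rw [h1, Finset.sum_add_distrib]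
    rw [add_comm]
    refine Nat.add_le_add_right ?_ _
    rw [← Finset.card_sigma]
    refine card_le_levelCount_extend hK hB hBd hε hM hsmall _ (fun p hp => ?_) fun p hp y hy hz => ?_
    · exact (Finset.mem_filter.1 (Finset.mem_filter.1 (Finset.mem_sigma.1 hp).2).1).2
    · obtain ⟨h1, h2⟩ := Finset.mem_filter.1 (Finset.mem_sigma.1 hp).2
      have hpW := hW (hJ j (Finset.mem_filter.1 h1).2)
      refine hc' p.1 p.2 hpW y hy ?_
      obtain ⟨z, hzΛ, hzB, hzy⟩ := hz
      have hcB := hcB' p.1 p.2 hpW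
      have hcg : ¬ c' p.1 p.2 ∈ bad := fun h => h2 (Finset.mem_inter.2 ⟨h, hcB⟩)
      rw [hbad, mem_badSites, not_and, not_not] at hcg
      obtain ⟨k, hk⟩ := hcg (hB _ hcB)
      -- The block containing the neighbourhood of the centre contains the centre itself, because `0
      -- ≤ t`; disjointness forces it to be `B p.1`. Hence a site next to `Λ \ B p.1` is at distance
      -- at least `t` from the centre.
      have hkk : k = p.1 := by
        by_contra hne
        refine Finset.disjoint_left.1 (hBd _ _ hne) (hk (Finset.mem_filter.2 ⟨hB _ hcB, ?_⟩)) hcB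
        rw [sub_self, abs_zero]
        exact ht
      subst hkk
      by_contra! h
      refine hzB (hk (Finset.mem_filter.2 ⟨hzΛ, ?_⟩))
      rw [abs_le] at hzy ⊢
      rw [abs_lt] at h
      constructor <;> linarith [h.1, h.2, hzy.1, hzy.2]
  have hYb : ∑ j, ∑ k, (Yb j k).card ≤ ∑ k, ∑ x ∈ bad ∩ B k,
      levelCount a V ((B k).filter fun y => |y - x| ≤ t) (nearSet ε W) := by
    rw [Finset.sum_comm]
    refine Finset.sum_le_sum fun k _ => ?_
    rw [← Finset.card_biUnion]
    · have hMk : ((B k).card : ℝ) ≤ M :=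
        le_trans (by exact_mod_cast Finset.card_le_card (hB k)) hM
      refine card_centers_le hK hε hMk hsmall (c' k) (fun i hi => hc' k i (hW hi)) _ _
        fun i hi => ?_
      obtain ⟨j, -, hj⟩ := Finset.mem_biUnion.1 hi
      obtain ⟨h1, h2⟩ := Finset.mem_filter.1 hj
      exact ⟨hJ j (Finset.mem_filter.1 h1).2, h2⟩
    · intro i _ j _ hij
      refine Finset.disjoint_left.2 fun e he he' => ?_
      exact Set.disjoint_left.1 (hd i j hij)
        (Finset.mem_filter.1 (Finset.mem_filter.1 he).1).2
        (Finset.mem_filter.1 (Finset.mem_filter.1 he').1).2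
  -- conclusion
  have hpt : ∀ j, |(levelCount a V Λ (J j) : ℝ) - ∑ k, (levelCount a V (B k) (J j) : ℝ)|
      ≤ ((levelCount a V Λ (nearSet ε (J j) \ J j) : ℝ)
          + ∑ k, (levelCount a V (B k) (nearSet ε (J j) \ J j) : ℝ))
        + (((Xb j).card : ℝ) + ∑ k, ((Yb j k).card : ℝ)) := by
    intro j
    have e1 : levelCount a V Λ (J j) ≤ ∑ k, levelCount a V (B k) (J j)
        + ∑ k, levelCount a V (B k) (nearSet ε (J j) \ J j) + (Xb j).card := by
      refine (hX j).trans (Nat.add_le_add_right ?_ _)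
      rw [← Finset.sum_add_distrib]
      exact Finset.sum_le_sum fun k _ => levelCount_nearSet_le a V (B k) ε (J j)
    have e2 := (hY j).trans (Nat.add_le_add_right (levelCount_nearSet_le a V Λ ε (J j)) _)
    exact abs_sub_le_of_nat_le e1 e2
  refine (Finset.sum_le_sum fun j _ => hpt j).trans ?_
  rw [Finset.sum_add_distrib]
  refine add_le_add le_rfl ?_
  rw [Finset.sum_add_distrib]
  refine add_le_add ?_ ?_
  · exact_mod_cast hXb
  · exact_mod_cast hYb

end RandomJacobi

namespace RandomJacobi

/-! ### Translations -/

/-- The block of `m` sites to the right of `x`. -/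
noncomputable def block (x m : ℕ) : Finset ℤ := Finset.Icc ((x : ℤ) + 1) ((x : ℤ) + m)

theorem mem_block {x m : ℕ} {n : ℤ} : n ∈ block x m ↔ (x : ℤ) + 1 ≤ n ∧ n ≤ (x : ℤ) + m :=
  Finset.mem_Icc

theorem mem_box {L : ℕ} {n : ℤ} : n ∈ box L ↔ 1 ≤ n ∧ n ≤ (L : ℤ) := Finset.mem_Icc

theorem card_block (x m : ℕ) : (block x m).card = m := by
  simp [block]

theorem card_box (L : ℕ) : (box L).card = L := by
  simp [box]

theorem block_zero (m : ℕ) : block 0 m = box m := by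
  simp [block, box]

/-- Translation of a box onto a block. -/
noncomputable def blockEquiv (x m : ℕ) : box m ≃ block x m where
  toFun n := ⟨n + x, by have := mem_box.1 n.2; rw [mem_block]; omega⟩
  invFun n := ⟨n - x, by have := mem_block.1 n.2; rw [mem_box]; omega⟩
  left_inv n := by simp
  right_inv n := by simp

theorem boxMatrix_block (a V : ℤ → ℝ) (x m : ℕ) :
    boxMatrix (fun n => a (n + x)) (fun n => V (n + x)) (box m)
      = (boxMatrix a V (block x m)).submatrix (blockEquiv x m) (blockEquiv x m) := by
  ext i j
  simp only [boxMatrix, blockEquiv, Matrix.of_apply, Matrix.submatrix_apply, Equiv.coe_fn_mk]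
  have h1 : ((j : ℤ) = i + 1) ↔ ((j : ℤ) + x = i + x + 1) := by omega
  have h2 : ((i : ℤ) = j + 1) ↔ ((i : ℤ) + x = j + x + 1) := by omega
  simp [h1, h2]

theorem cfc_boxMatrix_block (a V : ℤ → ℝ) (x m : ℕ) (f : ℝ → ℝ) (i j : box m) :
    cfc f (boxMatrix (fun n => a (n + x)) (fun n => V (n + x)) (box m)) i j
      = cfc f (boxMatrix a V (block x m)) (blockEquiv x m i) (blockEquiv x m j) := by
  rw [boxMatrix_block, cfc_submatrix_equiv (boxMatrix_isHermitian a V _)]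

theorem levelCount_block (a V : ℤ → ℝ) (x m : ℕ) (J : Set ℝ) :
    levelCount (fun n => a (n + x)) (fun n => V (n + x)) (box m) J
      = levelCount a V (block x m) J := by
  have h := levelCount_eq_trace (fun n => a (n + x)) (fun n => V (n + x)) (box m) J
  simp_rw [cfc_boxMatrix_block] at h
  rw [Equiv.sum_comp (blockEquiv x m)
    fun y => cfc (J.indicator fun _ => (1 : ℝ)) (boxMatrix a V (block x m)) y y,
    ← levelCount_eq_trace] at h
  exact_mod_cast h

/-! ### Measurability -/

section Meas

variable {X : Type*} [MeasurableSpace X] {a V : ℤ → X → ℝ}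

theorem measurable_boxMatrix (ha : ∀ n, Measurable (a n)) (hV : ∀ n, Measurable (V n))
    (Λ : Finset ℤ) (x y : Λ) : Measurable fun ω => boxMatrix (a · ω) (V · ω) Λ x y := by
  simp only [boxMatrix, Matrix.of_apply]
  split_ifs
  exacts [hV _, ha _, ha _, measurable_const]

theorem measurable_cfc_boxMatrix (ha : ∀ n, Measurable (a n)) (hV : ∀ n, Measurable (V n))
    (Λ : Finset ℤ) {J : Set ℝ} (hJ : MeasurableSet J) (x y : Λ) :
    Measurable fun ω => cfc (J.indicator fun _ => (1 : ℝ)) (boxMatrix (a · ω) (V · ω) Λ) x y :=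
  measurable_cfc_indicator_apply (measurable_boxMatrix ha hV Λ)
    (fun _ => boxMatrix_isHermitian _ _ Λ) hJ x y

theorem measurable_of_natCast {f : X → ℕ} (h : Measurable fun ω => (f ω : ℝ)) : Measurable f := by
  refine measurable_to_countable' fun n => ?_
  have : f ⁻¹' {n} = (fun ω => (f ω : ℝ)) ⁻¹' {(n : ℝ)} := by ext; simp
  rw [this]
  exact h (measurableSet_singleton _)

theorem measurable_levelCount (ha : ∀ n, Measurable (a n)) (hV : ∀ n, Measurable (V n))
    (Λ : Finset ℤ) {J : Set ℝ} (hJ : MeasurableSet J) :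
    Measurable fun ω => levelCount (a · ω) (V · ω) Λ J := by
  refine measurable_of_natCast ?_
  simp_rw [levelCount_eq_trace]
  exact Finset.measurable_sum _ fun x _ => measurable_cfc_boxMatrix ha hV Λ hJ x x

end Meas

theorem measurable_coord_fst (n : ℤ) : Measurable fun z : ℤ → ℝ × ℝ => (z n).1 :=
  (measurable_pi_apply n).fst

theorem measurable_coord_snd (n : ℤ) : Measurable fun z : ℤ → ℝ × ℝ => (z n).2 :=
  (measurable_pi_apply n).snd

/-! ### Localization centres from spectral cells -/

/-- If the level is the only one in its cell, the spectral kernel of the cell is `φ(x) φ(y)`. With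
`x` the site where `|φ|` is maximal, normalization gives `|φ(x)| ≥ |Λ|^(-1/2) ≥ |Λ|^(-1)`, so decay
of the kernel passes to `φ(y)` at the cost of a factor `|Λ|`. -/
theorem hasCenters_of_cells {a V : ℤ → ℝ} {Λ : Finset ℤ} {κ : Type*} (c : κ → Set ℝ)
    {W : Set ℝ} (hW : W ⊆ ⋃ k, c k) {t : ℤ} {η : ℝ} (h1 : ∀ k, levelCount a V Λ (c k) < 2)
    (h2 : ∀ k, ∀ x y : Λ, t ≤ |(x : ℤ) - y| →
      |cfc ((c k).indicator fun _ => (1 : ℝ)) (boxMatrix a V Λ) x y| ≤ η) :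
    HasCenters a V Λ W t (η * Λ.card) := by
  classical
  intro i hi
  obtain ⟨k, hk⟩ := Set.mem_iUnion.1 (hW hi)
  have huniq : ∀ j : Λ, levels a V Λ j ∈ c k → j = i := by
    intro j hj
    by_contra hne
    have : 2 ≤ levelCount a V Λ (c k) := by
      rw [← Finset.card_pair hne]
      refine Finset.card_le_card fun l hl => ?_
      rcases Finset.mem_insert.1 hl with rfl | hl
      · simpa using hj
      · rw [Finset.mem_singleton.1 hl]; simpa using hk
    exact absurd (h1 k) (not_lt.2 this)
  have hker : ∀ x y : Λ, cfc ((c k).indicator fun _ => (1 : ℝ)) (boxMatrix a V Λ) x y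
      = boxEig a V Λ i x * boxEig a V Λ i y := by
    intro x y
    rw [cfc_apply_eq_sum (boxMatrix_isHermitian a V Λ), Finset.sum_eq_single i]
    · rw [Set.indicator_of_mem (show (boxMatrix_isHermitian a V Λ).eigenvalues i ∈ c k from hk),
        one_mul, boxEig_coe, boxEig_coe]
    · intro j _ hj
      rw [Set.indicator_of_notMem, zero_mul]
      exact fun h => hj (huniq j h)
    · intro h; exact absurd (Finset.mem_univ _) h
  obtain ⟨x, hx, hmax⟩ := Finset.exists_max_image Λ (fun n => |boxEig a V Λ i n|) ⟨i, i.2⟩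
  refine ⟨x, hx, fun y hy hyx => ?_⟩
  have hcard : (1 : ℝ) ≤ Λ.card := by exact_mod_cast Finset.card_pos.2 ⟨x, hx⟩
  set u := |boxEig a V Λ i x| with hu
  have hnorm : 1 ≤ Λ.card * u ^ 2 := by
    have h := boxEig_orthonormal a V Λ i i
    rw [if_pos rfl] at h
    rw [← h, ← nsmul_eq_mul, ← Finset.sum_const]
    refine Finset.sum_le_sum fun n hn => ?_
    rw [← sq, ← sq_abs]
    exact pow_le_pow_left₀ (abs_nonneg _) (hmax n hn) 2
  have hu0 : 0 ≤ u := abs_nonneg _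
  have hu1 : 1 ≤ Λ.card * u := by
    by_contra! h
    nlinarith
  have h3 : |boxEig a V Λ i y| * u ≤ η := by
    rw [hu, ← abs_mul, ← hker ⟨y, hy⟩ ⟨x, hx⟩]
    exact h2 k _ _ hyx
  calc |boxEig a V Λ i y| ≤ |boxEig a V Λ i y| * (Λ.card * u) :=
        le_mul_of_one_le_right (abs_nonneg _) hu1
    _ = (|boxEig a V Λ i y| * u) * Λ.card := by ring
    _ ≤ _ := mul_le_mul_of_nonneg_right h3 (by positivity)

theorem HasCenters.mono {a V : ℤ → ℝ} {Λ : Finset ℤ} {W : Set ℝ} {t t' : ℤ} {δ δ' : ℝ}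
    (h : HasCenters a V Λ W t δ) (ht : t ≤ t') (hδ : δ ≤ δ') : HasCenters a V Λ W t' δ' := by
  intro i hi
  obtain ⟨x, hx, h'⟩ := h i hi
  exact ⟨x, hx, fun y hy hyx => (h' y hy (ht.trans hyx)).trans hδ⟩

/-- The coefficient sequences for which the box of length `m` has two levels in one of the cells
`c k`, or a spectral kernel of a cell that is larger than `η` at distance at least `t`. -/
def badCells {κ : Type*} (c : κ → Set ℝ) (m : ℕ) (t : ℤ) (η : ℝ) : Set (ℤ → ℝ × ℝ) :=
  ⋃ k, ({z | 2 ≤ levelCount (fun n => (z n).1) (fun n => (z n).2) (box m) (c k)} ∪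
    ⋃ x : box m, ⋃ y : box m, ⋃ _ : t ≤ |(x : ℤ) - y|, {z | η < |cfc ((c k).indicator fun _ => (1 : ℝ))
      (boxMatrix (fun n => (z n).1) (fun n => (z n).2) (box m)) x y|})

theorem measurableSet_badCells {κ : Type*} [Countable κ] {c : κ → Set ℝ}
    (hc : ∀ k, MeasurableSet (c k)) (m : ℕ) (t : ℤ) (η : ℝ) :
    MeasurableSet (badCells c m t η) := by
  refine MeasurableSet.iUnion fun k => MeasurableSet.union ?_ ?_
  · exact measurableSet_le measurable_const
      (measurable_levelCount measurable_coord_fst measurable_coord_snd _ (hc k))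
  · refine MeasurableSet.iUnion fun x => MeasurableSet.iUnion fun y => MeasurableSet.iUnion fun _ => ?_
    refine measurableSet_lt measurable_const ?_
    exact (measurable_cfc_boxMatrix measurable_coord_fst measurable_coord_snd _ (hc k) x y).abs

theorem hasCenters_block_of_notMem_badCells {a V : ℤ → ℝ} {κ : Type*} {c : κ → Set ℝ}
    {W : Set ℝ} (hW : W ⊆ ⋃ k, c k) {m x : ℕ} {t : ℤ} {η : ℝ}
    (h : (fun n => (a (n + x), V (n + x))) ∉ badCells c m t η) :
    HasCenters a V (block x m) W t (η * m) := by
  simp only [badCells, Set.mem_iUnion, Set.mem_union, Set.mem_ofPred_eq, not_exists, not_or,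
    not_le, not_lt, levelCount_block] at h
  have hh := hasCenters_of_cells (a := a) (V := V) (Λ := block x m) c hW (t := t) (η := η)
    (fun k => (h k).1) fun k i j hij => ?_
  · rwa [card_block] at hh
  · have := (h k).2 ((blockEquiv x m).symm i) ((blockEquiv x m).symm j) (by
      simpa [blockEquiv] using hij)
    rwa [cfc_boxMatrix_block, Equiv.apply_symm_apply, Equiv.apply_symm_apply] at this

/-! ### The random operator -/

/-- The standing assumptions on a random Jacobi operator in a region of localization. -/
structure LocalizedModel {Ω : Type*} [MeasurableSpace Ω] (P : Measure Ω) (a V : ℤ → Ω → ℝ)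
    (K : ℝ) (q : ℕ) (I : Set ℝ) (ρ : ℝ) : Prop where
  meas_a : ∀ n, Measurable (a n)
  meas_V : ∀ n, Measurable (V n)
  bound : ∀ n, ∀ᵐ ω ∂P, |a n ω| ≤ K ∧ |V n ω| ≤ K
  q_pos : 0 < q
  periodic : PeriodicInLaw P a V q
  indep : IndepAtDistance P a V
  wegner : Wegner P a V I
  rho_pos : 0 < ρ
  minami : Minami P a V I ρ
  loc : Localized P a V I

section Model

set_option linter.unusedSectionVars false

variable {Ω : Type*} [MeasurableSpace Ω] {P : Measure Ω} [IsProbabilityMeasure P]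
  {a V : ℤ → Ω → ℝ} {K : ℝ} {q : ℕ} {I : Set ℝ} {ρ : ℝ}

theorem LocalizedModel.ae_bound (h : LocalizedModel P a V K q I ρ) :
    ∀ᵐ ω ∂P, ∀ n, |a n ω| ≤ K ∧ |V n ω| ≤ K := ae_all_iff.2 h.bound

theorem LocalizedModel.measurable_coeff (h : LocalizedModel P a V K q I ρ) (x : ℤ) :
    Measurable fun ω (n : ℤ) => (a (n + x) ω, V (n + x) ω) :=
  measurable_pi_lambda _ fun _ => (h.meas_a _).prodMk (h.meas_V _)

/-- Only translations by multiples of `q` are known to preserve the law; this is why blocks start at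
multiples of `q` below. -/
theorem LocalizedModel.map_shift (h : LocalizedModel P a V K q I ρ) (k : ℕ) :
    P.map (fun ω (n : ℤ) => (a (n + (k * q : ℕ)) ω, V (n + (k * q : ℕ)) ω))
      = P.map fun ω (n : ℤ) => (a n ω, V n ω) := by
  induction k with
  | zero => simp
  | succ k ih =>
    have hs : Measurable fun (z : ℤ → ℝ × ℝ) (n : ℤ) => z (n + q) :=
      measurable_pi_lambda _ fun _ => measurable_pi_apply _
    have h0 : Measurable fun ω (n : ℤ) => (a n ω, V n ω) := by
      simpa using h.measurable_coeff 0
    have := congrArg (Measure.map fun (z : ℤ → ℝ × ℝ) (n : ℤ) => z (n + q)) ih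
    rw [Measure.map_map hs (h.measurable_coeff _), Measure.map_map hs h0] at this
    refine Eq.trans (Eq.trans ?_ this) h.periodic
    congr 1
    funext ω n
    simp only [Function.comp]
    rw [show n + (((k + 1) * q : ℕ) : ℤ) = n + (q : ℤ) + ((k * q : ℕ) : ℤ) by push_cast; ring]

theorem LocalizedModel.measure_shift (h : LocalizedModel P a V K q I ρ) (k : ℕ)
    {S : Set (ℤ → ℝ × ℝ)} (hS : MeasurableSet S) :
    P.real {ω | (fun n : ℤ => (a (n + (k * q : ℕ)) ω, V (n + (k * q : ℕ)) ω)) ∈ S}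
      = P.real {ω | (fun n : ℤ => (a n ω, V n ω)) ∈ S} := by
  have h0 : Measurable fun ω (n : ℤ) => (a n ω, V n ω) := by
    simpa using h.measurable_coeff 0
  have h1 := congrArg (fun μ : Measure (ℤ → ℝ × ℝ) => μ.real S) (h.map_shift k)
  simp only [measureReal_def] at h1 ⊢
  rw [Measure.map_apply (h.measurable_coeff _) hS, Measure.map_apply h0 hS] at h1
  exact h1

theorem LocalizedModel.integral_shift (h : LocalizedModel P a V K q I ρ) (k : ℕ)
    {f : (ℤ → ℝ × ℝ) → ℝ} (hf : Measurable f) :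
    ∫ ω, f (fun n : ℤ => (a (n + (k * q : ℕ)) ω, V (n + (k * q : ℕ)) ω)) ∂P
      = ∫ ω, f (fun n : ℤ => (a n ω, V n ω)) ∂P := by
  have h0 : Measurable fun ω (n : ℤ) => (a n ω, V n ω) := by
    simpa using h.measurable_coeff 0
  rw [← integral_map (f := f) (h.measurable_coeff _).aemeasurable hf.aestronglyMeasurable,
    h.map_shift, integral_map h0.aemeasurable hf.aestronglyMeasurable]

/-- (Loc) with exponent `1/2`, applied to one term of the sum over `y`, followed by Markov's
inequality. -/
theorem LocalizedModel.exists_kernel_bound (h : LocalizedModel P a V K q I ρ) :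
    ∃ B : ℝ, 0 ≤ B ∧ ∀ (m : ℕ) (c : Set ℝ), MeasurableSet c → c ⊆ I → ∀ (x y : box m) (t η : ℝ),
      0 ≤ t → t ≤ |((x : ℤ) : ℝ) - ((y : ℤ) : ℝ)| → 0 < η →
      P.real {ω | η < |cfc (c.indicator fun _ => (1 : ℝ)) (boxMatrix (a · ω) (V · ω) (box m)) x y|}
        ≤ B * Real.exp (-t ^ (1 / 2 : ℝ)) / η := by
  obtain ⟨B, hB⟩ := h.loc (1 / 2) ⟨by norm_num, by norm_num⟩
  refine ⟨B, B.2, fun m c hc hcI x y t η ht0 ht hη => ?_⟩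
  have hB' := hB m x (c.indicator fun _ => (1 : ℝ)) (measurable_const.indicator hc)
    (fun E => by by_cases hE : E ∈ c <;> simp [hE])
    (fun E hE => hcI (Set.mem_of_indicator_ne_zero hE))
  set g := fun ω => cfc (c.indicator fun _ => (1 : ℝ)) (boxMatrix (a · ω) (V · ω) (box m)) x y
    with hg
  have hgm : Measurable g := measurable_cfc_boxMatrix h.meas_a h.meas_V (box m) hc x y
  have h1 : ∫⁻ ω, ENNReal.ofReal (Real.exp (t ^ (1 / 2 : ℝ)) * |g ω|) ∂P ≤ B := by
    refine le_trans (lintegral_mono fun ω => ?_) hB'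
    refine le_trans (ENNReal.ofReal_le_ofReal ?_)
      (Finset.single_le_sum (f := fun y : box m => ENNReal.ofReal
      (Real.exp (|((x : ℤ) : ℝ) - ((y : ℤ) : ℝ)| ^ (1 / 2 : ℝ))
        * |cfc (c.indicator fun _ => (1 : ℝ)) (boxMatrix (a · ω) (V · ω) (box m)) x y|))
        (fun _ _ => zero_le) (Finset.mem_univ y))
    gcongr
  have h2 : ENNReal.ofReal (Real.exp (t ^ (1 / 2 : ℝ)) * η) * P {ω | η < |g ω|} ≤ B := by
    refine le_trans ?_ h1
    refine le_trans ?_ (mul_meas_ge_le_lintegral₀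
      (hgm.abs.const_mul _).ennreal_ofReal.aemeasurable
      (ENNReal.ofReal (Real.exp (t ^ (1 / 2 : ℝ)) * η)))
    refine mul_le_mul_right (measure_mono fun ω hω => ?_) _
    have hω' : η < |g ω| := hω
    refine ENNReal.ofReal_le_ofReal ?_
    gcongr
  have h3 := ENNReal.toReal_mono ENNReal.coe_ne_top h2
  rw [ENNReal.toReal_mul, ENNReal.toReal_ofReal (by positivity), ENNReal.coe_toReal] at h3
  rw [le_div_iff₀ hη, Real.exp_neg, ← div_eq_mul_inv, le_div_iff₀ (Real.exp_pos _)]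
  change (P {ω | η < |g ω|}).toReal * η * _ ≤ _
  linarith

/-- A single term of the exponential series, of order `k ≥ A / σ`, already beats the power. -/
theorem exists_exp_neg_rpow_le {c σ : ℝ} (hc : 0 < c) (hσ : 0 < σ) (A : ℝ) :
    ∃ C > 0, ∀ x : ℝ, 1 ≤ x → Real.exp (-(c * x ^ σ)) ≤ C * x ^ (-A) := by
  obtain ⟨k, hk⟩ := exists_nat_ge (A / σ)
  refine ⟨k.factorial / c ^ k, by positivity, fun x hx => ?_⟩
  have hx0 : 0 < x := by linarith
  have h1 := Real.pow_div_factorial_le_exp (c * x ^ σ) (by positivity) k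
  rw [Real.exp_neg, inv_le_comm₀ (Real.exp_pos _) (by positivity)]
  refine le_trans ?_ h1
  rw [mul_inv, inv_div, Real.rpow_neg hx0.le, inv_inv, mul_pow, mul_div_right_comm]
  refine mul_le_mul_of_nonneg_left ?_ (by positivity)
  rw [← Real.rpow_natCast, ← Real.rpow_mul hx0.le]
  refine Real.rpow_le_rpow_of_exponent_le hx ?_
  rwa [div_le_iff₀ hσ, mul_comm] at hk

/-- The localization radius at scale `m`. -/
noncomputable def locRad (τ : ℝ) (m : ℕ) : ℤ := ⌈(m : ℝ) ^ τ⌉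

/-- The size of the tails of eigenfunctions at scale `m`. -/
noncomputable def locTol (τ : ℝ) (m : ℕ) : ℝ := Real.exp (-((m : ℝ) ^ τ) ^ (1 / 2 : ℝ) / 2)

/-- The energies within `w` of `E₀`. -/
abbrev window (E₀ w : ℝ) : Set ℝ := Set.Icc (E₀ - w) (E₀ + w)

/-- **Localization of eigenfunctions.** Outside an event of probability `O(m ^ (-A))`, all
eigenfunctions of a block of length `m` with energies in a compact interval have centres. -/
theorem LocalizedModel.exists_bad_event (h : LocalizedModel P a V K q I ρ) {E₀ w₀ : ℝ}
    (hw₀ : 0 < w₀) (hwI : window E₀ w₀ ⊆ I) {τ : ℝ} (hτ : 0 < τ) (A : ℝ) :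
    ∃ C > 0, ∀ m : ℕ, 1 ≤ m → ∃ S : Set (ℤ → ℝ × ℝ), MeasurableSet S ∧
      (∀ k : ℕ, P.real {ω | (fun n : ℤ => (a (n + (k * q : ℕ)) ω, V (n + (k * q : ℕ)) ω)) ∈ S}
        ≤ C * (m : ℝ) ^ (-A)) ∧
      ∀ (a V : ℤ → ℝ) (x : ℕ), (fun n => (a (n + x), V (n + x))) ∉ S →
        HasCenters a V (block x m) (window E₀ w₀) (locRad τ m) (locTol τ m * m) := by
  obtain ⟨CM, hCM, hM⟩ := h.minami
  obtain ⟨B, hB0, hB⟩ := h.exists_kernel_bound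
  have hρ := h.rho_pos
  -- With `N ≈ m^A₁` cells of length `2w₀/N`, the Minami bounds add up to order `m^(1+ρ) N^(-ρ)`;
  -- `A₁` makes this at most `m^(-A)`.
  set A₁ : ℝ := max 0 ((1 + ρ + A) / ρ) with hA₁
  have hA₁0 : 0 ≤ A₁ := le_max_left _ _
  have hA₁' : 1 + ρ - ρ * A₁ ≤ -A := by
    have := le_max_right 0 ((1 + ρ + A) / ρ)
    rw [← hA₁, div_le_iff₀ hρ] at this
    linarith
  -- The extra exponent `A₁ + 2` pays for the sum over about `m^A₁` cells and `m²` pairs of sites.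
  obtain ⟨CE, hCE, hE⟩ := exists_exp_neg_rpow_le (c := 1 / 2) (σ := τ / 2) (by norm_num)
    (by positivity) (A + A₁ + 2)
  refine ⟨CM * (2 * w₀) ^ (1 + ρ) + 2 * B * CE, by positivity, fun m hm => ?_⟩
  have hm1 : (1 : ℝ) ≤ m := by exact_mod_cast hm
  have hm0 : (0 : ℝ) < m := by linarith
  set N : ℕ := ⌈(m : ℝ) ^ A₁⌉₊ with hN
  have hN1 : (m : ℝ) ^ A₁ ≤ N := Nat.le_ceil _
  have hmA : 1 ≤ (m : ℝ) ^ A₁ := Real.one_le_rpow hm1 hA₁0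
  have hN0 : (0 : ℝ) < N := by linarith
  have hN2 : (N : ℝ) ≤ 2 * (m : ℝ) ^ A₁ := by
    have := Nat.ceil_lt_add_one (a := (m : ℝ) ^ A₁) (by positivity)
    linarith
  set s : ℝ := 2 * w₀ / N with hs
  have hs0 : 0 < s := by positivity
  have hsN : N * s = 2 * w₀ := by rw [hs]; field_simp
  let c : Fin N → Set ℝ := fun k => Set.Icc (E₀ - w₀ + k * s) (E₀ - w₀ + k * s + s)
  have hcW : ∀ k, c k ⊆ window E₀ w₀ := by
    intro k E hE
    have hk : ((k : ℕ) : ℝ) + 1 ≤ N := by exact_mod_cast k.2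
    have h1 : (((k : ℕ) : ℝ) + 1) * s ≤ N * s := mul_le_mul_of_nonneg_right hk hs0.le
    have h2 : 0 ≤ ((k : ℕ) : ℝ) * s := by positivity
    obtain ⟨h3, h4⟩ := hE
    constructor <;> linarith
  have hcover : window E₀ w₀ ⊆ ⋃ k, c k := by
    intro E hE
    obtain ⟨h3, h4⟩ := hE
    -- At the right end of the window the floor would give the index `N`, which is out of range; the
    -- last cell is used there.
    rcases eq_or_lt_of_le h4 with h5 | h5
    · have hNpos : 0 < N := by exact_mod_cast hN0
      refine Set.mem_iUnion.2 ⟨⟨N - 1, by omega⟩, ?_⟩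
      have : ((N - 1 : ℕ) : ℝ) = N - 1 := by
        rw [Nat.cast_sub (by omega)]; simp
      constructor
      · simp only [this]; linarith [sub_mul (N : ℝ) 1 s]
      · simp only [this]; linarith [sub_mul (N : ℝ) 1 s]
    · set u := (E - (E₀ - w₀)) / s with hu
      have hu0 : 0 ≤ u := div_nonneg (by linarith) hs0.le
      have huN : u < N := by rw [hu, div_lt_iff₀ hs0]; linarith
      refine Set.mem_iUnion.2 ⟨⟨⌊u⌋₊, (Nat.floor_lt hu0).2 huN⟩, ?_⟩
      have e1 := Nat.floor_le hu0
      have e2 := Nat.lt_floor_add_one u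
      have e3 : u * s = E - (E₀ - w₀) := by rw [hu]; field_simp
      have e4 := mul_le_mul_of_nonneg_right e1 hs0.le
      have e5 := mul_le_mul_of_nonneg_right e2.le hs0.le
      constructor <;> simp only <;> linarith
  have hcm : ∀ k, MeasurableSet (c k) := fun k => measurableSet_Icc
  refine ⟨badCells c m (locRad τ m) (locTol τ m), measurableSet_badCells hcm m _ _, fun k => ?_,
    fun a V x hx => hasCenters_block_of_notMem_badCells hcover hx⟩
  rw [h.measure_shift k (measurableSet_badCells hcm m _ _)]
  have hset : {ω | (fun n : ℤ => (a n ω, V n ω)) ∈ badCells c m (locRad τ m) (locTol τ m)}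
      = ⋃ k, ({ω | 2 ≤ levelCount (a · ω) (V · ω) (box m) (c k)} ∪
        ⋃ x : box m, ⋃ y : box m, ⋃ _ : locRad τ m ≤ |(x : ℤ) - y|,
          {ω | locTol τ m < |cfc ((c k).indicator fun _ => (1 : ℝ))
            (boxMatrix (a · ω) (V · ω) (box m)) x y|}) := by
    ext ω; simp [badCells]
  rw [hset]
  have hcell : ∀ k, P.real {ω | 2 ≤ levelCount (a · ω) (V · ω) (box m) (c k)}
      ≤ CM * (s * m) ^ (1 + ρ) := by
    intro k
    have := hM 1 m (E₀ - w₀ + k * s) (E₀ - w₀ + k * s + s) (by linarith) ((hcW k).trans hwI)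
    simpa [box] using this
  have hT0 : 0 < locTol τ m := Real.exp_pos _
  -- `locTol` is the square root of the decay factor in (Loc), so Markov's inequality at level
  -- `locTol` leaves a probability of order `locTol`.
  have hpair : ∀ k, ∀ x y : box m, P.real (⋃ _ : locRad τ m ≤ |(x : ℤ) - y|,
      {ω | locTol τ m < |cfc ((c k).indicator fun _ => (1 : ℝ))
            (boxMatrix (a · ω) (V · ω) (box m)) x y|}) ≤ B * locTol τ m := by
    intro k x y
    by_cases hxy : locRad τ m ≤ |(x : ℤ) - y|
    · simp only [hxy, Set.iUnion_true]
      refine (hB m (c k) (hcm k) ((hcW k).trans hwI) x y ((m : ℝ) ^ τ) _ (by positivity) ?_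
        hT0).trans (le_of_eq ?_)
      · refine (Int.le_ceil _).trans ?_
        exact_mod_cast hxy
      · have : Real.exp (-((m : ℝ) ^ τ) ^ (1 / 2 : ℝ)) = locTol τ m * locTol τ m := by
          rw [locTol, ← Real.exp_add]; ring_nf
        rw [this]; field_simp
    · simp only [hxy, Set.iUnion_of_empty, measureReal_empty]
      positivity
  have hcardm : (Fintype.card (box m) : ℝ) = m := by rw [Fintype.card_coe, card_box]
  have htol : locTol τ m ≤ CE * (m : ℝ) ^ (-(A + A₁ + 2)) := by
    refine le_trans (le_of_eq ?_) (hE m hm1)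
    rw [locTol, ← Real.rpow_mul hm0.le]
    congr 1
    rw [mul_one_div]
    ring
  calc _ ≤ ∑ k : Fin N, (CM * (s * m) ^ (1 + ρ) + ∑ x : box m, ∑ y : box m, B * locTol τ m) := by
        refine (measureReal_iUnion_fintype_le _).trans (Finset.sum_le_sum fun k _ => ?_)
        refine (measureReal_union_le _ _).trans (add_le_add (hcell k) ?_)
        refine (measureReal_iUnion_fintype_le _).trans (Finset.sum_le_sum fun x _ => ?_)
        exact (measureReal_iUnion_fintype_le _).trans (Finset.sum_le_sum fun y _ => hpair k x y)
    _ = N * (CM * (s * m) ^ (1 + ρ)) + N * (m * (m * (B * locTol τ m))) := by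
        simp only [Finset.sum_const, Finset.card_univ, nsmul_eq_mul, hcardm, Fintype.card_fin]
        ring
    _ ≤ CM * (2 * w₀) ^ (1 + ρ) * (m : ℝ) ^ (-A) + 2 * B * CE * (m : ℝ) ^ (-A) := by
        refine add_le_add ?_ ?_
        · have e1 : (N : ℝ) * (CM * (s * m) ^ (1 + ρ))
              = CM * (2 * w₀) ^ (1 + ρ) * ((m : ℝ) ^ (1 + ρ) * (N : ℝ) ^ (-ρ)) := by
            rw [hs, div_mul_eq_mul_div, Real.div_rpow (by positivity) hN0.le,
              Real.mul_rpow (by positivity) hm0.le, Real.rpow_neg hN0.le,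
              Real.rpow_add hN0, Real.rpow_one]
            field_simp
          rw [e1]
          refine mul_le_mul_of_nonneg_left ?_ (by positivity)
          calc (m : ℝ) ^ (1 + ρ) * (N : ℝ) ^ (-ρ)
              ≤ (m : ℝ) ^ (1 + ρ) * ((m : ℝ) ^ A₁) ^ (-ρ) :=
                mul_le_mul_of_nonneg_left (Real.rpow_le_rpow_of_nonpos (by positivity) hN1
                  (by linarith)) (by positivity)
            _ = (m : ℝ) ^ (1 + ρ - ρ * A₁) := by
                rw [← Real.rpow_mul hm0.le, ← Real.rpow_add hm0]; ring_nf
            _ ≤ _ := Real.rpow_le_rpow_of_exponent_le hm1 hA₁'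
        · calc (N : ℝ) * (m * (m * (B * locTol τ m)))
              ≤ (2 * (m : ℝ) ^ A₁) * (m * (m * (B * (CE * (m : ℝ) ^ (-(A + A₁ + 2)))))) := by
                gcongr
            _ = 2 * B * CE * ((m : ℝ) ^ A₁ * (m : ℝ) ^ (2 : ℝ) * (m : ℝ) ^ (-(A + A₁ + 2))) := by
                rw [Real.rpow_two]; ring
            _ = _ := by
                rw [← Real.rpow_add hm0, ← Real.rpow_add hm0]; ring_nf
    _ = _ := by ring

end Model

end RandomJacobi

namespace RandomJacobi

/-! ### Decoupling in expectation -/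

/-- Reduces the levels near the boundary of an interval to two energy intervals of length `2ε`, to
which the Wegner estimate applies; order convexity excludes points between the ends. -/
theorem nearSet_sdiff_subset {J : Set ℝ} (hJ : J.OrdConnected) (hb : Bornology.IsBounded J) (ε : ℝ) :
    nearSet ε J \ J ⊆ Set.Icc (sInf J - ε) (sInf J + ε) ∪ Set.Icc (sSup J - ε) (sSup J + ε) := by
  rintro E ⟨⟨E', hE', hEE⟩, hE⟩
  rw [abs_le] at hEE
  have h0 : E ≠ E' := fun h => hE (h ▸ hE')
  have h1 := csInf_le hb.bddBelow hE'
  have h2 := le_csSup hb.bddAbove hE'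
  rcases lt_or_gt_of_ne h0 with hlt | hlt
  · left
    have : E ≤ sInf J := le_csInf ⟨E', hE'⟩ fun x hx => by
      by_contra! hxE
      exact hE (hJ.out hx hE' ⟨hxE.le, hlt.le⟩)
    constructor <;> linarith
  · right
    have : sSup J ≤ E := csSup_le ⟨E', hE'⟩ fun x hx => by
      by_contra! hxE
      exact hE (hJ.out hE' hx ⟨hlt.le, hxE.le⟩)
    constructor <;> linarith

theorem nearSet_window_subset {E₀ w ε : ℝ} (hεw : ε ≤ w) :
    nearSet ε (window E₀ w) ⊆ window E₀ (2 * w) := by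
  rintro E ⟨E', ⟨h1, h2⟩, hE⟩
  rw [abs_le] at hE
  constructor <;> linarith

/-- Neighbourhoods of sites inside a block are intervals with natural endpoints and size at most `2t
+ 1`, as the Wegner estimate requires. -/
theorem filter_block_eq {x m : ℕ} {z t : ℤ} (ht : 0 ≤ t) (hz : z ∈ block x m) :
    ∃ l r : ℕ, (block x m).filter (fun y => |y - z| ≤ t) = Finset.Icc (l : ℤ) r ∧
      ((Finset.Icc (l : ℤ) r).card : ℝ) ≤ 2 * t + 1 := by
  have hz' := mem_block.1 hz
  refine ⟨(max ((x : ℤ) + 1) (z - t)).toNat, (min ((x : ℤ) + m) (z + t)).toNat, ?_, ?_⟩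
  · ext y
    rw [Finset.mem_filter, mem_block, Finset.mem_Icc, abs_le]
    omega
  · rw [Int.card_Icc]
    have : (((((min ((x : ℤ) + m) (z + t)).toNat : ℤ) + 1
        - ((max ((x : ℤ) + 1) (z - t)).toNat : ℤ)).toNat : ℤ)) ≤ 2 * t + 1 := by omega
    exact_mod_cast this

/-- The Wegner estimate with given constants. -/
def WegnerWith {Ω : Type*} [MeasurableSpace Ω] (P : Measure Ω) (a V : ℤ → Ω → ℝ) (I : Set ℝ)
    (C s : ℝ) : Prop :=
  ∀ (l r : ℕ) (c d : ℝ), c ≤ d → Set.Icc c d ⊆ I →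
    P.real {ω | 1 ≤ levelCount (a · ω) (V · ω) (Finset.Icc (l : ℤ) r) (Set.Icc c d)}
      ≤ C * (d - c) * ((Finset.Icc (l : ℤ) r).card : ℝ) ^ s

section Model

set_option linter.unusedSectionVars false

variable {Ω : Type*} [MeasurableSpace Ω] {P : Measure Ω} [IsProbabilityMeasure P]
  {a V : ℤ → Ω → ℝ} {K : ℝ} {q : ℕ} {I : Set ℝ} {ρ : ℝ}

theorem LocalizedModel.measurable_levelCount (h : LocalizedModel P a V K q I ρ) (Λ : Finset ℤ)
    {J : Set ℝ} (hJ : MeasurableSet J) : Measurable fun ω => levelCount (a · ω) (V · ω) Λ J :=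
  RandomJacobi.measurable_levelCount h.meas_a h.meas_V Λ hJ

theorem LocalizedModel.measurable_levelCount_real (h : LocalizedModel P a V K q I ρ)
    (Λ : Finset ℤ) {J : Set ℝ} (hJ : MeasurableSet J) :
    Measurable fun ω => (levelCount (a · ω) (V · ω) Λ J : ℝ) :=
  measurable_from_top.comp (h.measurable_levelCount Λ hJ)

theorem LocalizedModel.integrable_levelCount (h : LocalizedModel P a V K q I ρ) (Λ : Finset ℤ)
    {J : Set ℝ} (hJ : MeasurableSet J) :
    Integrable (fun ω => (levelCount (a · ω) (V · ω) Λ J : ℝ)) P := by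
  refine Integrable.of_bound (h.measurable_levelCount_real Λ hJ).aestronglyMeasurable Λ.card
    (ae_of_all _ fun ω => ?_)
  rw [Real.norm_of_nonneg (by positivity)]
  exact_mod_cast levelCount_le_card _ _ Λ J

/-- The count vanishes unless the Wegner event occurs and never exceeds the volume; the crude factor
`|Λ|` is harmless, since the energy intervals are tiny or the boxes small. -/
theorem LocalizedModel.integral_levelCount_le (h : LocalizedModel P a V K q I ρ) {CW mW : ℝ}
    (hW : WegnerWith P a V I CW mW) (l r : ℕ) {c d : ℝ} (hcd : c ≤ d) (hI : Set.Icc c d ⊆ I) :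
    ∫ ω, (levelCount (a · ω) (V · ω) (Finset.Icc (l : ℤ) r) (Set.Icc c d) : ℝ) ∂P
      ≤ (Finset.Icc (l : ℤ) r).card
        * (CW * (d - c) * ((Finset.Icc (l : ℤ) r).card : ℝ) ^ mW) := by
  set Λ := Finset.Icc (l : ℤ) r
  have hm := h.measurable_levelCount Λ (J := Set.Icc c d) measurableSet_Icc
  have hset : MeasurableSet {ω | 1 ≤ levelCount (a · ω) (V · ω) Λ (Set.Icc c d)} :=
    measurableSet_le measurable_const hm
  calc _ ≤ ∫ ω, (Λ.card : ℝ)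
        * {ω | 1 ≤ levelCount (a · ω) (V · ω) Λ (Set.Icc c d)}.indicator 1 ω ∂P := by
        refine integral_mono (h.integrable_levelCount Λ measurableSet_Icc) ?_ fun ω => ?_
        · exact ((integrable_const (1 : ℝ)).indicator hset).const_mul _
        · by_cases hω : 1 ≤ levelCount (a · ω) (V · ω) Λ (Set.Icc c d)
          · have : ω ∈ {ω | 1 ≤ levelCount (a · ω) (V · ω) Λ (Set.Icc c d)} := hω
            simp only [Set.indicator_of_mem this, Pi.one_apply, mul_one]
            exact_mod_cast levelCount_le_card _ _ Λ _
          · have : levelCount (a · ω) (V · ω) Λ (Set.Icc c d) = 0 := by omega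
            simp only [this, Nat.cast_zero]
            exact mul_nonneg (by positivity) (Set.indicator_nonneg (fun _ _ => zero_le_one) _)
    _ = Λ.card * P.real {ω | 1 ≤ levelCount (a · ω) (V · ω) Λ (Set.Icc c d)} := by
        rw [integral_const_mul, integral_indicator_one hset]
    _ ≤ _ := mul_le_mul_of_nonneg_left (hW l r c d hcd hI) (by positivity)

set_option maxHeartbeats 1000000 in
/-- **Decoupling in expectation.** -/
theorem LocalizedModel.decoupling (h : LocalizedModel P a V K q I ρ) {E₀ w₀ : ℝ}
    (hw₀ : 0 < w₀) (hwI : window E₀ w₀ ⊆ I) {CW mW : ℝ} (hCW : 0 < CW) (hmW : 1 ≤ mW)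
    (hW : WegnerWith P a V I CW mW) {τ : ℝ} (hτ : 0 < τ) {A : ℝ} (hA : 0 ≤ A) :
    ∃ C > 0, ∀ (L m n : ℕ) (x : Fin n → ℕ) (w ε : ℝ), 1 ≤ m → m ≤ L →
      (∀ k, block (x k * q) m ⊆ box L) →
      (∀ k k', k ≠ k' → Disjoint (block (x k * q) m) (block (x k' * q) m)) →
      0 < ε → ε ≤ w → 2 * w ≤ w₀ → SmallErr K L (locTol τ m * L) ε →
      ∀ {ι : Type} [Fintype ι] (J : ι → Set ℝ), (∀ j, (J j).OrdConnected) →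
      (∀ j, (J j).Nonempty) → (∀ j, J j ⊆ window E₀ w) → (∀ i j, i ≠ j → Disjoint (J i) (J j)) →
      ∫ ω, ∑ j, |(levelCount (a · ω) (V · ω) (box L) (J j) : ℝ)
          - ∑ k, (levelCount (a · ω) (V · ω) (block (x k * q) m) (J j) : ℝ)| ∂P
        ≤ C * (L * (n + 1) * (m : ℝ) ^ (-A)
          + (badSites (box L) (fun k => block (x k * q) m) (locRad τ L)).card
            * (2 * (locRad τ L : ℝ) + 1) ^ (1 + mW) * w
          + Fintype.card ι * ε * (L : ℝ) ^ (1 + mW)) := by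
  obtain ⟨C, hC, hbad⟩ := h.exists_bad_event hw₀ hwI hτ A
  refine ⟨2 * C + 8 * CW, by positivity, fun L m n x w ε hm hmL hB hBd hε hεw hww hsmall ι _ J hJo
    hJn hJw hJd => ?_⟩
  have hm1 : (1 : ℝ) ≤ m := by exact_mod_cast hm
  have hm0 : (0 : ℝ) < m := by linarith
  have hmLr : (m : ℝ) ≤ L := by exact_mod_cast hmL
  have hL0 : (0 : ℝ) < L := by linarith
  have hw : 0 < w := by linarith
  set t := locRad τ L with ht
  have ht0 : 0 ≤ t := Int.ceil_nonneg (by positivity)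
  have ht0' : (0 : ℝ) ≤ t := by exact_mod_cast ht0
  obtain ⟨SL, hSLm, hSLp, hSLc⟩ := hbad L (hm.trans hmL)
  obtain ⟨Sm, hSmm, hSmp, hSmc⟩ := hbad m hm
  set Bd : Set Ω := {ω | (fun n : ℤ => (a (n + (0 * q : ℕ)) ω, V (n + (0 * q : ℕ)) ω)) ∈ SL} ∪
    ⋃ k, {ω | (fun n : ℤ => (a (n + (x k * q : ℕ)) ω, V (n + (x k * q : ℕ)) ω)) ∈ Sm} with hBdef
  have hBm : MeasurableSet Bd := (h.measurable_coeff _ hSLm).union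
    (MeasurableSet.iUnion fun k => h.measurable_coeff _ hSmm)
  have hBp : P.real Bd ≤ (n + 1) * (C * (m : ℝ) ^ (-A)) := by
    have h1 : C * (L : ℝ) ^ (-A) ≤ C * (m : ℝ) ^ (-A) :=
      mul_le_mul_of_nonneg_left (Real.rpow_le_rpow_of_nonpos hm0 hmLr (by linarith)) hC.le
    calc _ ≤ C * (m : ℝ) ^ (-A) + ∑ k : Fin n, C * (m : ℝ) ^ (-A) := by
          refine (measureReal_union_le _ _).trans (add_le_add ((hSLp 0).trans h1) ?_)
          exact (measureReal_iUnion_fintype_le _).trans (Finset.sum_le_sum fun k _ => hSmp _)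
      _ = _ := by simp; ring
  have hnm : (n : ℝ) * m ≤ L := by
    have h1 : (Finset.univ.biUnion fun k => block (x k * q) m).card ≤ (box L).card :=
      Finset.card_le_card (Finset.biUnion_subset.2 fun k _ => hB k)
    rw [Finset.card_biUnion fun k _ k' _ hk => hBd k k' hk, card_box] at h1
    simp only [card_block, Finset.sum_const, Finset.card_univ, Fintype.card_fin, smul_eq_mul] at h1
    exact_mod_cast h1
  set bad := badSites (box L) (fun k => block (x k * q) m) t with hbaddef
  -- the local level counts
  let e : ι → Finset ℤ → Ω → ℝ := fun j Λ ω =>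
    (levelCount (a · ω) (V · ω) Λ (Set.Icc (sInf (J j) - ε) (sInf (J j) + ε)) : ℝ)
      + (levelCount (a · ω) (V · ω) Λ (Set.Icc (sSup (J j) - ε) (sSup (J j) + ε)) : ℝ)
  let u : Finset ℤ → ℤ → Ω → ℝ := fun Λ z ω =>
    (levelCount (a · ω) (V · ω) (Λ.filter fun y => |y - z| ≤ t) (window E₀ (2 * w)) : ℝ)
  have hei : ∀ j Λ, Integrable (e j Λ) P := fun j Λ =>
    (h.integrable_levelCount Λ measurableSet_Icc).add (h.integrable_levelCount Λ measurableSet_Icc)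
  have hui : ∀ Λ z, Integrable (u Λ z) P := fun Λ z => h.integrable_levelCount _ measurableSet_Icc
  have hej : ∀ j, Integrable (fun ω => e j (box L) ω + ∑ k, e j (block (x k * q) m) ω) P :=
    fun j => (hei j _).add (integrable_finsetSum _ fun k _ => hei j _)
  have hbdd : ∀ j, Bornology.IsBounded (J j) := fun j => (Metric.isBounded_Icc _ _).subset (hJw j)
  -- On the bad event the box and the blocks have at most `L` levels each, which gives `2L`. Off it,
  -- the deterministic decoupling applies with radius `locRad τ L` and tolerance `locTol τ m * L`,
  -- which are admissible for the box and the blocks alike.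
  have hpt : ∀ᵐ ω ∂P, ∑ j, |(levelCount (a · ω) (V · ω) (box L) (J j) : ℝ)
          - ∑ k, (levelCount (a · ω) (V · ω) (block (x k * q) m) (J j) : ℝ)|
      ≤ 2 * L * Bd.indicator 1 ω + (∑ j, (e j (box L) ω + ∑ k, e j (block (x k * q) m) ω)
        + (∑ z ∈ bad, u (box L) z ω
          + ∑ k, ∑ z ∈ bad ∩ block (x k * q) m, u (block (x k * q) m) z ω)) := by
    filter_upwards [h.ae_bound] with ω hω
    have hpos : (0 : ℝ) ≤ ∑ j, (e j (box L) ω + ∑ k, e j (block (x k * q) m) ω)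
        + (∑ z ∈ bad, u (box L) z ω
          + ∑ k, ∑ z ∈ bad ∩ block (x k * q) m, u (block (x k * q) m) z ω) := by
      simp only [e, u]; positivity
    by_cases hωB : ω ∈ Bd
    · rw [Set.indicator_of_mem hωB, Pi.one_apply, mul_one]
      refine le_trans ?_ (le_add_of_nonneg_right hpos)
      have hX : ∑ j, (levelCount (a · ω) (V · ω) (box L) (J j) : ℝ) ≤ L := by
        have := (sum_levelCount_le (a · ω) (V · ω) (box L) hJw hJd).trans
          (levelCount_le_card _ _ _ _)
        rw [card_box] at this
        exact_mod_cast this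
      have hY : ∀ k, ∑ j, (levelCount (a · ω) (V · ω) (block (x k * q) m) (J j) : ℝ) ≤ m := by
        intro k
        have := (sum_levelCount_le (a · ω) (V · ω) (block (x k * q) m) hJw hJd).trans
          (levelCount_le_card _ _ _ _)
        rw [card_block] at this
        exact_mod_cast this
      calc _ ≤ ∑ j, ((levelCount (a · ω) (V · ω) (box L) (J j) : ℝ)
            + ∑ k, (levelCount (a · ω) (V · ω) (block (x k * q) m) (J j) : ℝ)) := by
            refine Finset.sum_le_sum fun j _ => (abs_sub _ _).trans (le_of_eq ?_)
            rw [abs_of_nonneg (by positivity), abs_of_nonneg (by positivity)]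
        _ = ∑ j, (levelCount (a · ω) (V · ω) (box L) (J j) : ℝ)
            + ∑ k, ∑ j, (levelCount (a · ω) (V · ω) (block (x k * q) m) (J j) : ℝ) := by
            rw [Finset.sum_add_distrib, Finset.sum_comm (s := (Finset.univ : Finset ι))]
        _ ≤ L + ∑ _k : Fin n, (m : ℝ) := add_le_add hX (Finset.sum_le_sum fun k _ => hY k)
        _ ≤ 2 * L := by simp; linarith
    · rw [Set.indicator_of_notMem hωB, mul_zero, zero_add]
      simp only [hBdef, Set.mem_union, Set.mem_iUnion, not_or, not_exists] at hωB
      have hcL : HasCenters (a · ω) (V · ω) (box L) (window E₀ w₀) t (locTol τ m * L) := by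
        have := hSLc (a · ω) (V · ω) (0 * q) hωB.1
        rw [zero_mul, block_zero] at this
        refine this.mono le_rfl (mul_le_mul_of_nonneg_right ?_ hL0.le)
        rw [locTol, locTol, Real.exp_le_exp]
        have : ((m : ℝ) ^ τ) ^ (1 / 2 : ℝ) ≤ ((L : ℝ) ^ τ) ^ (1 / 2 : ℝ) := by gcongr
        linarith
      have hcm : ∀ k, HasCenters (a · ω) (V · ω) (block (x k * q) m) (window E₀ w₀) t
          (locTol τ m * L) := fun k =>
        (hSmc (a · ω) (V · ω) (x k * q) (hωB.2 k)).mono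
          (Int.ceil_le_ceil (by gcongr)) (mul_le_mul_of_nonneg_left hmLr (Real.exp_pos _).le)
      have hww' : window E₀ w ⊆ window E₀ w₀ :=
        Set.Icc_subset_Icc (by linarith) (by linarith)
      refine (sum_abs_levelCount_sub_le hω hB hBd ht0 hε (M := L) (by rw [card_box]) hsmall hww'
        hJw hJd hcL hcm).trans ?_
      have hedge : ∀ j Λ, (levelCount (a · ω) (V · ω) Λ (nearSet ε (J j) \ J j) : ℝ) ≤ e j Λ ω := by
        intro j Λ
        have := (levelCount_mono (a · ω) (V · ω) Λ
          (nearSet_sdiff_subset (hJo j) (hbdd j) ε)).trans (levelCount_union_le _ _ _ _ _)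
        simp only [e]
        exact_mod_cast this
      have hloc : ∀ Λ z, (levelCount (a · ω) (V · ω) (Λ.filter fun y => |y - z| ≤ t)
          (nearSet ε (window E₀ w)) : ℝ) ≤ u Λ z ω := by
        intro Λ z
        simp only [u]
        exact_mod_cast levelCount_mono _ _ _ (nearSet_window_subset hεw)
      gcongr with j _ k _ z _ k _ z _
      · exact hedge _ _
      · exact hedge _ _
      · exact hloc _ _
      · exact hloc _ _
  -- expectations
  have hcd : ∀ j, sInf (J j) ∈ window E₀ w ∧ sSup (J j) ∈ window E₀ w := by
    intro j
    obtain ⟨y, hy⟩ := hJn j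
    have h1 := csInf_le (hbdd j).bddBelow hy
    have h2 := le_csSup (hbdd j).bddAbove hy
    have h3 : E₀ - w ≤ sInf (J j) := le_csInf ⟨y, hy⟩ fun z hz => (hJw j hz).1
    have h4 : sSup (J j) ≤ E₀ + w := csSup_le ⟨y, hy⟩ fun z hz => (hJw j hz).2
    have h5 := hJw j hy
    exact ⟨⟨h3, h1.trans h5.2⟩, ⟨h5.1.trans h2, h4⟩⟩
  have hIcc : ∀ c ∈ window E₀ w, Set.Icc (c - ε) (c + ε) ⊆ I := fun c hc =>
    (Set.Icc_subset_Icc (by linarith [hc.1]) (by linarith [hc.2])).trans hwI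
  -- The volume factor is kept as `s` rather than `L`, so that the sum over blocks costs only `n * m
  -- ≤ L`.
  have hebound : ∀ j (y s : ℕ), (s : ℝ) ≤ L →
      ∫ ω, e j (block y s) ω ∂P ≤ s * (4 * CW * ε * (L : ℝ) ^ mW) := by
    intro j y s hs
    have key : ∀ c ∈ window E₀ w, ∫ ω, (levelCount (a · ω) (V · ω) (block y s)
        (Set.Icc (c - ε) (c + ε)) : ℝ) ∂P ≤ s * (2 * CW * ε * (L : ℝ) ^ mW) := by
      intro c hc
      have := h.integral_levelCount_le hW (y + 1) (y + s) (show c - ε ≤ c + ε by linarith)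
        (hIcc c hc)
      have hb : Finset.Icc (((y + 1 : ℕ)) : ℤ) ((y + s : ℕ) : ℤ) = block y s := by
        simp [block]
      rw [hb, card_block] at this
      refine this.trans ?_
      rw [show c + ε - (c - ε) = 2 * ε by ring, show CW * (2 * ε) = 2 * CW * ε by ring]
      gcongr
    simp only [e]
    rw [integral_add (h.integrable_levelCount _ measurableSet_Icc)
      (h.integrable_levelCount _ measurableSet_Icc)]
    linarith [key _ (hcd j).1, key _ (hcd j).2]
  have hubound : ∀ (y s : ℕ) (z : ℤ), z ∈ block y s →
      ∫ ω, u (block y s) z ω ∂P ≤ 4 * CW * w * (2 * (t : ℝ) + 1) ^ (1 + mW) := by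
    intro y s z hz
    obtain ⟨l, r, hlr, hcard⟩ := filter_block_eq ht0 hz
    simp only [u, hlr]
    refine (h.integral_levelCount_le hW l r (by linarith)
      ((Set.Icc_subset_Icc (by linarith) (by linarith)).trans hwI)).trans ?_
    rw [Real.rpow_add (by positivity), Real.rpow_one,
      show E₀ + 2 * w - (E₀ - 2 * w) = 4 * w by ring]
    calc _ ≤ (2 * (t : ℝ) + 1) * (CW * (4 * w) * (2 * (t : ℝ) + 1) ^ mW) := by gcongr
      _ = _ := by ring
  have hbadsub : bad ⊆ box L := fun z hz => (mem_badSites.1 hz).1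
  have hI1 : ∫ ω, (∑ j, (e j (box L) ω + ∑ k, e j (block (x k * q) m) ω)) ∂P
      ≤ 8 * CW * (Fintype.card ι * ε * (L : ℝ) ^ (1 + mW)) := by
    rw [integral_finsetSum _ fun j _ => hej j]
    have : ∀ j ∈ Finset.univ, ∫ ω, (e j (box L) ω + ∑ k, e j (block (x k * q) m) ω) ∂P
        ≤ 8 * CW * (ε * (L : ℝ) ^ (1 + mW)) := by
      intro j _
      rw [integral_add (hei j _) (integrable_finsetSum _ fun k _ => hei j _),
        integral_finsetSum _ fun k _ => hei j _, ← block_zero]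
      have e1 := hebound j 0 L le_rfl
      have e2 : ∑ k, ∫ ω, e j (block (x k * q) m) ω ∂P ≤ L * (4 * CW * ε * (L : ℝ) ^ mW) := by
        refine (Finset.sum_le_sum fun k _ => hebound j (x k * q) m hmLr).trans ?_
        rw [Finset.sum_const, Finset.card_univ, Fintype.card_fin, nsmul_eq_mul, ← mul_assoc]
        exact mul_le_mul_of_nonneg_right hnm (by positivity)
      rw [Real.rpow_add hL0, Real.rpow_one]
      linarith
    refine (Finset.sum_le_sum this).trans (le_of_eq ?_)
    rw [Finset.sum_const, Finset.card_univ, nsmul_eq_mul]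
    ring
  have hI2 : ∫ ω, (∑ z ∈ bad, u (box L) z ω
      + ∑ k, ∑ z ∈ bad ∩ block (x k * q) m, u (block (x k * q) m) z ω) ∂P
      ≤ 8 * CW * (bad.card * (2 * (t : ℝ) + 1) ^ (1 + mW) * w) := by
    rw [integral_add (integrable_finsetSum _ fun z _ => hui _ z)
      (integrable_finsetSum _ fun k _ => integrable_finsetSum _ fun z _ => hui _ z),
      integral_finsetSum _ fun z _ => hui _ z,
      integral_finsetSum _ fun k _ => integrable_finsetSum _ fun z _ => hui _ z]
    set U := 4 * CW * w * (2 * (t : ℝ) + 1) ^ (1 + mW) with hU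
    have hU0 : 0 ≤ U := by positivity
    have e1 : ∑ z ∈ bad, ∫ ω, u (box L) z ω ∂P ≤ bad.card * U := by
      rw [← nsmul_eq_mul, ← Finset.sum_const]
      refine Finset.sum_le_sum fun z hz => ?_
      rw [← block_zero]
      exact hubound 0 L z (by rw [block_zero]; exact hbadsub hz)
    have e2 : ∑ k, ∫ ω, ∑ z ∈ bad ∩ block (x k * q) m, u (block (x k * q) m) z ω ∂P
        ≤ bad.card * U := by
      have e3 : ∀ k ∈ Finset.univ, ∫ ω, ∑ z ∈ bad ∩ block (x k * q) m,
          u (block (x k * q) m) z ω ∂P ≤ ((bad ∩ block (x k * q) m).card : ℝ) * U := by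
        intro k _
        rw [integral_finsetSum _ fun z _ => hui _ z, ← nsmul_eq_mul, ← Finset.sum_const]
        exact Finset.sum_le_sum fun z hz => hubound _ m z (Finset.mem_inter.1 hz).2
      refine (Finset.sum_le_sum e3).trans ?_
      rw [← Finset.sum_mul]
      refine mul_le_mul_of_nonneg_right ?_ hU0
      rw [← Nat.cast_sum, ← Finset.card_biUnion]
      · exact_mod_cast Finset.card_le_card (Finset.biUnion_subset.2 fun k _ =>
          Finset.inter_subset_left)
      · intro k _ k' _ hk
        exact (hBd k k' hk).mono Finset.inter_subset_right Finset.inter_subset_right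
    rw [hU] at e1 e2
    linarith
  have hI0 : ∫ ω, 2 * (L : ℝ) * Bd.indicator 1 ω ∂P
      ≤ 2 * C * (L * (n + 1) * (m : ℝ) ^ (-A)) := by
    rw [integral_const_mul, integral_indicator_one hBm]
    calc 2 * (L : ℝ) * P.real Bd ≤ 2 * (L : ℝ) * ((n + 1) * (C * (m : ℝ) ^ (-A))) := by gcongr
      _ = _ := by ring
  have i0 : Integrable (fun ω => 2 * (L : ℝ) * Bd.indicator 1 ω) P :=
    ((integrable_const (1 : ℝ)).indicator hBm).const_mul _
  have i1 : Integrable (fun ω => ∑ j, (e j (box L) ω + ∑ k, e j (block (x k * q) m) ω)) P :=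
    integrable_finsetSum _ fun j _ => hej j
  have i2 : Integrable (fun ω => ∑ z ∈ bad, u (box L) z ω
      + ∑ k, ∑ z ∈ bad ∩ block (x k * q) m, u (block (x k * q) m) z ω) P :=
    (integrable_finsetSum _ fun z _ => hui _ z).add
      (integrable_finsetSum _ fun k _ => integrable_finsetSum _ fun z _ => hui _ z)
  have i12 : Integrable (fun ω => ∑ j, (e j (box L) ω + ∑ k, e j (block (x k * q) m) ω)
      + (∑ z ∈ bad, u (box L) z ω
        + ∑ k, ∑ z ∈ bad ∩ block (x k * q) m, u (block (x k * q) m) z ω)) P := i1.add i2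
  refine (integral_mono_of_nonneg (ae_of_all _ fun ω => by positivity) (i0.add i12)
    hpt).trans ?_
  have hsplit : ∫ ω, (2 * (L : ℝ) * Bd.indicator 1 ω
      + (∑ j, (e j (box L) ω + ∑ k, e j (block (x k * q) m) ω) + (∑ z ∈ bad, u (box L) z ω
          + ∑ k, ∑ z ∈ bad ∩ block (x k * q) m, u (block (x k * q) m) z ω))) ∂P
      = ∫ ω, 2 * (L : ℝ) * Bd.indicator 1 ω ∂P
      + (∫ ω, (∑ j, (e j (box L) ω + ∑ k, e j (block (x k * q) m) ω)) ∂P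
      + ∫ ω, (∑ z ∈ bad, u (box L) z ω
          + ∑ k, ∑ z ∈ bad ∩ block (x k * q) m, u (block (x k * q) m) z ω) ∂P) := by
    rw [← integral_add i1 i2, ← integral_add i0 i12]
  refine (le_of_eq hsplit).trans ((add_le_add hI0 (add_le_add hI1 hI2)).trans ?_)
  have p1 : 0 ≤ (L : ℝ) * (n + 1) * (m : ℝ) ^ (-A) := by positivity
  have p2 : 0 ≤ (bad.card : ℝ) * (2 * (t : ℝ) + 1) ^ (1 + mW) * w := by positivity
  have p3 : 0 ≤ Fintype.card ι * ε * (L : ℝ) ^ (1 + mW) := by positivity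
  nlinarith [mul_nonneg hCW.le p1, mul_nonneg hC.le p2, mul_nonneg hC.le p3]

end Model

end RandomJacobi

namespace RandomJacobi

/-! ### Moments of the Jacobi operator -/

section FuncCalc

variable {H : Type*} [NormedAddCommGroup H] [InnerProductSpace ℂ H] [CompleteSpace H]

theorem inner_funcCalc_polynomial {T : H →L[ℂ] H} (hT : IsSelfAdjoint T) (p : Polynomial ℝ)
    (v : H) : inner ℂ v (funcCalc p.eval T v)
      = ∑ i ∈ Finset.range (p.natDegree + 1), (p.coeff i : ℂ) * inner ℂ v (T^[i] v) := by
  rw [funcCalc, cfc_polynomial p T hT, Polynomial.aeval_eq_sum_range,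
    sum_apply, inner_sum]
  refine Finset.sum_congr rfl fun i _ => ?_
  rw [smul_apply, FunLike.coe_pow_eq_iterate, ← inner_smul_right]
  congr 1

theorem funcCalc_congr [Nontrivial H] {T : H →L[ℂ] H} {f g : ℝ → ℝ}
    (h : ∀ E, |E| ≤ ‖T‖ → f E = g E) : funcCalc f T = funcCalc g T :=
  cfc_congr fun E hE => h E (spectrum.norm_le_norm_of_mem hE)

theorem funcCalc_one {T : H →L[ℂ] H} (hT : IsSelfAdjoint T) :
    funcCalc (fun _ => (1 : ℝ)) T = 1 :=
  cfc_const_one ℝ T hT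

theorem funcCalc_zero (T : H →L[ℂ] H) : funcCalc (fun _ => 0) T = 0 := by
  rw [funcCalc, cfc_const_zero]

end FuncCalc

instance : Nontrivial L2Z :=
  ⟨delta 0, 0, fun h => by have := congrArg (fun u : L2Z => u 0) h; simp [delta] at this⟩

theorem delta_apply (x y : ℤ) : delta x y = if y = x then 1 else 0 := by
  simp [delta, lp.single_apply, Pi.single_apply]

theorem inner_delta_left (x : ℤ) (u : L2Z) : inner ℂ (delta x) u = u x := by
  rw [delta, lp.inner_single_left]; simp

theorem norm_mulOp_le {c : ℤ → ℝ} {K : ℝ} (h : ∀ n, |c n| ≤ K) : ‖mulOp c‖ ≤ K := by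
  have hK : 0 ≤ K := (abs_nonneg _).trans (h 0)
  refine ContinuousLinearMap.opNorm_le_bound _ hK fun u => ?_
  have hp : (0 : ℝ) < (2 : ENNReal).toReal := by norm_num
  refine lp.norm_le_of_forall_sum_le hp (by positivity) fun s => ?_
  calc _ ≤ ∑ n ∈ s, K ^ (2 : ENNReal).toReal * ‖u n‖ ^ (2 : ENNReal).toReal := by
        refine Finset.sum_le_sum fun n _ => ?_
        rw [← Real.mul_rpow hK (norm_nonneg _), mulOp_apply h, norm_mul, Complex.norm_real]
        exact Real.rpow_le_rpow (by positivity)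
          (mul_le_mul_of_nonneg_right (h n) (norm_nonneg _)) hp.le
    _ ≤ _ := by
        rw [← Finset.mul_sum, Real.mul_rpow hK (norm_nonneg _)]
        exact mul_le_mul_of_nonneg_left (lp.sum_rpow_le_norm_rpow hp u s) (by positivity)

theorem norm_shiftOp_le (k : ℤ) : ‖shiftOp k‖ ≤ 1 :=
  LinearMap.mkContinuous_norm_le _ zero_le_one _

theorem norm_jacobiOp_le {a V : ℤ → ℝ} {K : ℝ} (hK : ∀ n, |a n| ≤ K ∧ |V n| ≤ K) :
    ‖jacobiOp a V‖ ≤ 3 * K := by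
  have hK0 : 0 ≤ K := (abs_nonneg _).trans (hK 0).1
  have ha := norm_mulOp_le fun n => (hK n).1
  have hV := norm_mulOp_le fun n => (hK n).2
  have h1 : ‖shiftOp 1 ∘L mulOp a‖ ≤ 1 * K := (ContinuousLinearMap.opNorm_comp_le _ _).trans
    (mul_le_mul (norm_shiftOp_le 1) ha (norm_nonneg _) zero_le_one)
  have h2 : ‖mulOp a ∘L shiftOp (-1)‖ ≤ K * 1 := (ContinuousLinearMap.opNorm_comp_le _ _).trans
    (mul_le_mul ha (norm_shiftOp_le _) (norm_nonneg _) hK0)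
  rw [jacobiOp]
  refine (norm_add_le _ _).trans ?_
  have := norm_add_le (shiftOp 1 ∘L mulOp a) (mulOp a ∘L shiftOp (-1))
  linarith

/-- The matrix entries of the powers of the Jacobi operator on `ℤ`. -/
def kernelPow (a V : ℤ → ℝ) : ℕ → ℤ → ℤ → ℝ
  | 0, x, y => if x = y then 1 else 0
  | r + 1, x, y => a (x + 1) * kernelPow a V r (x + 1) y + a x * kernelPow a V r (x - 1) y
      + V x * kernelPow a V r x y

theorem iterate_jacobiOp_delta {a V : ℤ → ℝ} {K : ℝ} (hK : ∀ n, |a n| ≤ K ∧ |V n| ≤ K) (r : ℕ)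
    (x y : ℤ) : ((jacobiOp a V)^[r] (delta y)) x = kernelPow a V r x y := by
  induction r generalizing x with
  | zero =>
    simp only [kernelPow, Function.iterate_zero, id, delta_apply]
    split_ifs <;> simp
  | succ r ih =>
    rw [Function.iterate_succ_apply', jacobiOp_apply (fun n => (hK n).1) (fun n => (hK n).2),
      ih, ih, ih, kernelPow]
    push_cast
    ring

theorem jacobiKernel_self (a V : ℤ → ℝ) (x : ℤ) : jacobiKernel a V x x = V x := if_pos rfl

theorem jacobiKernel_succ (a V : ℤ → ℝ) (x : ℤ) : jacobiKernel a V x (x + 1) = a (x + 1) := by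
  rw [jacobiKernel, if_neg (by omega), if_pos rfl]

theorem jacobiKernel_pred (a V : ℤ → ℝ) (x : ℤ) : jacobiKernel a V x (x - 1) = a x := by
  rw [jacobiKernel, if_neg (by omega), if_neg (by omega), if_pos (by omega)]

theorem sum_jacobiKernel_mul {a V : ℤ → ℝ} {Λ : Finset ℤ} {x : ℤ} (h0 : x ∈ Λ)
    (h1 : x + 1 ∈ Λ) (h2 : x - 1 ∈ Λ) (g : ℤ → ℝ) :
    ∑ y ∈ Λ, jacobiKernel a V x y * g y
      = a (x + 1) * g (x + 1) + a x * g (x - 1) + V x * g x := by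
  have hsub : ({x + 1, x - 1, x} : Finset ℤ) ⊆ Λ := by
    intro y hy
    simp only [Finset.mem_insert, Finset.mem_singleton] at hy
    rcases hy with rfl | rfl | rfl <;> assumption
  rw [← Finset.sum_subset hsub]
  · rw [Finset.sum_insert (by simp; omega), Finset.sum_insert (by simp), Finset.sum_singleton]
    rw [jacobiKernel_self, jacobiKernel_succ, jacobiKernel_pred]
    ring
  · intro y _ hy
    simp only [Finset.mem_insert, Finset.mem_singleton, not_or] at hy
    rw [jacobiKernel, if_neg hy.2.2, if_neg hy.1, if_neg (by omega), zero_mul]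

/-- Matrix powers sum over nearest-neighbour walks, and an `r`-step walk from a site at least `r`
steps inside the box does not notice the boundary. -/
theorem boxMatrix_pow_apply (a V : ℤ → ℝ) (L r : ℕ) (x y : box L) (h1 : (r : ℤ) + 1 ≤ x)
    (h2 : (x : ℤ) + r ≤ L) : (boxMatrix a V (box L) ^ r) x y = kernelPow a V r x y := by
  induction r generalizing x with
  | zero =>
    rw [pow_zero, Matrix.one_apply, kernelPow]
    by_cases h : x = y
    · rw [if_pos h, if_pos (congrArg _ h)]
    · rw [if_neg h, if_neg fun h' => h (Subtype.ext h')]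
  | succ r ih =>
    push_cast at h1 h2
    have m1 : (x : ℤ) + 1 ∈ box L := mem_box.2 ⟨by omega, by omega⟩
    have m2 : (x : ℤ) - 1 ∈ box L := mem_box.2 ⟨by omega, by omega⟩
    let g : ℤ → ℝ := fun z => if h : z ∈ box L then (boxMatrix a V (box L) ^ r) ⟨z, h⟩ y else 0
    have hg : ∀ z : box L, g z = (boxMatrix a V (box L) ^ r) z y := fun z => by simp [g]
    rw [pow_succ', Matrix.mul_apply]
    have h3 : ∑ z : box L, boxMatrix a V (box L) x z * (boxMatrix a V (box L) ^ r) z y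
        = ∑ z ∈ box L, jacobiKernel a V x z * g z := by
      rw [← Finset.sum_coe_sort (box L) fun z => jacobiKernel a V x z * g z]
      exact Finset.sum_congr rfl fun z _ => by rw [hg]; rfl
    rw [h3, sum_jacobiKernel_mul x.2 m1 m2, kernelPow]
    have e0 := hg x
    have e1 := hg ⟨_, m1⟩
    have e2 := hg ⟨_, m2⟩
    rw [ih _ (by omega) (by omega)] at e0
    rw [ih _ (by simp only; omega) (by simp only; omega)] at e1
    rw [ih _ (by simp only; omega) (by simp only; omega)] at e2
    rw [e0, e1, e2]

theorem kernelPow_shift (a V : ℤ → ℝ) (r : ℕ) (s x y : ℤ) :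
    kernelPow (fun n => a (n + s)) (fun n => V (n + s)) r x y
      = kernelPow a V r (x + s) (y + s) := by
  induction r generalizing x with
  | zero => simp [kernelPow]
  | succ r ih =>
    simp only [kernelPow, ih]
    rw [show x + 1 + s = x + s + 1 by ring, show x - 1 + s = x + s - 1 by ring]

theorem abs_kernelPow_le {a V : ℤ → ℝ} {K : ℝ} (hK : ∀ n, |a n| ≤ K ∧ |V n| ≤ K) (r : ℕ)
    (x y : ℤ) : |kernelPow a V r x y| ≤ (3 * K) ^ r := by
  have hK0 : 0 ≤ K := (abs_nonneg _).trans (hK 0).1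
  induction r generalizing x with
  | zero => simp only [kernelPow, pow_zero]; split_ifs <;> simp
  | succ r ih =>
    rw [kernelPow]
    refine (abs_add_three _ _ _).trans ?_
    simp only [abs_mul]
    have h1 := mul_le_mul (hK (x + 1)).1 (ih (x + 1)) (abs_nonneg _) hK0
    have h2 := mul_le_mul (hK x).1 (ih (x - 1)) (abs_nonneg _) hK0
    have h3 := mul_le_mul (hK x).2 (ih x) (abs_nonneg _) hK0
    rw [pow_succ]
    linarith

theorem measurable_kernelPow {X : Type*} [MeasurableSpace X] {a V : ℤ → X → ℝ}
    (ha : ∀ n, Measurable (a n)) (hV : ∀ n, Measurable (V n)) (r : ℕ) (x y : ℤ) :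
    Measurable fun ω => kernelPow (a · ω) (V · ω) r x y := by
  induction r generalizing x with
  | zero => simp only [kernelPow]; exact measurable_const
  | succ r ih =>
    simp only [kernelPow]
    exact (((ha _).mul (ih _)).add ((ha _).mul (ih _))).add ((hV _).mul (ih _))

/-- The eigenvalue equation at a site where the eigenfunction is maximal involves at most three
entries, each bounded by `K`. -/
theorem abs_levels_le {a V : ℤ → ℝ} {K : ℝ} (hK : ∀ n, |a n| ≤ K ∧ |V n| ≤ K) (Λ : Finset ℤ)
    (i : Λ) : |levels a V Λ i| ≤ 3 * K := by
  have hK0 : 0 ≤ K := (abs_nonneg _).trans (hK 0).1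
  obtain ⟨x, hx, hmax⟩ := Finset.exists_max_image Λ (fun n => |boxEig a V Λ i n|) ⟨i, i.2⟩
  have hpos : 0 < |boxEig a V Λ i x| := by
    by_contra! h
    have h0 : ∀ n ∈ Λ, boxEig a V Λ i n = 0 := fun n hn =>
      abs_eq_zero.1 (le_antisymm ((hmax n hn).trans h) (abs_nonneg _))
    have h1 := boxEig_orthonormal a V Λ i i
    rw [if_pos rfl, Finset.sum_eq_zero fun n hn => by rw [h0 n hn, zero_mul]] at h1
    exact zero_ne_one h1
  have h1 := sum_jacobiKernel_mul_boxEig a V Λ i hx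
  have h2 : |levels a V Λ i| * |boxEig a V Λ i x| ≤ 3 * K * |boxEig a V Λ i x| := by
    rw [← abs_mul, ← h1]
    have h3 : ∑ y ∈ Λ, jacobiKernel a V x y * boxEig a V Λ i y
        = ∑ y ∈ Λ ∩ {x + 1, x - 1, x}, jacobiKernel a V x y * boxEig a V Λ i y := by
      refine (Finset.sum_subset Finset.inter_subset_left fun y hy hy' => ?_).symm
      have : y ∉ ({x + 1, x - 1, x} : Finset ℤ) := fun h => hy' (Finset.mem_inter.2 ⟨hy, h⟩)
      simp only [Finset.mem_insert, Finset.mem_singleton, not_or] at this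
      rw [jacobiKernel, if_neg this.2.2, if_neg this.1, if_neg (by omega), zero_mul]
    rw [h3]
    refine (Finset.abs_sum_le_sum_abs _ _).trans ?_
    calc _ ≤ ∑ _y ∈ Λ ∩ {x + 1, x - 1, x}, K * |boxEig a V Λ i x| := by
          refine Finset.sum_le_sum fun y hy => ?_
          rw [abs_mul]
          exact mul_le_mul (abs_jacobiKernel_le hK _ _) (hmax y (Finset.mem_inter.1 hy).1)
            (abs_nonneg _) hK0
      _ ≤ _ := by
          rw [Finset.sum_const, nsmul_eq_mul, mul_assoc 3]
          refine mul_le_mul_of_nonneg_right ?_ (by positivity)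
          exact_mod_cast (Finset.card_le_card Finset.inter_subset_right).trans Finset.card_le_three
  exact le_of_mul_le_mul_right h2 hpos

end RandomJacobi

namespace RandomJacobi

/-! ### The density of states as a limit of normalized level counts -/

theorem sum_cfc_diag {n : Type*} [Fintype n] [DecidableEq n] {A : Matrix n n ℝ}
    (hA : A.IsHermitian) (f : ℝ → ℝ) : ∑ x, cfc f A x x = ∑ i, f (hA.eigenvalues i) := by
  simp_rw [cfc_apply_eq_sum hA]
  rw [Finset.sum_comm]
  simp_rw [← Finset.mul_sum, eigvec_orthonormal]
  simp

theorem abs_cfc_diag_le {n : Type*} [Fintype n] [DecidableEq n] {A : Matrix n n ℝ}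
    (hA : A.IsHermitian) {f : ℝ → ℝ} {B : ℝ} (hf : ∀ i, |f (hA.eigenvalues i)| ≤ B) (x : n) :
    |cfc f A x x| ≤ B := by
  rw [cfc_apply_eq_sum hA]
  refine (Finset.abs_sum_le_sum_abs _ _).trans ?_
  have h1 : ∑ i, eigvec hA i x * eigvec hA i x = 1 := by rw [eigvec_complete, if_pos rfl]
  calc _ ≤ ∑ i, B * (eigvec hA i x * eigvec hA i x) := by
        refine Finset.sum_le_sum fun i _ => ?_
        rw [abs_mul, abs_mul_self]
        exact mul_le_mul_of_nonneg_right (hf i) (mul_self_nonneg _)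
    _ = B := by rw [← Finset.mul_sum, h1, mul_one]

theorem sum_box_eq (f : ℤ → ℝ) (L : ℕ) : ∑ x ∈ box L, f x = ∑ i ∈ Finset.range L, f (i + 1) := by
  induction L with
  | zero => simp [box]
  | succ L ih =>
    have : box (L + 1) = insert ((L : ℤ) + 1) (box L) := by
      ext x
      rw [Finset.mem_insert, mem_box, mem_box]
      push_cast
      omega
    rw [this, Finset.sum_insert (by simp [mem_box]), ih, Finset.sum_range_succ, add_comm]

theorem sum_range_mul_of_periodic {f : ℤ → ℝ} {q : ℕ} (hf : ∀ x, f (x + q) = f x) (k : ℕ) :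
    ∑ i ∈ Finset.range (k * q), f (i + 1) = k * ∑ i ∈ Finset.range q, f i := by
  have hf' : ∀ (k : ℕ) (x : ℤ), f (x + k * q) = f x := by
    intro k x
    induction k with
    | zero => simp
    | succ k ih =>
      rw [← ih, ← hf (x + k * q)]
      congr 1
      push_cast
      ring
  -- Boxes start at site `1` while the period in the density of states starts at `0`; the two sums
  -- agree since `f q = f 0`.
  have h1 : ∑ i ∈ Finset.range q, f ((i : ℤ) + 1) = ∑ i ∈ Finset.range q, f i := by
    have e1 := Finset.sum_range_succ (fun i : ℕ => f (i : ℤ)) q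
    have e2 := Finset.sum_range_succ' (fun i : ℕ => f (i : ℤ)) q
    have e3 := hf 0
    simp only [Nat.cast_add, Nat.cast_one, Nat.cast_zero] at e2
    rw [zero_add] at e3
    linarith
  induction k with
  | zero => simp
  | succ k ih =>
    rw [add_mul, one_mul, Finset.sum_range_add, ih]
    have : ∀ i : ℕ, f (((k * q + i : ℕ) : ℤ) + 1) = f ((i : ℤ) + 1) := fun i => by
      rw [← hf' k ((i : ℤ) + 1)]
      congr 1
      push_cast
      ring
    simp_rw [this, h1]
    push_cast
    ring

theorem abs_integral_le_of_ae_bound {X : Type*} [MeasurableSpace X] {μ : Measure X}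
    [IsProbabilityMeasure μ] {f : X → ℝ} {C : ℝ} (h : ∀ᵐ x ∂μ, |f x| ≤ C) : |∫ x, f x ∂μ| ≤ C := by
  have := norm_integral_le_of_norm_le_const (μ := μ) (f := f) (C := C) h
  rwa [probReal_univ, mul_one] at this

section Model

set_option linter.unusedSectionVars false

variable {Ω : Type*} [MeasurableSpace Ω] {P : Measure Ω} [IsProbabilityMeasure P]
  {a V : ℤ → Ω → ℝ} {K : ℝ} {q : ℕ} {I : Set ℝ} {ρ : ℝ} {κ : Measure ℝ}

theorem LocalizedModel.K_nonneg (h : LocalizedModel P a V K q I ρ) : 0 ≤ K := by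
  obtain ⟨ω, hω⟩ := h.ae_bound.exists
  exact (abs_nonneg _).trans (hω 0).1

/-- Test with `ψ = 1`. An infinite total mass is excluded because its real value would be `0`
instead of `1`. -/
theorem LocalizedModel.isProbabilityMeasure_dos (h : LocalizedModel P a V K q I ρ)
    (hκ : IsDensityOfStates P a V q κ) : IsProbabilityMeasure κ := by
  have h1 := hκ (fun _ => 1) continuous_const
  have h3 : ∀ (x : ℤ) ω, (inner ℂ (delta x) (funcCalc (fun _ => (1 : ℝ))
      (jacobiOp (a · ω) (V · ω)) (delta x))).re = 1 := by
    intro x ω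
    rw [funcCalc_one (jacobiOp_isSelfAdjoint _ _), one_apply_eq_self, inner_delta_left,
      delta_apply, if_pos rfl, Complex.one_re]
  simp only [h3, integral_const, probReal_univ, smul_eq_mul, mul_one, Finset.sum_const,
    Finset.card_range, nsmul_eq_mul] at h1
  have hq : (q : ℝ) ≠ 0 := by exact_mod_cast h.q_pos.ne'
  rw [one_div, inv_mul_cancel₀ hq, measureReal_def] at h1
  exact ⟨by rw [← ENNReal.ofReal_toReal (a := κ Set.univ) (fun h => by simp [h] at h1), h1,
    ENNReal.ofReal_one]⟩

/-- A continuous function that vanishes on `[-3K, 3K]` and is positive outside has zero functional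
calculus, since the operator norm is at most `3K`; hence its integral against `κ` is zero. -/
theorem LocalizedModel.ae_abs_le_dos (h : LocalizedModel P a V K q I ρ)
    (hκ : IsDensityOfStates P a V q κ) : ∀ᵐ E ∂κ, |E| ≤ 3 * K := by
  have := h.isProbabilityMeasure_dos hκ
  set ψ : ℝ → ℝ := fun E => min 1 (max 0 (|E| - 3 * K)) with hψ
  have hc : Continuous ψ := by fun_prop
  have h0 : ∀ E, 0 ≤ ψ E := fun E => le_min zero_le_one (le_max_left _ _)
  have h1 := hκ ψ hc
  have h2 : ∀ x : ℤ, ∫ ω, (inner ℂ (delta x) (funcCalc ψ (jacobiOp (a · ω) (V · ω))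
      (delta x))).re ∂P = 0 := by
    intro x
    refine integral_eq_zero_of_ae ?_
    filter_upwards [h.ae_bound] with ω hω
    rw [funcCalc_congr (g := fun _ => 0) fun E hE => ?_, funcCalc_zero]
    · simp
    · have := hE.trans (norm_jacobiOp_le hω)
      simp only [hψ]
      rw [max_eq_left (by linarith), min_eq_right zero_le_one]
  simp only [h2, Finset.sum_const_zero, mul_zero] at h1
  have hint : Integrable ψ κ := Integrable.of_bound hc.aestronglyMeasurable 1
    (ae_of_all _ fun E => by rw [Real.norm_of_nonneg (h0 E)]; exact min_le_left _ _)
  filter_upwards [(integral_eq_zero_iff_of_nonneg h0 hint).1 h1] with E hE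
  by_contra! hlt
  have : 0 < ψ E := lt_min one_pos (lt_max_of_lt_right (by linarith))
  exact this.ne' hE

/-- The mean of a function of the levels of a box. -/
noncomputable def meanLevels (P : Measure Ω) (a V : ℤ → Ω → ℝ) (ψ : ℝ → ℝ) (L : ℕ) : ℝ :=
  ∫ ω, ∑ i, ψ (levels (a · ω) (V · ω) (box L) i) ∂P

theorem LocalizedModel.measurable_sum_levels (h : LocalizedModel P a V K q I ρ) {ψ : ℝ → ℝ}
    (hψ : Continuous ψ) (L : ℕ) :
    Measurable fun ω => ∑ i, ψ (levels (a · ω) (V · ω) (box L) i) := by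
  have : ∀ ω, ∑ i, ψ (levels (a · ω) (V · ω) (box L) i)
      = ∑ x, cfc ψ (boxMatrix (a · ω) (V · ω) (box L)) x x := fun ω =>
    (sum_cfc_diag (boxMatrix_isHermitian _ _ _) ψ).symm
  simp_rw [this]
  exact Finset.measurable_sum _ fun x _ => measurable_cfc_apply_of_continuous
    (measurable_boxMatrix h.meas_a h.meas_V _) (fun _ => boxMatrix_isHermitian _ _ _) hψ x x

theorem LocalizedModel.integrable_sum_levels (h : LocalizedModel P a V K q I ρ) {ψ : ℝ → ℝ}
    (hψ : Continuous ψ) (L : ℕ) :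
    Integrable (fun ω => ∑ i, ψ (levels (a · ω) (V · ω) (box L) i)) P := by
  obtain ⟨B, hB⟩ := isCompact_Icc.exists_bound_of_continuousOn
    (hψ.continuousOn (s := Set.Icc (-(3 * K)) (3 * K)))
  refine Integrable.of_bound (h.measurable_sum_levels hψ L).aestronglyMeasurable (L * B) ?_
  filter_upwards [h.ae_bound] with ω hω
  refine (norm_sum_le _ _).trans ((Finset.sum_le_sum fun i _ =>
    hB _ (abs_le.1 (abs_levels_le hω _ i))).trans (le_of_eq ?_))
  simp [card_box]

/-- The mean of a diagonal entry of a power of the Jacobi operator. -/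
noncomputable def meanPow (P : Measure Ω) (a V : ℤ → Ω → ℝ) (r : ℕ) (x : ℤ) : ℝ :=
  ∫ ω, kernelPow (a · ω) (V · ω) r x x ∂P

theorem LocalizedModel.integrable_kernelPow (h : LocalizedModel P a V K q I ρ) (r : ℕ) (x y : ℤ) :
    Integrable (fun ω => kernelPow (a · ω) (V · ω) r x y) P := by
  refine Integrable.of_bound
    (measurable_kernelPow h.meas_a h.meas_V r x y).aestronglyMeasurable ((3 * K) ^ r) ?_
  filter_upwards [h.ae_bound] with ω hω
  exact abs_kernelPow_le hω r x y

theorem LocalizedModel.meanPow_periodic (h : LocalizedModel P a V K q I ρ) (r : ℕ) (x : ℤ) :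
    meanPow P a V r (x + q) = meanPow P a V r x := by
  have := h.integral_shift 1 (f := fun z => kernelPow (fun n => (z n).1) (fun n => (z n).2) r x x)
    (measurable_kernelPow measurable_coord_fst measurable_coord_snd r x x)
  simp only [one_mul] at this
  rw [meanPow, meanPow, ← this]
  refine integral_congr_ae (ae_of_all _ fun ω => ?_)
  exact (kernelPow_shift (a · ω) (V · ω) r q x x).symm

/-- The diagonal of the `r`-th power of the box matrix agrees with that of the infinite operator
except at the at most `2r` sites within `r` of the ends. The bound does not depend on `k`, hence
disappears after division by the volume. -/
theorem LocalizedModel.abs_meanLevels_pow_sub_le (h : LocalizedModel P a V K q I ρ) (r k : ℕ) :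
    |meanLevels P a V (fun E => E ^ r) (k * q) - k * ∑ x ∈ Finset.range q, meanPow P a V r x|
      ≤ 2 * r * (2 * (3 * K) ^ r) := by
  have hK0 := h.K_nonneg
  set L := k * q with hL
  have e1 : (k : ℝ) * ∑ x ∈ Finset.range q, meanPow P a V r x
      = ∫ ω, ∑ x ∈ box L, kernelPow (a · ω) (V · ω) r x x ∂P := by
    rw [integral_finsetSum _ fun x _ => h.integrable_kernelPow r x x]
    change _ = ∑ x ∈ box L, meanPow P a V r x
    rw [sum_box_eq, sum_range_mul_of_periodic (h.meanPow_periodic r)]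
  rw [e1, meanLevels, ← integral_sub (h.integrable_sum_levels (continuous_pow r) L)
    (integrable_finsetSum _ fun x _ => h.integrable_kernelPow r x x)]
  refine abs_integral_le_of_ae_bound ?_
  filter_upwards [h.ae_bound] with ω hω
  have hA := boxMatrix_isHermitian (a · ω) (V · ω) (box L)
  set A := boxMatrix (a · ω) (V · ω) (box L)
  have hpow : A ^ r = cfc (fun E : ℝ => E ^ r) A := (cfc_pow_id A r hA.isSelfAdjoint).symm
  have e2 : ∑ i, levels (a · ω) (V · ω) (box L) i ^ r = ∑ x, (A ^ r) x x := by
    rw [hpow, sum_cfc_diag hA]; rfl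
  have e3 : ∀ x : box L, |(A ^ r) x x - kernelPow (a · ω) (V · ω) r x x| ≤ 2 * (3 * K) ^ r := by
    intro x
    have h1 : |(A ^ r) x x| ≤ (3 * K) ^ r := by
      rw [hpow]
      refine abs_cfc_diag_le hA (fun i => ?_) x
      rw [abs_pow]
      exact pow_le_pow_left₀ (abs_nonneg _) (abs_levels_le hω _ i) r
    have h2 := abs_kernelPow_le hω r x x
    refine (abs_sub _ _).trans ?_
    linarith
  rw [e2, ← Finset.sum_coe_sort (box L) fun x => kernelPow (a · ω) (V · ω) r x x,
    ← Finset.sum_sub_distrib]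
  let D : Finset (box L) := Finset.univ.filter fun x => ¬ ((r : ℤ) + 1 ≤ x ∧ (x : ℤ) + r ≤ L)
  have hD : (D.card : ℝ) ≤ 2 * r := by
    have h1 : D.card ≤ (Finset.Icc 1 (r : ℤ) ∪ Finset.Icc ((L : ℤ) - r + 1) L).card := by
      rw [← Finset.card_image_of_injective D Subtype.val_injective]
      refine Finset.card_le_card fun x hx => ?_
      obtain ⟨y, hy, rfl⟩ := Finset.mem_image.1 hx
      have hy1 := (Finset.mem_filter.1 hy).2
      have hy2 := mem_box.1 y.2
      rw [Finset.mem_union, Finset.mem_Icc, Finset.mem_Icc]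
      omega
    have h2 := h1.trans (Finset.card_union_le _ _)
    rw [Int.card_Icc, Int.card_Icc] at h2
    have h3 : D.card ≤ 2 * r := by omega
    exact_mod_cast h3
  rw [← Finset.sum_subset (Finset.subset_univ D) fun x _ hx => ?_]
  · refine (Finset.abs_sum_le_sum_abs _ _).trans ((Finset.sum_le_sum fun x _ => e3 x).trans ?_)
    rw [Finset.sum_const, nsmul_eq_mul]
    exact mul_le_mul_of_nonneg_right hD (by positivity)
  · have hx' : (r : ℤ) + 1 ≤ x ∧ (x : ℤ) + r ≤ L := by
      by_contra hcon
      exact hx (Finset.mem_filter.2 ⟨Finset.mem_univ _, hcon⟩)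
    rw [boxMatrix_pow_apply _ _ L r x x hx'.1 hx'.2, sub_self]

theorem LocalizedModel.tendsto_meanLevels_pow (h : LocalizedModel P a V K q I ρ) (r : ℕ) :
    Tendsto (fun k : ℕ => meanLevels P a V (fun E => E ^ r) (k * q) / ((k * q : ℕ) : ℝ)) atTop
      (𝓝 ((1 / (q : ℝ)) * ∑ x ∈ Finset.range q, meanPow P a V r x)) := by
  have hq : (0 : ℝ) < q := by exact_mod_cast h.q_pos
  rw [tendsto_iff_norm_sub_tendsto_zero]
  refine squeeze_zero' (Eventually.of_forall fun _ => norm_nonneg _) (g := fun k : ℕ =>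
    (2 * r * (2 * (3 * K) ^ r) / q) / k) ?_ (tendsto_const_div_atTop_nhds_zero_nat _)
  filter_upwards [eventually_gt_atTop 0] with k hk
  have hk0 : (0 : ℝ) < k := by exact_mod_cast hk
  have := h.abs_meanLevels_pow_sub_le r k
  have e : meanLevels P a V (fun E => E ^ r) (k * q) / ((k * q : ℕ) : ℝ)
      - (1 / (q : ℝ)) * ∑ x ∈ Finset.range q, meanPow P a V r x
      = (meanLevels P a V (fun E => E ^ r) (k * q)
        - k * ∑ x ∈ Finset.range q, meanPow P a V r x) / (k * q) := by
    push_cast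
    field_simp
  rw [e, norm_div, Real.norm_eq_abs, Real.norm_of_nonneg (by positivity), div_div,
    mul_comm (q : ℝ)]
  exact div_le_div_of_nonneg_right this (by positivity)

theorem LocalizedModel.integral_polynomial_dos (h : LocalizedModel P a V K q I ρ)
    (hκ : IsDensityOfStates P a V q κ) (p : Polynomial ℝ) :
    ∫ E, p.eval E ∂κ = ∑ i ∈ Finset.range (p.natDegree + 1),
      p.coeff i * ((1 / (q : ℝ)) * ∑ x ∈ Finset.range q, meanPow P a V i x) := by
  rw [hκ _ p.continuous]
  have h1 : ∀ x : ℤ, ∫ ω, (inner ℂ (delta x) (funcCalc (fun E => p.eval E)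
      (jacobiOp (a · ω) (V · ω)) (delta x))).re ∂P
      = ∑ i ∈ Finset.range (p.natDegree + 1), p.coeff i * meanPow P a V i x := by
    intro x
    have h2 : ∀ᵐ ω ∂P, (inner ℂ (delta x) (funcCalc (fun E => p.eval E)
        (jacobiOp (a · ω) (V · ω)) (delta x))).re
        = ∑ i ∈ Finset.range (p.natDegree + 1),
          p.coeff i * kernelPow (a · ω) (V · ω) i x x := by
      filter_upwards [h.ae_bound] with ω hω
      rw [inner_funcCalc_polynomial (jacobiOp_isSelfAdjoint _ _), Complex.re_sum]
      refine Finset.sum_congr rfl fun i _ => ?_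
      rw [inner_delta_left, iterate_jacobiOp_delta hω, ← Complex.ofReal_mul, Complex.ofReal_re]
    rw [integral_congr_ae h2,
      integral_finsetSum _ fun i _ => (h.integrable_kernelPow i x x).const_mul _]
    refine Finset.sum_congr rfl fun i _ => ?_
    rw [integral_const_mul, meanPow]
  simp_rw [h1]
  rw [Finset.sum_comm, Finset.mul_sum]
  refine Finset.sum_congr rfl fun i _ => ?_
  rw [← Finset.mul_sum]
  ring

theorem LocalizedModel.tendsto_meanLevels_polynomial (h : LocalizedModel P a V K q I ρ)
    (hκ : IsDensityOfStates P a V q κ) (p : Polynomial ℝ) :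
    Tendsto (fun k : ℕ => meanLevels P a V (fun E => p.eval E) (k * q) / ((k * q : ℕ) : ℝ)) atTop
      (𝓝 (∫ E, p.eval E ∂κ)) := by
  rw [h.integral_polynomial_dos hκ]
  have : ∀ k : ℕ, meanLevels P a V (fun E => p.eval E) (k * q) / ((k * q : ℕ) : ℝ)
      = ∑ i ∈ Finset.range (p.natDegree + 1),
        p.coeff i * (meanLevels P a V (fun E => E ^ i) (k * q) / ((k * q : ℕ) : ℝ)) := by
    intro k
    have e : meanLevels P a V (fun E => p.eval E) (k * q)
        = ∑ i ∈ Finset.range (p.natDegree + 1),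
          p.coeff i * meanLevels P a V (fun E => E ^ i) (k * q) := by
      simp only [meanLevels, ← integral_const_mul]
      rw [← integral_finsetSum _ fun i _ =>
        (h.integrable_sum_levels (continuous_pow i) (k * q)).const_mul _]
      refine integral_congr_ae (ae_of_all _ fun ω => ?_)
      simp only [Polynomial.eval_eq_sum_range]
      rw [Finset.sum_comm]
      exact Finset.sum_congr rfl fun i _ => (Finset.mul_sum _ _ _).symm
    rw [e, Finset.sum_div]
    exact Finset.sum_congr rfl fun i _ => mul_div_assoc _ _ _
  simp_rw [this]
  exact tendsto_finsetSum _ fun i _ => (h.tendsto_meanLevels_pow i).const_mul _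

/-- Weierstrass approximation on `[-3K, 3K]`, which carries both the levels of all boxes and the
measure `κ`, reduces the claim to polynomials. -/
theorem LocalizedModel.tendsto_meanLevels (h : LocalizedModel P a V K q I ρ)
    (hκ : IsDensityOfStates P a V q κ) {ψ : ℝ → ℝ} (hψ : Continuous ψ) :
    Tendsto (fun k : ℕ => meanLevels P a V ψ (k * q) / ((k * q : ℕ) : ℝ)) atTop
      (𝓝 (∫ E, ψ E ∂κ)) := by
  have := h.isProbabilityMeasure_dos hκ
  have hκae := h.ae_abs_le_dos hκ
  rw [Metric.tendsto_atTop]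
  intro ε hε
  obtain ⟨p, hp⟩ := exists_polynomial_near_of_continuousOn (-(3 * K)) (3 * K) ψ hψ.continuousOn
    (ε / 3) (by positivity)
  obtain ⟨N, hN⟩ := Metric.tendsto_atTop.1 (h.tendsto_meanLevels_polynomial hκ p) (ε / 3)
    (by positivity)
  have hint : ∀ {f : ℝ → ℝ}, Continuous f → Integrable f κ := by
    intro f hf
    obtain ⟨B, hB⟩ := isCompact_Icc.exists_bound_of_continuousOn
      (hf.continuousOn (s := Set.Icc (-(3 * K)) (3 * K)))
    refine Integrable.of_bound hf.aestronglyMeasurable B ?_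
    filter_upwards [hκae] with E hE
    exact hB E (abs_le.1 hE)
  have e1 : |∫ E, p.eval E ∂κ - ∫ E, ψ E ∂κ| ≤ ε / 3 := by
    rw [← integral_sub (hint p.continuous) (hint hψ)]
    refine abs_integral_le_of_ae_bound ?_
    filter_upwards [hκae] with E hE
    exact (hp E (abs_le.1 hE)).le
  refine ⟨max N 1, fun k hk => ?_⟩
  have hk1 : 1 ≤ k := (le_max_right _ _).trans hk
  have e2 := hN k ((le_max_left _ _).trans hk)
  set L := k * q with hL
  have hL0 : (0 : ℝ) < L := by exact_mod_cast Nat.mul_pos hk1 h.q_pos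
  have e3 : |meanLevels P a V ψ L / L - meanLevels P a V (fun E => p.eval E) L / L| ≤ ε / 3 := by
    rw [← sub_div, abs_div, abs_of_pos hL0, div_le_iff₀ hL0, meanLevels, meanLevels,
      ← integral_sub (h.integrable_sum_levels hψ L) (h.integrable_sum_levels p.continuous L)]
    refine abs_integral_le_of_ae_bound ?_
    filter_upwards [h.ae_bound] with ω hω
    rw [← Finset.sum_sub_distrib]
    calc _ ≤ ∑ _i : box L, ε / 3 := (Finset.abs_sum_le_sum_abs _ _).trans
          (Finset.sum_le_sum fun i _ => by
            rw [abs_sub_comm]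
            exact (hp _ (abs_le.1 (abs_levels_le hω _ i))).le)
      _ = ε / 3 * L := by simp [card_box]; ring
  rw [Real.dist_eq] at e2 ⊢
  rw [abs_lt] at e2
  rw [abs_le] at e1 e3
  rw [abs_lt]
  constructor <;> linarith [e1.1, e1.2, e2.1, e2.2, e3.1, e3.2]

/-- The mean number of levels of a box in a set of energies. -/
noncomputable def meanCount (P : Measure Ω) (a V : ℤ → Ω → ℝ) (L : ℕ) (J : Set ℝ) : ℝ :=
  ∫ ω, (levelCount (a · ω) (V · ω) (box L) J : ℝ) ∂P

theorem levelCount_eq_sum (a V : ℤ → ℝ) (Λ : Finset ℤ) (J : Set ℝ) :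
    (levelCount a V Λ J : ℝ) = ∑ i, J.indicator (fun _ => (1 : ℝ)) (levels a V Λ i) := by
  rw [levelCount_eq_trace, sum_cfc_diag (boxMatrix_isHermitian a V Λ)]
  rfl

/-- A portmanteau argument: the indicator of `J` lies between `1 - g` and `f`, thickened indicators
of the closures of `Jᶜ` and `J`, and since the frontier is null both integrals approach `κ J`. -/
theorem LocalizedModel.tendsto_meanCount (h : LocalizedModel P a V K q I ρ)
    (hκ : IsDensityOfStates P a V q κ) {J : Set ℝ} (hJ : MeasurableSet J)
    (hfr : κ (frontier J) = 0) :
    Tendsto (fun k : ℕ => meanCount P a V (k * q) J / ((k * q : ℕ) : ℝ)) atTop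
      (𝓝 (κ.real J)) := by
  have := h.isProbabilityMeasure_dos hκ
  have hδ : ∀ n : ℕ, (0 : ℝ) < 1 / ((n : ℝ) + 1) := fun n => by positivity
  have hδl := tendsto_one_div_add_atTop_nhds_zero_nat (𝕜 := ℝ)
  have hup := tendsto_integral_thickenedIndicator_of_isClosed κ (isClosed_closure (s := J)) hδ hδl
  have hdn := tendsto_integral_thickenedIndicator_of_isClosed κ (isClosed_closure (s := Jᶜ)) hδ hδl
  have m1 : κ.real (closure J) = κ.real J := by
    rw [measureReal_def, measure_closure_of_null_frontier hfr, measureReal_def]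
  have m2 : κ.real (closure Jᶜ) = 1 - κ.real J := by
    rw [closure_compl, probReal_compl_eq_one_sub isOpen_interior.measurableSet, measureReal_def,
      measure_interior_of_null_frontier hfr, measureReal_def]
  rw [m1] at hup
  rw [m2] at hdn
  rw [Metric.tendsto_atTop]
  intro ε hε
  obtain ⟨N, hN⟩ := Metric.tendsto_atTop.1 hup (ε / 2) (by positivity)
  obtain ⟨N', hN'⟩ := Metric.tendsto_atTop.1 hdn (ε / 2) (by positivity)
  set n := max N N'
  have hn1 := hN n (le_max_left _ _)
  have hn2 := hN' n (le_max_right _ _)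
  set f : ℝ → ℝ := fun E => (thickenedIndicator (hδ n) (closure J) E : ℝ) with hf
  set g : ℝ → ℝ := fun E => (thickenedIndicator (hδ n) (closure Jᶜ) E : ℝ) with hg
  have hfc : Continuous f := NNReal.continuous_coe.comp (thickenedIndicator (hδ n) _).continuous
  have hgc : Continuous g := NNReal.continuous_coe.comp (thickenedIndicator (hδ n) _).continuous
  have hJf : ∀ E, J.indicator (fun _ => (1 : ℝ)) E ≤ f E := by
    intro E
    by_cases hE : E ∈ J
    · rw [Set.indicator_of_mem hE, hf]
      simp only
      rw [thickenedIndicator_one (hδ n) _ (subset_closure hE), NNReal.coe_one]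
    · rw [Set.indicator_of_notMem hE]; exact NNReal.coe_nonneg _
  have hJg : ∀ E, 1 - g E ≤ J.indicator (fun _ => (1 : ℝ)) E := by
    intro E
    by_cases hE : E ∈ J
    · rw [Set.indicator_of_mem hE]
      have : 0 ≤ g E := NNReal.coe_nonneg _
      linarith
    · rw [Set.indicator_of_notMem hE, hg]
      simp only
      rw [thickenedIndicator_one (hδ n) _ (subset_closure (show E ∈ Jᶜ from hE)), NNReal.coe_one,
        sub_self]
  have hgint : ∫ E, (1 - g E) ∂κ = 1 - ∫ E, g E ∂κ := by
    rw [integral_sub (integrable_const _) (integrable_thickenedIndicator _ (hδ n)), integral_const,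
      probReal_univ, one_smul]
  obtain ⟨N₁, hN₁⟩ := Metric.tendsto_atTop.1 (h.tendsto_meanLevels hκ hfc) (ε / 2) (by positivity)
  have hgc' : Continuous fun E => 1 - g E := continuous_const.sub hgc
  obtain ⟨N₂, hN₂⟩ := Metric.tendsto_atTop.1 (h.tendsto_meanLevels hκ hgc') (ε / 2)
    (by positivity)
  refine ⟨max (max N₁ N₂) 1, fun k hk => ?_⟩
  have hk1 : 1 ≤ k := (le_max_right _ _).trans hk
  have e1 := hN₁ k ((le_max_left _ _).trans ((le_max_left _ _).trans hk))
  have e2 := hN₂ k ((le_max_right _ _).trans ((le_max_left _ _).trans hk))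
  set L := k * q with hL
  have hL0 : (0 : ℝ) < L := by exact_mod_cast Nat.mul_pos hk1 h.q_pos
  have c1 : meanCount P a V L J / L ≤ meanLevels P a V f L / L := by
    refine div_le_div_of_nonneg_right ?_ hL0.le
    refine integral_mono (h.integrable_levelCount _ hJ) (h.integrable_sum_levels hfc L) fun ω => ?_
    simp only [levelCount_eq_sum]
    exact Finset.sum_le_sum fun i _ => hJf _
  have c2 : meanLevels P a V (fun E => 1 - g E) L / L ≤ meanCount P a V L J / L := by
    refine div_le_div_of_nonneg_right ?_ hL0.le
    refine integral_mono (h.integrable_sum_levels hgc' L)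
      (h.integrable_levelCount _ hJ) fun ω => ?_
    simp only [levelCount_eq_sum]
    exact Finset.sum_le_sum fun i _ => hJg _
  rw [hgint] at e2
  rw [Real.dist_eq, abs_lt] at e1 e2 hn1 hn2 ⊢
  constructor <;> linarith [e1.1, e1.2, e2.1, e2.2, hn1.1, hn1.2, hn2.1, hn2.2]

/-- A point is a degenerate interval of length `0`, so (R) makes `L * κ {E}` tend to zero. -/
theorem dos_singleton_eq_zero (hR : RegularIDS κ I) {E : ℝ} (hE : E ∈ I) : κ {E} = 0 := by
  have h1 := hR (1 / 2) ⟨by norm_num, by norm_num⟩ (1 / 2) ⟨by norm_num, by norm_num⟩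
  refine le_antisymm (ge_of_tendsto h1 ?_) zero_le
  filter_upwards [eventually_ge_atTop 1] with L hL
  have h2 : κ {E} ≤ idsModulus κ I (Real.exp (-(((L : ℝ) ^ (1 / 2 : ℝ)) ^ (1 / 2 : ℝ)))) := by
    rw [← Set.Icc_self]
    refine le_iSup_of_le E (le_iSup_of_le E (le_iSup_of_le le_rfl (le_iSup_of_le ?_
      (le_iSup_of_le ?_ le_rfl))))
    · simpa using hE
    · rw [sub_self]; positivity
  refine h2.trans (le_mul_of_one_le_left zero_le ?_)
  exact_mod_cast hL

theorem frontier_subset_of_ordConnected {J : Set ℝ} (hJ : J.OrdConnected)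
    (hb : Bornology.IsBounded J) : frontier J ⊆ {sInf J, sSup J} := by
  rcases J.eq_empty_or_nonempty with rfl | hn
  · simp
  have h1 : closure J ⊆ Set.Icc (sInf J) (sSup J) :=
    closure_minimal (subset_Icc_csInf_csSup hb.bddBelow hb.bddAbove) isClosed_Icc
  have h2 : Set.Ioo (sInf J) (sSup J) ⊆ interior J :=
    interior_maximal (IsConnected.Ioo_csInf_csSup_subset ⟨hn, hJ.isPreconnected⟩ hb.bddBelow
      hb.bddAbove) isOpen_Ioo
  intro E hE
  have h3 := h1 hE.1
  by_contra hcon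
  simp only [Set.mem_insert_iff, Set.mem_singleton_iff, not_or] at hcon
  exact hE.2 (h2 ⟨lt_of_le_of_ne h3.1 (Ne.symm hcon.1), lt_of_le_of_ne h3.2 hcon.2⟩)

end Model

end RandomJacobi

namespace RandomJacobi

/-! ### Decoupling with polynomial errors -/

/-- Bad sites lie in the gaps, which have `L - n m` sites in all, or within `t` of one of the two
ends of a block. -/
theorem card_badSites_le {L m n : ℕ} {x : Fin n → ℕ} {t : ℤ} (ht : 0 ≤ t)
    (hB : ∀ k, block (x k) m ⊆ box L)
    (hd : ∀ k k', k ≠ k' → Disjoint (block (x k) m) (block (x k') m)) :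
    ((badSites (box L) (fun k => block (x k) m) t).card : ℤ) ≤ L - n * m + 2 * n * t := by
  classical
  set U := Finset.univ.biUnion fun k => block (x k) m with hU
  let e : Fin n → Finset ℤ := fun k =>
    Finset.Icc ((x k : ℤ) + 1) (x k + t) ∪ Finset.Icc ((x k : ℤ) + m - t + 1) (x k + m)
  have hsub : badSites (box L) (fun k => block (x k) m) t ⊆ (box L \ U) ∪ Finset.univ.biUnion e := by
    intro z hz
    obtain ⟨hz1, hz2⟩ := mem_badSites.1 hz
    rw [Finset.mem_union, Finset.mem_sdiff]
    by_cases hzU : z ∈ U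
    · right
      obtain ⟨k, -, hk⟩ := Finset.mem_biUnion.1 hzU
      refine Finset.mem_biUnion.2 ⟨k, Finset.mem_univ _, ?_⟩
      by_contra hcon
      refine hz2 ⟨k, fun y hy => ?_⟩
      have hy' := (Finset.mem_filter.1 hy).2
      rw [abs_le] at hy'
      rw [mem_block] at hk ⊢
      simp only [e, Finset.mem_union, Finset.mem_Icc, not_or, not_and_or] at hcon
      omega
    · exact Or.inl ⟨hz1, hzU⟩
  have hUc : U.card = n * m := by
    rw [hU, Finset.card_biUnion fun k _ k' _ hk => hd k k' hk]
    simp [card_block]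
  have hUs : U ⊆ box L := Finset.biUnion_subset.2 fun k _ => hB k
  have h1 : (box L \ U).card = L - n * m := by
    rw [Finset.card_sdiff_of_subset hUs, card_box, hUc]
  have h1' : n * m ≤ L := by
    rw [← hUc, ← card_box L]; exact Finset.card_le_card hUs
  have h2 : ∀ k, (e k).card ≤ 2 * t.toNat := by
    intro k
    refine (Finset.card_union_le _ _).trans ?_
    rw [Int.card_Icc, Int.card_Icc]
    omega
  have h3 : (Finset.univ.biUnion e).card ≤ n * (2 * t.toNat) := by
    refine Finset.card_biUnion_le.trans ((Finset.sum_le_sum fun k _ => h2 k).trans ?_)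
    simp
  have h4 := (Finset.card_le_card hsub).trans (Finset.card_union_le _ _)
  rw [h1] at h4
  have h5 : ((badSites (box L) (fun k => block (x k) m) t).card : ℤ)
      ≤ ((L - n * m : ℕ) : ℤ) + ((n * (2 * t.toNat) : ℕ) : ℤ) := by
    exact_mod_cast h4.trans (Nat.add_le_add_left h3 _)
  refine h5.trans (le_of_eq ?_)
  push_cast [Nat.cast_sub h1']
  rw [Int.toNat_of_nonneg ht]
  ring

/-- The energy resolution at scale `m`. -/
noncomputable def locRes (τ : ℝ) (m : ℕ) : ℝ := Real.exp (-((m : ℝ) ^ τ) ^ (1 / 2 : ℝ) / 4)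

theorem locRes_pos (τ : ℝ) (m : ℕ) : 0 < locRes τ m := Real.exp_pos _

theorem locRes_antitone {τ : ℝ} (hτ : 0 ≤ τ) {m m' : ℕ} (h : m ≤ m') :
    locRes τ m' ≤ locRes τ m := by
  rw [locRes, locRes, Real.exp_le_exp]
  have : ((m : ℝ) ^ τ) ^ (1 / 2 : ℝ) ≤ ((m' : ℝ) ^ τ) ^ (1 / 2 : ℝ) := by gcongr
  linarith

theorem exists_exp_locExponent_le {c τ : ℝ} (hc : 0 < c) (hτ : 0 < τ) (A : ℝ) :
    ∃ C > 0, ∀ m : ℕ, 1 ≤ m →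
      Real.exp (-(c * ((m : ℝ) ^ τ) ^ (1 / 2 : ℝ))) ≤ C * (m : ℝ) ^ (-A) := by
  obtain ⟨C, hC, h⟩ := exists_exp_neg_rpow_le hc (σ := τ * (1 / 2)) (by positivity) A
  refine ⟨C, hC, fun m hm => ?_⟩
  rw [← Real.rpow_mul (by positivity)]
  exact h m (by exact_mod_cast hm)

/-- With `s = (m^τ)^(1/2)`, the tails are `exp(-s/2)` and the resolution is `exp(-s/4)`, so the
squared ratio `exp(-s/2)` still beats every power of `m`, and hence of `L ≤ m^b`. -/
theorem exists_smallErr (K : ℝ) {τ : ℝ} (hτ : 0 < τ) (b : ℝ) :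
    ∃ m₀ : ℕ, 1 ≤ m₀ ∧ ∀ m : ℕ, m₀ ≤ m → ∀ L : ℝ, 1 ≤ L → L ≤ (m : ℝ) ^ b →
      SmallErr K L (locTol τ m * L) (locRes τ m) := by
  obtain ⟨C, hC, hE⟩ := exists_exp_locExponent_le (c := 1 / 2) (by norm_num) hτ (6 * b + 1)
  obtain ⟨N, hN⟩ := exists_nat_gt (C * (1 + K ^ 2))
  refine ⟨max N 1, le_max_right _ _, fun m hm L hL hLm => ?_⟩
  have hm1 : 1 ≤ m := (le_max_right _ _).trans hm
  have hmN : (N : ℝ) ≤ m := by exact_mod_cast (le_max_left _ _).trans hm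
  have hm0 : (0 : ℝ) < m := by exact_mod_cast hm1
  set s := ((m : ℝ) ^ τ) ^ (1 / 2 : ℝ) with hs
  have hs0 : 0 ≤ s := by positivity
  set T := locTol τ m
  set ε := locRes τ m
  have hT2 : T ^ 2 ≤ Real.exp (-(1 / 2 * s)) := by
    have : T = Real.exp (-s / 2) := rfl
    rw [this, ← Real.exp_nat_mul, Real.exp_le_exp]
    push_cast; linarith
  have hTe : T ^ 2 / ε ^ 2 = Real.exp (-(1 / 2 * s)) := by
    have e1 : T = Real.exp (-s / 2) := rfl
    have e2 : ε = Real.exp (-s / 4) := rfl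
    rw [e1, e2, ← Real.exp_nat_mul, ← Real.exp_nat_mul, ← Real.exp_sub]
    congr 1; push_cast; ring
  have hL6 : L ^ 6 ≤ (m : ℝ) ^ (6 * b) := by
    rw [mul_comm, Real.rpow_mul hm0.le]
    exact_mod_cast pow_le_pow_left₀ (by linarith) hLm 6
  unfold SmallErr
  calc L * (L * (T * L) ^ 2 + L * (L * K * (T * L)) ^ 2 / ε ^ 2)
      = L ^ 4 * T ^ 2 + K ^ 2 * L ^ 6 * (T ^ 2 / ε ^ 2) := by ring
    _ ≤ L ^ 6 * Real.exp (-(1 / 2 * s)) + K ^ 2 * L ^ 6 * Real.exp (-(1 / 2 * s)) := by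
        rw [hTe]
        have : L ^ 4 ≤ L ^ 6 := pow_le_pow_right₀ hL (by norm_num)
        gcongr
    _ = (1 + K ^ 2) * (L ^ 6 * Real.exp (-(1 / 2 * s))) := by ring
    _ ≤ (1 + K ^ 2) * ((m : ℝ) ^ (6 * b) * (C * (m : ℝ) ^ (-(6 * b + 1)))) := by
        gcongr
        exact hE m hm1
    _ = C * (1 + K ^ 2) * ((m : ℝ) ^ (6 * b) * (m : ℝ) ^ (-(6 * b + 1))) := by ring
    _ = C * (1 + K ^ 2) / m := by
        rw [← Real.rpow_add hm0, show 6 * b + -(6 * b + 1) = -1 by ring, Real.rpow_neg_one]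
        rfl
    _ < 1 := by
        rw [div_lt_one hm0]
        linarith

theorem locRad_nonneg (τ : ℝ) (m : ℕ) : 0 ≤ locRad τ m := Int.ceil_nonneg (by positivity)

theorem locRad_le {τ : ℝ} (hτ : 0 ≤ τ) {m : ℕ} (hm : 1 ≤ m) :
    (locRad τ m : ℝ) ≤ 2 * (m : ℝ) ^ τ := by
  have h1 : 1 ≤ (m : ℝ) ^ τ := Real.one_le_rpow (by exact_mod_cast hm) hτ
  have h2 := Int.ceil_lt_add_one ((m : ℝ) ^ τ)
  have h3 : (locRad τ m : ℝ) = ⌈(m : ℝ) ^ τ⌉ := rfl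
  linarith

section Model

set_option linter.unusedSectionVars false

variable {Ω : Type*} [MeasurableSpace Ω] {P : Measure Ω} [IsProbabilityMeasure P]
  {a V : ℤ → Ω → ℝ} {K : ℝ} {q : ℕ} {I : Set ℝ} {ρ : ℝ} {κ : Measure ℝ}

/-- The decoupling estimate with resolution `locRes`. Asking for exponent `A + 2b` absorbs `L (n+1)
≤ 2 m^(2b)`; allowing up to `exp(s/8)` intervals uses half of the exponent `s/4` in the resolution,
so the edge terms stay below every power of `m`. -/
theorem LocalizedModel.decoupling_poly (h : LocalizedModel P a V K q I ρ) {E₀ w₀ : ℝ}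
    (hw₀ : 0 < w₀) (hwI : window E₀ w₀ ⊆ I) {CW mW : ℝ} (hCW : 0 < CW) (hmW : 1 ≤ mW)
    (hW : WegnerWith P a V I CW mW) {τ : ℝ} (hτ : 0 < τ) {A b : ℝ} (hA : 0 ≤ A) (hb : 1 ≤ b) :
    ∃ C > 0, ∃ m₀ : ℕ, 1 ≤ m₀ ∧ ∀ (L m n : ℕ) (x : Fin n → ℕ) (w : ℝ), m₀ ≤ m → m ≤ L →
      (L : ℝ) ≤ (m : ℝ) ^ b → 
      (∀ k, block (x k * q) m ⊆ box L) →
      (∀ k k', k ≠ k' → Disjoint (block (x k * q) m) (block (x k' * q) m)) →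
      locRes τ m ≤ w → 2 * w ≤ w₀ → 
      ∀ {ι : Type} [Fintype ι] (J : ι → Set ℝ), (∀ j, (J j).OrdConnected) →
      (∀ j, (J j).Nonempty) → (∀ j, J j ⊆ window E₀ w) → (∀ i j, i ≠ j → Disjoint (J i) (J j)) →
      Fintype.card ι ≤ Real.exp (((m : ℝ) ^ τ) ^ (1 / 2 : ℝ) / 8) →
      ∫ ω, ∑ j, |(levelCount (a · ω) (V · ω) (box L) (J j) : ℝ)
          - ∑ k, (levelCount (a · ω) (V · ω) (block (x k * q) m) (J j) : ℝ)| ∂P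
        ≤ C * ((m : ℝ) ^ (-A) + (L - n * m + n) * (L : ℝ) ^ (τ * (2 + mW)) * w) := by
  obtain ⟨C, hC, hdec⟩ := h.decoupling hw₀ hwI hCW hmW hW hτ (A := A + 2 * b) (by linarith)
  obtain ⟨m₀, hm₀, hsmall⟩ := exists_smallErr K hτ b
  obtain ⟨C', hC', hE⟩ := exists_exp_locExponent_le (c := 1 / 8) (by norm_num) hτ
    (A + b * (1 + mW))
  refine ⟨C * (2 + 4 * 5 ^ (1 + mW) + C'), by positivity, m₀, hm₀,
    fun L m n x w hm hmL hLb hB hd hεw hw ι _ J hJo hJn hJw hJd hcard => ?_⟩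
  have hm1 : 1 ≤ m := hm₀.trans hm
  have hmr : (1 : ℝ) ≤ m := by exact_mod_cast hm1
  have hm0 : (0 : ℝ) < m := by linarith
  have hmLr : (m : ℝ) ≤ L := by exact_mod_cast hmL
  have hL1 : (1 : ℝ) ≤ L := by linarith
  have hL0 : (0 : ℝ) < L := by linarith
  have hε := locRes_pos τ m
  have hw' : 0 < w := by linarith
  refine (hdec L m n x w (locRes τ m) hm1 hmL hB hd hε hεw hw (hsmall m hm L hL1 hLb) J hJo hJn
    hJw hJd).trans ?_
  rw [mul_assoc C]
  refine mul_le_mul_of_nonneg_left ?_ hC.le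
  set t := locRad τ L with ht
  have ht0 : 0 ≤ t := locRad_nonneg _ _
  have ht0' : (0 : ℝ) ≤ t := by exact_mod_cast ht0
  have ht1 : (t : ℝ) ≤ 2 * (L : ℝ) ^ τ := locRad_le hτ.le (hm1.trans hmL)
  have hLτ : 1 ≤ (L : ℝ) ^ τ := Real.one_le_rpow hL1 hτ.le
  have hnm : (n : ℝ) * m ≤ L := by
    have h1 : (Finset.univ.biUnion fun k => block (x k * q) m).card ≤ (box L).card :=
      Finset.card_le_card (Finset.biUnion_subset.2 fun k _ => hB k)
    rw [Finset.card_biUnion fun k _ k' _ hk => hd k k' hk, card_box] at h1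
    simp only [card_block, Finset.sum_const, Finset.card_univ, Fintype.card_fin, smul_eq_mul] at h1
    exact_mod_cast h1
  have hbad : ((badSites (box L) (fun k => block (x k * q) m) t).card : ℝ)
      ≤ 4 * (L - n * m + n) * (L : ℝ) ^ τ := by
    have h1 : ((badSites (box L) (fun k => block (x k * q) m) t).card : ℝ)
        ≤ L - n * m + 2 * n * t := by exact_mod_cast card_badSites_le ht0 hB hd
    have h2 : (n : ℝ) * t ≤ n * (2 * (L : ℝ) ^ τ) := by gcongr
    have h3 : ((L : ℝ) - n * m) * 1 ≤ ((L : ℝ) - n * m) * (L : ℝ) ^ τ :=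
      mul_le_mul_of_nonneg_left hLτ (by linarith)
    have h4 : 0 ≤ ((L : ℝ) - n * m) * (L : ℝ) ^ τ := mul_nonneg (by linarith) (by positivity)
    linarith
  have i1 : (L : ℝ) * (n + 1) * (m : ℝ) ^ (-(A + 2 * b)) ≤ 2 * (m : ℝ) ^ (-A) := by
    have h1 : (n : ℝ) ≤ L := by nlinarith [(Nat.cast_nonneg n : (0 : ℝ) ≤ n)]
    calc _ ≤ (m : ℝ) ^ b * (2 * (m : ℝ) ^ b) * (m : ℝ) ^ (-(A + 2 * b)) := by
          gcongr
          linarith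
      _ = 2 * ((m : ℝ) ^ b * (m : ℝ) ^ b * (m : ℝ) ^ (-(A + 2 * b))) := by ring
      _ = _ := by
          rw [← Real.rpow_add hm0, ← Real.rpow_add hm0]
          congr 2
          ring
  have i2 : ((badSites (box L) (fun k => block (x k * q) m) t).card : ℝ)
      * (2 * (t : ℝ) + 1) ^ (1 + mW) * w
      ≤ 4 * 5 ^ (1 + mW) * ((L - n * m + n) * (L : ℝ) ^ (τ * (2 + mW)) * w) := by
    have h1 : (2 * (t : ℝ) + 1) ^ (1 + mW) ≤ (5 * (L : ℝ) ^ τ) ^ (1 + mW) :=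
      Real.rpow_le_rpow (by linarith) (by linarith) (by linarith)
    have h2 : 0 ≤ (L : ℝ) - n * m + n := by linarith [(Nat.cast_nonneg n : (0 : ℝ) ≤ n)]
    calc _ ≤ 4 * (L - n * m + n) * (L : ℝ) ^ τ * (5 * (L : ℝ) ^ τ) ^ (1 + mW) * w := by gcongr
      _ = 4 * 5 ^ (1 + mW) * ((L - n * m + n) * ((L : ℝ) ^ τ * ((L : ℝ) ^ τ) ^ (1 + mW)) * w) := by
          rw [Real.mul_rpow (by norm_num) (by positivity)]; ring
      _ = _ := by
          rw [← Real.rpow_mul hL0.le, ← Real.rpow_add hL0,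
            show τ + τ * (1 + mW) = τ * (2 + mW) by ring]
  have i3 : Fintype.card ι * locRes τ m * (L : ℝ) ^ (1 + mW) ≤ C' * (m : ℝ) ^ (-A) := by
    set s := ((m : ℝ) ^ τ) ^ (1 / 2 : ℝ) with hs
    have e1 : Fintype.card ι * locRes τ m ≤ Real.exp (-(1 / 8 * s)) := by
      calc _ ≤ Real.exp (s / 8) * Real.exp (-s / 4) := by
            exact mul_le_mul_of_nonneg_right hcard hε.le
        _ = _ := by rw [← Real.exp_add]; congr 1; ring
    have e2 : (L : ℝ) ^ (1 + mW) ≤ (m : ℝ) ^ (b * (1 + mW)) := by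
      rw [Real.rpow_mul hm0.le]
      exact Real.rpow_le_rpow hL0.le hLb (by linarith)
    calc _ ≤ C' * (m : ℝ) ^ (-(A + b * (1 + mW))) * (m : ℝ) ^ (b * (1 + mW)) := by
          exact mul_le_mul (e1.trans (hE m hm1)) e2 (by positivity) (by positivity)
      _ = C' * ((m : ℝ) ^ (-(A + b * (1 + mW))) * (m : ℝ) ^ (b * (1 + mW))) := by ring
      _ = _ := by
          rw [← Real.rpow_add hm0]
          congr 2
          ring
  have p1 : 0 ≤ (m : ℝ) ^ (-A) := by positivity
  have p2 : 0 ≤ (L - n * m + n) * (L : ℝ) ^ (τ * (2 + mW)) * w := by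
    have : 0 ≤ (L : ℝ) - n * m + n := by linarith [(Nat.cast_nonneg n : (0 : ℝ) ≤ n)]
    positivity
  have p3 : 0 ≤ (5 : ℝ) ^ (1 + mW) := by positivity
  have p4 := mul_nonneg p3 p1
  have p5 := mul_nonneg hC'.le p2
  linarith

end Model

end RandomJacobi

namespace RandomJacobi

/-! ### Rate of convergence of mean level counts to the density of states. -/

section Model

set_option linter.unusedSectionVars false

variable {Ω : Type*} [MeasurableSpace Ω] {P : Measure Ω} [IsProbabilityMeasure P]
  {a V : ℤ → Ω → ℝ} {K : ℝ} {q : ℕ} {I : Set ℝ} {ρ : ℝ} {κ : Measure ℝ}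

theorem LocalizedModel.integral_levelCount_block (h : LocalizedModel P a V K q I ρ) (k m : ℕ)
    {J : Set ℝ} (hJ : MeasurableSet J) :
    ∫ ω, (levelCount (a · ω) (V · ω) (block (k * q) m) J : ℝ) ∂P = meanCount P a V m J := by
  rw [meanCount, ← h.integral_shift k (f := fun z => (levelCount (fun n => (z n).1)
    (fun n => (z n).2) (box m) J : ℝ)) (measurable_from_top.comp
      (RandomJacobi.measurable_levelCount measurable_coord_fst measurable_coord_snd _ hJ))]
  exact integral_congr_ae (ae_of_all _ fun ω => congrArg (Nat.cast (R := ℝ))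
    (levelCount_block (a · ω) (V · ω) (k * q) m J).symm)

theorem dos_frontier_eq_zero (hR : RegularIDS κ I) {E₀ w : ℝ} (hwI : window E₀ w ⊆ I) {J : Set ℝ}
    (hJ : J.OrdConnected) (hn : J.Nonempty) (hJw : J ⊆ window E₀ w) : κ (frontier J) = 0 := by
  have hb : Bornology.IsBounded J := (Metric.isBounded_Icc _ _).subset hJw
  obtain ⟨y, hy⟩ := hn
  have h1 := csInf_le hb.bddBelow hy
  have h2 := le_csSup hb.bddAbove hy
  have h3 : E₀ - w ≤ sInf J := le_csInf ⟨y, hy⟩ fun z hz => (hJw hz).1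
  have h4 : sSup J ≤ E₀ + w := csSup_le ⟨y, hy⟩ fun z hz => (hJw hz).2
  have h5 := hJw hy
  refine measure_mono_null (frontier_subset_of_ordConnected hJ hb) ?_
  rw [Set.insert_eq]
  exact measure_union_null
    (dos_singleton_eq_zero hR (hwI ⟨h3, h1.trans h5.2⟩))
    (dos_singleton_eq_zero hR (hwI ⟨h5.1.trans h2, h4⟩))

/-- **Finite volume approximation of the density of states.** -/
theorem LocalizedModel.exists_meanCount_sub_le (h : LocalizedModel P a V K q I ρ)
    (hκ : IsDensityOfStates P a V q κ) (hR : RegularIDS κ I) {E₀ w₀ : ℝ}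
    (hw₀ : 0 < w₀) (hwI : window E₀ w₀ ⊆ I) {CW mW : ℝ} (hCW : 0 < CW) (hmW : 1 ≤ mW)
    (hW : WegnerWith P a V I CW mW) {τ : ℝ} (hτ : 0 < τ) (hτ1 : τ * (2 + mW) < 1) {A : ℝ}
    (hA : 0 ≤ A) :
    ∃ C > 0, ∃ m₀ : ℕ, 1 ≤ m₀ ∧ ∀ (k : ℕ) (w : ℝ), m₀ ≤ k * q → locRes τ (k * q) ≤ w →
      2 * w ≤ w₀ → ∀ {ι : Type} [Fintype ι] (J : ι → Set ℝ), (∀ j, (J j).OrdConnected) →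
      (∀ j, (J j).Nonempty) → (∀ j, J j ⊆ window E₀ w) → (∀ i j, i ≠ j → Disjoint (J i) (J j)) →
      Fintype.card ι ≤ Real.exp ((((k * q : ℕ) : ℝ) ^ τ) ^ (1 / 2 : ℝ) / 8) →
      ∑ j, |meanCount P a V (k * q) (J j) - ((k * q : ℕ) : ℝ) * κ.real (J j)|
        ≤ C * (((k * q : ℕ) : ℝ) ^ (-A) + ((k * q : ℕ) : ℝ) ^ (τ * (2 + mW)) * w) := by
  obtain ⟨C, hC, m₀, hm₀, hdec⟩ := h.decoupling_poly hw₀ hwI hCW hmW hW hτ hA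
    (b := 2) (by norm_num)
  set σ := τ * (2 + mW) with hσ
  have hσ0 : 0 < σ := by positivity
  -- Each doubling multiplies the decoupling error by at most about `2^σ` and the volume by `2`; the
  -- normalized errors form a geometric series because `σ < 1`.
  set r : ℝ := 2 ^ σ / 2 with hr
  have h2σ : (1 : ℝ) ≤ 2 ^ σ := Real.one_le_rpow (by norm_num) hσ0.le
  have h2σ' : (2 : ℝ) ^ σ < 2 := by
    conv_rhs => rw [← Real.rpow_one 2]
    exact Real.rpow_lt_rpow_of_exponent_lt (by norm_num) hτ1
  have hr0 : 0 ≤ r := by positivity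
  have hr1 : r < 1 := by rw [hr]; linarith
  refine ⟨4 * C / (1 - r), div_pos (by positivity) (by linarith), max m₀ 2,
    hm₀.trans (le_max_left _ _), fun k w hm hεw hw ι _ J hJo hJn hJw hJd hcard => ?_⟩
  set m := k * q with hmdef
  have hm2 : 2 ≤ m := (le_max_right _ _).trans hm
  have hm0 : (0 : ℝ) < m := by exact_mod_cast (by omega : 0 < m)
  have hw' : 0 < w := (locRes_pos τ m).trans_le hεw
  set B : ℝ := C * ((m : ℝ) ^ (-A) + 4 * (m : ℝ) ^ σ * w) with hB
  have hB0 : 0 ≤ B := by positivity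
  have hJm : ∀ j, MeasurableSet (J j) := fun j => (hJo j).measurableSet
  -- Mean counts per site along the boxes of length `2^i m`; the telescoped differences bound the
  -- distance of the first one from its limit `κ (J j)`.
  let u : ι → ℕ → ℝ := fun j i => meanCount P a V (2 ^ i * m) (J j) / ((2 ^ i * m : ℕ) : ℝ)
  have hstep : ∀ i, ∑ j, |u j i - u j (i + 1)| ≤ r ^ i * (B / m) := by
    intro i
    set M := 2 ^ i * m with hM
    have hM' : 2 ^ (i + 1) * m = 2 * M := by rw [hM, pow_succ]; ring
    have hmM : m ≤ M := Nat.le_mul_of_pos_left m (by positivity)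
    have hmMr : (m : ℝ) ≤ M := by exact_mod_cast hmM
    have hM2 : 2 ≤ M := hm2.trans hmM
    have hM2r : (2 : ℝ) ≤ M := by exact_mod_cast hM2
    have hM0 : (0 : ℝ) < M := by linarith
    have hMq : M = (2 ^ i * k) * q := by rw [hM, hmdef]; ring
    -- The halves are adjacent, without a gap: only expectations are compared, so independence plays
    -- no role. The exponent `b = 2` suffices because `2M ≤ M²`.
    let x : Fin 2 → ℕ := ![0, 2 ^ i * k]
    have hx0 : x 0 * q = 0 := by simp [x]
    have hx1 : x 1 * q = M := by rw [hMq]; simp [x]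
    have hD := hdec (2 * M) M 2 x w ((le_max_left _ _).trans (hm.trans hmM)) (by omega)
      (by push_cast; rw [Real.rpow_two]; nlinarith) (by
        intro l
        fin_cases l
        · change block (x 0 * q) M ⊆ _
          rw [hx0]; intro z; rw [mem_block, mem_box]; omega
        · change block (x 1 * q) M ⊆ _
          rw [hx1]; intro z; rw [mem_block, mem_box]; omega) (by
        have hdd : Disjoint (block (x 0 * q) M) (block (x 1 * q) M) := by
          rw [hx0, hx1, Finset.disjoint_left]
          intro z; rw [mem_block, mem_block]; omega
        intro l l' hl
        fin_cases l <;> fin_cases l'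
        · exact absurd rfl hl
        · exact hdd
        · exact hdd.symm
        · exact absurd rfl hl) ((locRes_antitone hτ.le hmM).trans hεw) hw J hJo hJn hJw hJd
      (hcard.trans (Real.exp_le_exp.2 (by gcongr)))
    have hF : ∀ j, |meanCount P a V (2 * M) (J j) - 2 * meanCount P a V M (J j)|
        ≤ ∫ ω, |(levelCount (a · ω) (V · ω) (box (2 * M)) (J j) : ℝ)
          - ∑ l, (levelCount (a · ω) (V · ω) (block (x l * q) M) (J j) : ℝ)| ∂P := by
      intro j
      refine le_trans (le_of_eq ?_) abs_integral_le_integral_abs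
      rw [integral_sub (h.integrable_levelCount _ (hJm j))
        (integrable_finsetSum _ fun l _ => h.integrable_levelCount _ (hJm j)),
        integral_finsetSum _ fun l _ => h.integrable_levelCount _ (hJm j)]
      simp only [h.integral_levelCount_block _ _ (hJm j), Finset.sum_const, Finset.card_univ,
        Fintype.card_fin, nsmul_eq_mul]
      rfl
    have hsum : ∑ j, |meanCount P a V (2 * M) (J j) - 2 * meanCount P a V M (J j)|
        ≤ C * ((M : ℝ) ^ (-A) + 2 * (2 * (M : ℝ)) ^ σ * w) := by
      refine (Finset.sum_le_sum fun j _ => hF j).trans ?_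
      have hint : ∀ j, Integrable (fun ω => |(levelCount (a · ω) (V · ω) (box (2 * M)) (J j) : ℝ)
          - ∑ l, (levelCount (a · ω) (V · ω) (block (x l * q) M) (J j) : ℝ)|) P := fun j =>
        ((h.integrable_levelCount _ (hJm j)).sub
          (integrable_finsetSum _ fun l _ => h.integrable_levelCount _ (hJm j))).abs
      rw [← integral_finsetSum _ fun j _ => hint j]
      refine hD.trans (le_of_eq ?_)
      push_cast
      ring
    have hub : C * ((M : ℝ) ^ (-A) + 2 * (2 * (M : ℝ)) ^ σ * w) ≤ (2 ^ σ) ^ i * B := by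
      have e1 : (M : ℝ) ^ (-A) ≤ (2 ^ σ) ^ i * (m : ℝ) ^ (-A) :=
        (Real.rpow_le_rpow_of_nonpos hm0 hmMr (by linarith)).trans
          (le_mul_of_one_le_left (by positivity) (one_le_pow₀ h2σ))
      have e2 : (2 * (M : ℝ)) ^ σ = 2 ^ σ * ((2 ^ σ) ^ i * (m : ℝ) ^ σ) := by
        rw [hM]
        push_cast
        rw [Real.mul_rpow (by norm_num) (by positivity), Real.mul_rpow (by positivity) hm0.le,
          ← Real.rpow_natCast 2 i, ← Real.rpow_natCast (2 ^ σ) i, ← Real.rpow_mul (by norm_num),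
          ← Real.rpow_mul (by norm_num), mul_comm (i : ℝ)]
      have e3 : (2 * (M : ℝ)) ^ σ ≤ 2 * ((2 ^ σ) ^ i * (m : ℝ) ^ σ) := by
        rw [e2]; gcongr
      calc _ ≤ C * ((2 ^ σ) ^ i * (m : ℝ) ^ (-A) + 2 * (2 * ((2 ^ σ) ^ i * (m : ℝ) ^ σ)) * w) := by
            gcongr
        _ = _ := by rw [hB]; ring
    have heq : ∀ j, |u j i - u j (i + 1)|
        = |meanCount P a V (2 * M) (J j) - 2 * meanCount P a V M (J j)| / (2 * M) := by
      intro j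
      simp only [u]
      rw [hM', ← hM, abs_sub_comm, ← abs_of_pos (show (0 : ℝ) < 2 * M by positivity), ← abs_div]
      congr 1
      push_cast
      field_simp
    simp_rw [heq]
    rw [← Finset.sum_div]
    have hMr : (M : ℝ) = 2 ^ i * m := by rw [hM]; push_cast; ring
    calc _ ≤ (2 ^ σ) ^ i * B / (2 * M) := by gcongr; exact hsum.trans hub
      _ ≤ (2 ^ σ) ^ i * B / M := by
          gcongr
          linarith
      _ = r ^ i * (B / m) := by rw [hMr, hr, div_pow]; field_simp
  have htend : ∀ j, Tendsto (u j) atTop (𝓝 (κ.real (J j))) := by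
    intro j
    have h1 := h.tendsto_meanCount hκ (hJm j) (dos_frontier_eq_zero hR
      ((Set.Icc_subset_Icc (by linarith) (by linarith)).trans hwI) (hJo j) (hJn j) (hJw j))
    have hk : 0 < k := Nat.pos_of_ne_zero fun h0 => by simp [hmdef, h0] at hm2
    have h2 : Tendsto (fun i : ℕ => 2 ^ i * k) atTop atTop :=
      (tendsto_pow_atTop_atTop_of_one_lt (by norm_num : 1 < 2)).atTop_mul_const' hk
    refine (h1.comp h2).congr fun i => ?_
    simp only [u, Function.comp, hmdef, mul_assoc]
  have hfin : ∀ N, ∑ j, |u j 0 - u j N| ≤ B / m / (1 - r) := by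
    intro N
    calc _ ≤ ∑ j, ∑ i ∈ Finset.range N, |u j i - u j (i + 1)| :=
          Finset.sum_le_sum fun j _ => dist_le_range_sum_dist (u j) N
      _ = ∑ i ∈ Finset.range N, ∑ j, |u j i - u j (i + 1)| := Finset.sum_comm
      _ ≤ ∑ i ∈ Finset.range N, r ^ i * (B / m) := Finset.sum_le_sum fun i _ => hstep i
      _ = (∑ i ∈ Finset.range N, r ^ i) * (B / m) := (Finset.sum_mul _ _ _).symm
      _ ≤ (1 - r)⁻¹ * (B / m) := by
          refine mul_le_mul_of_nonneg_right ?_ (by positivity)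
          rw [← tsum_geometric_of_lt_one hr0 hr1]
          exact (summable_geometric_of_lt_one hr0 hr1).sum_le_tsum _ fun i _ => by positivity
      _ = _ := by rw [div_eq_mul_inv (B / m), mul_comm]
  have hlim : ∑ j, |u j 0 - κ.real (J j)| ≤ B / m / (1 - r) :=
    le_of_tendsto' (tendsto_finsetSum _ fun j _ => ((htend j).const_sub (u j 0)).abs) hfin
  have heq : ∀ j, |meanCount P a V m (J j) - m * κ.real (J j)| = m * |u j 0 - κ.real (J j)| := by
    intro j
    rw [← abs_of_pos hm0, ← abs_mul, abs_of_pos hm0]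
    congr 1
    simp only [u, pow_zero, one_mul]
    field_simp
  simp_rw [heq]
  rw [← Finset.mul_sum]
  calc _ ≤ m * (B / m / (1 - r)) := by gcongr
    _ = B / (1 - r) := by field_simp
    _ ≤ (4 * C * ((m : ℝ) ^ (-A) + (m : ℝ) ^ σ * w)) / (1 - r) := by
        refine div_le_div_of_nonneg_right ?_ (by linarith)
        have : 0 ≤ C * (m : ℝ) ^ (-A) := by positivity
        rw [hB]
        linarith
    _ = _ := by ring

end Model

end RandomJacobi

namespace RandomJacobi

/-! ### Independence of level counts -/

/-- The level count of a matrix, as a function of its entries. -/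
noncomputable def matrixCount (Λ : Finset ℤ) (J : Set ℝ) (M : Λ × Λ → ℝ) : ℕ :=
  ⌊∑ x, cfc (J.indicator fun _ => (1 : ℝ))
    (Matrix.of fun x y : Λ => (M (x, y) + M (y, x)) / 2) x x⌋₊

/-- Symmetrizing the argument makes the matrix Hermitian for every choice of entries, so the
measurability of the functional calculus applies on the whole space. -/
theorem measurable_matrixCount (Λ : Finset ℤ) {J : Set ℝ} (hJ : MeasurableSet J) :
    Measurable (matrixCount Λ J) := by
  refine Nat.measurable_floor.comp (Finset.measurable_sum _ fun x _ => ?_)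
  refine measurable_cfc_indicator_apply (fun i j => ?_) (fun M => ?_) hJ x x
  · simp only [Matrix.of_apply]
    fun_prop
  · refine Matrix.IsHermitian.ext fun i j => ?_
    simp [add_comm]

theorem matrixCount_boxMatrix (a V : ℤ → ℝ) (Λ : Finset ℤ) (J : Set ℝ) :
    matrixCount Λ J (fun e => boxMatrix a V Λ e.1 e.2) = levelCount a V Λ J := by
  have : (Matrix.of fun x y : Λ => (boxMatrix a V Λ x y + boxMatrix a V Λ y x) / 2)
      = boxMatrix a V Λ := by
    ext x y
    have := (boxMatrix_isHermitian a V Λ).apply x y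
    rw [star_trivial] at this
    rw [Matrix.of_apply, this, add_self_div_two]
  rw [matrixCount]
  simp only [this]
  rw [← levelCount_eq_trace, Nat.floor_natCast]

/-- Level counts in intervals at pairwise distance at least `S` are independent. -/
def IndepCounts {Ω : Type*} [MeasurableSpace Ω] (P : Measure Ω) (a V : ℤ → Ω → ℝ) (S : ℕ) : Prop :=
  ∀ (n : ℕ) (l r : Fin n → ℤ),
    (∀ k k', k ≠ k' → ∀ x ∈ Finset.Icc (l k) (r k), ∀ y ∈ Finset.Icc (l k') (r k'),
      (S : ℤ) ≤ |x - y|) →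
    ∀ {ι : Type} (J : ι → Set ℝ), (∀ j, MeasurableSet (J j)) →
    iIndepFun (fun k ω j => levelCount (a · ω) (V · ω) (Finset.Icc (l k) (r k)) (J j)) P

theorem IndepAtDistance.exists_indepCounts {Ω : Type*} [MeasurableSpace Ω] {P : Measure Ω}
    {a V : ℤ → Ω → ℝ} (h : IndepAtDistance P a V) : ∃ S, IndepCounts P a V S := by
  obtain ⟨S, hS⟩ := h
  refine ⟨S, fun n l r hlr ι J hJ => ?_⟩
  have := (hS n l r hlr).comp (fun k M j => matrixCount (Finset.Icc (l k) (r k)) (J j) M)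
    fun k => measurable_pi_lambda _ fun j => measurable_matrixCount _ (hJ j)
  convert this using 3 with k ω
  funext j
  exact (matrixCount_boxMatrix _ _ _ _).symm

/-- Greedy choice from the left: keep the smallest element and discard the elements closer than `s`
to it, at most `s` in number. -/
theorem exists_spread {s : ℕ} (r : ℕ) : ∀ D : Finset ℤ, r * s ≤ D.card → 0 < s →
    ∃ f : Fin r → ℤ, (∀ i, f i ∈ D) ∧ ∀ i j, i ≠ j → (s : ℤ) ≤ |f i - f j| := by
  induction r with
  | zero => exact fun D _ _ => ⟨Fin.elim0, fun i => i.elim0, fun i => i.elim0⟩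
  | succ r ih =>
    intro D hD hs
    have hne : D.Nonempty := Finset.card_pos.1 (lt_of_lt_of_le (by positivity) hD)
    set x := D.min' hne with hx
    have hxm : ∀ y ∈ D, x ≤ y := fun y hy => D.min'_le y hy
    have hcard : r * s ≤ (D.filter fun y => x + s ≤ y).card := by
      have h1 := Finset.card_filter_add_card_filter_not (s := D) (fun y => x + (s : ℤ) ≤ y)
      have h2 : (D.filter fun y => ¬ x + (s : ℤ) ≤ y).card ≤ s := by
        have : D.filter (fun y => ¬ x + (s : ℤ) ≤ y) ⊆ Finset.Ico x (x + s) := by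
          intro y hy
          obtain ⟨hy1, hy2⟩ := Finset.mem_filter.1 hy
          rw [Finset.mem_Ico]
          exact ⟨hxm y hy1, by omega⟩
        refine (Finset.card_le_card this).trans (by simp)
      have h3 : (r + 1) * s = r * s + s := by ring
      omega
    obtain ⟨f, hf1, hf2⟩ := ih _ hcard hs
    have hf3 : ∀ i, f i ∈ D ∧ x + s ≤ f i := fun i => Finset.mem_filter.1 (hf1 i)
    refine ⟨Fin.cons x f, fun i => ?_, fun i j => ?_⟩
    · refine Fin.cases ?_ (fun i => ?_) i
      · exact D.min'_mem hne
      · exact (hf3 i).1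
    · refine Fin.cases ?_ (fun i => ?_) i <;> refine Fin.cases ?_ (fun j => ?_) j
      · exact fun h => absurd rfl h
      · intro _
        rw [Fin.cons_zero, Fin.cons_succ, abs_sub_comm]
        exact (by linarith [(hf3 j).2] : (s : ℤ) ≤ f j - x).trans (le_abs_self _)
      · intro _
        rw [Fin.cons_zero, Fin.cons_succ]
        exact (by linarith [(hf3 i).2] : (s : ℤ) ≤ f i - x).trans (le_abs_self _)
      · intro h
        rw [Fin.cons_succ, Fin.cons_succ]
        exact hf2 i j fun h' => h (congrArg Fin.succ h')

section Model

set_option linter.unusedSectionVars false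

variable {Ω : Type*} [MeasurableSpace Ω] {P : Measure Ω} [IsProbabilityMeasure P]
  {a V : ℤ → Ω → ℝ} {K : ℝ} {q : ℕ} {I : Set ℝ} {ρ : ℝ} {κ : Measure ℝ}

/-- The probability that `r` sites at mutual distance are all surrounded by levels. -/
theorem IndepCounts.measure_occupied_le {S : ℕ} (hS : IndepCounts P a V S) {CW mW : ℝ} (hCW : 0 < CW) (hmW : 1 ≤ mW)
    (hW : WegnerWith P a V I CW mW) {c d : ℝ} (hcd : c ≤ d) (hI : Set.Icc c d ⊆ I) {m r : ℕ} {t : ℤ}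
    (ht : 0 ≤ t) (f : Fin r → ℤ) (hf : ∀ i, f i ∈ box m)
    (hs : ∀ i j, i ≠ j → 2 * t + S ≤ |f i - f j|) :
    P.real (⋂ i, {ω | 1 ≤ levelCount (a · ω) (V · ω) ((box m).filter fun y => |y - f i| ≤ t)
      (Set.Icc c d)}) ≤ (CW * (d - c) * (2 * t + 1) ^ mW) ^ r := by
  have h1 : ∀ i, ∃ l r : ℕ, (box m).filter (fun y => |y - f i| ≤ t) = Finset.Icc (l : ℤ) r ∧
      ((Finset.Icc (l : ℤ) r).card : ℝ) ≤ 2 * t + 1 := fun i => by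
    have := filter_block_eq (x := 0) (m := m) ht (by rw [block_zero]; exact hf i)
    rwa [block_zero] at this
  choose l u hlu hcard using h1
  have ht' : (0 : ℝ) ≤ t := by exact_mod_cast ht
  -- Balls of radius `t` around points at distance at least `2t + S` are still at distance at least
  -- `S`.
  have hind := hS r (fun i => l i) (fun i => u i) (fun k k' hk x hx y hy => by
    rw [← hlu] at hx hy
    have e1 := (Finset.mem_filter.1 hx).2
    have e2 := (Finset.mem_filter.1 hy).2
    have e3 := hs k k' hk
    rw [abs_le] at e1 e2
    rcases abs_cases (f k - f k') with e | e <;> rcases abs_cases (x - y) with e' | e' <;> omega)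
    (ι := Unit) (fun _ => Set.Icc c d) (fun _ => measurableSet_Icc)
  have h2 := hind.measure_inter_preimage_eq_mul Finset.univ (sets := fun _ => {z | 1 ≤ z ()})
    (fun i _ => measurableSet_le measurable_const (measurable_pi_apply _))
  have h3 : (⋂ i, {ω | 1 ≤ levelCount (a · ω) (V · ω) ((box m).filter fun y => |y - f i| ≤ t)
      (Set.Icc c d)}) = ⋂ i ∈ (Finset.univ : Finset (Fin r)), (fun ω (_ : Unit) =>
        levelCount (a · ω) (V · ω) (Finset.Icc (l i : ℤ) (u i)) (Set.Icc c d)) ⁻¹' {z | 1 ≤ z ()} := by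
    ext ω
    simp [hlu]
  rw [h3, measureReal_def, h2, ENNReal.toReal_prod]
  calc _ ≤ ∏ i : Fin r, CW * (d - c) * (2 * t + 1) ^ mW := by
        refine Finset.prod_le_prod (fun i _ => ENNReal.toReal_nonneg) fun i _ => ?_
        refine (hW (l i) (u i) c d hcd hI).trans ?_
        have := hcard i
        have hdc : 0 ≤ d - c := by linarith
        gcongr
    _ = _ := by simp

set_option maxHeartbeats 1000000 in
/-- **Multiple levels.** The mean number of levels of a box in a small window, on the event that
there are at least two. -/
theorem LocalizedModel.exists_integral_multiple_le (h : LocalizedModel P a V K q I ρ) {S : ℕ}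
    (hS : IndepCounts P a V S) {E₀ w₀ : ℝ}
    (hw₀ : 0 < w₀) (hwI : window E₀ w₀ ⊆ I) {CW mW : ℝ} (hCW : 0 < CW) (hmW : 1 ≤ mW)
    (hW : WegnerWith P a V I CW mW) {τ : ℝ} (hτ : 0 < τ) (A : ℝ) (r : ℕ) :
    ∃ C > 0, ∃ m₀ : ℕ, 1 ≤ m₀ ∧ ∀ (m : ℕ) (w : ℝ), m₀ ≤ m → locRes τ m ≤ w → 2 * w ≤ w₀ →
      ∫ ω, {ω | 2 ≤ levelCount (a · ω) (V · ω) (box m) (window E₀ w)}.indicator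
          (fun ω => (levelCount (a · ω) (V · ω) (box m) (window E₀ w) : ℝ)) ω ∂P
        ≤ C * ((m : ℝ) ^ (2 * τ) * (w * m) ^ (1 + ρ) + m * ((m : ℝ) ^ (1 + τ * mW) * w) ^ r
          + (m : ℝ) ^ (-A)) := by
  obtain ⟨CB, hCB, hbad⟩ := h.exists_bad_event hw₀ hwI hτ (A + 1)
  obtain ⟨CM, hCM, hM⟩ := h.minami
  obtain ⟨m₀, hm₀, hsmall⟩ := exists_smallErr K hτ 1
  refine ⟨r * (5 + S) * 5 * (CM * 2 ^ (1 + ρ)) + (4 * CW * 5 ^ mW) ^ r + CB, by positivity, m₀, hm₀,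
    fun m w hm hεw hw => ?_⟩
  have hρ := h.rho_pos
  have hm1 : 1 ≤ m := hm₀.trans hm
  have hmr : (1 : ℝ) ≤ m := by exact_mod_cast hm1
  have hm0 : (0 : ℝ) < m := by linarith
  have hε := locRes_pos τ m
  have hw' : 0 < w := by linarith
  have hsm := hsmall m hm m hmr (by rw [Real.rpow_one])
  obtain ⟨B, hBm, hBp, hBc⟩ := hbad m hm1
  set t := locRad τ m with ht
  have ht0 : 0 ≤ t := locRad_nonneg _ _
  have ht0' : (0 : ℝ) ≤ t := by exact_mod_cast ht0
  have hmτ : 1 ≤ (m : ℝ) ^ τ := Real.one_le_rpow hmr hτ.le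
  have ht1 : 2 * (t : ℝ) + 1 ≤ 5 * (m : ℝ) ^ τ := by
    have : (t : ℝ) ≤ 2 * (m : ℝ) ^ τ := locRad_le hτ.le hm1
    linarith
  set W := window E₀ w with hWdef
  set W₂ := window E₀ (2 * w) with hW2
  have hW₂I : W₂ ⊆ I := (Set.Icc_subset_Icc (by linarith) (by linarith)).trans hwI
  have hWI : W ⊆ I := (Set.Icc_subset_Icc (by linarith) (by linarith)).trans hwI
  let Y : Ω → ℕ := fun ω => levelCount (a · ω) (V · ω) (box m) W
  have hYm : Measurable Y := h.measurable_levelCount _ measurableSet_Icc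
  set T : ℕ := t.toNat with hT
  have hTt : (T : ℤ) = t := Int.toNat_of_nonneg ht0
  -- At most `2T + 1` levels share a centre, the size of a ball of radius `t`. So more than `R = r s
  -- (2T + 1)` levels have at least `r s` distinct centres, and `r` of these are mutually
  -- `s`-separated, enough for independent neighbourhoods.
  set s : ℕ := 2 * T + S + 1 with hs
  set R : ℕ := r * s * (2 * T + 1) with hR
  let F : Finset (Fin r → ℤ) := (Fintype.piFinset fun _ => box m).filter fun f =>
    ∀ i j, i ≠ j → 2 * t + S ≤ |f i - f j|
  let Ev : (Fin r → ℤ) → Set Ω := fun f => ⋂ i, {ω | 1 ≤ levelCount (a · ω) (V · ω)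
    ((box m).filter fun y => |y - f i| ≤ t) W₂}
  let Bd : Set Ω := {ω | (fun n : ℤ => (a (n + (0 * q : ℕ)) ω, V (n + (0 * q : ℕ)) ω)) ∈ B}
  have hBdm : MeasurableSet Bd := h.measurable_coeff _ hBm
  have hEvm : ∀ f, MeasurableSet (Ev f) := fun f => MeasurableSet.iInter fun i =>
    measurableSet_le measurable_const (h.measurable_levelCount _ measurableSet_Icc)
  have hYle : ∀ ω, Y ω ≤ m := fun ω => by
    have := levelCount_le_card (a · ω) (V · ω) (box m) W
    rwa [card_box] at this
  have hmain : ∀ᵐ ω ∂P, ω ∉ Bd → R < Y ω → ∃ f ∈ F, ω ∈ Ev f := by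
    filter_upwards [h.ae_bound] with ω hω hωB hRY
    have hc : HasCenters (a · ω) (V · ω) (box m) (window E₀ w₀) t (locTol τ m * m) := by
      have := hBc (a · ω) (V · ω) (0 * q) hωB
      rwa [zero_mul, block_zero] at this
    classical
    have hc' : ∀ i : box m, ∃ x : ℤ, levels (a · ω) (V · ω) (box m) i ∈ W → x ∈ box m ∧
        ∀ y ∈ box m, t ≤ |y - x| → |boxEig (a · ω) (V · ω) (box m) i y| ≤ locTol τ m * m := by
      intro i
      by_cases hi : levels (a · ω) (V · ω) (box m) i ∈ W
      · obtain ⟨x, hx⟩ := hc i (Set.Icc_subset_Icc (by linarith) (by linarith) hi)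
        exact ⟨x, fun _ => hx⟩
      · exact ⟨0, fun h => absurd h hi⟩
    choose c hcc using hc'
    set σ : Finset (box m) := Finset.univ.filter fun i => levels (a · ω) (V · ω) (box m) i ∈ W
    have hσ : ∀ i ∈ σ, levels (a · ω) (V · ω) (box m) i ∈ W := fun i hi =>
      (Finset.mem_filter.1 hi).2
    have hσY : σ.card = Y ω := by
      simp only [σ, Y, levelCount]
      congr
    have key := fun (D : Finset ℤ) (σ' : Finset (box m)) =>
      card_centers_le hω hε (by rw [card_box]) hsm (W := W) c (fun i hi => (hcc i hi).2) D σ'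
    set D := σ.image c with hD
    have hDcard : r * s ≤ D.card := by
      by_contra! hlt
      have h1 := key D σ fun i hi => ⟨hσ i hi, Finset.mem_image_of_mem c hi⟩
      have h2 : ∀ x ∈ D, levelCount (a · ω) (V · ω) ((box m).filter fun y => |y - x| ≤ t)
          (nearSet (locRes τ m) W) ≤ 2 * T + 1 := by
        intro x _
        refine (levelCount_le_card _ _ _ _).trans ?_
        have : (box m).filter (fun y => |y - x| ≤ t) ⊆ Finset.Icc (x - t) (x + t) := by
          intro y hy
          have := (Finset.mem_filter.1 hy).2
          rw [abs_le] at this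
          rw [Finset.mem_Icc]
          omega
        refine (Finset.card_le_card this).trans ?_
        rw [Int.card_Icc]
        omega
      have h3 := h1.trans (Finset.sum_le_card_nsmul _ _ _ h2)
      rw [hσY, smul_eq_mul] at h3
      have h4 : D.card * (2 * T + 1) ≤ R := Nat.mul_le_mul_right _ hlt.le
      omega
    obtain ⟨f, hf1, hf2⟩ := exists_spread r D hDcard (by omega)
    refine ⟨f, Finset.mem_filter.2 ⟨Fintype.mem_piFinset.2 fun i => ?_, fun i j hij => ?_⟩,
      Set.mem_iInter.2 fun i => ?_⟩
    · obtain ⟨e, he, hei⟩ := Finset.mem_image.1 (hf1 i)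
      rw [← hei]
      exact (hcc e (hσ e he)).1
    · have := hf2 i j hij
      rw [hs] at this
      push_cast at this
      omega
    · obtain ⟨e, he, hei⟩ := Finset.mem_image.1 (hf1 i)
      -- Even a single eigenfunction centred at `f i` forces a level of the small box around `f i`
      -- in the doubled window.
      have h1 := key {f i} {e} fun i' hi' => by
        rw [Finset.mem_singleton.1 hi']
        exact ⟨hσ e he, by simp [hei]⟩
      rw [Finset.card_singleton, Finset.sum_singleton] at h1
      exact h1.trans (levelCount_mono _ _ _ (nearSet_window_subset hεw))
  -- If there are two or more levels, either their number is at most `R`, or localization fails, or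
  -- some `r`-tuple of separated sites is occupied; the count is at most `m` in the last two cases.
  have hpt : ∀ᵐ ω ∂P, {ω | 2 ≤ Y ω}.indicator (fun ω => (Y ω : ℝ)) ω
      ≤ (R : ℝ) * {ω | 2 ≤ Y ω}.indicator 1 ω
        + m * (Bd.indicator 1 ω + ∑ f ∈ F, (Ev f).indicator 1 ω) := by
    filter_upwards [hmain] with ω hω
    have p0 : ∀ A : Set Ω, 0 ≤ A.indicator (1 : Ω → ℝ) ω := fun A =>
      Set.indicator_nonneg (fun _ _ => zero_le_one) _
    have p1 : 0 ≤ ∑ f ∈ F, (Ev f).indicator (1 : Ω → ℝ) ω := Finset.sum_nonneg fun f _ => p0 _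
    have hYr : (Y ω : ℝ) ≤ m := by exact_mod_cast hYle ω
    by_cases h2 : ω ∈ {ω | 2 ≤ Y ω}
    · rw [Set.indicator_of_mem h2, Set.indicator_of_mem h2, Pi.one_apply, mul_one]
      by_cases hB : ω ∈ Bd
      · rw [Set.indicator_of_mem hB, Pi.one_apply]
        nlinarith [(Nat.cast_nonneg R : (0 : ℝ) ≤ R)]
      by_cases hY : R < Y ω
      · obtain ⟨f, hf, hωf⟩ := hω hB hY
        have : 1 ≤ ∑ f ∈ F, (Ev f).indicator (1 : Ω → ℝ) ω := by
          refine le_trans (le_of_eq ?_) (Finset.single_le_sum (fun f _ => p0 (Ev f)) hf)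
          rw [Set.indicator_of_mem hωf, Pi.one_apply]
        nlinarith [(Nat.cast_nonneg R : (0 : ℝ) ≤ R), p0 Bd]
      · have : (Y ω : ℝ) ≤ R := by exact_mod_cast not_lt.1 hY
        nlinarith [p0 Bd]
    · rw [Set.indicator_of_notMem h2, Set.indicator_of_notMem h2, mul_zero, zero_add]
      exact mul_nonneg hm0.le (add_nonneg (p0 _) p1)
  have h2m : MeasurableSet {ω | 2 ≤ Y ω} := measurableSet_le measurable_const hYm
  have i1 : Integrable (fun ω => (R : ℝ) * {ω | 2 ≤ Y ω}.indicator 1 ω) P :=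
    ((integrable_const (1 : ℝ)).indicator h2m).const_mul _
  have i2 : Integrable (fun ω => Bd.indicator (1 : Ω → ℝ) ω) P :=
    (integrable_const (1 : ℝ)).indicator hBdm
  have i3f : ∀ f, Integrable (fun ω => (Ev f).indicator (1 : Ω → ℝ) ω) P := fun f =>
    (integrable_const (1 : ℝ)).indicator (hEvm f)
  have i3 : Integrable (fun ω => ∑ f ∈ F, (Ev f).indicator (1 : Ω → ℝ) ω) P :=
    integrable_finsetSum _ fun f _ => i3f f
  have i23 : Integrable (fun ω => Bd.indicator (1 : Ω → ℝ) ω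
      + ∑ f ∈ F, (Ev f).indicator (1 : Ω → ℝ) ω) P := i2.add i3
  have i4 : Integrable (fun ω => (m : ℝ) * (Bd.indicator (1 : Ω → ℝ) ω
      + ∑ f ∈ F, (Ev f).indicator (1 : Ω → ℝ) ω)) P := i23.const_mul _
  have hint : ∫ ω, {ω | 2 ≤ Y ω}.indicator (fun ω => (Y ω : ℝ)) ω ∂P
      ≤ R * P.real {ω | 2 ≤ Y ω} + m * (P.real Bd + ∑ f ∈ F, P.real (Ev f)) := by
    refine (integral_mono_of_nonneg (ae_of_all _ fun ω =>
      Set.indicator_nonneg (fun _ _ => by positivity) _) (i1.add i4) hpt).trans (le_of_eq ?_)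
    have e1 : ∫ ω, ((R : ℝ) * {ω | 2 ≤ Y ω}.indicator 1 ω + m * (Bd.indicator 1 ω
        + ∑ f ∈ F, (Ev f).indicator 1 ω)) ∂P
      = ∫ ω, (R : ℝ) * {ω | 2 ≤ Y ω}.indicator 1 ω ∂P + ∫ ω, (m : ℝ) * (Bd.indicator 1 ω
        + ∑ f ∈ F, (Ev f).indicator 1 ω) ∂P := integral_add i1 i4
    refine Eq.trans e1 ?_
    rw [integral_const_mul, integral_const_mul, integral_add i2 i3,
      integral_finsetSum _ fun f _ => i3f f, integral_indicator_one h2m, integral_indicator_one hBdm]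
    simp_rw [integral_indicator_one (hEvm _)]
  have b1 : P.real {ω | 2 ≤ Y ω} ≤ CM * 2 ^ (1 + ρ) * (w * m) ^ (1 + ρ) := by
    have := hM 1 m (E₀ - w) (E₀ + w) (by linarith) hWI
    have hb : Finset.Icc (((1 : ℕ)) : ℤ) m = box m := by simp [box]
    rw [hb, card_box, show (E₀ + w - (E₀ - w)) * (m : ℝ) = 2 * (w * m) by ring,
      Real.mul_rpow (by norm_num) (by positivity), ← mul_assoc] at this
    exact this
  have b2 : P.real Bd ≤ CB * (m : ℝ) ^ (-(A + 1)) := hBp 0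
  have b3 : ∀ f ∈ F, P.real (Ev f) ≤ (CW * (4 * w) * (5 * (m : ℝ) ^ τ) ^ mW) ^ r := by
    intro f hf
    obtain ⟨hf1, hf2⟩ := Finset.mem_filter.1 hf
    have := hS.measure_occupied_le hCW hmW hW (c := E₀ - 2 * w) (d := E₀ + 2 * w) (by linarith)
      hW₂I ht0 f (fun i => Fintype.mem_piFinset.1 hf1 i) hf2
    refine this.trans ?_
    rw [show E₀ + 2 * w - (E₀ - 2 * w) = 4 * w by ring]
    gcongr
  have hFc : (F.card : ℝ) ≤ (m : ℝ) ^ r := by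
    have : F.card ≤ m ^ r := by
      refine (Finset.card_filter_le _ _).trans ?_
      rw [Fintype.card_piFinset]
      simp [card_box]
    exact_mod_cast this
  have b4 : ∑ f ∈ F, P.real (Ev f) ≤ (4 * CW * 5 ^ mW) ^ r * ((m : ℝ) ^ (1 + τ * mW) * w) ^ r := by
    refine (Finset.sum_le_sum b3).trans ?_
    rw [Finset.sum_const, nsmul_eq_mul]
    calc _ ≤ (m : ℝ) ^ r * (CW * (4 * w) * (5 * (m : ℝ) ^ τ) ^ mW) ^ r := by gcongr
      _ = _ := by
        rw [← mul_pow, ← mul_pow, Real.mul_rpow (by norm_num) (by positivity),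
          ← Real.rpow_mul hm0.le, Real.rpow_add hm0, Real.rpow_one]
        congr 1
        ring
  have b5 : (R : ℝ) ≤ r * (5 + S) * 5 * (m : ℝ) ^ (2 * τ) := by
    have hTr : (T : ℝ) = t := by exact_mod_cast hTt
    rw [hR, hs]
    push_cast
    rw [hTr, mul_comm 2 τ, Real.rpow_mul hm0.le, Real.rpow_two]
    have e1 : 2 * (t : ℝ) + S + 1 ≤ (5 + S) * (m : ℝ) ^ τ := by
      nlinarith [(Nat.cast_nonneg S : (0 : ℝ) ≤ S)]
    calc _ ≤ r * ((5 + S) * (m : ℝ) ^ τ) * (5 * (m : ℝ) ^ τ) := by gcongr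
      _ = _ := by ring
  have b6 : (m : ℝ) * (m : ℝ) ^ (-(A + 1)) = (m : ℝ) ^ (-A) := by
    conv_lhs => rw [← Real.rpow_one (m : ℝ), ← Real.rpow_mul hm0.le, one_mul, ← Real.rpow_add hm0]
    ring_nf
  refine hint.trans ?_
  calc _ ≤ r * (5 + S) * 5 * (m : ℝ) ^ (2 * τ) * (CM * 2 ^ (1 + ρ) * (w * m) ^ (1 + ρ))
        + m * (CB * (m : ℝ) ^ (-(A + 1))
          + (4 * CW * 5 ^ mW) ^ r * ((m : ℝ) ^ (1 + τ * mW) * w) ^ r) := by gcongr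
    _ = r * (5 + S) * 5 * (CM * 2 ^ (1 + ρ)) * ((m : ℝ) ^ (2 * τ) * (w * m) ^ (1 + ρ))
        + (4 * CW * 5 ^ mW) ^ r * (m * ((m : ℝ) ^ (1 + τ * mW) * w) ^ r)
        + CB * (m : ℝ) ^ (-A) := by rw [← b6]; ring
    _ ≤ _ := by
        have c1 : 0 ≤ r * (5 + S) * 5 * (CM * 2 ^ (1 + ρ)) := by positivity
        have c2 : 0 ≤ (4 * CW * 5 ^ mW) ^ r := by positivity
        have d1 : 0 ≤ (m : ℝ) ^ (2 * τ) * (w * m) ^ (1 + ρ) := by positivity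
        have d2 : 0 ≤ m * ((m : ℝ) ^ (1 + τ * mW) * w) ^ r := by positivity
        have d3 : 0 ≤ (m : ℝ) ^ (-A) := by positivity
        generalize r * (5 + S) * 5 * (CM * 2 ^ (1 + ρ)) = u1 at *
        generalize (4 * CW * 5 ^ mW) ^ r = u2 at *
        generalize (m : ℝ) ^ (2 * τ) * (w * m) ^ (1 + ρ) = v1 at *
        generalize m * ((m : ℝ) ^ (1 + τ * mW) * w) ^ r = v2 at *
        generalize (m : ℝ) ^ (-A) = v3 at *
        nlinarith [mul_nonneg c1 d2, mul_nonneg c1 d3, mul_nonneg c2 d1, mul_nonneg c2 d3,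
          mul_nonneg hCB.le d1, mul_nonneg hCB.le d2]

end Model

end RandomJacobi

namespace RandomJacobi

/-! ### Law of the counts in a block and the probability that it is occupied. -/

section Model

set_option linter.unusedSectionVars false

variable {Ω : Type*} [MeasurableSpace Ω] {P : Measure Ω} [IsProbabilityMeasure P]
  {a V : ℤ → Ω → ℝ} {K : ℝ} {q : ℕ} {I : Set ℝ} {ρ : ℝ} {κ : Measure ℝ}

theorem LocalizedModel.measurable_counts (h : LocalizedModel P a V K q I ρ) (Λ : Finset ℤ)
    {ι : Type*} {J : ι → Set ℝ} (hJ : ∀ j, MeasurableSet (J j)) :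
    Measurable fun ω j => levelCount (a · ω) (V · ω) Λ (J j) :=
  measurable_pi_lambda _ fun j => h.measurable_levelCount Λ (hJ j)

theorem LocalizedModel.map_counts_block (h : LocalizedModel P a V K q I ρ) (k m : ℕ) {ι : Type*}
    {J : ι → Set ℝ} (hJ : ∀ j, MeasurableSet (J j)) :
    P.map (fun ω j => levelCount (a · ω) (V · ω) (block (k * q) m) (J j))
      = P.map fun ω j => levelCount (a · ω) (V · ω) (box m) (J j) := by
  have hm : Measurable fun (z : ℤ → ℝ × ℝ) j =>
      levelCount (fun n => (z n).1) (fun n => (z n).2) (box m) (J j) :=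
    measurable_pi_lambda _ fun j => RandomJacobi.measurable_levelCount measurable_coord_fst
      measurable_coord_snd _ (hJ j)
  have h0 : Measurable fun ω (n : ℤ) => (a n ω, V n ω) := by
    simpa using h.measurable_coeff 0
  have := congrArg (Measure.map fun (z : ℤ → ℝ × ℝ) j =>
      levelCount (fun n => (z n).1) (fun n => (z n).2) (box m) (J j)) (h.map_shift k)
  rw [Measure.map_map hm (h.measurable_coeff _), Measure.map_map hm h0] at this
  refine Eq.trans ?_ this
  congr 1
  funext ω j
  exact (levelCount_block (a · ω) (V · ω) (k * q) m (J j)).symm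

theorem LocalizedModel.measure_one_le_block (h : LocalizedModel P a V K q I ρ) (k m : ℕ)
    {J : Set ℝ} (hJ : MeasurableSet J) :
    P.real {ω | 1 ≤ levelCount (a · ω) (V · ω) (block (k * q) m) J}
      = P.real {ω | 1 ≤ levelCount (a · ω) (V · ω) (box m) J} := by
  refine Eq.trans ?_ (h.measure_shift k (S := {z | 1 ≤ levelCount (fun n => (z n).1) (fun n => (z n).2)
    (box m) J}) (measurableSet_le measurable_const (RandomJacobi.measurable_levelCount
      measurable_coord_fst measurable_coord_snd _ hJ)))
  congr 1
  ext ω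
  exact iff_of_eq (congrArg (1 ≤ ·) (levelCount_block (a · ω) (V · ω) (k * q) m J).symm)

set_option maxHeartbeats 1000000 in
/-- The probability that a small window is occupied is controlled by the Minami estimate on a box
of twice the length. -/
theorem LocalizedModel.exists_occupied_sq_le (h : LocalizedModel P a V K q I ρ) {S : ℕ}
    (hS : IndepCounts P a V S) {E₀ w₀ : ℝ}
    (hw₀ : 0 < w₀) (hwI : window E₀ w₀ ⊆ I) {CW mW : ℝ} (hCW : 0 < CW) (hmW : 1 ≤ mW)
    (hW : WegnerWith P a V I CW mW) {τ : ℝ} (hτ : 0 < τ) {A : ℝ} (hA : 0 ≤ A) :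
    ∃ C > 0, ∃ m₀ : ℕ, 1 ≤ m₀ ∧ ∀ (k : ℕ) (w : ℝ), m₀ ≤ k * q → locRes τ (k * q) ≤ w →
      2 * w ≤ w₀ →
      P.real {ω | 1 ≤ levelCount (a · ω) (V · ω) (box (k * q)) (window E₀ w)} ^ 2
        ≤ C * (((k * q : ℕ) : ℝ) ^ (-A) + ((k * q : ℕ) : ℝ) ^ (τ * (2 + mW)) * w
          + (w * ((k * q : ℕ) : ℝ)) ^ (1 + ρ)) := by
  obtain ⟨CD, hCD, m₀, hm₀, hdec⟩ := h.decoupling_poly hw₀ hwI hCW hmW hW hτ hA (b := 2)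
    (by norm_num)
  obtain ⟨CM, hCM, hM⟩ := h.minami
  have hρ := h.rho_pos
  set σ := τ * (2 + mW) with hσ
  have hσ0 : 0 < σ := by positivity
  refine ⟨CD * (1 + (S * q + 2) ^ (1 + σ)) + CM * (2 * (S * q + 2)) ^ (1 + ρ), by positivity,
    max m₀ (S * q + 2), hm₀.trans (le_max_left _ _), fun k w hm hεw hw => ?_⟩
  set m := k * q with hmdef
  have hmm : S * q + 2 ≤ m := (le_max_right _ _).trans hm
  have hm1 : 1 ≤ m := by omega
  have hmr : (1 : ℝ) ≤ m := by exact_mod_cast hm1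
  have hm0 : (0 : ℝ) < m := by linarith
  have hw' : 0 < w := (locRes_pos τ m).trans_le hεw
  have hmmr : (S : ℝ) * q + 2 ≤ m := by exact_mod_cast hmm
  -- Room for two blocks of length `m` and a gap `S * q`: long enough for independence, and a
  -- multiple of `q`, so that the second block has the law of the first.
  set L := 2 * m + S * q with hL
  have hLr : (L : ℝ) = 2 * m + S * q := by rw [hL]; push_cast; ring
  have hSq0 : (0 : ℝ) ≤ S * q := by positivity
  have hLm : (L : ℝ) ≤ (S * q + 2) * m := by rw [hLr]; nlinarith
  have hWI : window E₀ w ⊆ I := (Set.Icc_subset_Icc (by linarith) (by linarith)).trans hwI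
  let x : Fin 2 → ℕ := ![0, k + S]
  have hx0 : x 0 * q = 0 := by simp [x]
  have hx1 : x 1 * q = m + S * q := by simp [x, hmdef, add_mul]
  have hSS : S ≤ S * q := Nat.le_mul_of_pos_right S h.q_pos
  let W : Unit → Set ℝ := fun _ => window E₀ w
  let X : Ω → ℕ := fun ω => levelCount (a · ω) (V · ω) (box L) (window E₀ w)
  let Y : Fin 2 → Ω → ℕ := fun l ω => levelCount (a · ω) (V · ω) (block (x l * q) m) (window E₀ w)
  have hXm : Measurable X := h.measurable_levelCount _ measurableSet_Icc
  have hYm : ∀ l, Measurable (Y l) := fun l => h.measurable_levelCount _ measurableSet_Icc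
  have hD := hdec L m 2 x w ((le_max_left _ _).trans hm) (by omega)
    (by rw [Real.rpow_two]; nlinarith) (by
      intro l
      fin_cases l
      · change block (x 0 * q) m ⊆ _
        rw [hx0]; intro z; rw [mem_block, mem_box]; omega
      · change block (x 1 * q) m ⊆ _
        rw [hx1]; intro z; rw [mem_block, mem_box]; push_cast [hL]; omega) (by
      have hdd : Disjoint (block (x 0 * q) m) (block (x 1 * q) m) := by
        rw [hx0, hx1, Finset.disjoint_left]
        intro z; rw [mem_block, mem_block]; push_cast; omega
      intro l l' hl
      fin_cases l <;> fin_cases l'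
      · exact absurd rfl hl
      · exact hdd
      · exact hdd.symm
      · exact absurd rfl hl) hεw hw W (fun _ => Set.ordConnected_Icc)
    (fun _ => ⟨E₀, by constructor <;> linarith⟩) (fun _ => le_rfl)
    (fun i j hij => absurd (Subsingleton.elim i j) hij)
    (by rw [Fintype.card_unit, Nat.cast_one, ← Real.exp_zero, Real.exp_le_exp]; positivity)
  simp only [Finset.univ_unique, Finset.sum_singleton, W] at hD
  -- independence of the two halves
  have hind := hS 2 (fun l => ((x l * q : ℕ) : ℤ) + 1) (fun l => ((x l * q : ℕ) : ℤ) + m) (by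
    have hsep : ∀ y ∈ block (x 0 * q) m, ∀ z ∈ block (x 1 * q) m, (S : ℤ) ≤ z - y := by
      intro y hy z hz
      rw [hx0, mem_block] at hy
      rw [hx1, mem_block] at hz
      have : (S : ℤ) ≤ S * q := by exact_mod_cast hSS
      push_cast at hy hz
      omega
    intro l l' hl y hy z hz
    fin_cases l <;> fin_cases l'
    · exact absurd rfl hl
    · rw [abs_sub_comm]; exact (hsep y hy z hz).trans (le_abs_self _)
    · exact (hsep z hz y hy).trans (le_abs_self _)
    · exact absurd rfl hl) W (fun _ => measurableSet_Icc)
  have h2 := hind.measure_inter_preimage_eq_mul Finset.univ (sets := fun _ => {z | 1 ≤ z ()})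
    (fun i _ => measurableSet_le measurable_const (measurable_pi_apply _))
  have hboth : P.real {ω | ∀ l, 1 ≤ Y l ω}
      = P.real {ω | 1 ≤ levelCount (a · ω) (V · ω) (box m) (window E₀ w)} ^ 2 := by
    have h3 : {ω | ∀ l, 1 ≤ Y l ω} = ⋂ l ∈ (Finset.univ : Finset (Fin 2)), (fun ω (j : Unit) =>
        levelCount (a · ω) (V · ω) (Finset.Icc (((x l * q : ℕ) : ℤ) + 1) (((x l * q : ℕ) : ℤ) + m))
          (W j)) ⁻¹' {z | 1 ≤ z ()} := by
      ext ω
      simp [Y, W, block]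
    rw [h3, measureReal_def, h2, ENNReal.toReal_prod, ← Fin.prod_const]
    refine Finset.prod_congr rfl fun l _ => ?_
    exact h.measure_one_le_block (x l) m measurableSet_Icc
  -- If both blocks are occupied and the large box has at most one level, the decoupling discrepancy
  -- is at least `1`; Markov's inequality bounds that event.
  have hsub : {ω | ∀ l, 1 ≤ Y l ω} ⊆ {ω | 2 ≤ X ω} ∪ {ω | 1 ≤ |(X ω : ℝ) - ∑ l, (Y l ω : ℝ)|} := by
    intro ω hω
    have h0 : 1 ≤ Y 0 ω := hω 0
    have h1 : 1 ≤ Y 1 ω := hω 1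
    by_cases hX : 2 ≤ X ω
    · exact Or.inl hX
    · right
      have e1 : (X ω : ℝ) ≤ 1 := by exact_mod_cast (by omega : X ω ≤ 1)
      have e2 : (1 : ℝ) ≤ Y 0 ω := by exact_mod_cast h0
      have e3 : (1 : ℝ) ≤ Y 1 ω := by exact_mod_cast h1
      change 1 ≤ |(X ω : ℝ) - ∑ l, (Y l ω : ℝ)|
      rw [Fin.sum_univ_two, abs_sub_comm]
      exact (by linarith : (1 : ℝ) ≤ Y 0 ω + Y 1 ω - X ω).trans (le_abs_self _)
  have hint : Integrable (fun ω => |(X ω : ℝ) - ∑ l, (Y l ω : ℝ)|) P :=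
    ((h.integrable_levelCount _ measurableSet_Icc).sub
      (integrable_finsetSum _ fun l _ => h.integrable_levelCount _ measurableSet_Icc)).abs
  have hmarkov := mul_meas_ge_le_integral_of_nonneg
    (ae_of_all P fun ω => abs_nonneg ((X ω : ℝ) - ∑ l, (Y l ω : ℝ))) hint 1
  rw [one_mul] at hmarkov
  have hMX : P.real {ω | 2 ≤ X ω} ≤ CM * ((2 * (S * q + 2)) ^ (1 + ρ) * (w * m) ^ (1 + ρ)) := by
    have := hM 1 L (E₀ - w) (E₀ + w) (by linarith) hWI
    have hb : Finset.Icc (((1 : ℕ)) : ℤ) L = box L := by simp [box]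
    rw [hb, card_box] at this
    refine this.trans ?_
    rw [← Real.mul_rpow (by positivity) (by positivity)]
    refine mul_le_mul_of_nonneg_left (Real.rpow_le_rpow ?_ ?_ (by positivity)) hCM.le
    · exact mul_nonneg (by linarith) (by positivity)
    · calc (E₀ + w - (E₀ - w)) * (L : ℝ) = 2 * w * L := by ring
        _ ≤ 2 * w * ((S * q + 2) * m) := by gcongr
        _ = _ := by ring
  have hLσ : (L : ℝ) ^ σ ≤ (S * q + 2) ^ σ * (m : ℝ) ^ σ := by
    rw [← Real.mul_rpow (by positivity) hm0.le]
    exact Real.rpow_le_rpow (by positivity) hLm hσ0.le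
  have hD2 : ∫ ω, |(X ω : ℝ) - ∑ l, (Y l ω : ℝ)| ∂P
      ≤ CD * ((m : ℝ) ^ (-A) + (S * q + 2) ^ (1 + σ) * ((m : ℝ) ^ σ * w)) := by
    refine hD.trans (mul_le_mul_of_nonneg_left (add_le_add le_rfl ?_) hCD.le)
    have e : (L : ℝ) - ((2 : ℕ) : ℝ) * m + ((2 : ℕ) : ℝ) = S * q + 2 := by
      rw [hLr]; push_cast; ring
    rw [e, Real.rpow_add (by positivity), Real.rpow_one]
    calc _ ≤ (S * q + 2) * ((S * q + 2) ^ σ * (m : ℝ) ^ σ) * w := by gcongr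
      _ = _ := by ring
  rw [← hboth]
  have hfin := (measureReal_mono hsub).trans ((measureReal_union_le _ _).trans
    (add_le_add hMX (hmarkov.trans hD2)))
  refine hfin.trans ?_
  have c1 : 0 ≤ CM * (2 * ((S : ℝ) * q + 2)) ^ (1 + ρ) := by positivity
  have c2 : 0 ≤ ((S : ℝ) * q + 2) ^ (1 + σ) := by positivity
  have d1 : 0 ≤ (w * (m : ℝ)) ^ (1 + ρ) := by positivity
  have d2 : 0 ≤ (m : ℝ) ^ σ * w := by positivity
  have d3 : 0 ≤ (m : ℝ) ^ (-A) := by positivity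
  rw [← mul_assoc CM]
  generalize CM * (2 * ((S : ℝ) * q + 2)) ^ (1 + ρ) = u1 at *
  generalize ((S : ℝ) * q + 2) ^ (1 + σ) = u2 at *
  generalize (w * (m : ℝ)) ^ (1 + ρ) = v1 at *
  generalize (m : ℝ) ^ σ * w = v2 at *
  generalize (m : ℝ) ^ (-A) = v3 at *
  have f1 := mul_nonneg hCD.le d1
  have f2 := mul_nonneg hCD.le d2
  have f3 := mul_nonneg (mul_nonneg hCD.le c2) d1
  have f4 := mul_nonneg (mul_nonneg hCD.le c2) d3
  nlinarith [mul_nonneg c1 d2, mul_nonneg c1 d3]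

end Model

end RandomJacobi

namespace RandomJacobi

/-! ### Poisson approximation -/

section Close

variable {α : Type*} [MeasurableSpace α]

/-- The integrals of all functions bounded by `1` differ by at most `Δ`. -/
def CloseWithin (μ ν : Measure α) (Δ : ℝ) : Prop :=
  ∀ g : α → ℝ, (∀ x, |g x| ≤ 1) → |∫ x, g x ∂μ - ∫ x, g x ∂ν| ≤ Δ

theorem CloseWithin.mono {μ ν : Measure α} {Δ Δ' : ℝ} (h : CloseWithin μ ν Δ) (hΔ : Δ ≤ Δ') :
    CloseWithin μ ν Δ' := fun g hg => (h g hg).trans hΔ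

theorem integrable_of_abs_le_one [DiscreteMeasurableSpace α] [Countable α] {μ : Measure α}
    [IsFiniteMeasure μ] {g : α → ℝ} (hg : ∀ x, |g x| ≤ 1) : Integrable g μ :=
  Integrable.of_bound (Measurable.of_discrete.aestronglyMeasurable) 1 (ae_of_all _ hg)

/-- Replace one factor at a time: integrating a function bounded by `1` over one factor leaves a
function of the other that is bounded by `1`. -/
theorem CloseWithin.conv [AddMonoid α] [DiscreteMeasurableSpace α] [Countable α]
    [MeasurableAdd₂ α] {μ ν μ' ν' : Measure α} [IsProbabilityMeasure μ] [IsProbabilityMeasure ν]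
    [IsProbabilityMeasure μ'] [IsProbabilityMeasure ν'] {Δ Δ' : ℝ} (h : CloseWithin μ ν Δ)
    (h' : CloseWithin μ' ν' Δ') : CloseWithin (μ ∗ μ') (ν ∗ ν') (Δ + Δ') := by
  intro g hg
  have hin : ∀ (η : Measure α) [IsProbabilityMeasure η] x, |∫ y, g (x + y) ∂η| ≤ 1 :=
    fun η _ x => abs_integral_le_of_ae_bound (ae_of_all _ fun y => hg _)
  rw [integral_conv (integrable_of_abs_le_one hg), integral_conv (integrable_of_abs_le_one hg)]
  have h1 := h (fun x => ∫ y, g (x + y) ∂ν') (hin ν')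
  have h2 : |∫ x, ∫ y, g (x + y) ∂μ' ∂μ - ∫ x, ∫ y, g (x + y) ∂ν' ∂μ| ≤ Δ' := by
    rw [← integral_sub (integrable_of_abs_le_one (hin μ')) (integrable_of_abs_le_one (hin ν'))]
    exact abs_integral_le_of_ae_bound (ae_of_all _ fun x => h' _ fun y => hg _)
  rw [abs_le] at h1 h2 ⊢
  constructor <;> linarith [h1.1, h1.2, h2.1, h2.2]

end Close

section Poisson

variable {ι : Type*} [Fintype ι]

/-- The law of independent Poisson variables with means `l j`. -/
noncomputable def poissonPi (l : ι → NNReal) : Measure (ι → ℕ) :=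
  Measure.pi fun j => poissonMeasure (l j)

instance (l : ι → NNReal) : IsProbabilityMeasure (poissonPi l) := by
  unfold poissonPi; infer_instance

theorem poissonPi_real_singleton (l : ι → NNReal) (k : ι → ℕ) :
    (poissonPi l).real {k} = ∏ j, Real.exp (-l j) * l j ^ k j / (k j).factorial := by
  rw [measureReal_def, poissonPi, Measure.pi_singleton, ENNReal.toReal_prod]
  exact Finset.prod_congr rfl fun j _ => poissonMeasure_real_singleton _ _

theorem poissonPi_conv (l l' : ι → NNReal) : poissonPi l ∗ poissonPi l' = poissonPi (l + l') := by
  have hmp := measurePreserving_arrowProdEquivProdArrow ℕ ℕ ι (fun j => poissonMeasure (l j))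
    (fun j => poissonMeasure (l' j))
  have hadd : Measurable fun x : (ι → ℕ) × (ι → ℕ) => x.1 + x.2 := measurable_add
  rw [Measure.conv, poissonPi, poissonPi, ← hmp.map_eq,
    Measure.map_map hadd (MeasurableEquiv.measurable _)]
  have hpi := Measure.pi_map_pi (μ := fun j => (poissonMeasure (l j)).prod (poissonMeasure (l' j)))
    (f := fun (_ : ι) (p : ℕ × ℕ) => p.1 + p.2) fun i => Measurable.of_discrete.aemeasurable
  refine Eq.trans hpi ?_
  rw [poissonPi]
  congr 1
  funext j
  exact poissonMeasure_conv_poissonMeasure (l j) (l' j)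

theorem exp_neg_sum_eq (l : ι → NNReal) :
    Real.exp (-∑ j, (l j : ℝ)) = ∏ j, Real.exp (-l j) := by
  rw [← Finset.sum_neg_distrib, Real.exp_sum]

theorem poissonPi_real_zero (l : ι → NNReal) :
    (poissonPi l).real {0} = Real.exp (-∑ j, (l j : ℝ)) := by
  rw [poissonPi_real_singleton, exp_neg_sum_eq]
  simp

variable [DecidableEq ι]

theorem poissonPi_real_single (l : ι → NNReal) (i : ι) :
    (poissonPi l).real {Pi.single i 1} = l i * Real.exp (-∑ j, (l j : ℝ)) := by
  rw [poissonPi_real_singleton, exp_neg_sum_eq]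
  have : ∀ j, Real.exp (-l j) * (l j : ℝ) ^ (Pi.single i 1 : ι → ℕ) j
      / ((Pi.single i 1 : ι → ℕ) j).factorial
      = Real.exp (-l j) * if j = i then (l i : ℝ) else 1 := by
    intro j
    by_cases hj : j = i
    · subst hj; simp
    · simp [hj]
  simp_rw [this]
  rw [Finset.prod_mul_distrib, Finset.prod_ite_eq' Finset.univ i fun _ => (l i : ℝ)]
  simp [mul_comm]

theorem eq_zero_or_single_or_two_le (x : ι → ℕ) :
    x = 0 ∨ (∃ i, x = Pi.single i 1) ∨ 2 ≤ ∑ j, x j := by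
  by_cases h0 : x = 0
  · exact Or.inl h0
  right
  obtain ⟨i, hi⟩ := Function.ne_iff.1 h0
  by_cases h1 : x = Pi.single i 1
  · exact Or.inl ⟨i, h1⟩
  right
  rw [Pi.zero_apply] at hi
  obtain ⟨j, hj⟩ := Function.ne_iff.1 h1
  by_cases hij : j = i
  · subst hij
    rw [Pi.single_eq_same] at hj
    have := Finset.single_le_sum (fun j _ => Nat.zero_le (x j)) (Finset.mem_univ j)
    omega
  · rw [Pi.single_eq_of_ne hij] at hj
    have h2 : ∑ k ∈ {i, j}, x k ≤ ∑ k, x k :=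
      Finset.sum_le_sum_of_subset (Finset.subset_univ _)
    rw [Finset.sum_pair (Ne.symm hij)] at h2
    omega

/-- The decomposition of a function of a configuration according to its number of points. -/
theorem eq_sum_single_add (f : (ι → ℕ) → ℝ) (x : ι → ℕ) :
    f x = ({0} : Set (ι → ℕ)).indicator (fun _ => f 0) x
      + ∑ i, ({Pi.single i 1} : Set (ι → ℕ)).indicator (fun _ => f (Pi.single i 1)) x
      + {x | 2 ≤ ∑ j, x j}.indicator f x := by
  have hs : ∀ i, ∑ j, (Pi.single i 1 : ι → ℕ) j = 1 := fun i => by simp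
  have hinj : ∀ i j : ι, (Pi.single i 1 : ι → ℕ) = Pi.single j 1 → i = j := fun i j h => by
    by_contra hne
    have := congrFun h i
    rw [Pi.single_eq_same, Pi.single_eq_of_ne hne] at this
    exact one_ne_zero this
  have hs0 : ∀ i, (Pi.single i 1 : ι → ℕ) ≠ 0 := fun i h => by
    have := congrFun h i
    simp at this
  rcases eq_zero_or_single_or_two_le x with rfl | ⟨i, rfl⟩ | h2
  · have e2 : (0 : ι → ℕ) ∉ {x : ι → ℕ | 2 ≤ ∑ j, x j} := by simp
    rw [Set.indicator_of_notMem e2, Finset.sum_eq_zero fun i _ =>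
      Set.indicator_of_notMem (fun h => hs0 i (Set.mem_singleton_iff.1 h).symm) _]
    simp
  · have e2 : (Pi.single i 1 : ι → ℕ) ∉ {x : ι → ℕ | 2 ≤ ∑ j, x j} := by
      simp only [Set.mem_ofPred_eq, hs]; norm_num
    rw [Set.indicator_of_notMem e2, Set.indicator_of_notMem (s := {0})
        (fun h => hs0 i (Set.mem_singleton_iff.1 h)),
      Finset.sum_eq_single i (fun j _ hj => Set.indicator_of_notMem (s := {Pi.single j 1})
          (fun h => hj (hinj i j (Set.mem_singleton_iff.1 h)).symm) _)
        (fun h => absurd (Finset.mem_univ i) h), Set.indicator_of_mem (Set.mem_singleton _)]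
    ring
  · have e0 : x ∉ ({0} : Set (ι → ℕ)) := by
      rintro rfl
      simp at h2
    have e1 : ∀ i, x ∉ ({Pi.single i 1} : Set (ι → ℕ)) := by
      rintro i rfl
      rw [hs] at h2
      omega
    rw [Set.indicator_of_notMem e0, Finset.sum_eq_zero fun i _ => Set.indicator_of_notMem (e1 i) _,
      Set.indicator_of_mem (show x ∈ {x : ι → ℕ | 2 ≤ ∑ j, x j} from h2)]
    ring

theorem integral_eq_sum_single_add {μ : Measure (ι → ℕ)} [IsProbabilityMeasure μ]
    {f : (ι → ℕ) → ℝ} (hf : Integrable f μ) :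
    ∫ x, f x ∂μ = μ.real {0} * f 0 + ∑ i, μ.real {Pi.single i 1} * f (Pi.single i 1)
      + ∫ x, {x | 2 ≤ ∑ j, x j}.indicator f x ∂μ := by
  have hm : ∀ s : Set (ι → ℕ), MeasurableSet s := fun s => MeasurableSet.of_discrete
  have i0 : ∀ (s : Set (ι → ℕ)) (c : ℝ), Integrable (fun x => s.indicator (fun _ => c) x) μ :=
    fun s c => (integrable_const c).indicator (hm s)
  have i1 : Integrable (fun x => ∑ i, ({Pi.single i 1} : Set (ι → ℕ)).indicator
      (fun _ => f (Pi.single i 1)) x) μ := integrable_finsetSum _ fun i _ => i0 _ _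
  have i2 : Integrable (fun x => {x | 2 ≤ ∑ j, x j}.indicator f x) μ := hf.indicator (hm _)
  have i01 : Integrable (fun x => ({0} : Set (ι → ℕ)).indicator (fun _ => f 0) x
      + ∑ i, ({Pi.single i 1} : Set (ι → ℕ)).indicator (fun _ => f (Pi.single i 1)) x) μ :=
    (i0 _ _).add i1
  rw [integral_congr_ae (ae_of_all _ (eq_sum_single_add f)), integral_add i01 i2,
    integral_add (i0 _ _) i1, integral_finsetSum _ fun i _ => i0 _ _]
  simp only [integral_indicator_const _ (hm _), smul_eq_mul]

/-- With `s` the total mean, the mass is `1 - exp(-s) (1 + s)`, at most `s²` because `exp(-s) ≥ 1 -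
s`. -/
theorem poissonPi_real_two_le (l : ι → NNReal) :
    (poissonPi l).real {x | 2 ≤ ∑ j, x j} ≤ (∑ j, (l j : ℝ)) ^ 2 := by
  have h := integral_eq_sum_single_add (μ := poissonPi l) (f := fun _ => (1 : ℝ))
    (integrable_const 1)
  rw [integral_const, probReal_univ, one_smul, integral_indicator_const _ MeasurableSet.of_discrete,
    poissonPi_real_zero, smul_eq_mul] at h
  simp only [poissonPi_real_single, mul_one] at h
  rw [← Finset.sum_mul] at h
  set s := ∑ j, (l j : ℝ) with hs
  have hs0 : 0 ≤ s := Finset.sum_nonneg fun j _ => (l j).2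
  have h1 := Real.add_one_le_exp (-s)
  nlinarith

/-- A law on configurations with few multiple points is close to the Poisson law. -/
theorem closeWithin_poissonPi {μ : Measure (ι → ℕ)} [IsProbabilityMeasure μ] (l : ι → NNReal)
    (hint : ∀ j, Integrable (fun x => (x j : ℝ)) μ) :
    CloseWithin μ (poissonPi l)
      (4 * ∫ x, {x : ι → ℕ | 2 ≤ ∑ j, x j}.indicator (fun x => ∑ j, (x j : ℝ)) x ∂μ
        + 2 * ∑ j, |∫ x, (x j : ℝ) ∂μ - l j| + 4 * (∑ j, (l j : ℝ)) ^ 2) := by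
  intro g hg
  set T : Set (ι → ℕ) := {x | 2 ≤ ∑ j, x j} with hT
  set M := ∫ x, T.indicator (fun x => ∑ j, (x j : ℝ)) x ∂μ with hM
  set s := ∑ j, (l j : ℝ) with hs
  have hs0 : 0 ≤ s := Finset.sum_nonneg fun j _ => (l j).2
  have hTm : MeasurableSet T := MeasurableSet.of_discrete
  -- Subtracting `g 0` removes the empty configuration from the comparison, leaving single and
  -- multiple points only.
  set f : (ι → ℕ) → ℝ := fun x => g x - g 0 with hf
  have hf2 : ∀ x, |f x| ≤ 2 := fun x => (abs_sub _ _).trans (by linarith [hg x, hg 0])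
  have hgi : ∀ (η : Measure (ι → ℕ)) [IsProbabilityMeasure η], Integrable g η := fun η _ =>
    integrable_of_abs_le_one hg
  have hfi : ∀ (η : Measure (ι → ℕ)) [IsProbabilityMeasure η], Integrable f η := fun η _ =>
    (hgi η).sub (integrable_const _)
  have hgf : ∀ (η : Measure (ι → ℕ)) [IsProbabilityMeasure η],
      ∫ x, g x ∂η = g 0 + ∫ x, f x ∂η := fun η _ => by
    rw [integral_sub (hgi η) (integrable_const _), integral_const, probReal_univ, one_smul]
    ring
  have htail : ∀ (η : Measure (ι → ℕ)) [IsProbabilityMeasure η],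
      |∫ x, T.indicator f x ∂η| ≤ 2 * η.real T := fun η _ => by
    refine abs_integral_le_integral_abs.trans ?_
    calc _ ≤ ∫ x, T.indicator (fun _ => (2 : ℝ)) x ∂η := by
          refine integral_mono ((hfi η).indicator hTm).abs
            ((integrable_const (2 : ℝ)).indicator hTm) fun x => ?_
          by_cases hx : x ∈ T
          · simp only [Set.indicator_of_mem hx]; exact hf2 x
          · simp only [Set.indicator_of_notMem hx, abs_zero]; exact le_rfl
      _ = _ := by rw [integral_indicator_const _ hTm, smul_eq_mul, mul_comm]
  have hsumi : Integrable (fun x : ι → ℕ => ∑ j, (x j : ℝ)) μ :=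
    integrable_finsetSum _ fun j _ => hint j
  have hμT : 2 * μ.real T ≤ M := by
    rw [hM]
    calc 2 * μ.real T = ∫ x, T.indicator (fun _ => (2 : ℝ)) x ∂μ := by
          rw [integral_indicator_const _ hTm, smul_eq_mul, mul_comm]
      _ ≤ _ := by
          refine integral_mono ((integrable_const (2 : ℝ)).indicator hTm)
            (hsumi.indicator hTm) fun x => ?_
          by_cases hx : x ∈ T
          · simp only [Set.indicator_of_mem hx]
            exact_mod_cast hx
          · simp only [Set.indicator_of_notMem hx]; exact le_rfl
  -- The `i`-th mean is the mass of the single-point configuration plus a contribution of multiple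
  -- configurations; so the masses of single points are controlled by the means. Summed over `i`,
  -- the multiple contributions give exactly `M`.
  have hμj : ∀ i, ∫ x, (x i : ℝ) ∂μ = μ.real {Pi.single i 1}
      + ∫ x, T.indicator (fun x => (x i : ℝ)) x ∂μ := by
    intro i
    rw [integral_eq_sum_single_add (hint i), Finset.sum_eq_single i]
    · simp
      rfl
    · intro j _ hj
      rw [Pi.single_eq_of_ne (Ne.symm hj)]
      simp
    · exact fun h => absurd (Finset.mem_univ i) h
  have hMs : ∑ i, ∫ x, T.indicator (fun x => (x i : ℝ)) x ∂μ = M := by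
    rw [← integral_finsetSum _ fun i _ => (hint i).indicator hTm, hM]
    refine integral_congr_ae (ae_of_all _ fun x => ?_)
    by_cases hx : x ∈ T
    · simp only [Set.indicator_of_mem hx]
    · simp only [Set.indicator_of_notMem hx, Finset.sum_const_zero]
  have hMi : ∀ i, 0 ≤ ∫ x, T.indicator (fun x => (x i : ℝ)) x ∂μ := fun i =>
    integral_nonneg fun x => Set.indicator_nonneg (fun _ _ => by positivity) x
  have hsingle : ∑ i, |μ.real {Pi.single i 1} - (poissonPi l).real {Pi.single i 1}|
      ≤ M + ∑ j, |∫ x, (x j : ℝ) ∂μ - l j| + s ^ 2 := by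
    have e1 : ∀ i ∈ Finset.univ, |μ.real {Pi.single i 1} - (poissonPi l).real {Pi.single i 1}|
        ≤ ∫ x, T.indicator (fun x => (x i : ℝ)) x ∂μ + |∫ x, (x i : ℝ) ∂μ - l i| + l i * s := by
      intro i _
      rw [poissonPi_real_single, ← hs]
      have e2 := Real.add_one_le_exp (-s)
      have e3 : Real.exp (-s) ≤ 1 := Real.exp_le_one_iff.2 (by linarith)
      have e4 := hμj i
      have e5 := hMi i
      have e6 : (0 : ℝ) ≤ l i := (l i).2
      have e7 := abs_le.1 (le_refl |∫ x, (x i : ℝ) ∂μ - l i|)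
      have e8 : (l i : ℝ) * Real.exp (-s) ≤ l i := mul_le_of_le_one_right e6 e3
      have e9 : (l i : ℝ) - l i * s ≤ l i * Real.exp (-s) := by nlinarith
      rw [abs_le]
      constructor <;> nlinarith [e7.1, e7.2]
    refine (Finset.sum_le_sum e1).trans (le_of_eq ?_)
    rw [Finset.sum_add_distrib, Finset.sum_add_distrib, hMs, ← Finset.sum_mul, sq]
  have hdiff : |∑ i, μ.real {Pi.single i 1} * f (Pi.single i 1)
      - ∑ i, (poissonPi l).real {Pi.single i 1} * f (Pi.single i 1)|
      ≤ 2 * (M + ∑ j, |∫ x, (x j : ℝ) ∂μ - l j| + s ^ 2) := by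
    rw [← Finset.sum_sub_distrib]
    refine (Finset.abs_sum_le_sum_abs _ _).trans (le_trans ?_
      (mul_le_mul_of_nonneg_left hsingle (by norm_num)))
    rw [Finset.mul_sum]
    refine Finset.sum_le_sum fun i _ => ?_
    rw [← sub_mul, abs_mul, mul_comm]
    exact mul_le_mul_of_nonneg_right (hf2 _) (abs_nonneg _)
  have hνT := poissonPi_real_two_le l
  rw [← hs, ← hT] at hνT
  have t1 := htail μ
  have t2 := htail (poissonPi l)
  have hf0 : f 0 = 0 := sub_self _
  rw [hgf μ, hgf (poissonPi l), integral_eq_sum_single_add (hfi μ),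
    integral_eq_sum_single_add (hfi (poissonPi l)), ← hT, hf0, mul_zero, mul_zero, zero_add,
    zero_add]
  have hM0 : 0 ≤ M := by rw [← hMs]; exact Finset.sum_nonneg fun i _ => hMi i
  rw [abs_le] at t1 t2 hdiff ⊢
  constructor <;> linarith [t1.1, t1.2, t2.1, t2.2, hdiff.1, hdiff.2]

end Poisson

section Sum

variable {Ω : Type*} [MeasurableSpace Ω] {P : Measure Ω} [IsProbabilityMeasure P]
  {ι : Type*} [Fintype ι]

theorem closeWithin_map_zero :
    CloseWithin (P.map fun _ => (0 : ι → ℕ)) (poissonPi (0 : ι → NNReal)) 0 := by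
  intro g hg
  have h1 : (poissonPi (0 : ι → NNReal)).real {0} = 1 := by
    rw [poissonPi_real_zero]; simp
  have h2 : ∀ᵐ x ∂(poissonPi (0 : ι → NNReal)), x = 0 := by
    rw [ae_iff]
    have h3 : {x : ι → ℕ | ¬ x = 0} = {0}ᶜ := rfl
    rw [h3, ← measureReal_eq_zero_iff, probReal_compl_eq_one_sub MeasurableSet.of_discrete, h1,
      sub_self]
  have h4 : ∫ x, g x ∂(poissonPi (0 : ι → NNReal)) = g 0 := by
    rw [integral_congr_ae (g := fun _ => g 0) (h2.mono fun x hx => by rw [hx]), integral_const,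
      probReal_univ, one_smul]
  rw [h4, integral_map measurable_const.aemeasurable
    Measurable.of_discrete.aestronglyMeasurable, integral_const, probReal_univ, one_smul, sub_self,
    abs_zero]

/-- Sums of independent configurations close to Poisson configurations. -/
theorem closeWithin_map_sum {n : ℕ} {Y : Fin n → Ω → ι → ℕ} (hY : ∀ k, Measurable (Y k))
    (hind : iIndepFun Y P) {l : ι → NNReal} {Δ : ℝ}
    (h : ∀ k, CloseWithin (P.map (Y k)) (poissonPi l) Δ) :
    CloseWithin (P.map fun ω => ∑ k, Y k ω) (poissonPi fun j => n * l j) (n * Δ) := by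
  classical
  have key : ∀ s : Finset (Fin n), CloseWithin (P.map (∑ k ∈ s, Y k))
      (poissonPi fun j => s.card * l j) (s.card * Δ) := by
    intro s
    induction s using Finset.induction_on with
    | empty =>
      have h1 : (fun j => (((∅ : Finset (Fin n)).card : ℕ) : NNReal) * l j) = 0 := by
        funext j; simp
      rw [h1, Finset.card_empty, Nat.cast_zero, zero_mul]
      exact closeWithin_map_zero
    | insert i s hi ih =>
      have hsm : Measurable (∑ k ∈ s, Y k) := by
        have h0 := Finset.measurable_sum s fun k _ => hY k
        convert h0 using 1
        funext ω
        exact Finset.sum_apply ω s Y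
      have h1 : P.map (∑ k ∈ insert i s, Y k) = P.map (∑ k ∈ s, Y k) ∗ P.map (Y i) := by
        rw [Finset.sum_insert hi, add_comm]
        exact (hind.indepFun_finsetSum_of_notMem hY hi).map_add_eq_map_conv_map hsm (hY i)
      have h2 : (poissonPi fun j => ((insert i s).card : NNReal) * l j)
          = poissonPi (fun j => (s.card : NNReal) * l j) ∗ poissonPi l := by
        rw [poissonPi_conv, Finset.card_insert_of_notMem hi]
        congr 1
        funext j
        simp [add_mul]
      have := Measure.isProbabilityMeasure_map (μ := P) hsm.aemeasurable
      have := Measure.isProbabilityMeasure_map (μ := P) (hY i).aemeasurable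
      rw [h1, h2]
      refine (ih.conv (h i)).mono (le_of_eq ?_)
      rw [Finset.card_insert_of_notMem hi]
      push_cast
      ring
  have := key Finset.univ
  rw [Finset.card_univ, Fintype.card_fin] at this
  convert this using 2
  funext ω
  rw [Finset.sum_apply]

end Sum

end RandomJacobi

namespace RandomJacobi

/-! ### The unfolding -/

/-- The energies whose unfolded value lies in `J`. -/
def energySet (κ : Measure ℝ) (E₀ : ℝ) (L : ℕ) (J : Set ℝ) : Set ℝ :=
  {E | (L : ℝ) * (ids κ E - ids κ E₀) ∈ J}

theorem unfoldedCount_eq (κ : Measure ℝ) (E₀ : ℝ) (a V : ℤ → ℝ) (L : ℕ) (J : Set ℝ) :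
    unfoldedCount κ E₀ a V L J = levelCount a V (box L) (energySet κ E₀ L J) := rfl

theorem disjoint_energySet (κ : Measure ℝ) (E₀ : ℝ) (L : ℕ) {J J' : Set ℝ} (h : Disjoint J J') :
    Disjoint (energySet κ E₀ L J) (energySet κ E₀ L J') := h.preimage _

section Ids

variable {κ : Measure ℝ} [IsProbabilityMeasure κ] {I : Set ℝ} {E₀ w : ℝ}

theorem ids_eq_cdf (E : ℝ) : ids κ E = cdf κ E := (cdf_eq_real κ E).symm

theorem monotone_ids : Monotone (ids κ) := fun x y h => by
  rw [ids_eq_cdf, ids_eq_cdf]; exact monotone_cdf κ h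

theorem dos_real_Icc {x y : ℝ} (hxy : x ≤ y) (hx : κ {x} = 0) :
    κ.real (Set.Icc x y) = ids κ y - ids κ x := by
  have h1 : Set.Iic y = Set.Iic x ∪ Set.Ioc x y := (Set.Iic_union_Ioc_eq_Iic hxy).symm
  have h2 : κ.real (Set.Iic y) = κ.real (Set.Iic x) + κ.real (Set.Ioc x y) := by
    rw [h1, measureReal_union _ measurableSet_Ioc]
    rw [Set.disjoint_left]
    exact fun z hz hz' => not_lt.2 (Set.mem_Iic.1 hz) hz'.1
  have h3 : κ.real (Set.Icc x y) = κ.real (Set.Ioc x y) := by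
    rw [measureReal_def, measureReal_def, ← Set.Icc_sdiff_left, measure_sdiff_null hx]
  rw [h3, ids, ids, h2]
  ring

theorem continuousAt_ids {E : ℝ} (hE : κ {E} = 0) : ContinuousAt (ids κ) E := by
  have h1 : ids κ = cdf κ := funext ids_eq_cdf
  rw [h1, (monotone_cdf κ).continuousAt_iff_leftLim_eq_rightLim, StieltjesFunction.rightLim_eq]
  have h2 := StieltjesFunction.measure_singleton (cdf κ) E
  rw [measure_cdf, hE] at h2
  have h3 := ENNReal.ofReal_eq_zero.1 h2.symm
  exact le_antisymm ((monotone_cdf κ).leftLim_le le_rfl) (by linarith)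

theorem monotone_unfold (L : ℕ) : Monotone fun E => (L : ℝ) * (ids κ E - ids κ E₀) :=
  fun _ _ h => mul_le_mul_of_nonneg_left (sub_le_sub_right (monotone_ids h) _) (Nat.cast_nonneg L)

theorem ordConnected_energySet (L : ℕ) {J : Set ℝ} (hJ : J.OrdConnected) :
    (energySet κ E₀ L J).OrdConnected := hJ.preimage_mono (monotone_unfold L)

variable (hat : ∀ E ∈ window E₀ w, κ {E} = 0) {L : ℕ} (hL : 0 < L) {T : ℝ}
  (hT₁ : L * (ids κ (E₀ - w) - ids κ E₀) < -T) (hT₂ : T < L * (ids κ (E₀ + w) - ids κ E₀))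

include hT₁ hT₂ in
theorem energySet_subset_window {J : Set ℝ} (hJ : J ⊆ Set.Icc (-T) T) :
    energySet κ E₀ L J ⊆ window E₀ w := by
  intro E hE
  have h := hJ hE
  constructor
  · by_contra! hlt
    have := monotone_unfold (κ := κ) (E₀ := E₀) L hlt.le
    linarith [h.1]
  · by_contra! hlt
    have := monotone_unfold (κ := κ) (E₀ := E₀) L hlt.le
    linarith [h.2]

include hat hT₁ hT₂ in
theorem exists_unfold_eq (hw : 0 ≤ w) {y : ℝ} (hy : y ∈ Set.Icc (-T) T) :
    ∃ E ∈ window E₀ w, (L : ℝ) * (ids κ E - ids κ E₀) = y := by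
  have hc : ContinuousOn (fun E => (L : ℝ) * (ids κ E - ids κ E₀)) (window E₀ w) := fun E hE =>
    (((continuousAt_ids (hat E hE)).sub continuousAt_const).const_mul _).continuousWithinAt
  have := intermediate_value_Icc (show E₀ - w ≤ E₀ + w by linarith) hc
    (show y ∈ Set.Icc _ _ from ⟨by linarith [hy.1], by linarith [hy.2]⟩)
  exact this

-- Without atoms the unfolding map is continuous on the window and takes every value in `[-T, T]`.
-- The preimage of `[c, d]` is therefore a compact interval whose ends are mapped exactly to `c` and
-- `d`, even if the IDS has plateaus.
include hat hT₁ hT₂ hL in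
theorem dos_energySet_Icc (hw : 0 ≤ w) {c d : ℝ} (hcd : c ≤ d) (hc : -T ≤ c) (hd : d ≤ T) :
    κ.real (energySet κ E₀ L (Set.Icc c d)) = (d - c) / L := by
  set A := energySet κ E₀ L (Set.Icc c d) with hA
  have hAw : A ⊆ window E₀ w :=
    energySet_subset_window hT₁ hT₂ (Set.Icc_subset_Icc hc hd)
  obtain ⟨x, hx, hxc⟩ := exists_unfold_eq hat hT₁ hT₂ hw (y := c) ⟨hc, hcd.trans hd⟩
  obtain ⟨y, hy, hyd⟩ := exists_unfold_eq hat hT₁ hT₂ hw (y := d) ⟨hc.trans hcd, hd⟩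
  have hxA : x ∈ A := by rw [hA, energySet, Set.mem_ofPred_eq, hxc]; exact ⟨le_rfl, hcd⟩
  have hyA : y ∈ A := by rw [hA, energySet, Set.mem_ofPred_eq, hyd]; exact ⟨hcd, le_rfl⟩
  have hcont : ContinuousOn (fun E => (L : ℝ) * (ids κ E - ids κ E₀)) (window E₀ w) := fun E hE =>
    (((continuousAt_ids (hat E hE)).sub continuousAt_const).const_mul _).continuousWithinAt
  have hAc : IsClosed A := by
    have h1 := hcont.preimage_isClosed_of_isClosed isClosed_Icc (isClosed_Icc (a := c) (b := d))
    have h2 : window E₀ w ∩ (fun E => (L : ℝ) * (ids κ E - ids κ E₀)) ⁻¹' Set.Icc c d = A :=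
      Set.inter_eq_right.2 hAw
    rwa [h2] at h1
  have hAb : Bornology.IsBounded A := (Metric.isBounded_Icc _ _).subset hAw
  have hi := hAc.csInf_mem ⟨x, hxA⟩ hAb.bddBelow
  have hs := hAc.csSup_mem ⟨x, hxA⟩ hAb.bddAbove
  have hAeq : A = Set.Icc (sInf A) (sSup A) :=
    Set.Subset.antisymm (subset_Icc_csInf_csSup hAb.bddBelow hAb.bddAbove)
      ((ordConnected_energySet L Set.ordConnected_Icc).out hi hs)
  have hic : (L : ℝ) * (ids κ (sInf A) - ids κ E₀) = c :=
    le_antisymm ((monotone_unfold L (csInf_le hAb.bddBelow hxA)).trans hxc.le) hi.1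
  have hsd : (L : ℝ) * (ids κ (sSup A) - ids κ E₀) = d :=
    le_antisymm hs.2 (hyd.ge.trans (monotone_unfold L (le_csSup hAb.bddAbove hyA)))
  rw [hAeq, dos_real_Icc ((csInf_le hAb.bddBelow hxA).trans (le_csSup hAb.bddAbove hxA))
    (hat _ (hAw hi))]
  have hL' : (0 : ℝ) < L := by exact_mod_cast hL
  rw [eq_div_iff hL'.ne', ← hic, ← hsd]
  ring

include hat hT₁ hT₂ hL in
/-- The density of states measure of an unfolded interval. -/
theorem dos_energySet (hw : 0 ≤ w) {J : Set ℝ} (hJo : J.OrdConnected) (hJn : J.Nonempty)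
    (hJ : J ⊆ Set.Icc (-T) T) : κ.real (energySet κ E₀ L J) = volume.real J / L := by
  have hb : Bornology.IsBounded J := (Metric.isBounded_Icc _ _).subset hJ
  obtain ⟨y, hy⟩ := hJn
  set c := sInf J
  set d := sSup J
  have hcy : c ≤ y := csInf_le hb.bddBelow hy
  have hyd : y ≤ d := le_csSup hb.bddAbove hy
  have hc : -T ≤ c := le_csInf ⟨y, hy⟩ fun z hz => (hJ hz).1
  have hd : d ≤ T := csSup_le ⟨y, hy⟩ fun z hz => (hJ hz).2
  have h1 : J ⊆ Set.Icc c d := subset_Icc_csInf_csSup hb.bddBelow hb.bddAbove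
  have h2 : Set.Ioo c d ⊆ J :=
    IsConnected.Ioo_csInf_csSup_subset ⟨⟨y, hy⟩, hJo.isPreconnected⟩ hb.bddBelow hb.bddAbove
  have hvol : volume.real J = d - c := by
    refine le_antisymm ?_ ?_
    · refine (measureReal_mono h1 (by simp)).trans (le_of_eq ?_)
      rw [Real.volume_real_Icc_of_le (hcy.trans hyd)]
    · refine le_trans (le_of_eq ?_) (measureReal_mono h2
        ((measure_mono h1).trans_lt (by simp)).ne)
      rw [Real.volume_real_Ioo_of_le (hcy.trans hyd)]
  have key := fun {c d : ℝ} => dos_energySet_Icc hat hL hT₁ hT₂ hw (c := c) (d := d)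
  rw [hvol]
  refine le_antisymm ?_ ?_
  · rw [← key (hcy.trans hyd) hc hd]
    exact measureReal_mono fun E hE => h1 hE
  · rw [← key (hcy.trans hyd) hc hd]
    -- The preimages of the end points may be plateaus of the IDS, but they carry no `κ`-mass, so it
    -- does not matter whether `J` contains its ends.
    have h3 : energySet κ E₀ L (Set.Icc c d) ⊆ energySet κ E₀ L J
        ∪ (energySet κ E₀ L (Set.Icc c c) ∪ energySet κ E₀ L (Set.Icc d d)) := by
      intro E hE
      rcases eq_or_lt_of_le hE.1 with h | h
      · exact Or.inr (Or.inl ⟨h.le, h.ge⟩)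
      rcases eq_or_lt_of_le hE.2 with h' | h'
      · exact Or.inr (Or.inr ⟨h'.ge, h'.le⟩)
      · exact Or.inl (h2 ⟨h, h'⟩)
    refine (measureReal_mono h3).trans ((measureReal_union_le _ _).trans ?_)
    have h4 := measureReal_union_le (μ := κ) (energySet κ E₀ L (Set.Icc c c))
      (energySet κ E₀ L (Set.Icc d d))
    rw [key le_rfl hc (hcy.trans (hyd.trans hd)), key le_rfl (hc.trans (hcy.trans hyd)) hd,
      sub_self, sub_self, zero_div, add_zero] at h4
    linarith

end Ids

/-- The window which contains all energies with unfolded value at most `L ^ (1 - α)`. -/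
theorem LowerGrowth.exists_window {κ : Measure ℝ} [IsProbabilityMeasure κ] {E₀ ρ' α : ℝ}
    (h : LowerGrowth κ E₀ ρ') (hρ' : 0 ≤ ρ') (hα : 0 < α) :
    ∃ c > (0 : ℝ), ∀ᶠ L : ℕ in atTop,
      (L : ℝ) * (ids κ (E₀ - c * (L : ℝ) ^ (-(α / (1 + ρ')))) - ids κ E₀) < -((L : ℝ) ^ (1 - α)) ∧
      (L : ℝ) ^ (1 - α) < L * (ids κ (E₀ + c * (L : ℝ) ^ (-(α / (1 + ρ')))) - ids κ E₀) := by
  obtain ⟨C, hC, ε₀, hε₀, hg⟩ := h (1 / 2) ⟨by norm_num, by norm_num⟩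
  -- Chosen so that for `ε = b L^(-α/(1+ρ'))` the growth bound reads `C ε^(1+ρ') = 2 L^(-α)`; the
  -- factor `2` makes the inequalities strict.
  set b : ℝ := (2 / C) ^ (1 / (1 + ρ')) with hb
  have hb0 : 0 < b := by positivity
  have hα0 : 0 < α / (1 + ρ') := by positivity
  refine ⟨b / 2, by positivity, ?_⟩
  have hlim : Tendsto (fun L : ℕ => b * (L : ℝ) ^ (-(α / (1 + ρ')))) atTop (𝓝 0) := by
    have := ((tendsto_rpow_neg_atTop hα0).comp tendsto_natCast_atTop_atTop).const_mul b
    simpa using this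
  filter_upwards [hlim.eventually (gt_mem_nhds hε₀), eventually_ge_atTop 1] with L hL hL1
  have hL0 : (0 : ℝ) < L := by exact_mod_cast hL1
  set ε := b * (L : ℝ) ^ (-(α / (1 + ρ'))) with hε
  have hε0 : 0 < ε := by positivity
  have e0 : b / 2 * (L : ℝ) ^ (-(α / (1 + ρ'))) = ε / 2 := by rw [hε]; ring
  have e1 : C * ε ^ (1 + ρ') = 2 * (L : ℝ) ^ (-α) := by
    rw [hε, Real.mul_rpow hb0.le (by positivity), hb, ← Real.rpow_mul (by positivity),
      ← Real.rpow_mul hL0.le, one_div_mul_cancel (by positivity), Real.rpow_one,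
      show -(α / (1 + ρ')) * (1 + ρ') = -α by field_simp]
    field_simp
  have e2 : (L : ℝ) * (L : ℝ) ^ (-α) = (L : ℝ) ^ (1 - α) := by
    rw [sub_eq_add_neg, Real.rpow_add hL0, Real.rpow_one]
  have hpos : 0 < (L : ℝ) ^ (1 - α) := by positivity
  rw [e0]
  -- Growth with `δ = 1/2`, at `t = 0` and `t = -1/2`, covers the intervals of length `ε/2` on the
  -- right and on the left of `E₀`.
  have g1 := hg ε ⟨hε0, hL⟩ 0 (by norm_num)
  have g2 := hg ε ⟨hε0, hL⟩ (-1 / 2) (by norm_num)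
  rw [e1] at g1 g2
  rw [show E₀ + (0 + 1 / 2) * ε = E₀ + ε / 2 by ring, show E₀ + 0 * ε = E₀ by ring,
    abs_of_nonneg (sub_nonneg.2 (monotone_ids (by linarith)))] at g1
  rw [show E₀ + (-1 / 2 + 1 / 2) * ε = E₀ by ring, show E₀ + -1 / 2 * ε = E₀ - ε / 2 by ring,
    abs_of_nonneg (sub_nonneg.2 (monotone_ids (by linarith)))] at g2
  have h1 := mul_le_mul_of_nonneg_left g1 hL0.le
  have h2 := mul_le_mul_of_nonneg_left g2 hL0.le
  constructor <;> nlinarith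

end RandomJacobi

namespace RandomJacobi

/-! ### Poisson approximation of level counts -/

/-- Distinct integer vectors differ by at least `1` in some coordinate, so the mean `ℓ¹` distance
bounds the probability that they differ. -/
theorem closeWithin_map_map {Ω ι : Type*} [MeasurableSpace Ω] {P : Measure Ω}
    [IsProbabilityMeasure P] [Fintype ι] {X Y : Ω → ι → ℕ} (hX : Measurable X) (hY : Measurable Y)
    (hint : Integrable (fun ω => ∑ j, |(X ω j : ℝ) - Y ω j|) P) :
    CloseWithin (P.map X) (P.map Y) (2 * ∫ ω, ∑ j, |(X ω j : ℝ) - Y ω j| ∂P) := by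
  intro g hg
  have hgm : ∀ {Z : Ω → ι → ℕ}, Measurable Z → Integrable (fun ω => g (Z ω)) P := fun hZ =>
    Integrable.of_bound (Measurable.of_discrete.comp hZ).aestronglyMeasurable 1
      (ae_of_all _ fun ω => hg _)
  rw [integral_map hX.aemeasurable Measurable.of_discrete.aestronglyMeasurable,
    integral_map hY.aemeasurable Measurable.of_discrete.aestronglyMeasurable,
    ← integral_sub (hgm hX) (hgm hY), ← integral_const_mul]
  refine abs_integral_le_integral_abs.trans
    (integral_mono ((hgm hX).sub (hgm hY)).abs (hint.const_mul 2) fun ω => ?_)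
  simp only
  by_cases hXY : X ω = Y ω
  · rw [hXY, sub_self, abs_zero]
    positivity
  · obtain ⟨j, hj⟩ := Function.ne_iff.1 hXY
    have h1 : (1 : ℝ) ≤ |(X ω j : ℝ) - Y ω j| := by
      have : (1 : ℤ) ≤ |(X ω j : ℤ) - Y ω j| := Int.one_le_abs (by omega)
      exact_mod_cast this
    have h2 := Finset.single_le_sum (f := fun j => |(X ω j : ℝ) - Y ω j|)
      (fun j _ => abs_nonneg _) (Finset.mem_univ j)
    have h3 := abs_sub (g (X ω)) (g (Y ω))
    linarith [hg (X ω), hg (Y ω)]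

/-- The error of the decoupling of a box into `n` blocks of length `m`. -/
noncomputable def decouplingErr (A σ L m n w : ℝ) : ℝ :=
  m ^ (-A) + (L - n * m + n) * L ^ σ * w

/-- The bound for the mean number of multiple levels. -/
noncomputable def multipleErr (A τ ρ s : ℝ) (r : ℕ) (m w : ℝ) : ℝ :=
  m ^ (2 * τ) * (w * m) ^ (1 + ρ) + m * (m ^ (1 + τ * s) * w) ^ r + m ^ (-A)

/-- The bound for the square of the probability that a window is occupied. -/
noncomputable def occupiedErr (A σ ρ m w : ℝ) : ℝ :=
  m ^ (-A) + m ^ σ * w + (w * m) ^ (1 + ρ)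

/-- The error of the means of the counts in one block. -/
noncomputable def meanErr (C A σ L m n w T : ℝ) : ℝ :=
  C * (m ^ (-A) + m ^ σ * w) + T * ((L - n * m) / (n * L))

section Model

set_option linter.unusedSectionVars false

variable {Ω : Type*} [MeasurableSpace Ω] {P : Measure Ω} [IsProbabilityMeasure P]
  {a V : ℤ → Ω → ℝ} {K : ℝ} {q : ℕ} {I : Set ℝ} {ρ : ℝ} {κ : Measure ℝ}

set_option maxHeartbeats 1000000 in
/-- **Poisson approximation.** The counts of levels of a box in disjoint intervals are close to
independent Poisson variables, in terms of the parameters of a decomposition into blocks. -/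
theorem LocalizedModel.exists_closeWithin_counts (h : LocalizedModel P a V K q I ρ)
    (hκ : IsDensityOfStates P a V q κ) (hR : RegularIDS κ I) {S : ℕ} (hS : IndepCounts P a V S)
    {E₀ w₀ : ℝ} (hw₀ : 0 < w₀) (hwI : window E₀ w₀ ⊆ I) {CW mW : ℝ} (hCW : 0 < CW) (hmW : 1 ≤ mW)
    (hW : WegnerWith P a V I CW mW) {τ : ℝ} (hτ : 0 < τ) (hτ1 : τ * (2 + mW) < 1) {A b : ℝ}
    (hA : 0 ≤ A) (hb : 1 ≤ b) (r : ℕ) :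
    ∃ C > 0, ∃ m₀ : ℕ, 1 ≤ m₀ ∧ ∀ (L k n : ℕ) (w T : ℝ), m₀ ≤ k * q → 0 < n →
      n * ((k + S) * q) ≤ L → (L : ℝ) ≤ ((k * q : ℕ) : ℝ) ^ b → locRes τ (k * q) ≤ w →
      2 * w ≤ w₀ → ∀ {ι : Type} [Fintype ι] (H : ι → Set ℝ) (t : ι → NNReal),
      (∀ j, (H j).OrdConnected) → (∀ j, (H j).Nonempty) → (∀ j, H j ⊆ window E₀ w) →
      (∀ i j, i ≠ j → Disjoint (H i) (H j)) →
      Fintype.card ι ≤ Real.exp ((((k * q : ℕ) : ℝ) ^ τ) ^ (1 / 2 : ℝ) / 8) →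
      (∀ j, κ.real (H j) = t j / L) → ∑ j, (t j : ℝ) ≤ T →
      CloseWithin (P.map fun ω j => levelCount (a · ω) (V · ω) (box L) (H j)) (poissonPi t)
        (2 * (C * decouplingErr A (τ * (2 + mW)) L (k * q : ℕ) n w)
          + n * (4 * (C * multipleErr A τ ρ mW r (k * q : ℕ) w)
            + 2 * meanErr C A (τ * (2 + mW)) L (k * q : ℕ) n w T
            + 12 * (meanErr C A (τ * (2 + mW)) L (k * q : ℕ) n w T ^ 2
              + C * occupiedErr A (τ * (2 + mW)) ρ (k * q : ℕ) w
              + (C * multipleErr A τ ρ mW r (k * q : ℕ) w) ^ 2))) := by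
  classical
  obtain ⟨C₁, hC₁, m₁, hm₁, hdec⟩ := h.decoupling_poly hw₀ hwI hCW hmW hW hτ hA hb
  obtain ⟨C₂, hC₂, m₂, hm₂, hmul⟩ := h.exists_integral_multiple_le hS hw₀ hwI hCW hmW hW hτ A r
  obtain ⟨C₃, hC₃, m₃, hm₃, hocc⟩ := h.exists_occupied_sq_le hS hw₀ hwI hCW hmW hW hτ hA
  obtain ⟨C₄, hC₄, m₄, hm₄, hmean⟩ := h.exists_meanCount_sub_le hκ hR hw₀ hwI hCW hmW hW hτ hτ1 hA
  set C := C₁ + C₂ + C₃ + C₄ with hC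
  refine ⟨C, by positivity, m₁ + m₂ + m₃ + m₄, by omega,
    fun L k n w T hm hn hnL hLb hεw hw ι _ H t hHo hHn hHw hHd hcard hκH hT => ?_⟩
  set m := k * q with hmdef
  have hm1 : 1 ≤ m := by omega
  have hm0 : (0 : ℝ) < m := by exact_mod_cast hm1
  have hn0 : (0 : ℝ) < n := by exact_mod_cast hn
  have hw' : 0 < w := (locRes_pos τ m).trans_le hεw
  set σ := τ * (2 + mW) with hσ
  have hHm : ∀ j, MeasurableSet (H j) := fun j => (hHo j).measurableSet
  have hℓ : m + S * q = (k + S) * q := by rw [hmdef]; ring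
  have hSS : S ≤ S * q := Nat.le_mul_of_pos_right S h.q_pos
  rw [← hℓ] at hnL
  have hnm : n * m ≤ L := (Nat.mul_le_mul_left n (Nat.le_add_right m _)).trans hnL
  have hmL : m ≤ L := (Nat.le_mul_of_pos_left m hn).trans hnm
  have hL0 : (0 : ℝ) < L := by exact_mod_cast (by omega : 0 < L)
  have hnmr : (n : ℝ) * m ≤ L := by exact_mod_cast hnm
  -- Blocks are repeated with spacing `(k + S) q = m + S q`, a multiple of `q` that leaves a gap `S
  -- q` between neighbours.
  let x : Fin n → ℕ := fun l => l * (k + S)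
  have hx : ∀ l, x l * q = l * (m + S * q) := fun l => by rw [hℓ]; simp only [x]; ring
  have hxlt : ∀ l l' : Fin n, l < l' → x l * q + m + S * q ≤ x l' * q := by
    intro l l' hll
    rw [hx, hx]
    have h1 : ((l : ℕ) + 1) * (m + S * q) ≤ l' * (m + S * q) := Nat.mul_le_mul_right _ hll
    linarith
  have hsep : ∀ l l' : Fin n, l ≠ l' → ∀ y ∈ block (x l * q) m, ∀ z ∈ block (x l' * q) m,
      (S : ℤ) < |y - z| := by
    have key : ∀ l l' : Fin n, l < l' → ∀ y ∈ block (x l * q) m, ∀ z ∈ block (x l' * q) m,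
        (S : ℤ) < z - y := by
      intro l l' hll y hy z hz
      have e1 := (mem_block.1 hy).2
      have e2 := (mem_block.1 hz).1
      have e3 : ((x l * q : ℕ) : ℤ) + m + S ≤ ((x l' * q : ℕ) : ℤ) := by
        exact_mod_cast (by linarith [hxlt l l' hll] : x l * q + m + S ≤ x l' * q)
      omega
    intro l l' hl y hy z hz
    rcases lt_or_gt_of_ne hl with hll | hll
    · rw [abs_sub_comm]; exact (key l l' hll y hy z hz).trans_le (le_abs_self _)
    · exact (key l' l hll z hz y hy).trans_le (le_abs_self _)
  have hBd : ∀ l l', l ≠ l' → Disjoint (block (x l * q) m) (block (x l' * q) m) := by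
    intro l l' hl
    rw [Finset.disjoint_left]
    intro z hz hz'
    have := hsep l l' hl z hz z hz'
    rw [sub_self, abs_zero] at this
    omega
  have hB : ∀ l, block (x l * q) m ⊆ box L := by
    intro l z hz
    rw [mem_block] at hz
    rw [mem_box]
    have h1 : ((l : ℕ) + 1) * (m + S * q) ≤ n * (m + S * q) := Nat.mul_le_mul_right _ l.2
    have h2 : x l * q + m ≤ L := by rw [hx]; linarith [Nat.zero_le (S * q)]
    have h3 : ((x l * q : ℕ) : ℤ) + m ≤ L := by exact_mod_cast h2
    omega
  let X : Ω → ι → ℕ := fun ω j => levelCount (a · ω) (V · ω) (box L) (H j)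
  let Y : Fin n → Ω → ι → ℕ := fun l ω j => levelCount (a · ω) (V · ω) (block (x l * q) m) (H j)
  let Y₀ : Ω → ι → ℕ := fun ω j => levelCount (a · ω) (V · ω) (box m) (H j)
  have hXm : Measurable X := h.measurable_counts _ hHm
  have hYm : ∀ l, Measurable (Y l) := fun l => h.measurable_counts _ hHm
  have hY₀m : Measurable Y₀ := h.measurable_counts _ hHm
  have hYlaw : ∀ l, P.map (Y l) = P.map Y₀ := fun l => h.map_counts_block (x l) m hHm
  have hind : iIndepFun Y P := hS n (fun l => ((x l * q : ℕ) : ℤ) + 1)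
    (fun l => ((x l * q : ℕ) : ℤ) + m) (fun l l' hl y hy z hz => (hsep l l' hl y hy z hz).le) H hHm
  -- the counts in one block
  have hprob := Measure.isProbabilityMeasure_map (μ := P) hY₀m.aemeasurable
  have hY₀i : ∀ j, Integrable (fun ω => (Y₀ ω j : ℝ)) P := fun j => h.integrable_levelCount _ (hHm j)
  have hμi : ∀ j, Integrable (fun x : ι → ℕ => (x j : ℝ)) (P.map Y₀) := fun j =>
    (integrable_map_measure Measurable.of_discrete.aestronglyMeasurable hY₀m.aemeasurable).2
      (hY₀i j)
  have hμint : ∀ f : (ι → ℕ) → ℝ, ∫ x, f x ∂(P.map Y₀) = ∫ ω, f (Y₀ ω) ∂P := fun f =>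
    integral_map hY₀m.aemeasurable Measurable.of_discrete.aestronglyMeasurable
  -- The parameter `t j / n`, instead of `m κ(H j)`, makes the `n`-fold convolution exactly
  -- `poissonPi t`; the sites lost to gaps then appear as the term `T (L - n m)/(n L)` of `meanErr`.
  let l : ι → NNReal := fun j => t j / n
  have hlr : ∀ j, (l j : ℝ) = t j / n := fun j => by simp [l]
  let Y' : Ω → ℕ := fun ω => levelCount (a · ω) (V · ω) (box m) (window E₀ w)
  have hY'm : Measurable Y' := h.measurable_levelCount _ measurableSet_Icc
  have hY'i : Integrable (fun ω => (Y' ω : ℝ)) P := h.integrable_levelCount _ measurableSet_Icc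
  have hYY' : ∀ ω, ∑ j, Y₀ ω j ≤ Y' ω := fun ω => sum_levelCount_le _ _ _ hHw hHd
  have h2m : MeasurableSet {ω | 2 ≤ Y' ω} := measurableSet_le measurable_const hY'm
  have h1m : MeasurableSet {ω | 1 ≤ Y' ω} := measurableSet_le measurable_const hY'm
  set M := C * multipleErr A τ ρ mW r m w with hM
  set D := meanErr C A σ L m n w T with hD
  set O := C * occupiedErr A σ ρ m w with hO
  have hpm : 0 ≤ (m : ℝ) ^ (-A) := by positivity
  have hM' : ∫ ω, {ω | 2 ≤ Y' ω}.indicator (fun ω => (Y' ω : ℝ)) ω ∂P ≤ M := by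
    refine (hmul m w (by omega) hεw hw).trans ?_
    rw [hM, multipleErr]
    refine mul_le_mul_of_nonneg_right (by rw [hC]; linarith) (by positivity)
  have hO' : P.real {ω | 1 ≤ Y' ω} ^ 2 ≤ O := by
    refine (hocc k w (by omega) hεw hw).trans ?_
    rw [hO, occupiedErr]
    refine mul_le_mul_of_nonneg_right (by rw [hC]; linarith) (by positivity)
  have hM2 : ∫ x, {x : ι → ℕ | 2 ≤ ∑ j, x j}.indicator (fun x => ∑ j, (x j : ℝ)) x ∂(P.map Y₀)
      ≤ M := by
    rw [hμint]
    refine le_trans (integral_mono_of_nonneg (ae_of_all _ fun ω => Set.indicator_nonneg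
      (fun _ _ => by positivity) _) (hY'i.indicator h2m) (ae_of_all _ fun ω => ?_)) hM'
    have hle : ∑ j, (Y₀ ω j : ℝ) ≤ Y' ω := by exact_mod_cast hYY' ω
    by_cases hω : Y₀ ω ∈ {x : ι → ℕ | 2 ≤ ∑ j, x j}
    · have hω' : ω ∈ {ω | 2 ≤ Y' ω} := le_trans hω (hYY' ω)
      simp only [Set.indicator_of_mem hω, Set.indicator_of_mem hω']
      exact hle
    · simp only [Set.indicator_of_notMem hω]
      exact Set.indicator_nonneg (fun _ _ => by positivity) _
  have hD2 : ∑ j, |∫ x, (x j : ℝ) ∂(P.map Y₀) - l j| ≤ D := by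
    have e1 : ∀ j ∈ Finset.univ, |∫ x, (x j : ℝ) ∂(P.map Y₀) - l j|
        ≤ |meanCount P a V m (H j) - (m : ℝ) * κ.real (H j)|
          + t j * ((L - n * m) / (n * L)) := by
      intro j _
      have e2 : ∫ x, (x j : ℝ) ∂(P.map Y₀) = meanCount P a V m (H j) := hμint fun x => (x j : ℝ)
      have e3 : (m : ℝ) * κ.real (H j) - l j = -(t j * ((L - n * m) / (n * L))) := by
        rw [hκH, hlr]; field_simp; ring
      rw [e2, show meanCount P a V m (H j) - l j
        = (meanCount P a V m (H j) - (m : ℝ) * κ.real (H j)) + ((m : ℝ) * κ.real (H j) - l j) by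
          ring, e3]
      refine (abs_add_le _ _).trans (add_le_add le_rfl (le_of_eq ?_))
      rw [abs_neg, abs_of_nonneg]
      exact mul_nonneg (t j).2 (div_nonneg (by linarith) (by positivity))
    refine (Finset.sum_le_sum e1).trans ?_
    rw [Finset.sum_add_distrib, ← Finset.sum_mul, hD, meanErr]
    refine add_le_add ((hmean k w (by omega) hεw hw H hHo hHn hHw hHd hcard).trans ?_) ?_
    · exact mul_le_mul_of_nonneg_right (by rw [hC]; linarith) (by positivity)
    · exact mul_le_mul_of_nonneg_right hT (div_nonneg (by linarith) (by positivity))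
  have hD0 : 0 ≤ D := le_trans (Finset.sum_nonneg fun j _ => abs_nonneg _) hD2
  have hM0 : 0 ≤ M := le_trans (integral_nonneg fun ω => Set.indicator_nonneg
    (fun _ _ => by positivity) _) hM'
  -- The total Poisson mean is close to the mean number of levels in the window, which is at most
  -- the probability of being occupied plus the contribution of multiple levels. Its square is what
  -- the two-block Minami argument controls.
  have hs : ∑ j, (l j : ℝ) ≤ D + (P.real {ω | 1 ≤ Y' ω} + M) := by
    have e1 : ∑ j, (l j : ℝ) ≤ D + ∑ j, ∫ x, (x j : ℝ) ∂(P.map Y₀) := by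
      have e2 : ∑ j, (l j : ℝ) ≤ ∑ j, (|∫ x, (x j : ℝ) ∂(P.map Y₀) - l j|
          + ∫ x, (x j : ℝ) ∂(P.map Y₀)) := by
        refine Finset.sum_le_sum fun j _ => ?_
        have := neg_abs_le (∫ x, (x j : ℝ) ∂(P.map Y₀) - l j)
        linarith
      rw [Finset.sum_add_distrib] at e2
      linarith
    refine e1.trans (add_le_add le_rfl ?_)
    have e3 : ∑ j, ∫ x, (x j : ℝ) ∂(P.map Y₀) = ∫ ω, ∑ j, (Y₀ ω j : ℝ) ∂P := by
      rw [integral_finsetSum _ fun j _ => hY₀i j]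
      exact Finset.sum_congr rfl fun j _ => hμint fun x => (x j : ℝ)
    have i1 : Integrable (fun ω => {ω | 1 ≤ Y' ω}.indicator (1 : Ω → ℝ) ω) P :=
      (integrable_const (1 : ℝ)).indicator h1m
    have i2 : Integrable (fun ω => {ω | 2 ≤ Y' ω}.indicator (fun ω => (Y' ω : ℝ)) ω) P :=
      hY'i.indicator h2m
    rw [e3]
    calc _ ≤ ∫ ω, ({ω | 1 ≤ Y' ω}.indicator (1 : Ω → ℝ) ω
          + {ω | 2 ≤ Y' ω}.indicator (fun ω => (Y' ω : ℝ)) ω) ∂P := by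
          refine integral_mono (integrable_finsetSum _ fun j _ => hY₀i j) (i1.add i2) fun ω => ?_
          have hle : ∑ j, (Y₀ ω j : ℝ) ≤ Y' ω := by exact_mod_cast hYY' ω
          refine hle.trans ?_
          by_cases hω2 : ω ∈ {ω | 2 ≤ Y' ω}
          · simp only [Set.indicator_of_mem hω2]
            exact le_add_of_nonneg_left (Set.indicator_nonneg (fun _ _ => zero_le_one) _)
          · by_cases hω1 : ω ∈ {ω | 1 ≤ Y' ω}
            · have : Y' ω < 2 := not_le.1 hω2
              simp only [Set.indicator_of_notMem hω2, Set.indicator_of_mem hω1, Pi.one_apply,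
                add_zero]
              exact_mod_cast Nat.lt_succ_iff.1 this
            · have : Y' ω = 0 := by
                have : ¬ 1 ≤ Y' ω := hω1
                omega
              simp only [Set.indicator_of_notMem hω2, Set.indicator_of_notMem hω1, this,
                Nat.cast_zero, add_zero, le_refl]
      _ = P.real {ω | 1 ≤ Y' ω}
          + ∫ ω, {ω | 2 ≤ Y' ω}.indicator (fun ω => (Y' ω : ℝ)) ω ∂P := by
          rw [integral_add i1 i2, integral_indicator_one h1m]
      _ ≤ _ := add_le_add le_rfl hM'
  have hs2 : (∑ j, (l j : ℝ)) ^ 2 ≤ 3 * (D ^ 2 + O + M ^ 2) := by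
    have hp0 : 0 ≤ P.real {ω | 1 ≤ Y' ω} := measureReal_nonneg
    have hs0 : 0 ≤ ∑ j, (l j : ℝ) := Finset.sum_nonneg fun j _ => (l j).2
    have e1 := pow_le_pow_left₀ hs0 hs 2
    nlinarith [sq_nonneg (D - P.real {ω | 1 ≤ Y' ω}), sq_nonneg (D - M),
      sq_nonneg (P.real {ω | 1 ≤ Y' ω} - M)]
  have hone : CloseWithin (P.map Y₀) (poissonPi l)
      (4 * M + 2 * D + 12 * (D ^ 2 + O + M ^ 2)) := by
    refine (closeWithin_poissonPi l hμi).mono ?_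
    linarith
  have hsumP : (fun j => (n : NNReal) * l j) = t := by
    funext j
    simp only [l]
    rw [mul_div_cancel₀]
    exact_mod_cast hn.ne'
  have hsum := closeWithin_map_sum hYm hind (l := l) fun l' => by rw [hYlaw]; exact hone
  rw [hsumP] at hsum
  -- the decoupling
  have hSm : Measurable fun ω => ∑ l, Y l ω := Finset.measurable_sum _ fun l _ => hYm l
  have hcoord : ∀ ω j, ((∑ l, Y l ω) j : ℝ) = ∑ l, (Y l ω j : ℝ) := fun ω j => by
    rw [Finset.sum_apply]; push_cast; rfl
  have hcl := closeWithin_map_map hXm hSm (P := P) (by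
    simp only [hcoord]
    exact integrable_finsetSum _ fun j _ => ((h.integrable_levelCount _ (hHm j)).sub
      (integrable_finsetSum _ fun l _ => h.integrable_levelCount _ (hHm j))).abs)
  simp only [hcoord] at hcl
  have hdd := hdec L m n x w (by omega) hmL hLb hB hBd hεw hw H hHo hHn hHw hHd hcard
  have hdd' : ∫ ω, ∑ j, |(X ω j : ℝ) - ∑ l, (Y l ω j : ℝ)| ∂P ≤ C * decouplingErr A σ L m n w := by
    refine hdd.trans ?_
    rw [decouplingErr]
    refine mul_le_mul_of_nonneg_right (by rw [hC]; linarith) ?_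
    have : 0 ≤ (L : ℝ) - n * m + n := by linarith
    positivity
  intro g hg
  have f1 := hcl g hg
  have f2 := hsum g hg
  have f3 := abs_sub_le (∫ x, g x ∂(P.map X)) (∫ x, g x ∂(P.map fun ω => ∑ l, Y l ω))
    (∫ x, g x ∂(poissonPi t))
  linarith

end Model

end RandomJacobi

namespace RandomJacobi

/-! ### Powers of the length of the box -/

section Powers

open Asymptotics

/-- `f` grows at most like the power `e`. -/
def PowerBound (f : ℕ → ℝ) (e : ℝ) : Prop := f =O[atTop] fun L : ℕ => (L : ℝ) ^ e

variable {f g : ℕ → ℝ} {e e' : ℝ}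

theorem PowerBound.mono (h : PowerBound f e) (he : e ≤ e') : PowerBound f e' := by
  refine h.trans (IsBigO.of_bound 1 ?_)
  filter_upwards [eventually_ge_atTop 1] with L hL
  have hL' : (1 : ℝ) ≤ L := by exact_mod_cast hL
  rw [one_mul, Real.norm_of_nonneg (by positivity), Real.norm_of_nonneg (by positivity)]
  exact Real.rpow_le_rpow_of_exponent_le hL' he

theorem PowerBound.add (h : PowerBound f e) (h' : PowerBound g e) :
    PowerBound (fun L => f L + g L) e := IsBigO.add h h'

theorem PowerBound.const_mul (h : PowerBound f e) (c : ℝ) : PowerBound (fun L => c * f L) e :=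
  IsBigO.const_mul_left h c

theorem PowerBound.mul (h : PowerBound f e) (h' : PowerBound g e') :
    PowerBound (fun L => f L * g L) (e + e') := by
  refine (IsBigO.mul h h').congr' EventuallyEq.rfl ?_
  filter_upwards [eventually_ge_atTop 1] with L hL
  have hL' : (0 : ℝ) < L := by exact_mod_cast hL
  rw [Real.rpow_add hL']

theorem PowerBound.rpow (h : PowerBound f e) {r : ℝ} (hr : 0 ≤ r) :
    PowerBound (fun L => f L ^ r) (e * r) := by
  have := IsBigO.rpow (r := r) hr (Eventually.of_forall fun L : ℕ =>
    Real.rpow_nonneg (Nat.cast_nonneg L) e) h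
  refine this.congr' EventuallyEq.rfl (Eventually.of_forall fun L => ?_)
  exact (Real.rpow_mul (Nat.cast_nonneg L) e r).symm

theorem PowerBound.pow (h : PowerBound f e) (r : ℕ) :
    PowerBound (fun L => f L ^ r) (e * r) := by
  have := h.rpow (Nat.cast_nonneg r)
  simpa only [Real.rpow_natCast] using this

theorem PowerBound.tendsto (h : PowerBound f e) (he : e < 0) : Tendsto f atTop (𝓝 0) := by
  refine IsBigO.trans_tendsto h ?_
  have := (tendsto_rpow_neg_atTop (neg_pos.2 he)).comp tendsto_natCast_atTop_atTop
  rw [neg_neg] at this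
  exact this

theorem PowerBound.of_le {C : ℝ} (h : ∀ᶠ L : ℕ in atTop, |f L| ≤ C * (L : ℝ) ^ e) :
    PowerBound f e := by
  refine IsBigO.of_bound C ?_
  filter_upwards [h] with L hL
  rwa [Real.norm_of_nonneg (r := (L : ℝ) ^ e) (by positivity)]

theorem powerBound_rpow (e : ℝ) : PowerBound (fun L : ℕ => (L : ℝ) ^ e) e := isBigO_refl _ _

/-- Blocks whose length is a power of the length of the box. -/
theorem exists_blocks {β : ℝ} (hβ0 : 0 < β) (hβ1 : β < 1) {q : ℕ} (hq : 0 < q) (S : ℕ) :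
    ∃ k n : ℕ → ℕ, (∀ᶠ L : ℕ in atTop, (L : ℝ) ^ β ≤ ((k L * q : ℕ) : ℝ) ∧ 0 < n L ∧
        n L * ((k L + S) * q) ≤ L) ∧
      PowerBound (fun L => ((k L * q : ℕ) : ℝ)) β ∧ PowerBound (fun L => (n L : ℝ)) (1 - β) ∧
      PowerBound (fun L => (n L : ℝ)⁻¹) (β - 1) ∧
      PowerBound (fun L => (L : ℝ) - n L * ((k L * q : ℕ) : ℝ)) (max β (1 - β)) := by
  set k : ℕ → ℕ := fun L => ⌈(L : ℝ) ^ β⌉₊ with hk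
  set d : ℕ → ℕ := fun L => (k L + S) * q with hd
  set n : ℕ → ℕ := fun L => L / d L with hn
  have hkl : ∀ L : ℕ, (L : ℝ) ^ β ≤ k L := fun L => Nat.le_ceil _
  have hq' : (1 : ℝ) ≤ q := by exact_mod_cast hq
  have hku : ∀ L : ℕ, L ≥ 1 → (k L : ℝ) ≤ 2 * (L : ℝ) ^ β := fun L hL => by
    have h1 : (1 : ℝ) ≤ (L : ℝ) ^ β := Real.one_le_rpow (by exact_mod_cast hL) hβ0.le
    have h2 := Nat.ceil_lt_add_one (show 0 ≤ (L : ℝ) ^ β by positivity)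
    have h3 : (k L : ℝ) < (L : ℝ) ^ β + 1 := h2
    linarith
  have hdu : ∀ L : ℕ, L ≥ 1 → (d L : ℝ) ≤ (2 + S) * q * (L : ℝ) ^ β := fun L hL => by
    have h1 : (1 : ℝ) ≤ (L : ℝ) ^ β := Real.one_le_rpow (by exact_mod_cast hL) hβ0.le
    have h2 := hku L hL
    have h3 : (S : ℝ) ≤ S * (L : ℝ) ^ β := le_mul_of_one_le_right (by positivity) h1
    simp only [hd]
    push_cast
    calc ((k L : ℝ) + S) * q ≤ (2 * (L : ℝ) ^ β + S * (L : ℝ) ^ β) * q := by gcongr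
      _ = _ := by ring
  have hkpos : ∀ L ≥ 1, 0 < k L := fun L hL =>
    Nat.ceil_pos.2 (Real.rpow_pos_of_pos (by exact_mod_cast hL) _)
  have hdpos : ∀ L ≥ 1, 0 < d L := fun L hL =>
    Nat.mul_pos (Nat.add_pos_left (hkpos L hL) _) hq
  have hnd : ∀ L, n L * d L ≤ L := fun L => Nat.div_mul_le_self _ _
  have hdL : ∀ᶠ L : ℕ in atTop, d L ≤ L := by
    have h1 : Tendsto (fun L : ℕ => (2 + S) * q * (L : ℝ) ^ (-(1 - β))) atTop (𝓝 0) := by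
      have := ((tendsto_rpow_neg_atTop (sub_pos.2 hβ1)).comp
        tendsto_natCast_atTop_atTop).const_mul ((2 + S : ℝ) * q)
      simpa using this
    filter_upwards [h1.eventually (gt_mem_nhds one_pos), eventually_ge_atTop 1] with L hL hL1
    have hL' : (0 : ℝ) < L := by exact_mod_cast hL1
    have e1 := hdu L hL1
    have e2 : (L : ℝ) ^ β = (L : ℝ) ^ (-(1 - β)) * L := by
      rw [← Real.rpow_add_one hL'.ne']; congr 1; ring
    rw [e2, ← mul_assoc] at e1
    have : (d L : ℝ) ≤ L := e1.trans (mul_le_of_le_one_left hL'.le hL.le)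
    exact_mod_cast this
  have hnpos : ∀ᶠ L : ℕ in atTop, 0 < n L := by
    filter_upwards [hdL, eventually_ge_atTop 1] with L hL hL1
    exact Nat.div_pos hL (hdpos L hL1)
  have hnb : PowerBound (fun L => (n L : ℝ)) (1 - β) := by
    refine PowerBound.of_le (C := 1) ?_
    filter_upwards [eventually_ge_atTop 1] with L hL
    have hL' : (0 : ℝ) < L := by exact_mod_cast hL
    have h1 : (n L : ℝ) * d L ≤ L := by exact_mod_cast hnd L
    have h2 : (L : ℝ) ^ β ≤ d L := by
      refine (hkl L).trans ?_
      have : k L ≤ d L := (Nat.le_add_right _ _).trans (Nat.le_mul_of_pos_right _ hq)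
      exact_mod_cast this
    have h3 : 0 < (L : ℝ) ^ β := by positivity
    rw [one_mul, Nat.abs_cast, Real.rpow_sub hL', Real.rpow_one, le_div_iff₀ h3]
    exact (mul_le_mul_of_nonneg_left h2 (Nat.cast_nonneg _)).trans h1
  have hdb : PowerBound (fun L => (d L : ℝ)) β := by
    refine PowerBound.of_le (C := (2 + S) * q) ?_
    filter_upwards [eventually_ge_atTop 1] with L hL
    rw [Nat.abs_cast]
    exact hdu L hL
  refine ⟨k, n, ?_, ?_, hnb, ?_, ?_⟩
  · filter_upwards [hnpos] with L hL
    refine ⟨(hkl L).trans ?_, hL, hnd L⟩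
    exact_mod_cast Nat.le_mul_of_pos_right _ hq
  · refine PowerBound.of_le (C := 2 * q) ?_
    filter_upwards [eventually_ge_atTop 1] with L hL
    rw [Nat.abs_cast]
    push_cast
    have := mul_le_mul_of_nonneg_right (hku L hL) (show (0 : ℝ) ≤ q by positivity)
    linarith
  -- Since `n ≥ 1`, division with remainder gives `L < (n + 1) d ≤ 2 n d`.
  · refine PowerBound.of_le (C := 2 * ((2 + S) * q)) ?_
    filter_upwards [hnpos, eventually_ge_atTop 1] with L hn0 hL
    have hL' : (0 : ℝ) < L := by exact_mod_cast hL
    have hn0' : (0 : ℝ) < n L := by exact_mod_cast hn0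
    have h1 : L < (n L + 1) * d L := by
      have := Nat.lt_mul_div_succ L (hdpos L hL)
      rw [mul_comm] at this
      exact this
    have h2 : (L : ℝ) ≤ 2 * n L * d L := by
      have h3 : (L : ℝ) < (n L + 1) * d L := by exact_mod_cast h1
      have h4 : (1 : ℝ) ≤ n L := by exact_mod_cast hn0
      have h5 : ((n L : ℝ) + 1) * d L ≤ (2 * n L) * d L := by
        refine mul_le_mul_of_nonneg_right (by linarith) (Nat.cast_nonneg _)
      linarith
    rw [abs_of_pos (inv_pos.2 hn0'), Real.rpow_sub hL', Real.rpow_one, inv_le_iff_one_le_mul₀ hn0']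
    rw [← mul_div_assoc, div_mul_eq_mul_div, le_div_iff₀ hL', one_mul]
    have h6 := mul_le_mul_of_nonneg_left (hdu L hL) (show 0 ≤ 2 * (n L : ℝ) by positivity)
    linarith
  -- The uncovered sites are the remainder of the division, fewer than `d`, and the `n` gaps of
  -- length `S q`.
  · have h1 : PowerBound (fun L => (d L : ℝ) + (S * q : ℝ) * n L) (max β (1 - β)) :=
      (hdb.mono (le_max_left _ _)).add ((hnb.mono (le_max_right _ _)).const_mul _)
    refine IsBigO.trans (IsBigO.of_bound 1 ?_) h1
    filter_upwards [eventually_ge_atTop 1] with L hL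
    have h2 : L < (n L + 1) * d L := by
      have := Nat.lt_mul_div_succ L (hdpos L hL)
      rw [mul_comm] at this
      exact this
    have h3 : (L : ℝ) < (n L + 1) * d L := by exact_mod_cast h2
    have h4 : (n L : ℝ) * d L ≤ L := by exact_mod_cast hnd L
    have h5 : (d L : ℝ) = (k L + S) * q := by simp only [hd]; push_cast; ring
    have h6 : (n L : ℝ) * d L = n L * (k L * q) + S * q * n L := by rw [h5]; ring
    have h7 : (0 : ℝ) ≤ S * q * n L := by positivity
    push_cast
    rw [one_mul, Real.norm_of_nonneg (by linarith), Real.norm_of_nonneg (by positivity)]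
    linarith

end Powers

end RandomJacobi

namespace RandomJacobi

/-- The error of the Poisson approximation tends to zero. -/
theorem tendsto_poissonErr {C A τ ρ s c α β a₀ d : ℝ} {r : ℕ} {m n : ℕ → ℝ} (hβ0 : 0 < β)
    (hβ1 : β < 1) (hρ : 0 < ρ) (hs : 1 ≤ s) (hτ : 0 < τ) (hd : 0 < d) (ha₀ : a₀ < 1) (hα : a₀ ≤ α)
    (hd1 : β + d ≤ a₀) (hd2 : 1 - β + d ≤ a₀) (hd3 : 1 + ρ * β + d ≤ a₀ * (1 + ρ))
    (hτd : τ * (2 + s) ≤ d / 4) (hr : 4 ≤ r * d)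
    (hm : PowerBound m β) (hmA : PowerBound (fun L => m L ^ (-A)) (-2))
    (hn : PowerBound n (1 - β)) (hni : PowerBound (fun L => (n L)⁻¹) (β - 1))
    (hg : PowerBound (fun L => (L : ℝ) - n L * m L) (max β (1 - β))) :
    Tendsto (fun L : ℕ => 2 * (C * decouplingErr A (τ * (2 + s)) L (m L) (n L) (c * (L : ℝ) ^ (-a₀)))
      + n L * (4 * (C * multipleErr A τ ρ s r (m L) (c * (L : ℝ) ^ (-a₀)))
        + 2 * meanErr C A (τ * (2 + s)) L (m L) (n L) (c * (L : ℝ) ^ (-a₀)) (2 * (L : ℝ) ^ (1 - α))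
        + 12 * (meanErr C A (τ * (2 + s)) L (m L) (n L) (c * (L : ℝ) ^ (-a₀))
              (2 * (L : ℝ) ^ (1 - α)) ^ 2
          + C * occupiedErr A (τ * (2 + s)) ρ (m L) (c * (L : ℝ) ^ (-a₀))
          + (C * multipleErr A τ ρ s r (m L) (c * (L : ℝ) ^ (-a₀))) ^ 2))) atTop (𝓝 0) := by
  set σ := τ * (2 + s) with hσ
  have hσ0 : 0 < σ := by positivity
  have hτs : τ * s ≤ d / 4 := by nlinarith
  have hτ2 : 2 * τ ≤ d / 4 := by nlinarith
  set w : ℕ → ℝ := fun L => c * (L : ℝ) ^ (-a₀) with hw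
  -- Every error of one block is of order `L^θ`, so that multiplication by `n ≈ L^(1-β)` still
  -- leaves `L^(-d/2)`.
  set θ : ℝ := -(1 - β) - d / 2 with hθ
  have hd1' : d < 1 := by linarith
  have hwb : PowerBound w (-a₀) := (powerBound_rpow _).const_mul c
  have hγ : max β (1 - β) + d ≤ a₀ := by
    rw [max_add_add_right β (1 - β) d |>.symm]; exact max_le hd1 hd2
  have hβσ : β * σ ≤ d / 4 := (mul_le_of_le_one_left hσ0.le hβ1.le).trans hτd
  have hβτ : β * (2 * τ) ≤ d / 4 := (mul_le_of_le_one_left (by positivity) hβ1.le).trans hτ2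
  have hβs : β * (τ * s) ≤ d / 4 := (mul_le_of_le_one_left (by positivity) hβ1.le).trans hτs
  have hmσ : PowerBound (fun L => m L ^ σ * w L) (β * σ + -a₀) := (hm.rpow hσ0.le).mul hwb
  have hwm : PowerBound (fun L => (w L * m L) ^ (1 + ρ)) ((-a₀ + β) * (1 + ρ)) :=
    (hwb.mul hm).rpow (by linarith)
  have hdec : PowerBound (fun L : ℕ => decouplingErr A σ L (m L) (n L) (w L)) (-(d / 2)) := by
    refine (hmA.mono (by linarith)).add ?_
    have h1 : PowerBound (fun L => (L : ℝ) - n L * m L + n L) (max β (1 - β)) :=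
      hg.add (hn.mono (le_max_right _ _))
    exact ((h1.mul (powerBound_rpow σ)).mul hwb).mono (by linarith)
  have hmul : PowerBound (fun L => multipleErr A τ ρ s r (m L) (w L)) θ := by
    refine PowerBound.add (PowerBound.add ?_ ?_) (hmA.mono (by linarith))
    · refine ((hm.rpow (by positivity)).mul hwm).mono ?_
      nlinarith
    -- The base of the `r`-th power decays like `L^(-3d/4)`, and `r d ≥ 4` turns this into at least
    -- `L^(-3)`.
    · refine (hm.mul (((hm.rpow (r := 1 + τ * s) (by positivity)).mul hwb).pow r)).mono ?_
      have h1 : β * (1 + τ * s) + -a₀ ≤ -(3 * d / 4) := by nlinarith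
      have h2 := mul_le_mul_of_nonneg_right h1 (Nat.cast_nonneg (α := ℝ) r)
      nlinarith
  have hmean : PowerBound (fun L : ℕ => meanErr C A σ L (m L) (n L) (w L) (2 * (L : ℝ) ^ (1 - α)))
      θ := by
    refine PowerBound.add (((hmA.mono (by linarith)).add (hmσ.mono (by linarith))).const_mul C) ?_
    have h1 : PowerBound (fun L : ℕ => ((L : ℝ) - n L * m L) / (n L * L))
        (max β (1 - β) + (β - 1 + -1)) := by
      refine (hg.mul (hni.mul (powerBound_rpow (-1)))).congr_left fun L => ?_
      rw [Real.rpow_neg_one, div_eq_mul_inv, mul_inv]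
    exact (((powerBound_rpow (1 - α)).const_mul 2).mul h1).mono (by linarith)
  have hocc : PowerBound (fun L => occupiedErr A σ ρ (m L) (w L)) θ :=
    ((hmA.mono (by linarith)).add (hmσ.mono (by linarith))).add (hwm.mono (by nlinarith))
  have hsq : ∀ {f : ℕ → ℝ}, PowerBound f θ → PowerBound (fun L => f L ^ 2) θ := fun hf =>
    (hf.pow 2).mono (by push_cast; linarith)
  have hrest := hn.mul ((((hmul.const_mul C).const_mul 4).add (hmean.const_mul 2)).add
    ((((hsq hmean).add (hocc.const_mul C)).add (hsq (hmul.const_mul C))).const_mul 12))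
  have h1 := ((hdec.const_mul C).const_mul 2).tendsto (by linarith)
  have h2 := hrest.tendsto (by linarith)
  simpa only [add_zero] using h1.add h2

end RandomJacobi

namespace RandomJacobi

/-! ### Choice of scales and total variation closeness of the unfolded counts. -/

theorem sum_volume_le {ι : Type*} [Fintype ι] {J : ι → Set ℝ} {T : ℝ} (hT : 0 ≤ T)
    (hJo : ∀ j, (J j).OrdConnected) (hJ : ∀ j, J j ⊆ Set.Icc (-T) T)
    (hJd : ∀ i j, i ≠ j → Disjoint (J i) (J j)) : ∑ j, volume.real (J j) ≤ 2 * T := by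
  have hfin : ∀ j, volume (J j) ≠ ⊤ := fun j => ((measure_mono (hJ j)).trans_lt (by simp)).ne
  rw [← measureReal_iUnion_fintype (fun i j hij => hJd i j hij)
    (fun j => (hJo j).measurableSet) hfin]
  refine (measureReal_mono (Set.iUnion_subset hJ) (by simp)).trans (le_of_eq ?_)
  rw [Real.volume_real_Icc_of_le (by linarith)]
  ring

theorem tendsto_natCast_rpow_atTop {e : ℝ} (he : 0 < e) :
    Tendsto (fun L : ℕ => (L : ℝ) ^ e) atTop atTop :=
  (tendsto_rpow_atTop he).comp tendsto_natCast_atTop_atTop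

theorem tendsto_natCast_rpow_neg {e : ℝ} (he : 0 < e) :
    Tendsto (fun L : ℕ => (L : ℝ) ^ (-e)) atTop (𝓝 0) :=
  (tendsto_rpow_neg_atTop he).comp tendsto_natCast_atTop_atTop

theorem eventually_exp_neg_rpow_le {c c' σ e : ℝ} (hc : 0 < c) (hσ : 0 < σ) (hc' : 0 < c') :
    ∀ᶠ L : ℕ in atTop, Real.exp (-(c * (L : ℝ) ^ σ)) ≤ c' * (L : ℝ) ^ (-e) := by
  obtain ⟨C, hC, h⟩ := exists_exp_neg_rpow_le hc hσ (e + 1)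
  have h1 := (tendsto_natCast_rpow_neg one_pos).const_mul C
  rw [mul_zero] at h1
  filter_upwards [eventually_ge_atTop 1, h1.eventually (gt_mem_nhds hc')] with L hL hL1
  have hL' : (0 : ℝ) < L := by exact_mod_cast hL
  refine (h L (by exact_mod_cast hL)).trans ?_
  rw [neg_add, add_comm, Real.rpow_add hL', ← mul_assoc]
  exact mul_le_mul_of_nonneg_right hL1.le (by positivity)

section Model

variable {Ω : Type*} [MeasurableSpace Ω] {P : Measure Ω} [IsProbabilityMeasure P]
  {a V : ℤ → Ω → ℝ} {K : ℝ} {q : ℕ} {I : Set ℝ} {ρ : ℝ} {κ : Measure ℝ}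

set_option maxHeartbeats 1000000 in
/-- The counts of unfolded levels in a moderate number of disjoint intervals are asymptotically
independent Poisson variables. -/
theorem LocalizedModel.exists_closeWithin_unfoldedCount (h : LocalizedModel P a V K q I ρ)
    (hκ : IsDensityOfStates P a V q κ) (hR : RegularIDS κ I) (hIo : IsOpen I) {E₀ ρ' α : ℝ}
    (hE₀ : E₀ ∈ I) (hρ' : 0 ≤ ρ') (hgrowth : LowerGrowth κ E₀ ρ')
    (hα0 : (1 + ρ') * ((1 + ρ) / (1 + 2 * ρ)) < α) (hα1 : α < 1) :
    ∃ δ > (0 : ℝ), ∃ err : ℕ → ℝ, Tendsto err atTop (𝓝 0) ∧ ∀ᶠ L : ℕ in atTop,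
      ∀ {ι : Type} [Fintype ι] (J : ι → Set ℝ), (∀ j, (J j).OrdConnected) →
      (∀ j, (J j).Nonempty) → (∀ j, J j ⊆ Set.Icc (-((L : ℝ) ^ (1 - α))) ((L : ℝ) ^ (1 - α))) →
      (∀ i j, i ≠ j → Disjoint (J i) (J j)) →
      (Fintype.card ι : ℝ) ≤ Real.exp ((L : ℝ) ^ δ) →
      CloseWithin (P.map fun ω j => unfoldedCount κ E₀ (a · ω) (V · ω) L (J j))
        (poissonPi fun j => (volume.real (J j)).toNNReal) (err L) := by
  have := h.isProbabilityMeasure_dos hκ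
  have hρ := h.rho_pos
  obtain ⟨S, hS⟩ := h.indep.exists_indepCounts
  obtain ⟨CW, hCW, mW, hmW, hW⟩ := h.wegner
  obtain ⟨w₁, hw₁, hw₁I⟩ := Metric.isOpen_iff.1 hIo E₀ hE₀
  have hw₀I : window E₀ (w₁ / 2) ⊆ I := by
    refine subset_trans ?_ hw₁I
    rw [window, ← Real.closedBall_eq_Icc]
    exact Metric.closedBall_subset_ball (by linarith)
  have hα : 0 < α := lt_trans (by positivity) hα0
  set a₀ := α / (1 + ρ') with ha₀
  have ha₀0 : 0 < a₀ := by positivity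
  have ha₀α : a₀ ≤ α := div_le_self hα.le (by linarith)
  have ha₀1 : a₀ < 1 := ha₀α.trans_lt hα1
  have hkey : 1 + ρ < a₀ * (1 + 2 * ρ) := by
    have h1 : (1 + ρ) / (1 + 2 * ρ) < a₀ := by
      rw [ha₀, lt_div_iff₀ (by linarith), mul_comm]; exact hα0
    rwa [div_lt_iff₀ (by linarith)] at h1
  -- The left bound makes the number of block ends times `w` small; the right bound is `1 + ρβ <
  -- a₀(1+ρ)`, that is, `n (w m)^(1+ρ) → 0`. The interval for `β` is nonempty precisely by `hkey`;
  -- `β < a₀`, needed for the remainder of the division, then follows from `a₀ < 1`.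
  obtain ⟨β, hβl, hβu⟩ : ∃ β, 1 - a₀ < β ∧ β < (a₀ * (1 + ρ) - 1) / ρ := by
    refine exists_between ?_
    rw [lt_div_iff₀ hρ]
    linarith
  rw [lt_div_iff₀ hρ] at hβu
  have hβ0 : 0 < β := by linarith
  have hβa : β < a₀ := by
    by_contra! hc
    nlinarith
  have hβ1 : β < 1 := hβa.trans ha₀1
  obtain ⟨d, hd, hd1, hd2, hd3⟩ : ∃ d > 0, β + d ≤ a₀ ∧ 1 - β + d ≤ a₀ ∧
      1 + ρ * β + d ≤ a₀ * (1 + ρ) := by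
    refine ⟨min (a₀ - β) (min (a₀ - (1 - β)) (a₀ * (1 + ρ) - (1 + ρ * β))),
      lt_min (by linarith) (lt_min (by linarith) (by linarith)), ?_, ?_, ?_⟩
    · linarith [min_le_left (a₀ - β) (min (a₀ - (1 - β)) (a₀ * (1 + ρ) - (1 + ρ * β)))]
    · linarith [(min_le_right (a₀ - β) (min (a₀ - (1 - β)) (a₀ * (1 + ρ) - (1 + ρ * β)))).trans
        (min_le_left _ _)]
    · linarith [(min_le_right (a₀ - β) (min (a₀ - (1 - β)) (a₀ * (1 + ρ) - (1 + ρ * β)))).trans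
        (min_le_right _ _)]
  -- All losses `L^(τ (2 + mW))` caused by localization radii are then at most `L^(d/4)`, a fraction
  -- of the margin `d`.
  set τ := d / (4 * (2 + mW)) with hτd
  have hτ : 0 < τ := by positivity
  have hτ4 : τ * (2 + mW) = d / 4 := by rw [hτd]; field_simp
  obtain ⟨r, hr⟩ := exists_nat_ge (4 / d)
  rw [div_le_iff₀ hd] at hr
  obtain ⟨k, n, hkn, hmb, hnb, hnib, hgb⟩ := exists_blocks hβ0 hβ1 h.q_pos S
  -- Since `m ≥ L^β`, the choice `A = 2/β` gives `m^(-A) ≤ L^(-2)`, and `b = 1/β` gives `L ≤ m^b`.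
  obtain ⟨C, hC, m₀, hm₀, hmain⟩ := h.exists_closeWithin_counts hκ hR hS (half_pos hw₁) hw₀I hCW
    hmW hW hτ (by linarith) (A := 2 / β) (b := 1 / β) (by positivity)
    ((one_le_div hβ0).2 hβ1.le) r
  obtain ⟨c, hc, hwin⟩ := hgrowth.exists_window hρ' hα
  have hmA : PowerBound (fun L => ((k L * q : ℕ) : ℝ) ^ (-(2 / β))) (-2) := by
    refine PowerBound.of_le (C := 1) ?_
    filter_upwards [hkn, eventually_ge_atTop 1] with L hL hL1
    have hL' : (0 : ℝ) < L := by exact_mod_cast hL1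
    rw [abs_of_nonneg (by positivity), one_mul]
    refine (Real.rpow_le_rpow_of_nonpos (by positivity) hL.1
      (neg_nonpos.2 (by positivity))).trans (le_of_eq ?_)
    rw [← Real.rpow_mul hL'.le]
    congr 1
    field_simp
  -- The scale `s = (m^τ)^(1/2)` is at least `L^(βτ/2) = (L^δ)²`; so once `L^δ ≥ 8`, the admissible
  -- number `exp(s/8)` of intervals exceeds `exp(L^δ)`.
  refine ⟨β * τ / 4, by positivity, _, tendsto_poissonErr (C := C) (A := 2 / β) (c := c) (r := r)
    hβ0 hβ1 hρ hmW hτ hd ha₀1 ha₀α hd1 hd2 hd3 hτ4.le hr hmb hmA hnb hnib hgb, ?_⟩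
  have hw0 := (tendsto_natCast_rpow_neg ha₀0).const_mul c
  rw [mul_zero] at hw0
  filter_upwards [hkn, hwin, eventually_ge_atTop 1,
    (tendsto_natCast_rpow_atTop hβ0).eventually (eventually_ge_atTop (m₀ : ℝ)),
    hw0.eventually (gt_mem_nhds (show 0 < w₁ / 4 by positivity)),
    eventually_exp_neg_rpow_le (c := 1 / 4) (σ := β * τ / 2) (e := a₀) (by norm_num)
      (by positivity) hc,
    (tendsto_natCast_rpow_atTop (show 0 < β * τ / 4 by positivity)).eventually
      (eventually_ge_atTop (8 : ℝ))] with L hL hLw hL1 hLm hLw' hLe hL8 ι _ J hJo hJn hJT hJd hcard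
  have hL' : (0 : ℝ) < L := by exact_mod_cast hL1
  set m : ℝ := ((k L * q : ℕ) : ℝ) with hm
  have hmτ : (L : ℝ) ^ (β * τ / 2) ≤ (m ^ τ) ^ (1 / 2 : ℝ) := by
    have h1 : (L : ℝ) ^ (β * τ / 2) = (((L : ℝ) ^ β) ^ τ) ^ (1 / 2 : ℝ) := by
      rw [← Real.rpow_mul hL'.le, ← Real.rpow_mul hL'.le]; congr 1; ring
    rw [h1]
    exact Real.rpow_le_rpow (by positivity) (Real.rpow_le_rpow (by positivity) hL.1 hτ.le)
      (by norm_num)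
  have hw : 0 ≤ c * (L : ℝ) ^ (-a₀) := by positivity
  have hT : 0 ≤ (L : ℝ) ^ (1 - α) := by positivity
  have hat : ∀ E ∈ window E₀ (c * (L : ℝ) ^ (-a₀)), κ {E} = 0 := fun E hE =>
    dos_singleton_eq_zero hR (hw₀I (Set.Icc_subset_Icc (by linarith) (by linarith) hE))
  have hcoe : ∀ j, (((volume.real (J j)).toNNReal : NNReal) : ℝ) = volume.real (J j) := fun j =>
    Real.coe_toNNReal _ measureReal_nonneg
  have key := hmain L (k L) (n L) (c * (L : ℝ) ^ (-a₀)) (2 * (L : ℝ) ^ (1 - α)) ?_ hL.2.1 hL.2.2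
    ?_ ?_ (by linarith) (fun j => energySet κ E₀ L (J j))
    (fun j => (volume.real (J j)).toNNReal) (fun j => ordConnected_energySet L (hJo j))
    (fun j => ?_) (fun j => energySet_subset_window hLw.1 hLw.2 (hJT j))
    (fun i j hij => disjoint_energySet κ E₀ L (hJd i j hij)) ?_ (fun j => ?_) ?_
  · simp only [unfoldedCount_eq]
    exact key
  · have : (m₀ : ℝ) ≤ ((k L * q : ℕ) : ℝ) := hLm.trans hL.1
    exact_mod_cast this
  · have h1 := Real.rpow_le_rpow (by positivity) hL.1 (show 0 ≤ 1 / β by positivity)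
    rwa [← Real.rpow_mul hL'.le, mul_one_div_cancel hβ0.ne', Real.rpow_one] at h1
  · refine le_trans ?_ hLe
    rw [locRes, Real.exp_le_exp]
    linarith
  · obtain ⟨y, hy⟩ := hJn j
    obtain ⟨E, -, hE⟩ := exists_unfold_eq hat hLw.1 hLw.2 hw (hJT j hy)
    exact ⟨E, by rw [energySet, Set.mem_ofPred_eq, hE]; exact hy⟩
  · refine hcard.trans (Real.exp_le_exp.2 ?_)
    have h1 : (L : ℝ) ^ (β * τ / 2) = (L : ℝ) ^ (β * τ / 4) * (L : ℝ) ^ (β * τ / 4) := by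
      rw [← Real.rpow_add hL']; congr 1; ring
    nlinarith
  · rw [hcoe]
    exact dos_energySet hat hL1 hLw.1 hLw.2 hw (hJo j) (hJn j) (hJT j)
  · simp only [hcoe]
    exact sum_volume_le hT hJo hJT hJd

end Model

end RandomJacobi

namespace RandomJacobi

/-! ### From total variation closeness to probabilities of prescribed counts. -/

theorem CloseWithin.nonneg {α : Type*} [MeasurableSpace α] {μ ν : Measure α} {Δ : ℝ}
    (h : CloseWithin μ ν Δ) : 0 ≤ Δ := by
  simpa using h (fun _ => 0) (by simp)

theorem CloseWithin.real_singleton {α : Type*} [MeasurableSpace α] [MeasurableSingletonClass α]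
    {μ ν : Measure α} {Δ : ℝ} (h : CloseWithin μ ν Δ) (k : α) :
    |μ.real {k} - ν.real {k}| ≤ Δ := by
  have := h (({k} : Set α).indicator 1) fun x => by
    by_cases hx : x ∈ ({k} : Set α)
    · rw [Set.indicator_of_mem hx]; simp
    · rw [Set.indicator_of_notMem hx]; simp
  rwa [integral_indicator_one (measurableSet_singleton k),
    integral_indicator_one (measurableSet_singleton k)] at this

theorem unfoldedCount_empty (κ : Measure ℝ) (E₀ : ℝ) (a V : ℤ → ℝ) (L : ℕ) :
    unfoldedCount κ E₀ a V L ∅ = 0 := by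
  simp [unfoldedCount]

section Model

variable {Ω : Type*} [MeasurableSpace Ω] {P : Measure Ω} [IsProbabilityMeasure P]
  {a V : ℤ → Ω → ℝ} {K : ℝ} {q : ℕ} {I : Set ℝ} {ρ : ℝ} {κ : Measure ℝ}

theorem LocalizedModel.measurable_unfoldedCounts [IsProbabilityMeasure κ]
    (h : LocalizedModel P a V K q I ρ) (E₀ : ℝ) (L : ℕ) {ι : Type*} {J : ι → Set ℝ}
    (hJ : ∀ j, (J j).OrdConnected) :
    Measurable fun ω j => unfoldedCount κ E₀ (a · ω) (V · ω) L (J j) :=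
  h.measurable_counts (box L) (J := fun j => energySet κ E₀ L (J j))
    fun j => (ordConnected_energySet L (hJ j)).measurableSet

-- Empty intervals may occur in the family but not in the approximation theorem. On them the count
-- is `0` and the Poisson mean is `0`: they drop out of both sides if the prescribed number is `0`,
-- and otherwise both probabilities vanish.
open Classical in
theorem LocalizedModel.abs_sub_poissonProb_le [IsProbabilityMeasure κ]
    (h : LocalizedModel P a V K q I ρ) {E₀ Δ : ℝ} {L p : ℕ} {J : Fin p → Set ℝ} (k : Fin p → ℕ)
    (hJ : ∀ j, (J j).OrdConnected)
    (hcl : CloseWithin (P.map fun ω (j : {j // (J j).Nonempty}) =>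
        unfoldedCount κ E₀ (a · ω) (V · ω) L (J j))
      (poissonPi fun j => (volume.real (J j)).toNNReal) Δ) :
    |P.real {ω | ∀ j, unfoldedCount κ E₀ (a · ω) (V · ω) L (J j) = k j} - poissonProb J k| ≤ Δ := by
  have hemp : ∀ {j}, ¬ (J j).Nonempty → J j = ∅ := fun hj => Set.not_nonempty_iff_eq_empty.1 hj
  by_cases hk : ∀ j, ¬ (J j).Nonempty → k j = 0
  · have h1 := hcl.real_singleton fun j => k j
    have hm := h.measurable_unfoldedCounts (κ := κ) E₀ L
      (J := fun j : {j // (J j).Nonempty} => J j) fun j => hJ j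
    rw [map_measureReal_apply hm (measurableSet_singleton _), poissonPi_real_singleton] at h1
    have e1 : {ω | ∀ j, unfoldedCount κ E₀ (a · ω) (V · ω) L (J j) = k j}
        = (fun ω (j : {j // (J j).Nonempty}) => unfoldedCount κ E₀ (a · ω) (V · ω) L (J j)) ⁻¹'
          {fun j : {j // (J j).Nonempty} => k j} := by
      ext ω
      simp only [Set.mem_ofPred_eq, Set.mem_preimage, Set.mem_singleton_iff, funext_iff,
        Subtype.forall]
      refine ⟨fun hω j _ => hω j, fun hω j => ?_⟩
      by_cases hj : (J j).Nonempty
      · exact hω j hj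
      · rw [hk j hj, hemp hj, unfoldedCount_empty]
    have e2 : poissonProb J k = ∏ j : {j // (J j).Nonempty},
        Real.exp (-((volume.real (J j)).toNNReal : NNReal))
          * ((volume.real (J j)).toNNReal : NNReal) ^ k j / (k j).factorial := by
      rw [poissonProb, ← Fintype.prod_subtype_mul_prod_subtype (fun j => (J j).Nonempty),
        Fintype.prod_eq_one (fun j : {j // ¬ (J j).Nonempty} => _) fun j => ?_, mul_one]
      · refine Finset.prod_congr rfl fun j _ => ?_
        rw [Real.coe_toNNReal _ measureReal_nonneg]
      · rw [hk j j.2, hemp j.2]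
        simp
    rwa [e1, e2]
  · push Not at hk
    obtain ⟨j, hj, hkj⟩ := hk
    have e1 : {ω | ∀ j, unfoldedCount κ E₀ (a · ω) (V · ω) L (J j) = k j} = ∅ := by
      refine Set.eq_empty_iff_forall_notMem.2 fun ω hω => hkj ?_
      rw [← hω j, hj, unfoldedCount_empty]
    have e2 : poissonProb J k = 0 := by
      refine Finset.prod_eq_zero (Finset.mem_univ j) ?_
      rw [hj]
      simp [hkj]
    rw [e1, e2]
    simpa using hcl.nonneg

end Model

/-- The number of nonempty sets in an interval with given separation. -/
theorem card_le_of_separated {ι : Type*} [Fintype ι] {J : ι → Set ℝ} {T s : ℝ} (hs : 0 < s)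
    (hsT : s ≤ T) (hJn : ∀ j, (J j).Nonempty) (hJ : ∀ j, J j ⊆ Set.Icc (-T) T)
    (hsep : ∀ i j, i ≠ j → ∀ x ∈ J i, ∀ y ∈ J j, s ≤ |x - y|) :
    (Fintype.card ι : ℝ) ≤ 4 * T / s := by
  choose x hx using hJn
  -- Points in different sets are at distance at least `s`, so they fall into different cells of the
  -- grid of mesh `s`.
  have hinj : Set.InjOn (fun j => ⌊x j / s⌋) (Finset.univ : Finset ι) := by
    intro i _ j _ hij
    by_contra hne
    have h1 := Int.abs_sub_lt_one_of_floor_eq_floor hij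
    rw [← sub_div, abs_div, abs_of_pos hs, div_lt_one hs] at h1
    exact absurd (hsep i j hne _ (hx i) _ (hx j)) (not_le.2 h1)
  have hmap : Set.MapsTo (fun j => ⌊x j / s⌋) (Finset.univ : Finset ι)
      (Finset.Icc ⌊-T / s⌋ ⌊T / s⌋ : Finset ℤ) := fun j _ => by
    rw [Finset.coe_Icc]
    exact ⟨Int.floor_mono (by have := (hJ j (hx j)).1; gcongr),
      Int.floor_mono (by have := (hJ j (hx j)).2; gcongr)⟩
  have hcard := Finset.card_le_card_of_injOn _ hmap hinj
  rw [Finset.card_univ, Int.card_Icc] at hcard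
  have h1 : (Fintype.card ι : ℤ) ≤ ⌊T / s⌋ + 1 - ⌊-T / s⌋ := by
    have h2 : ⌊-T / s⌋ ≤ ⌊T / s⌋ := Int.floor_mono (by gcongr; linarith)
    omega
  have h2 : (Fintype.card ι : ℝ) ≤ ⌊T / s⌋ + 1 - ⌊-T / s⌋ := by exact_mod_cast h1
  have h3 := Int.floor_le (T / s)
  have h4 := Int.sub_one_lt_floor (-T / s)
  have h5 : 1 ≤ T / s := (one_le_div hs).2 hsT
  rw [neg_div] at h4
  rw [neg_div] at h2
  rw [mul_div_assoc]
  linarith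

end RandomJacobi

namespace RandomJacobi

/-! ### Laplace functionals -/

theorem integral_exp_neg_mul_poissonMeasure (l : NNReal) (c : ℝ) :
    ∫ n : ℕ, Real.exp (-(c * n)) ∂(poissonMeasure l) = Real.exp (-((1 - Real.exp (-c)) * l)) := by
  rw [integral_poissonMeasure]
  have h1 := NormedSpace.expSeries_div_hasSum_exp (𝔸 := ℝ) (l * Real.exp (-c))
  rw [← Real.exp_eq_exp_ℝ] at h1
  have h2 := (h1.mul_left (Real.exp (-l))).tsum_eq
  rw [← Real.exp_add] at h2
  rw [show -((1 - Real.exp (-c)) * (l : ℝ)) = -l + l * Real.exp (-c) by ring, ← h2]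
  refine tsum_congr fun n => ?_
  rw [smul_eq_mul, mul_pow, ← Real.exp_nat_mul, show -(c * (n : ℝ)) = n * -c by ring]
  ring

theorem integral_exp_neg_sum_poissonPi {ι : Type*} [Fintype ι] (l : ι → NNReal) (c : ι → ℝ) :
    ∫ x, Real.exp (-∑ j, c j * (x j : ℝ)) ∂(poissonPi l)
      = Real.exp (-∑ j, (1 - Real.exp (-c j)) * (l j : ℝ)) := by
  simp only [← Finset.sum_neg_distrib, Real.exp_sum]
  rw [poissonPi, integral_fintype_prod_eq_prod fun j (n : ℕ) => Real.exp (-(c j * n))]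
  exact Finset.prod_congr rfl fun j _ => integral_exp_neg_mul_poissonMeasure _ _

/-- The form `1 - exp(-|u - v|)` is kept instead of `|u - v|` because it stays bounded: total
variation closeness controls bounded functions of the counts, but not the mean number of points. -/
theorem abs_exp_neg_sub_exp_neg_le {u v : ℝ} (hu : 0 ≤ u) (hv : 0 ≤ v) :
    |Real.exp (-u) - Real.exp (-v)| ≤ 1 - Real.exp (-|u - v|) := by
  wlog h : u ≤ v generalizing u v
  · rw [abs_sub_comm, abs_sub_comm u]
    exact this hv hu (le_of_not_ge h)
  have h1 : Real.exp (-v) = Real.exp (-u) * Real.exp (-(v - u)) := by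
    rw [← Real.exp_add]; congr 1; ring
  have h2 : Real.exp (-(v - u)) ≤ 1 := Real.exp_le_one_iff.2 (by linarith)
  have h3 : Real.exp (-u) ≤ 1 := Real.exp_le_one_iff.2 (by linarith)
  rw [abs_sub_comm u, abs_of_nonneg (sub_nonneg.2 h), abs_of_nonneg, h1]
  · nlinarith
  · rw [sub_nonneg, Real.exp_le_exp]; linarith

theorem one_sub_exp_neg_le (u : ℝ) : 1 - Real.exp (-u) ≤ u := by
  linarith [Real.add_one_le_exp (-u)]

/-- A nonnegative continuous function with compact support is nearly constant on the cells of a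
partition of a neighbourhood of its support. -/
theorem exists_cells {f : ℝ → ℝ} (hf : Continuous f) (hfc : HasCompactSupport f) :
    ∃ R > (0 : ℝ), ∀ η > (0 : ℝ), ∃ (ι : Type) (_ : Fintype ι) (J : ι → Set ℝ) (x : ι → ℝ),
      (∀ i, (J i).OrdConnected) ∧ (∀ i, (J i).Nonempty) ∧ (∀ i, J i ⊆ Set.Icc (-R) R) ∧
      (∀ i j, i ≠ j → Disjoint (J i) (J j)) ∧ (∀ i, ∀ y ∈ J i, |f y - f (x i)| ≤ η) ∧
      ∀ y, f y ≠ 0 → ∃ i, y ∈ J i := by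
  obtain ⟨T, hT⟩ := hfc.isCompact.isBounded.subset_closedBall (0 : ℝ)
  rw [Real.closedBall_eq_Icc, zero_sub, zero_add] at hT
  set T' := max T 0 with hT'
  have hT0 : 0 ≤ T' := le_max_right _ _
  -- The radius must be fixed before `η`, since it multiplies `η` in the final error; cells have
  -- length at most `1`, so they overhang the support by a bounded amount.
  refine ⟨T' + 4, by linarith, fun η hη => ?_⟩
  have huc : UniformContinuous f := hfc.uniformContinuous_of_continuous hf
  obtain ⟨d, hd, hdf⟩ := Metric.uniformContinuous_iff.1 huc η hη
  set h := min d 1 with hh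
  have hh0 : 0 < h := lt_min hd one_pos
  have hh1 : h ≤ 1 := min_le_right _ _
  set M : ℤ := ⌈T' / h⌉ + 1 with hM
  have hM1 : T' / h + 1 ≤ M := by
    rw [hM]; push_cast; linarith [Int.le_ceil (T' / h)]
  have hM2 : (M : ℝ) ≤ T' / h + 2 := by
    rw [hM]; push_cast; linarith [Int.ceil_lt_add_one (T' / h)]
  have hM3 : M * h ≤ T' + 2 := by
    have := mul_le_mul_of_nonneg_right hM2 hh0.le
    rw [add_mul, div_mul_cancel₀ _ hh0.ne'] at this
    linarith
  have hmem : ∀ (i : ℤ) (y : ℝ), y ∈ Set.Ico (i * h) ((i + 1) * h) ↔ ⌊y / h⌋ = i := fun i y => by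
    rw [Int.floor_eq_iff, le_div_iff₀ hh0, div_lt_iff₀ hh0, Set.mem_Ico]
  refine ⟨{i : ℤ // i ∈ Finset.Icc (-M) M}, inferInstance,
    fun i => Set.Ico (i * h) ((i + 1) * h), fun i => i * h, fun i => Set.ordConnected_Ico,
    fun i => ⟨i * h, le_rfl, by linarith⟩, fun i y hy => ?_, fun i j hij => ?_, fun i y hy => ?_,
    fun y hy => ?_⟩
  · have h1 := Finset.mem_Icc.1 i.2
    have h2 : -(M : ℝ) ≤ (i : ℤ) := by exact_mod_cast h1.1
    have h3 : ((i : ℤ) : ℝ) ≤ M := by exact_mod_cast h1.2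
    have h4 := mul_le_mul_of_nonneg_right h2 hh0.le
    have h5 := mul_le_mul_of_nonneg_right h3 hh0.le
    constructor
    · linarith [hy.1]
    · linarith [hy.2]
  · rw [Set.disjoint_left]
    intro y hy hy'
    exact hij (Subtype.ext (((hmem _ _).1 hy).symm.trans ((hmem _ _).1 hy')))
  · have h1 : dist y (i * h) < d := by
      rw [Real.dist_eq, abs_lt]
      have := min_le_left d 1
      constructor <;> linarith [hy.1, hy.2]
    exact (hdf h1).le
  · have h1 := hT (subset_tsupport f hy)
    have h2 : |y / h| ≤ T' / h := by
      rw [abs_div, abs_of_pos hh0]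
      have : |y| ≤ T' := (abs_le.2 ⟨h1.1, h1.2⟩).trans (le_max_left _ _)
      gcongr
    rw [abs_le] at h2
    refine ⟨⟨⌊y / h⌋, Finset.mem_Icc.2 ⟨?_, ?_⟩⟩, (hmem _ _).2 rfl⟩
    · rw [Int.le_floor]; push_cast; linarith
    · have := Int.floor_le (y / h)
      have h3 : (⌊y / h⌋ : ℝ) ≤ M := by linarith
      exact_mod_cast h3

/-- The integral of a function which is nearly constant on finitely many cells. -/
theorem abs_integral_sub_sum_le {ν : Measure ℝ} {ι : Type*} [Fintype ι] {J : ι → Set ℝ} {c : ι → ℝ}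
    {g : ℝ → ℝ} {η : ℝ} (hg : Integrable g ν) (hJm : ∀ i, MeasurableSet (J i))
    (hJν : ∀ i, ν (J i) ≠ ⊤) (hJd : ∀ i j, i ≠ j → Disjoint (J i) (J j))
    (hc : ∀ i, ∀ y ∈ J i, |g y - c i| ≤ η) (h0 : ∀ y, g y ≠ 0 → ∃ i, y ∈ J i) :
    |∫ y, g y ∂ν - ∑ i, c i * ν.real (J i)| ≤ η * ∑ i, ν.real (J i) := by
  have hi : ∀ (b : ι → ℝ) i, Integrable (fun y => (J i).indicator (fun _ => b i) y) ν :=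
    fun b i => (integrable_indicator_iff (hJm i)).2 (integrableOn_const (hJν i))
  have hs : ∀ b : ι → ℝ, Integrable (fun y => ∑ i, (J i).indicator (fun _ => b i) y) ν :=
    fun b => integrable_finsetSum _ fun i _ => hi b i
  have hint : ∀ b : ι → ℝ, ∫ y, ∑ i, (J i).indicator (fun _ => b i) y ∂ν
      = ∑ i, b i * ν.real (J i) := fun b => by
    rw [integral_finsetSum _ fun i _ => hi b i]
    refine Finset.sum_congr rfl fun i _ => ?_
    rw [integral_indicator_const _ (hJm i), smul_eq_mul, mul_comm]
  have hat : ∀ (b : ι → ℝ) {i y}, y ∈ J i → ∑ j, (J j).indicator (fun _ => b j) y = b i := by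
    intro b i y hy
    rw [Finset.sum_eq_single i (fun j _ hj => Set.indicator_of_notMem
      (fun hy' => Set.disjoint_left.1 (hJd j i hj) hy' hy) _)
      (fun h => absurd (Finset.mem_univ i) h), Set.indicator_of_mem hy]
  rw [← hint c, Finset.mul_sum, ← hint fun _ => η, ← integral_sub hg (hs c)]
  refine abs_integral_le_integral_abs.trans (integral_mono (hg.sub (hs c)).abs (hs _) fun y => ?_)
  simp only
  by_cases hy : ∃ i, y ∈ J i
  · obtain ⟨i, hi⟩ := hy
    rw [hat c hi, hat (fun _ => η) hi]
    exact hc i y hi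
  · have hz : ∀ b : ι → ℝ, ∑ i, (J i).indicator (fun _ => b i) y = 0 := fun b =>
      Finset.sum_eq_zero fun i _ => Set.indicator_of_notMem (fun h => hy ⟨i, h⟩) _
    have : g y = 0 := by
      by_contra h
      exact hy (h0 y h)
    rw [hz, hz, this]
    simp

instance (κ : Measure ℝ) (E₀ : ℝ) (a V : ℤ → ℝ) (L : ℕ) :
    IsFiniteMeasure (unfoldedProcess κ E₀ a V L) := by
  unfold unfoldedProcess; infer_instance

theorem unfoldedProcess_real (κ : Measure ℝ) (E₀ : ℝ) (a V : ℤ → ℝ) (L : ℕ) {J : Set ℝ}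
    (hJ : MeasurableSet J) :
    (unfoldedProcess κ E₀ a V L).real J = unfoldedCount κ E₀ a V L J := by
  classical
  have hi : ∀ j ∈ Finset.univ, Integrable (J.indicator (1 : ℝ → ℝ))
      (Measure.dirac (unfolded κ E₀ a V L j)) := fun j _ => (integrable_const (1 : ℝ)).indicator hJ
  rw [← integral_indicator_one hJ, unfoldedProcess, integral_finsetSum_measure hi, unfoldedCount]
  simp only [integral_dirac, Finset.card_filter, Nat.cast_sum, Set.indicator_apply, Pi.one_apply,
    Nat.cast_ite, Nat.cast_one, Nat.cast_zero]

end RandomJacobi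

namespace RandomJacobi

/-! ### Measurability and comparison of Laplace functionals. -/

theorem sum_measureReal_le_univ {ν : Measure ℝ} [IsFiniteMeasure ν] {ι : Type*} [Fintype ι]
    {J : ι → Set ℝ} (hJm : ∀ i, MeasurableSet (J i)) (hJd : ∀ i j, i ≠ j → Disjoint (J i) (J j)) :
    ∑ i, ν.real (J i) ≤ ν.real Set.univ := by
  rw [← measureReal_iUnion_fintype (fun i j hij => hJd i j hij) hJm]
  exact measureReal_mono (Set.subset_univ _)

section Model

variable {Ω : Type*} [MeasurableSpace Ω] {P : Measure Ω} [IsProbabilityMeasure P]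
  {a V : ℤ → Ω → ℝ} {K : ℝ} {q : ℕ} {I : Set ℝ} {ρ : ℝ} {κ : Measure ℝ}

/-- The individual levels are not known to be measurable, but counts are; the integral is a limit of
step-function sums weighted by counts in ever finer cells. -/
theorem LocalizedModel.measurable_integral_unfolded [IsProbabilityMeasure κ]
    (h : LocalizedModel P a V K q I ρ) (E₀ : ℝ) (L : ℕ) {f : ℝ → ℝ} (hf : Continuous f)
    (hfc : HasCompactSupport f) :
    Measurable fun ω => ∫ x, f x ∂(unfoldedProcess κ E₀ (a · ω) (V · ω) L) := by
  obtain ⟨R, -, hR⟩ := exists_cells hf hfc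
  choose ι hι J x hJo _ _ hJd hJf hJ0 using fun n : ℕ =>
    hR (1 / ((n : ℝ) + 1)) (by positivity)
  refine measurable_of_tendsto_metrizable (f := fun n ω =>
    ∑ i, f (x n i) * (unfoldedCount κ E₀ (a · ω) (V · ω) L (J n i) : ℝ)) (fun n => ?_)
    (tendsto_pi_nhds.2 fun ω => ?_)
  · have hm := h.measurable_unfoldedCounts (κ := κ) E₀ L (hJo n)
    refine Finset.measurable_sum _ fun i _ => Measurable.const_mul ?_ _
    exact (Measurable.of_discrete (f := fun k : ℕ => (k : ℝ))).comp ((measurable_pi_apply i).comp hm)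
  · set ν := unfoldedProcess κ E₀ (a · ω) (V · ω) L
    have h1 := (tendsto_one_div_add_atTop_nhds_zero_nat (𝕜 := ℝ)).mul_const (ν.real Set.univ)
    rw [zero_mul] at h1
    refine tendsto_iff_dist_tendsto_zero.2 (squeeze_zero (fun _ => dist_nonneg) (fun n => ?_) h1)
    have h2 := abs_integral_sub_sum_le (ν := ν) (hf.integrable_of_hasCompactSupport hfc)
      (fun i => (hJo n i).measurableSet) (fun i => measure_ne_top _ _) (hJd n) (hJf n) (hJ0 n)
    have h3 := sum_measureReal_le_univ (ν := ν) (fun i => (hJo n i).measurableSet) (hJd n)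
    simp only [ν, unfoldedProcess_real _ _ _ _ _ (hJo n _).measurableSet] at h2 h3 ⊢
    rw [dist_comm, Real.dist_eq]
    exact h2.trans (mul_le_mul_of_nonneg_left h3 (by positivity))

/-- The Laplace functional of the unfolded levels is close to that of the Poisson process. -/
theorem LocalizedModel.abs_laplace_sub_le [IsProbabilityMeasure κ]
    (h : LocalizedModel P a V K q I ρ) (E₀ : ℝ) (L : ℕ) {f : ℝ → ℝ} (hf : Continuous f)
    (hfc : HasCompactSupport f) (hf0 : ∀ x, 0 ≤ f x) {R η Δ : ℝ} (hR : 0 ≤ R) (hη : 0 < η)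
    {ι : Type} [Fintype ι] {J : ι → Set ℝ} {x : ι → ℝ} (hJo : ∀ i, (J i).OrdConnected)
    (hJR : ∀ i, J i ⊆ Set.Icc (-R) R) (hJd : ∀ i j, i ≠ j → Disjoint (J i) (J j))
    (hJf : ∀ i, ∀ y ∈ J i, |f y - f (x i)| ≤ η) (hJ0 : ∀ y, f y ≠ 0 → ∃ i, y ∈ J i)
    (hcl : CloseWithin (P.map fun ω j => unfoldedCount κ E₀ (a · ω) (V · ω) L (J j))
      (poissonPi fun j => (volume.real (J j)).toNNReal) Δ) :
    |∫ ω, Real.exp (-∫ x, f x ∂(unfoldedProcess κ E₀ (a · ω) (V · ω) L)) ∂P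
      - Real.exp (-∫ x, (1 - Real.exp (-f x)))| ≤ 2 * Δ + 4 * R * η := by
  set X : Ω → ι → ℕ := fun ω j => unfoldedCount κ E₀ (a · ω) (V · ω) L (J j) with hX
  set l : ι → NNReal := fun j => (volume.real (J j)).toNNReal with hl
  have hlv : ∀ j, (l j : ℝ) = volume.real (J j) := fun j => Real.coe_toNNReal _ measureReal_nonneg
  have hXm : Measurable X := h.measurable_unfoldedCounts E₀ L hJo
  have hJm : ∀ i, MeasurableSet (J i) := fun i => (hJo i).measurableSet
  have hlR : ∑ j, (l j : ℝ) ≤ 2 * R := by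
    simp only [hlv]; exact sum_volume_le hR hJo hJR hJd
  have hsum0 : ∀ (b : ι → ℝ) (k : ι → ℕ), (∀ j, 0 ≤ b j) → 0 ≤ ∑ j, b j * (k j : ℝ) :=
    fun b k hb => Finset.sum_nonneg fun j _ => mul_nonneg (hb j) (Nat.cast_nonneg _)
  set g₁ : (ι → ℕ) → ℝ := fun k => Real.exp (-∑ j, f (x j) * (k j : ℝ)) with hg₁
  -- `1 - g₂` dominates the error made by replacing `f` with its step function, since that error is
  -- at most `η` times the number of points in the cells. Its mean is within `Δ` of the Poisson
  -- value, which is at most `2Rη`.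
  set g₂ : (ι → ℕ) → ℝ := fun k => Real.exp (-∑ j, (fun _ => η) j * (k j : ℝ)) with hg₂
  have hexp : ∀ {u : ℝ}, 0 ≤ u → |Real.exp (-u)| ≤ 1 := fun hu => by
    rw [Real.abs_exp]; exact Real.exp_le_one_iff.2 (by linarith)
  have hb₁ : ∀ k, |g₁ k| ≤ 1 := fun k => hexp (hsum0 _ k fun j => hf0 _)
  have hb₂ : ∀ k, |g₂ k| ≤ 1 := fun k => hexp (hsum0 _ k fun j => hη.le)
  have hmap : ∀ g : (ι → ℕ) → ℝ, ∫ k, g k ∂(P.map X) = ∫ ω, g (X ω) ∂P := fun g =>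
    integral_map hXm.aemeasurable Measurable.of_discrete.aestronglyMeasurable
  have hXi : ∀ g : (ι → ℕ) → ℝ, (∀ k, |g k| ≤ 1) → Integrable (fun ω => g (X ω)) P := fun g hg =>
    Integrable.of_bound (Measurable.of_discrete.comp hXm).aestronglyMeasurable 1
      (ae_of_all _ fun ω => hg _)
  have c₁ := hcl g₁ hb₁
  have c₂ := hcl g₂ hb₂
  rw [hmap, integral_exp_neg_sum_poissonPi] at c₁ c₂
  set F : Ω → ℝ := fun ω => Real.exp (-∫ x, f x ∂(unfoldedProcess κ E₀ (a · ω) (V · ω) L)) with hF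
  have hFi : Integrable F P := by
    refine Integrable.of_bound (Real.measurable_exp.comp
      (h.measurable_integral_unfolded E₀ L hf hfc).neg).aestronglyMeasurable 1
      (ae_of_all _ fun ω => ?_)
    exact hexp (integral_nonneg hf0)
  have c₃ : |∫ ω, F ω ∂P - ∫ ω, g₁ (X ω) ∂P| ≤ 1 - ∫ ω, g₂ (X ω) ∂P := by
    have e1 : ∫ ω, (1 - g₂ (X ω)) ∂P = 1 - ∫ ω, g₂ (X ω) ∂P := by
      rw [integral_sub (integrable_const _) (hXi g₂ hb₂), integral_const, probReal_univ, one_smul]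
    rw [← integral_sub hFi (hXi g₁ hb₁), ← e1]
    refine abs_integral_le_integral_abs.trans (integral_mono (hFi.sub (hXi g₁ hb₁)).abs
      ((integrable_const _).sub (hXi g₂ hb₂)) fun ω => ?_)
    refine (abs_exp_neg_sub_exp_neg_le (integral_nonneg hf0)
      (hsum0 _ (X ω) fun j => hf0 _)).trans (sub_le_sub_left (Real.exp_le_exp.2 ?_) _)
    have e2 := abs_integral_sub_sum_le (ν := unfoldedProcess κ E₀ (a · ω) (V · ω) L)
      (hf.integrable_of_hasCompactSupport hfc) hJm (fun i => measure_ne_top _ _) hJd hJf hJ0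
    simp only [unfoldedProcess_real _ _ _ _ _ (hJm _), Finset.mul_sum] at e2
    exact neg_le_neg e2
  have c₄ : 1 - Real.exp (-∑ j, (1 - Real.exp (-η)) * (l j : ℝ)) ≤ 2 * R * η := by
    refine (one_sub_exp_neg_le _).trans ?_
    rw [← Finset.mul_sum]
    have e1 : 0 ≤ ∑ j, (l j : ℝ) := Finset.sum_nonneg fun j _ => (l j).2
    have e2 := one_sub_exp_neg_le η
    nlinarith
  have c₅ : |Real.exp (-∑ j, (1 - Real.exp (-f (x j))) * (l j : ℝ))
      - Real.exp (-∫ x, (1 - Real.exp (-f x)))| ≤ 2 * R * η := by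
    have hcomp : ∀ {u : ℝ}, 0 ≤ u → 0 ≤ 1 - Real.exp (-u) := fun hu =>
      sub_nonneg.2 (Real.exp_le_one_iff.2 (by linarith))
    refine (abs_exp_neg_sub_exp_neg_le (Finset.sum_nonneg fun j _ => mul_nonneg (hcomp (hf0 _))
      (l j).2) (integral_nonneg fun x => hcomp (hf0 x))).trans
      ((one_sub_exp_neg_le _).trans ?_)
    have hgc : HasCompactSupport fun x => 1 - Real.exp (-f x) :=
      hfc.comp_left (g := fun u => 1 - Real.exp (-u)) (by simp)
    have e1 := abs_integral_sub_sum_le (ν := volume)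
      ((by fun_prop : Continuous fun x => 1 - Real.exp (-f x)).integrable_of_hasCompactSupport hgc)
      hJm (fun i => ((measure_mono (hJR i)).trans_lt (by simp)).ne) hJd
      (c := fun i => 1 - Real.exp (-f (x i))) (η := η) (fun i y hy => ?_)
      (fun y hy => hJ0 y fun h0 => hy (by simp [h0]))
    · simp only [← hlv] at e1
      rw [abs_sub_comm]
      exact e1.trans (by nlinarith)
    · rw [sub_sub_sub_cancel_left, abs_sub_comm]
      exact (abs_exp_neg_sub_exp_neg_le (hf0 _) (hf0 _)).trans
        ((one_sub_exp_neg_le _).trans (hJf i y hy))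
  rw [abs_le] at c₁ c₂ c₃ c₅ ⊢
  constructor <;> linarith [c₁.1, c₁.2, c₂.1, c₂.2, c₃.1, c₃.2, c₅.1, c₅.2]

end Model

end RandomJacobi

/-! ### The main theorem. -/

theorem mainTheorem11 {Ω : Type*} [MeasurableSpace Ω] (P : Measure Ω) [IsProbabilityMeasure P]
    -- the random coefficients of the Jacobi operator
    (a V : ℤ → Ω → ℝ) (ha : ∀ n, Measurable (a n)) (hV : ∀ n, Measurable (V n))
    (K : ℝ) (hK : ∀ n, ∀ᵐ ω ∂P, |a n ω| ≤ K ∧ |V n ω| ≤ K)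
    (q : ℕ) (hq : 0 < q) (hper : PeriodicInLaw P a V q)
    (hIAD : IndepAtDistance P a V)
    -- the region of localization, with the Wegner, Minami and localization estimates
    (I : Set ℝ) (hIo : IsOpen I) (hIb : Bornology.IsBounded I)
    (hW : Wegner P a V I)
    (ρ : ℝ) (hρ : 0 < ρ) (hM : Minami P a V I ρ)
    (hLoc : Localized P a V I)
    -- the density of states measure
    (κ : Measure ℝ) (hκ : IsDensityOfStates P a V q κ) (hR : RegularIDS κ I)
    -- the reference energy
    (ρ' : ℝ) (hρ'0 : 0 ≤ ρ') (hρ'1 : ρ' < ρ / (1 + ρ))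
    (E₀ : ℝ) (hE₀ : E₀ ∈ I) (hgrowth : LowerGrowth κ E₀ ρ')
    (α : ℝ) (hα0 : (1 + ρ') * ((1 + ρ) / (1 + 2 * ρ)) < α) (hα1 : α < 1) :
    (∃ δ > (0 : ℝ), ∀ (p : ℕ → ℕ) (J : ∀ L, Fin (p L) → Set ℝ) (k : ∀ L, Fin (p L) → ℕ),
      (∀ L j, (J L j).OrdConnected) →
      (∀ L j, J L j ⊆ Set.Icc (-((L : ℝ) ^ (1 - α))) ((L : ℝ) ^ (1 - α))) →
      (∀ L i j, i ≠ j → ∀ x ∈ J L i, ∀ y ∈ J L j, Real.exp (-((L : ℝ) ^ δ)) ≤ |x - y|) →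
      Tendsto (fun L : ℕ =>
        |P.real {ω | ∀ j, unfoldedCount κ E₀ (a · ω) (V · ω) L (J L j) = k L j}
          - poissonProb (J L) (k L)|) atTop (𝓝 0)) ∧
    (∀ (p : ℕ) (J : Fin p → Set ℝ) (k : Fin p → ℕ),
      (∀ j, (J j).OrdConnected) → (∀ j, Bornology.IsBounded (J j)) →
      (∀ i j, i ≠ j → Disjoint (J i) (J j)) →
      Tendsto (fun L : ℕ =>
        P.real {ω | ∀ j, unfoldedCount κ E₀ (a · ω) (V · ω) L (J j) = k j}) atTop
        (𝓝 (poissonProb J k))) ∧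
    WeaklyConvergesToPoisson P (fun L ω => unfoldedProcess κ E₀ (a · ω) (V · ω) L) := by
  have h : LocalizedModel P a V K q I ρ := ⟨ha, hV, hK, hq, hper, hIAD, hW, hρ, hM, hLoc⟩
  have := h.isProbabilityMeasure_dos hκ
  obtain ⟨δ, hδ, err, herr, hev⟩ :=
    h.exists_closeWithin_unfoldedCount hκ hR hIo hE₀ hρ'0 hgrowth hα0 hα1
  have hα : 0 < α := lt_trans (by positivity) hα0
  have hT : Tendsto (fun L : ℕ => (L : ℝ) ^ (1 - α)) atTop atTop :=
    tendsto_natCast_rpow_atTop (by linarith)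
  have hcardev : ∀ N : ℕ, ∀ᶠ L : ℕ in atTop, (N : ℝ) ≤ Real.exp ((L : ℝ) ^ δ) := fun N =>
    (Real.tendsto_exp_atTop.comp (tendsto_natCast_rpow_atTop hδ)).eventually
      (eventually_ge_atTop _)
  -- Separation `exp(-L^(δ/2))` inside `[-L, L]` allows at most `4 L exp(L^(δ/2))` nonempty
  -- intervals, eventually fewer than `exp(L^δ)`; hence the smaller exponent.
  refine ⟨⟨δ / 2, half_pos hδ, fun p J k hJo hJT hsep => ?_⟩, fun p J k hJo hJb hJd => ?_,
    fun f hf hfc hf0 => ?_⟩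
  · classical
    refine squeeze_zero' (Eventually.of_forall fun L => abs_nonneg _) ?_ herr
    filter_upwards [hev, eventually_ge_atTop 1,
      eventually_exp_neg_rpow_le (c := 1) (c' := 1 / 4) (e := 1) one_pos (half_pos hδ)
        (by norm_num),
      (tendsto_natCast_rpow_atTop (half_pos hδ)).eventually (eventually_ge_atTop (2 : ℝ))]
      with L hL hL1 hLe hL2
    have hL1' : (1 : ℝ) ≤ L := by exact_mod_cast hL1
    have hL' : (0 : ℝ) < L := by linarith
    have hs := Real.exp_pos (-((L : ℝ) ^ (δ / 2)))
    refine h.abs_sub_poissonProb_le (k L) (hJo L) (hL _ (fun j => hJo L j) (fun j => j.2)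
      (fun j => hJT L j) (fun i j hij => ?_) ?_)
    · rw [Set.disjoint_left]
      intro x hx hx'
      have := hsep L i j (fun h => hij (Subtype.ext h)) x hx x hx'
      rw [sub_self, abs_zero] at this
      linarith
    · have hTL : (L : ℝ) ^ (1 - α) ≤ L := by
        have h1 := Real.rpow_le_rpow_of_exponent_le hL1'
          (show 1 - α ≤ 1 by linarith)
        rwa [Real.rpow_one] at h1
      have hc := card_le_of_separated (ι := {j // (J L j).Nonempty}) (J := fun j => J L j)
        (T := L) hs ((Real.exp_le_one_iff.2 (neg_nonpos.2 (by positivity))).trans hL1')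
        (fun j => j.2)
        (fun j => (hJT L j).trans (Set.Icc_subset_Icc (neg_le_neg hTL) hTL))
        (fun i j hij => hsep L i j fun h => hij (Subtype.ext h))
      refine hc.trans ?_
      have e1 : (L : ℝ) ^ δ = (L : ℝ) ^ (δ / 2) * (L : ℝ) ^ (δ / 2) := by
        rw [← Real.rpow_add hL']; congr 1; ring
      have e2 : 4 * (L : ℝ) ≤ Real.exp ((L : ℝ) ^ (δ / 2)) := by
        rw [one_mul, Real.rpow_neg_one, Real.exp_neg, ← one_div, ← div_eq_mul_inv,
          div_div, one_div_le_one_div (Real.exp_pos _) (by positivity)] at hLe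
        exact hLe
      rw [Real.exp_neg, div_inv_eq_mul]
      calc 4 * (L : ℝ) * Real.exp ((L : ℝ) ^ (δ / 2))
          ≤ Real.exp ((L : ℝ) ^ (δ / 2)) * Real.exp ((L : ℝ) ^ (δ / 2)) := by gcongr
        _ = Real.exp ((L : ℝ) ^ (δ / 2) + (L : ℝ) ^ (δ / 2)) := (Real.exp_add _ _).symm
        _ ≤ _ := Real.exp_le_exp.2 (by nlinarith)
  · classical
    rw [tendsto_iff_dist_tendsto_zero]
    refine squeeze_zero' (Eventually.of_forall fun L => dist_nonneg) ?_ herr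
    obtain ⟨R, hR⟩ := (Bornology.isBounded_iUnion.2 hJb).subset_closedBall (0 : ℝ)
    rw [Real.closedBall_eq_Icc, zero_sub, zero_add] at hR
    filter_upwards [hev, hT.eventually (eventually_ge_atTop R), hcardev p] with L hL hLR hLp
    rw [Real.dist_eq]
    refine h.abs_sub_poissonProb_le k hJo (hL _ (fun j => hJo j) (fun j => j.2)
      (fun j => ((Set.subset_iUnion J j).trans hR).trans
        (Set.Icc_subset_Icc (neg_le_neg hLR) hLR))
      (fun i j hij => hJd i j fun h => hij (Subtype.ext h)) (le_trans ?_ hLp))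
    have h1 := Fintype.card_subtype_le fun j => (J j).Nonempty
    rw [Fintype.card_fin] at h1
    exact_mod_cast h1
  · obtain ⟨R, hR0, hcells⟩ := exists_cells hf hfc
    rw [Metric.tendsto_nhds]
    intro ε hε
    -- With `η = ε / (8R)` the discretization error `4Rη` is `ε/2`; the number of cells is then
    -- fixed, so `2 * err L < ε/2` for large `L` suffices.
    obtain ⟨ι, _, J, x, hJo, hJn, hJR, hJd, hJf, hJ0⟩ := hcells (ε / (8 * R)) (by positivity)
    filter_upwards [hev, hT.eventually (eventually_ge_atTop R), hcardev (Fintype.card ι),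
      herr.eventually (gt_mem_nhds (show 0 < ε / 4 by positivity))] with L hL hLR hLp hLe
    have hcl := hL J hJo hJn
      (fun j => (hJR j).trans (Set.Icc_subset_Icc (neg_le_neg hLR) hLR)) hJd hLp
    have h1 := h.abs_laplace_sub_le E₀ L hf hfc hf0 hR0.le (by positivity) hJo hJR hJd hJf hJ0 hcl
    rw [Real.dist_eq]
    refine h1.trans_lt ?_
    have h2 : 4 * R * (ε / (8 * R)) = ε / 2 := by field_simp; norm_num
    linarith
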